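/- Let $(M,g)$ be a compact connected real analytic Riemannian manifold of dimension $m\ge 1$, with volume form $dV_g$ and nonnegative Laplacian $\Delta_g$. Let $M_{\mathbb C}$ be a (connected) Grauert tube of $(M,g)$ of some radius $r>0$: a complex manifold of complex dimension $m$ containing $M$ as a totally real, real analytic submanifold, with a smooth strictly plurisubharmonic function $\rho\ge 0$ such that $\{\rho=0\}=M$, $\sqrt\rho<r$, the sets $\{\sqrt\rho\le s\}$, $s<r$, are compact, the Kähler metric of $i\partial\bar\partial\rho$ induces $g$ on $M$, and $(\partial\bar\partial\sqrt\rho)^m=0$ off $M$. For a real function $\varphi$ on $M$ let $\varphi^{\mathbb C}$ denote its holomorphic extension to $M_{\mathbb C}$ (for the eigenfunctions of $\Delta_g$ this exists; by convention $\varphi^{\mathbb C}=0$ if there is none). Let $I_N\subset\mathbb R$, $N\ge 1$, be frequency windows, for instance $I_N=[N,N+1]$, or the eigenvalue clusters of a Zoll metric. Let $\mathcal H_N$ be the real vector space spanned by the smooth real functions $\varphi$ on $M$ with $\Delta_g\varphi=\lambda^2\varphi$ for some $\lambda\in I_N$, $\lambda\ge 0$, with the inner product $\langle u,v\rangle=\int_M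 uv\,dV_g$, and let $\{\varphi_{Nj}\}_{j=1}^{d_N}$ be an orthonormal basis of $\mathcal H_N$. Let $\gamma_N=(d_N/\pi)^{d_N/2}e^{-d_N|c|^2}dc$ on $\mathbb R^{d_N}$, and put $$f_N^{\mathbb C}=\sum_{j=1}^{d_N}c_j\,\varphi_{Nj}^{\mathbb C},\qquad \Pi_{I_N}(\zeta,\bar\zeta)=\sum_{j=1}^{d_N}|\varphi_{Nj}^{\mathbb C}(\zeta)|^2 .$$ For a holomorphic function $f$ let $\langle[Z_f],\psi\rangle=\int_{Z_f}\psi$ be the integral of $\psi$ over the regular part of the zero set of $f$, counted with multiplicity; write $\langle\mathbf E_{\gamma_N}[Z_{f_N^{\mathbb C}}],\psi\rangle=\int\langle[Z_{f_N^{\mathbb C}}],\psi\rangle\,d\gamma_N(c)$ and $\langle\partial\bar\partial u,\psi\rangle=\int_{M_{\mathbb C}}u\,\partial\bar\partial\psi$. Then for every smooth compactly supported complex-valued form $\psi$ of bidegree $(m-1,m-1)$ on $M_{\mathbb C}$ there is a constant $C$ such that for all $N\ge 1$ with $0<d_N<\infty$ and all such orthonormal bases: the integral $\int_{Z_{f_N^{\mathbb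 C}}}\psi$ converges absolutely for $\gamma_N$-almost every $c$ and is a $\gamma_N$-integrable function of $c$, the function $\log\Pi_{I_N}(\zeta,\bar\zeta)$ is locally integrable on $M_{\mathbb C}$, and $$\Big|\frac1N\big\langle\mathbf E_{\gamma_N}[Z_{f_N^{\mathbb C}}],\psi\big\rangle-\frac1N\Big\langle\frac{i}{2\pi}\partial\bar\partial\log\Pi_{I_N}(\zeta,\bar\zeta),\psi\Big\rangle\Big|\le\frac CN .$$ -/

import Mathlib

open Set MeasureTheory Topology
open scoped Manifold ContDiff NNReal ENNReal

noncomputable section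

namespace RandomWaves

/-! ## Integration over a manifold by cutting it into Borel pieces lying in charts -/

theorem exists_chart_cover (H X : Type*) [TopologicalSpace H] [TopologicalSpace X]
    [ChartedSpace H X] [SecondCountableTopology X] [Nonempty X] :
    ∃ c : ℕ → X, (⋃ k, (chartAt H (c k)).source) = univ := by
  obtain ⟨s, hs, hU⟩ := TopologicalSpace.countable_cover_nhds
    (f := fun x : X => (chartAt H x).source) (fun x => chart_source_mem_nhds H x)
  have hne : s.Nonempty := by
    by_contra h
    rw [Set.not_nonempty_iff_eq_empty] at h
    subst h
    simp only [mem_empty_iff_false, iUnion_of_empty, iUnion_empty] at hU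
    exact Set.empty_ne_univ hU
  obtain ⟨c, rfl⟩ := hs.exists_eq_range hne
  exact ⟨c, by simpa using hU⟩

/-- The base points of a countable family of charts covering `X`. -/
def chartCenter (H : Type*) {X : Type*} [TopologicalSpace H] [TopologicalSpace X]
    [ChartedSpace H X] [SecondCountableTopology X] [Nonempty X] : ℕ → X :=
  (exists_chart_cover H X).choose

/-- Pairwise disjoint Borel sets with union `X`; the `k`-th one lies in the domain of the
chart at `chartCenter k`. -/
def chartPiece (H : Type*) {X : Type*} [TopologicalSpace H] [TopologicalSpace X]
    [ChartedSpace H X] [SecondCountableTopology X] [Nonempty X] (k : ℕ) : Set X :=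
  disjointed (fun i => (chartAt H (chartCenter H (X := X) i)).source) k

/-- The integral over `X` of a density (or top-degree form) which in the coordinates `y` of the
chart at `c` has the coefficient `a c y`. -/
def chartIntegral {H X F : Type*} [TopologicalSpace H] [TopologicalSpace X] [ChartedSpace H X]
    [SecondCountableTopology X] [Nonempty X] [MeasureSpace H]
    [NormedAddCommGroup F] [NormedSpace ℝ F] (a : X → H → F) : F :=
  ∑' k : ℕ, ∫ y in chartAt H (chartCenter H (X := X) k) '' chartPiece H k,
    a (chartCenter H k) y

/-! ## The real manifold: metric, Laplacian, spectral subspaces -/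

section Riemannian

variable {m : ℕ} {M : Type*} [TopologicalSpace M] [ChartedSpace (EuclideanSpace ℝ (Fin m)) M]
  [IsManifold (𝓡 m) ω M]

/-- Real analytic Riemannian metrics on `M`. -/
abbrev AnalyticMetric (m : ℕ) (M : Type*) [TopologicalSpace M]
    [ChartedSpace (EuclideanSpace ℝ (Fin m)) M] [IsManifold (𝓡 m) ω M] :=
  Bundle.ContMDiffRiemannianMetric (𝓡 m) ω (EuclideanSpace ℝ (Fin m))
    (fun x : M => TangentSpace (𝓡 m) x)

/-- The matrix `(g_ij)` of the metric in the coordinates of the chart at `c`. -/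
def metricMatrix (g : AnalyticMetric m M) (c : M) (y : EuclideanSpace ℝ (Fin m)) :
    Matrix (Fin m) (Fin m) ℝ :=
  let e := chartAt (EuclideanSpace ℝ (Fin m)) c
  Matrix.of fun i j => g.inner (e.symm y)
    (mfderiv (𝓡 m) (𝓡 m) e.symm y (EuclideanSpace.single i (1 : ℝ)))
    (mfderiv (𝓡 m) (𝓡 m) e.symm y (EuclideanSpace.single j (1 : ℝ)))

/-- The Riemannian density `√(det g_ij)` in the chart at `c`. -/
def metricDensity (g : AnalyticMetric m M) (c : M) (y : EuclideanSpace ℝ (Fin m)) : ℝ :=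
  Real.sqrt (metricMatrix g c y).det

/-- The (nonnegative) Laplacian
`Δ φ = - (det g)^(-1/2) ∑_i ∂_i ((det g)^(1/2) ∑_j g^ij ∂_j φ)`,
computed at `p` in the chart at `p`. -/
def laplacian (g : AnalyticMetric m M) (φ : M → ℝ) (p : M) : ℝ :=
  let e := chartAt (EuclideanSpace ℝ (Fin m)) p
  (-(metricDensity g p (e p))⁻¹) * ∑ i, fderiv ℝ (fun y => metricDensity g p y *
      ∑ j, (metricMatrix g p y)⁻¹ i j *
        fderiv ℝ (fun z => φ (e.symm z)) y (EuclideanSpace.single j (1 : ℝ)))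
    (e p) (EuclideanSpace.single i (1 : ℝ))

/-- The space spanned by the real eigenfunctions with frequency (square root of the eigenvalue)
in `J`. -/
def spectralSpace (g : AnalyticMetric m M) (J : Set ℝ) : Submodule ℝ (M → ℝ) :=
  Submodule.span ℝ {φ | ContMDiff (𝓡 m) 𝓘(ℝ, ℝ) ∞ φ ∧
    ∃ l ∈ J, 0 ≤ l ∧ ∀ p, laplacian g φ p = l ^ 2 * φ p}

variable [SecondCountableTopology M] [Nonempty M]

/-- `⟨u, v⟩ = ∫_M u v dV_g`. -/
def l2Inner (g : AnalyticMetric m M) (u v : M → ℝ) : ℝ :=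
  chartIntegral fun (c : M) (y : EuclideanSpace ℝ (Fin m)) =>
    let x := (chartAt (EuclideanSpace ℝ (Fin m)) c).symm y
    u x * v x * metricDensity g c y

/-- `φ` is an orthonormal basis of the space `V`, for the inner product of `L²(M, dV_g)`. -/
def IsOrthonormalBasisOf (g : AnalyticMetric m M) (V : Submodule ℝ (M → ℝ)) {d : ℕ}
    (φ : Fin d → M → ℝ) : Prop :=
  (∀ i j, l2Inner g (φ i) (φ j) = if i = j then 1 else 0) ∧
    Submodule.span ℝ (range φ) = V

end Riemannian

/-- The Gaussian measure `(d/π)^(d/2) e^(-d|c|²) dc` on `ℝ^d`: the coordinates are independent,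
centred, of variance `1/(2d)`. -/
def waveMeasure (d : ℕ) : Measure (Fin d → ℝ) :=
  Measure.pi fun _ => ProbabilityTheory.gaussianReal 0 ((2 * d : ℝ≥0)⁻¹)

/-- Multiplication by `i`, as a real linear map. -/
def mulI (m : ℕ) : (Fin m → ℂ) →L[ℝ] (Fin m → ℂ) :=
  Complex.I • ContinuousLinearMap.id ℝ (Fin m → ℂ)

/-! ## The complexification: Levi forms and Grauert tubes -/

section Complex

variable {m : ℕ} {X : Type*} [TopologicalSpace X] [ChartedSpace (Fin m → ℂ) X]

/-- The Levi form `∑ u_{j k̄} v_j w̄_k` at `x`, in the chart at `x`, written with the real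
second derivative `D²u`. -/
def leviForm (u : X → ℝ) (x : X) (v w : Fin m → ℂ) : ℂ :=
  let e := chartAt (Fin m → ℂ) x
  let D : (Fin m → ℂ) → (Fin m → ℂ) → ℝ := fun a b =>
    fderiv ℝ (fderiv ℝ fun z => u (e.symm z)) (e x) a b
  (1 / 4 : ℂ) * ((D v w + D (Complex.I • v) (Complex.I • w) : ℝ) +
    Complex.I * (D v (Complex.I • w) - D (Complex.I • v) w : ℝ))

/-- The complex manifold `X`, with `ι : M → X` and `ρ : X → ℝ`, is the Grauert tube
`{√ρ < r}` of radius `r` of `(M, g)`: `M` is a totally real, real analytic submanifold, `ρ` is a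
strictly plurisubharmonic exhaustion with zero set `M`, the Kähler form `i ∂∂̄ρ` induces `g` on
`M` (its metric has the square norm `2 ∑ ρ_{j k̄} v_j v̄_k`), and `√ρ` solves the homogeneous
complex Monge-Ampère equation off `M`. -/
structure IsGrauertTube {M : Type*} [TopologicalSpace M]
    [ChartedSpace (EuclideanSpace ℝ (Fin m)) M] [IsManifold (𝓡 m) ω M]
    (g : AnalyticMetric m M) (ι : M → X) (ρ : X → ℝ) (r : ℝ) : Prop where
  analytic : ContMDiff (𝓡 m) 𝓘(ℝ, Fin m → ℂ) ω ι
  injective : Function.Injective ι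
  totally_real : ∀ (p : M) (v w : TangentSpace (𝓡 m) p),
    mfderiv (𝓡 m) 𝓘(ℝ, Fin m → ℂ) ι p v =
      mulI m (mfderiv (𝓡 m) 𝓘(ℝ, Fin m → ℂ) ι p w) → v = 0 ∧ w = 0
  smooth : ContMDiff 𝓘(ℝ, Fin m → ℂ) 𝓘(ℝ, ℝ) ∞ ρ
  nonneg : ∀ x, 0 ≤ ρ x
  zero_iff : ∀ x, ρ x = 0 ↔ x ∈ range ι
  radius_pos : 0 < r
  lt_radius : ∀ x, √(ρ x) < r
  exhaustion : ∀ s < r, IsCompact {x | √(ρ x) ≤ s}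
  strictly_psh : ∀ x (v : Fin m → ℂ), v ≠ 0 → 0 < (leviForm ρ x v v).re
  induces_metric : ∀ (p : M) (v : TangentSpace (𝓡 m) p),
    g.inner p v v = 2 * (leviForm ρ (ι p) (mfderiv (𝓡 m) 𝓘(ℝ, Fin m → ℂ) ι p v)
      (mfderiv (𝓡 m) 𝓘(ℝ, Fin m → ℂ) ι p v)).re
  monge_ampere : ∀ x ∉ range ι, ∃ v : Fin m → ℂ, v ≠ 0 ∧
    ∀ w, leviForm (fun z => √(ρ z)) x v w = 0

variable (m)

open Classical in
/-- The holomorphic extension `φ^ℂ` to `X` of a function `φ` on `M`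
(and `0` if `φ` has no holomorphic extension to `X`). -/
def complexify {M : Type*} (ι : M → X) (φ : M → ℝ) : X → ℂ :=
  if h : ∃ F : X → ℂ, MDifferentiable 𝓘(ℂ, Fin m → ℂ) 𝓘(ℂ, ℂ) F ∧ ∀ p, F (ι p) = φ p
  then h.choose else 0

/-- The complexified wave `f^ℂ = ∑ c_j φ_j^ℂ`. -/
def complexWave {M : Type*} (ι : M → X) {d : ℕ} (φ : Fin d → M → ℝ) (c : Fin d → ℝ) (x : X) : ℂ :=
  ∑ j, (c j : ℂ) * complexify m ι (φ j) x

/-- The kernel `Π(ζ, ζ̄) = ∑ |φ_j^ℂ(ζ)|²` on the anti-diagonal. -/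
def spectralKernel {M : Type*} (ι : M → X) {d : ℕ} (φ : Fin d → M → ℝ) (x : X) : ℝ :=
  ∑ j, ‖complexify m ι (φ j) x‖ ^ 2

variable {m}

/-! ## Differential forms on a complex manifold -/

/-- Complex valued real differential forms of degree `k` on `X`. -/
abbrev DiffForm (m : ℕ) (X : Type*) [TopologicalSpace X] [ChartedSpace (Fin m → ℂ) X] (k : ℕ) :=
  ∀ x : X, TangentSpace 𝓘(ℝ, Fin m → ℂ) x [⋀^Fin k]→L[ℝ] ℂ

/-- The expression of a form in the coordinates of the chart at `c` (its pullback under the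
inverse of the chart). -/
def DiffForm.inChart {k : ℕ} (ψ : DiffForm m X k) (c : X) (z : Fin m → ℂ) :
    (Fin m → ℂ) [⋀^Fin k]→L[ℝ] ℂ :=
  (ψ ((chartAt (Fin m → ℂ) c).symm z)).compContinuousLinearMap
    (mfderiv 𝓘(ℝ, Fin m → ℂ) 𝓘(ℝ, Fin m → ℂ) (chartAt (Fin m → ℂ) c).symm z)

/-- `ψ` is a test form of bidegree `(p, p)`: smooth, compactly supported, and
`ψ(a v_1, …, a v_2p) = a^p ā^p ψ(v_1, …, v_2p)` for all complex `a`. -/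
structure IsTestForm (p : ℕ) (ψ : DiffForm m X (2 * p)) : Prop where
  smooth : ∀ c : X, ContDiffOn ℝ ∞ (DiffForm.inChart ψ c) (chartAt (Fin m → ℂ) c).target
  compact_support : ∃ K : Set X, IsCompact K ∧ ∀ x ∉ K, ψ x = 0
  bidegree : ∀ c : X, ∀ z ∈ (chartAt (Fin m → ℂ) c).target, ∀ (a : ℂ) (v : Fin (2 * p) → Fin m → ℂ),
    DiffForm.inChart ψ c z (fun i => a • v i) =
      a ^ p * (starRingEnd ℂ a) ^ p * DiffForm.inChart ψ c z v

/-- `∂̄η` for a form `η` of bidegree `(p, p)` on an open subset of `ℂ^m`. On `dη = ∂η + ∂̄η`,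
of types `(p+1, p)` and `(p, p+1)`, precomposition with `i` acts by `i` and `-i`, so that
`∂̄η = (dη + i dη(i·, …, i·)) / 2`. -/
def delbar {k : ℕ} (η : (Fin m → ℂ) → (Fin m → ℂ) [⋀^Fin k]→L[ℝ] ℂ) (z : Fin m → ℂ) :
    (Fin m → ℂ) [⋀^Fin (k + 1)]→L[ℝ] ℂ :=
  (1 / 2 : ℂ) • (extDeriv η z + Complex.I • (extDeriv η z).compContinuousLinearMap (mulI m))

/-- `∂∂̄η = d∂̄η` for a form `η` of bidegree `(p, p)`. -/
def ddbar {k : ℕ} (η : (Fin m → ℂ) → (Fin m → ℂ) [⋀^Fin k]→L[ℝ] ℂ) (z : Fin m → ℂ) :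
    (Fin m → ℂ) [⋀^Fin (k + 1 + 1)]→L[ℝ] ℂ :=
  extDeriv (delbar η) z

/-- The real frame `b_1, i b_1, b_2, i b_2, …`, positively oriented on the complex span. -/
def complexFrame {p : ℕ} (b : Fin p → Fin m → ℂ) (k : Fin (2 * p)) : Fin m → ℂ :=
  if k.val % 2 = 0 then b ⟨k.val / 2, by omega⟩ else Complex.I • b ⟨k.val / 2, by omega⟩

end Complex

/-! ## The currents `∂∂̄ u` and `[Z_f]` -/

section Currents

variable {n : ℕ} {X : Type*} [TopologicalSpace X] [ChartedSpace (Fin (n + 1) → ℂ) X]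

/-- The coefficient of a form of top degree with respect to Lebesgue measure on `ℂ^(n+1)`. -/
def topCoeff (η : (Fin (n + 1) → ℂ) [⋀^Fin (2 * (n + 1))]→L[ℝ] ℂ) : ℂ :=
  η (complexFrame fun j => Pi.single j 1)

/-- `F = h^k u` near `z`, where `h, u` are holomorphic near `z`, `h(z) = 0`, `dh(z) = ℓ ≠ 0` and
`u(z) ≠ 0`: thus near `z` the zero set of `F` is the complex submanifold `{h = 0}`, with tangent
space `ker ℓ` at `z`, and it has multiplicity `k ≥ 1`. -/
def IsRegularZero (F : (Fin (n + 1) → ℂ) → ℂ) (z : Fin (n + 1) → ℂ) (k : ℕ)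
    (l : (Fin (n + 1) → ℂ) →L[ℂ] ℂ) : Prop :=
  1 ≤ k ∧ l ≠ 0 ∧ ∃ h u : (Fin (n + 1) → ℂ) → ℂ, AnalyticAt ℂ h z ∧ AnalyticAt ℂ u z ∧
    h z = 0 ∧ fderiv ℂ h z = l ∧ u z ≠ 0 ∧ F =ᶠ[𝓝 z] fun w => h w ^ k * u w

open Classical in
/-- The multiplicity of the zero divisor of `F` at a regular point `z` of the zero set;
`0` at all other points. -/
def zeroMultiplicity (F : (Fin (n + 1) → ℂ) → ℂ) (z : Fin (n + 1) → ℂ) : ℕ :=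
  if h : ∃ k l, IsRegularZero F z k l then h.choose else 0

open Classical in
/-- At a regular point `z` of the zero set of `F`, a linear form (unique up to a factor) whose
kernel is the tangent space of the zero set; `0` at all other points. -/
def zeroConormal (F : (Fin (n + 1) → ℂ) → ℂ) (z : Fin (n + 1) → ℂ) :
    (Fin (n + 1) → ℂ) →L[ℂ] ℂ :=
  if h : ∃ l k, IsRegularZero F z k l then h.choose else 0

/-- The regular zeros `z` of `F` for which `j` is the first index such that the projection of the
zero set along the `j`-th coordinate axis is a local biholomorphism at `z`. For `j = 0, …, n`
these sets form a Borel partition of the regular part of the zero set. -/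
def zeroSheet (F : (Fin (n + 1) → ℂ) → ℂ) (j : Fin (n + 1)) : Set (Fin (n + 1) → ℂ) :=
  {z | zeroConormal F z (Pi.single j 1) ≠ 0 ∧ ∀ i < j, zeroConormal F z (Pi.single i 1) = 0}

/-- The tangent vectors of the zero set at a point of `zeroSheet F j` that project to the standard
basis of `ℂ^n` along the `j`-th coordinate axis. -/
def zeroTangent (F : (Fin (n + 1) → ℂ) → ℂ) (j : Fin (n + 1)) (z : Fin (n + 1) → ℂ) (k : Fin n) :
    Fin (n + 1) → ℂ :=
  Pi.single (j.succAbove k) 1 -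
    (zeroConormal F z (Pi.single (j.succAbove k) 1) / zeroConormal F z (Pi.single j 1)) •
      Pi.single j 1

/-- Multiplicity times the coefficient, with respect to Lebesgue measure `dw` on `ℂ^n`, of the
restriction of `η` to the zero set of `F`, in the local coordinates `w` of the zero set given by
the projection along the `j`-th axis. -/
def zeroCoeff (F : (Fin (n + 1) → ℂ) → ℂ)
    (η : (Fin (n + 1) → ℂ) → (Fin (n + 1) → ℂ) [⋀^Fin (2 * n)]→L[ℝ] ℂ)
    (j : Fin (n + 1)) (z : Fin (n + 1) → ℂ) : ℂ :=
  zeroMultiplicity F z * η z (complexFrame (zeroTangent F j z))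

/-- The integral of `η` over the part in `S` of the zero set of `F`, counted with multiplicity. -/
def zeroIntegralOn (F : (Fin (n + 1) → ℂ) → ℂ)
    (η : (Fin (n + 1) → ℂ) → (Fin (n + 1) → ℂ) [⋀^Fin (2 * n)]→L[ℝ] ℂ)
    (S : Set (Fin (n + 1) → ℂ)) : ℂ :=
  ∑ j : Fin (n + 1), ∫ w : Fin n → ℂ,
    ∑' t : {t : ℂ // (j.insertNth t w : Fin (n + 1) → ℂ) ∈ S ∩ zeroSheet F j},
      zeroCoeff F η j (j.insertNth t.1 w)

/-- The corresponding integral of the absolute value. -/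
def zeroMassOn (F : (Fin (n + 1) → ℂ) → ℂ)
    (η : (Fin (n + 1) → ℂ) → (Fin (n + 1) → ℂ) [⋀^Fin (2 * n)]→L[ℝ] ℂ)
    (S : Set (Fin (n + 1) → ℂ)) : ℝ≥0∞ :=
  ∑ j : Fin (n + 1), ∫⁻ w : Fin n → ℂ,
    ∑' t : {t : ℂ // (j.insertNth t w : Fin (n + 1) → ℂ) ∈ S ∩ zeroSheet F j},
      ‖zeroCoeff F η j (j.insertNth t.1 w)‖ₑ

variable [SecondCountableTopology X] [Nonempty X]

/-- `⟨∂∂̄ u, ψ⟩ = ∫_X u ∂∂̄ψ`, for a test form `ψ` of bidegree `(n, n)`, `n + 1 = dim X`. -/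
def ddbarCurrent (u : X → ℝ) (ψ : DiffForm (n + 1) X (2 * n)) : ℂ :=
  chartIntegral fun (c : X) (z : Fin (n + 1) → ℂ) =>
    (u ((chartAt (Fin (n + 1) → ℂ) c).symm z) : ℂ) * topCoeff (ddbar (DiffForm.inChart ψ c) z)

/-- `⟨[Z_f], ψ⟩ = ∫_{Z_f} ψ`: the integral of `ψ` over the regular part of the zero set of `f`,
counted with multiplicity. -/
def zeroCurrent (f : X → ℂ) (ψ : DiffForm (n + 1) X (2 * n)) : ℂ :=
  ∑' k : ℕ,
    let c : X := chartCenter (Fin (n + 1) → ℂ) k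
    let e := chartAt (Fin (n + 1) → ℂ) c
    zeroIntegralOn (fun z => f (e.symm z)) (DiffForm.inChart ψ c)
      (e '' chartPiece (Fin (n + 1) → ℂ) k)

/-- The total variation of `ψ` over `Z_f`; the integral `∫_{Z_f} ψ` is absolutely convergent when
it is finite. -/
def zeroMass (f : X → ℂ) (ψ : DiffForm (n + 1) X (2 * n)) : ℝ≥0∞ :=
  ∑' k : ℕ,
    let c : X := chartCenter (Fin (n + 1) → ℂ) k
    let e := chartAt (Fin (n + 1) → ℂ) c
    zeroMassOn (fun z => f (e.symm z)) (DiffForm.inChart ψ c)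
      (e '' chartPiece (Fin (n + 1) → ℂ) k)

end Currents

end RandomWaves

end

open RandomWaves

noncomputable section

/-! By the Poincaré-Lelong formula the integral of `ψ` over the zero set of `f` is `(i/π) ∫ log|f|
∂∂̄ψ`. The mean zero current is therefore found by averaging `log|f(ζ)|` at each fixed point `ζ`.
There `f(ζ) = ∑ c_j Φ_j`, with independent centred Gaussian `c_j` of variance `1/(2d)`, and
`log|f(ζ)|` differs from `½ log ∑|Φ_j|² - ½ log(2d)` by a random variable whose mean absolute value
is at most an absolute constant (`integral_abs_log_norm_sum_le`). The coefficients are real, so the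
law of this deviation depends on the relative position of `Re Φ` and `Im Φ`. One of these two real
vectors carries at least half of `∑|Φ_j|²`, which bounds the deviation from below; the second moment
bounds it from above.

The first term gives exactly `(i/2π) ∂∂̄ log Π`. The constant `-½ log(2d)`, though unbounded in `d`,
disappears because `∂∂̄ψ` has integral zero. The deviation contributes at most a constant times the
`L¹` norms of the densities that make up `∂∂̄ψ`. The resulting bound depends on `ψ` alone
(`IsTestForm.exists_bound`), and division by `N` gives the theorem.

The Poincaré-Lelong formula is reduced to one variable. A partition of unity brings `ψ` into charts
(`IsTestForm.exists_eq_sum`). Forms of bidegree `(n, n)` are spanned by the constant forms `Vol(v,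
iv, ·)` (`exists_eq_sum_lineForm`), and a complex linear change of coordinates makes `v` the first
basis vector. For `χ Vol(v, iv, ·)` the integral over the zero set is then a sum of `χ` over the
zeros on each line parallel to the first axis, integrated over the lines. On almost every line the
zeros are regular points of the zero set, with multiplicity equal to the order of vanishing on the
line (`ae_isRegularZero_slice`), so that `tsum_order_mul_eq_integral_log` and Fubini conclude in
`zeroIntegralOn_smul_lineForm`. Since the integral over the zero set is defined through coordinate
projections, changing coordinates or charts requires its invariance under biholomorphic maps
(`IsPullback.isInvariantOn`).

The analytic input is the local integrability of `log|f|`, obtained from Jensen's inequality on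
circles (`lintegral_log_div_lt_top`), together with the analyticity of complex differentiable
functions of several variables and division by a defining function of a smooth hypersurface
(`exists_eq_mul_of_eq_zero_on_zeros`). -/

namespace RandomWaves

open Filter Metric

/-! ### Holomorphic functions of several variables: Cauchy estimates and analyticity. -/

section SeveralVariables

variable {E : Type*} [NormedAddCommGroup E] [NormedSpace ℂ E]
  {F : Type*} [NormedAddCommGroup F] [NormedSpace ℂ F]

/-- Cauchy's estimate for the Fréchet derivative. -/
theorem norm_fderiv_le_of_forall_mem_ball {f : E → F} {z : E} {r C : ℝ} (hr : 0 < r)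
    (hf : DifferentiableOn ℂ f (ball z r)) (hC : ∀ w ∈ ball z r, ‖f w‖ ≤ C) :
    ‖fderiv ℂ f z‖ ≤ 2 * C / r := by
  have hC0 : 0 ≤ C := (norm_nonneg _).trans (hC z (mem_ball_self hr))
  refine ContinuousLinearMap.opNorm_le_bound _ (by positivity) fun h => ?_
  rcases eq_or_ne h 0 with rfl | hh
  · simp
  have hh' : 0 < ‖h‖ := norm_pos_iff.2 hh
  have hfz : DifferentiableAt ℂ f z := hf.differentiableAt (ball_mem_nhds z hr)
  have hR : 0 < r / (2 * ‖h‖) := by positivity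
  have hmem : ∀ t ∈ closedBall (0 : ℂ) (r / (2 * ‖h‖)), z + t • h ∈ ball z r := by
    intro t ht
    rw [mem_closedBall_zero_iff] at ht
    rw [mem_ball_iff_norm, add_sub_cancel_left, norm_smul]
    calc ‖t‖ * ‖h‖ ≤ r / (2 * ‖h‖) * ‖h‖ := by gcongr
      _ = r / 2 := by field_simp
      _ < r := by linarith
  have hd : DifferentiableOn ℂ (fun t : ℂ => f (z + t • h)) (closedBall 0 (r / (2 * ‖h‖))) :=
    hf.comp (by fun_prop) hmem
  have hderiv : deriv (fun t : ℂ => f (z + t • h)) 0 = fderiv ℂ f z h := by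
    have h1 : HasFDerivAt f (fderiv ℂ f z) (z + (0 : ℂ) • h) := by simpa using hfz.hasFDerivAt
    have h2 : HasDerivAt (fun t : ℂ => z + t • h) h 0 := by
      simpa using ((hasDerivAt_id (0 : ℂ)).smul_const h).const_add z
    exact (h1.comp_hasDerivAt (0 : ℂ) h2).deriv
  have := Complex.norm_deriv_le_of_forall_mem_sphere_norm_le hR
    (f := fun t : ℂ => f (z + t • h)) (hd.diffContOnCl_ball subset_rfl)
    (fun t ht => hC _ (hmem t (sphere_subset_closedBall ht)))
  rw [hderiv] at this
  calc _ ≤ _ := this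
    _ = _ := by field_simp

/-- Differentiation under the integral sign. On a thickening of the compact curve `z + γ` the
function `G` is bounded, and Cauchy's estimate turns this into the dominating bound for its
derivative. It serves for Cauchy integrals over circles in a complex line, both for derivatives and
for quotients. -/
theorem differentiableAt_integral_smul_add [FiniteDimensional ℂ E] [FiniteDimensional ℂ F]
    {G : E → F} {V : Set E} (hV : IsOpen V) (hG : DifferentiableOn ℂ G V) {c : ℝ → ℂ}
    (hc : Continuous c) {γ : ℝ → E} (hγ : Continuous γ) {z : E} (hz : ∀ θ, z + γ θ ∈ V) :
    DifferentiableAt ℂ (fun w => ∫ θ in (0 : ℝ)..2 * Real.pi, c θ • G (w + γ θ)) z := by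
  have : CompleteSpace F := FiniteDimensional.complete ℂ F
  have : ProperSpace E := FiniteDimensional.proper ℂ E
  have : ProperSpace F := FiniteDimensional.proper ℂ F
  borelize E
  set K : Set E := (fun θ => z + γ θ) '' Icc 0 (2 * Real.pi) with hK
  have hKc : IsCompact K := isCompact_Icc.image (by fun_prop)
  obtain ⟨δ, hδ, hδV⟩ := hKc.exists_cthickening_subset_open hV (by rintro _ ⟨θ, -, rfl⟩; exact hz θ)
  have hKδ : IsCompact (cthickening δ K) := hKc.cthickening
  obtain ⟨C, hC⟩ := hKδ.exists_bound_of_continuousOn (hG.continuousOn.mono hδV)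
  have hmem : ∀ θ ∈ Ioc 0 (2 * Real.pi), ∀ w ∈ ball z (δ / 2), ball (w + γ θ) (δ / 2) ⊆
      cthickening δ K := by
    intro θ hθ w hw v hv
    refine mem_cthickening_of_dist_le v (z + γ θ) δ K ⟨θ, Ioc_subset_Icc_self hθ, rfl⟩ ?_
    rw [mem_ball] at hv hw
    calc dist v (z + γ θ) ≤ dist v (w + γ θ) + dist (w + γ θ) (z + γ θ) := dist_triangle _ _ _
      _ ≤ δ := by rw [dist_add_right]; linarith
  have hmem' : ∀ θ ∈ Ioc 0 (2 * Real.pi), ∀ w ∈ ball z (δ / 2), w + γ θ ∈ V :=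
    fun θ hθ w hw => hδV (hmem θ hθ w hw (mem_ball_self (by linarith)))
  have hcont : ∀ w ∈ ball z (δ / 2), AEStronglyMeasurable (fun θ => c θ • G (w + γ θ))
      (volume.restrict (Ioc 0 (2 * Real.pi))) := by
    intro w hw
    refine ContinuousOn.aestronglyMeasurable (fun θ hθ => ?_) measurableSet_Ioc
    refine ContinuousAt.continuousWithinAt (hc.continuousAt.smul ?_)
    exact ContinuousAt.comp (f := fun θ => w + γ θ)
      (hG.differentiableAt (hV.mem_nhds (hmem' θ hθ w hw))).continuousAt (by fun_prop)
  obtain ⟨Cc, hCc⟩ := (isCompact_Icc (a := 0) (b := 2 * Real.pi)).exists_bound_of_continuousOn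
    hc.continuousOn
  simp only [intervalIntegral.integral_of_le Real.two_pi_pos.le]
  refine HasFDerivAt.differentiableAt
    (hasFDerivAt_integral_of_dominated_of_fderiv_le (𝕜 := ℂ) (s := ball z (δ / 2))
    (F' := fun w θ => c θ • fderiv ℂ G (w + γ θ))
    (bound := fun _ => Cc * (2 * C / (δ / 2)))
    (ball_mem_nhds z (by linarith)) ?_ ?_ ?_ ?_ ?_ ?_)
  · filter_upwards [ball_mem_nhds z (show 0 < δ / 2 by linarith)] with w hw using hcont w hw
  · have : ContinuousOn (fun θ => c θ • G (z + γ θ)) (Icc 0 (2 * Real.pi)) := by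
      refine fun θ _ => ContinuousAt.continuousWithinAt (hc.continuousAt.smul ?_)
      exact ContinuousAt.comp (f := fun θ => z + γ θ)
        (hG.differentiableAt (hV.mem_nhds (hz θ))).continuousAt (by fun_prop)
    exact this.integrableOn_Icc.mono_set Ioc_subset_Icc_self
  · refine Measurable.aestronglyMeasurable ?_
    have : Measurable fun θ : ℝ => fderiv ℂ G (z + γ θ) :=
      (measurable_fderiv ℂ G).comp (by fun_prop : Continuous _).measurable
    exact hc.measurable.smul this
  · refine (ae_restrict_mem measurableSet_Ioc).mono fun θ hθ w hw => ?_
    have h1 := hmem θ hθ w hw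
    rw [norm_smul]
    refine mul_le_mul (hCc θ (Ioc_subset_Icc_self hθ))
      (norm_fderiv_le_of_forall_mem_ball (by linarith) (hG.mono (h1.trans hδV))
        fun v hv => hC v (h1 hv))
      (norm_nonneg _) ((norm_nonneg _).trans (hCc θ (Ioc_subset_Icc_self hθ)))
  · exact integrable_const _
  · refine (ae_restrict_mem measurableSet_Ioc).mono fun θ hθ w hw => ?_
    refine HasFDerivAt.const_smul ?_ _
    exact (hasFDerivAt_comp_add_right _).2
      (hG.differentiableAt (hV.mem_nhds (hmem' θ hθ w hw))).hasFDerivAt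

theorem hasDerivAt_comp_line {f : E → F} {f' : E →L[ℂ] F} {z h : E} {t : ℂ}
    (hf : HasFDerivAt f f' (z + t • h)) : HasDerivAt (fun s : ℂ => f (z + s • h)) (f' h) t := by
  have h2 : HasDerivAt (fun s : ℂ => z + s • h) h t := by
    simpa using ((hasDerivAt_id t).smul_const h).const_add z
  exact hf.comp_hasDerivAt t h2

/-- Cauchy's formula for the derivative on the line `z + ℂ h` writes the directional derivative as
an integral of translates of `f` over a circle of fixed radius, and such an integral is again
complex differentiable in `z`. -/
theorem differentiableOn_fderiv_apply [FiniteDimensional ℂ E] [FiniteDimensional ℂ F]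
    {f : E → F} {U : Set E} (hU : IsOpen U) (hf : DifferentiableOn ℂ f U) (h : E) :
    DifferentiableOn ℂ (fun z => fderiv ℂ f z h) U := by
  have : CompleteSpace F := FiniteDimensional.complete ℂ F
  intro z hz
  refine DifferentiableAt.differentiableWithinAt ?_
  obtain ⟨r, hr, hrU⟩ := Metric.isOpen_iff.1 hU z hz
  set R : ℝ := r / (4 * (‖h‖ + 1)) with hRdef
  have hh1 : 0 < ‖h‖ + 1 := by positivity
  have hR : 0 < R := by positivity
  have hmem : ∀ w ∈ ball z (r / 4), ∀ t ∈ closedBall (0 : ℂ) R, w + t • h ∈ U := by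
    intro w hw t ht
    refine hrU ?_
    rw [mem_closedBall_zero_iff] at ht
    rw [mem_ball_iff_norm] at hw ⊢
    calc ‖w + t • h - z‖ = ‖(w - z) + t • h‖ := by congr 1; abel
      _ ≤ ‖w - z‖ + ‖t‖ * ‖h‖ := (norm_add_le _ _).trans (by rw [norm_smul])
      _ < r / 4 + R * (‖h‖ + 1) := by
        have : ‖t‖ * ‖h‖ ≤ R * (‖h‖ + 1) := by gcongr; linarith
        linarith
      _ = r / 2 := by rw [hRdef]; field_simp; norm_num
      _ < r := by linarith
  have hcirc : ∀ θ : ℝ, circleMap 0 R θ ∈ closedBall (0 : ℂ) R := fun θ =>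
    circleMap_mem_closedBall 0 hR.le θ
  set c : ℝ → ℂ := fun θ => (2 * Real.pi * Complex.I : ℂ)⁻¹ *
    (deriv (circleMap 0 R) θ * (1 / (circleMap 0 R θ - 0) ^ 2)) with hc
  have hcc : Continuous c := by
    have : ∀ θ, circleMap 0 R θ - 0 ≠ 0 := fun θ => by simpa using hR.ne'
    simp only [hc, deriv_circleMap]
    refine continuous_const.mul (Continuous.mul (by fun_prop) ?_)
    exact continuous_const.div (by fun_prop) fun θ => pow_ne_zero 2 (this θ)
  have key : ∀ w ∈ ball z (r / 4), fderiv ℂ f w h =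
      ∫ θ in (0 : ℝ)..2 * Real.pi, c θ • f (w + circleMap 0 R θ • h) := by
    intro w hw
    have hd : DifferentiableOn ℂ (fun t : ℂ => f (w + t • h)) (closedBall 0 R) :=
      hf.comp (by fun_prop) (hmem w hw)
    have h1 : HasFDerivAt f (fderiv ℂ f w) (w + (0 : ℂ) • h) := by
      have := hmem w hw 0 (mem_closedBall_self hR.le)
      rw [zero_smul, add_zero] at this ⊢
      exact (hf.differentiableAt (hU.mem_nhds this)).hasFDerivAt
    have h3 := (hd.diffContOnCl_ball subset_rfl).deriv_eq_smul_circleIntegral hR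
    rw [(hasDerivAt_comp_line h1).deriv] at h3
    have h4 : (2 * Real.pi * Complex.I : ℂ) ≠ 0 := by simp [Real.pi_ne_zero]
    rw [← inv_smul_smul₀ h4 (fderiv ℂ f w h), ← h3]
    simp only [circleIntegral, hc, mul_smul, intervalIntegral.integral_smul]
  have hev : (fun w => fderiv ℂ f w h) =ᶠ[𝓝 z] _ :=
    Filter.eventuallyEq_of_mem (ball_mem_nhds z (show 0 < r / 4 by linarith)) key
  refine DifferentiableAt.congr_of_eventuallyEq ?_ hev
  exact differentiableAt_integral_smul_add hU hf hcc (γ := fun θ => circleMap 0 R θ • h)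
    (by fun_prop) fun θ => hmem z (mem_ball_self (by linarith)) _ (hcirc θ)

theorem contDiffOn_of_differentiableOn [FiniteDimensional ℂ E] [FiniteDimensional ℂ F]
    {f : E → F} {U : Set E} (hU : IsOpen U) (hf : DifferentiableOn ℂ f U) :
    ContDiffOn ℂ ∞ f U := by
  refine contDiffOn_infty.2 fun n => ?_
  induction n generalizing f with
  | zero => exact contDiffOn_zero.2 hf.continuousOn
  | succ n ih =>
    rw [Nat.cast_succ, contDiffOn_succ_iff_fderiv_apply hU.uniqueDiffOn]
    refine ⟨hf, fun h => absurd h (by simp), fun y => ?_⟩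
    refine (ih (differentiableOn_fderiv_apply hU hf y)).congr fun x hx => ?_
    rw [fderivWithin_of_isOpen hU hx]

/-- Each derivative costs a factor `2/δ` by Cauchy's estimate and shrinks the ball by `δ`. -/
theorem norm_iteratedFDeriv_le_of_forall_mem_ball [FiniteDimensional ℂ E] [FiniteDimensional ℂ F]
    {f : E → F} {z : E} {r C δ : ℝ} (hδ : 0 < δ)
    (hf : DifferentiableOn ℂ f (ball z r)) (hC : ∀ w ∈ ball z r, ‖f w‖ ≤ C) (n : ℕ) :
    ∀ w ∈ ball z (r - n * δ), ‖iteratedFDeriv ℂ n f w‖ ≤ C * (2 / δ) ^ n := by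
  induction n with
  | zero =>
    intro w hw
    simpa using hC w (by simpa using hw)
  | succ n ih =>
    intro w hw
    have hsub : ball w δ ⊆ ball z (r - n * δ) := by
      refine ball_subset_ball' ?_
      rw [mem_ball] at hw
      push_cast at hw
      linarith
    have hsub' : ball w δ ⊆ ball z r :=
      hsub.trans (ball_subset_ball (by have : 0 ≤ n * δ := by positivity
                                       linarith))
    have hd : DifferentiableOn ℂ (iteratedFDeriv ℂ n f) (ball w δ) := fun v hv =>
      (((contDiffOn_of_differentiableOn isOpen_ball hf).contDiffAt
        (isOpen_ball.mem_nhds (hsub' hv))).differentiableAt_iteratedFDeriv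
          (by exact_mod_cast WithTop.coe_lt_top _)).differentiableWithinAt
    have := norm_fderiv_le_of_forall_mem_ball hδ hd fun v hv => ih v (hsub hv)
    rw [norm_fderiv_iteratedFDeriv] at this
    calc _ ≤ _ := this
      _ = _ := by rw [pow_succ]; ring

/-- Holomorphic functions of several variables are analytic. -/
theorem analyticOnNhd_of_differentiableOn [FiniteDimensional ℂ E] [FiniteDimensional ℂ F]
    {f : E → F} {U : Set E} (hU : IsOpen U) (hf : DifferentiableOn ℂ f U) :
    AnalyticOnNhd ℂ f U := by
  have : CompleteSpace F := FiniteDimensional.complete ℂ F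
  have : ProperSpace E := FiniteDimensional.proper ℂ E
  intro z hz
  obtain ⟨r, hr, hrU⟩ := Metric.isOpen_iff.1 hU z hz
  obtain ⟨C, hC⟩ := (isCompact_closedBall z (r / 2)).exists_bound_of_continuousOn
    (hf.continuousOn.mono ((closedBall_subset_ball (by linarith)).trans hrU))
  have hfr : DifferentiableOn ℂ f (ball z (r / 2)) :=
    hf.mono ((ball_subset_ball (by linarith)).trans hrU)
  have hC' : ∀ w ∈ ball z (r / 2), ‖f w‖ ≤ C := fun w hw => hC w (ball_subset_closedBall hw)
  have hC0 : 0 ≤ C := (norm_nonneg _).trans (hC' z (mem_ball_self (by linarith)))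
  set p : FormalMultilinearSeries ℂ E F := fun n => ((n.factorial : ℂ)⁻¹) • iteratedFDeriv ℂ n f z
    with hp
  set s : ℝ := r / 16 with hs
  have hs0 : 0 < s := by positivity
  have hbd : ∀ n, ‖p n‖ * (s / 2) ^ n ≤ C := by
    intro n
    rcases n.eq_zero_or_pos with rfl | hn
    · simpa [hp] using hC' z (mem_ball_self (by linarith))
    have hn' : (0 : ℝ) < n := by exact_mod_cast hn
    -- The step is taken inversely proportional to `n`: the `n` derivatives together use up `4s =
    -- r/4` of the radius `r/2`. This produces the factor `n ^ n`, which `n! ≥ (n/e)^n` compensates.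
    have hδ : 0 < 4 * s / n := by positivity
    have h1 := norm_iteratedFDeriv_le_of_forall_mem_ball hδ hfr hC' n z
      (mem_ball_self (by rw [mul_div_cancel₀ _ hn'.ne', hs]; linarith))
    have h2 : (n : ℝ) ^ n / n.factorial ≤ 4 ^ n := by
      have h3 : (n : ℝ) ^ n / n.factorial ≤ Real.exp n := by
        exact_mod_cast Real.pow_div_factorial_le_exp n (by positivity) n
      refine h3.trans ?_
      rw [← mul_one (n : ℝ), Real.exp_nat_mul]
      gcongr
      have := Real.exp_one_lt_d9
      linarith
    have hfac : (0 : ℝ) < n.factorial := by exact_mod_cast n.factorial_pos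
    calc ‖p n‖ * (s / 2) ^ n = (n.factorial : ℝ)⁻¹ * ‖iteratedFDeriv ℂ n f z‖ * (s / 2) ^ n := by
          rw [hp, norm_smul, norm_inv, Complex.norm_natCast]
      _ ≤ (n.factorial : ℝ)⁻¹ * (C * (2 / (4 * s / n)) ^ n) * (s / 2) ^ n := by gcongr
      _ = C * ((n : ℝ) ^ n / n.factorial) * (1 / 4) ^ n := by
          rw [show (2 / (4 * s / n) : ℝ) = n * (1 / 4) * (s / 2)⁻¹ by field_simp, mul_pow,
            mul_pow, inv_pow]
          have : (s / 2) ^ n ≠ 0 := by positivity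
          field_simp
      _ ≤ C * 4 ^ n * (1 / 4) ^ n := by gcongr
      _ = C := by rw [mul_assoc, ← mul_pow]; norm_num
  refine ⟨p, ENNReal.ofReal (s / 2), ?_, ?_, ?_⟩
  · have := p.le_radius_of_bound C (r := (s / 2).toNNReal)
      (by rw [Real.coe_toNNReal _ (by positivity)]; exact hbd)
    simpa [ENNReal.ofReal] using this
  · simpa using hs0
  · intro y hy
    have hy' : ‖y‖ < s / 2 := by
      rw [Metric.eball_ofReal, mem_ball_zero_iff] at hy
      exact hy
    have hmem : ∀ t ∈ ball (0 : ℂ) 2, z + t • y ∈ ball z (r / 2) := by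
      intro t ht
      rw [mem_ball_zero_iff] at ht
      rw [mem_ball_iff_norm, add_sub_cancel_left, norm_smul]
      have : ‖t‖ * ‖y‖ ≤ 2 * (s / 2) := by gcongr
      linarith
    have hg : DifferentiableOn ℂ (fun t : ℂ => f (z + t • y)) (ball 0 2) :=
      hfr.comp (by fun_prop) hmem
    -- Convergence to `f (z + y)` is a one-variable fact: the restriction to the line through `y` is
    -- holomorphic on the disc of radius `2`, and its Taylor series is evaluated at `1`.
    have hit : ∀ n, ∀ t ∈ ball (0 : ℂ) 2, iteratedDeriv n (fun t : ℂ => f (z + t • y)) t =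
        iteratedFDeriv ℂ n f (z + t • y) fun _ => y := by
      intro n
      induction n with
      | zero => intro t _; simp
      | succ n ih =>
        intro t ht
        rw [iteratedDeriv_succ, ((Filter.eventuallyEq_of_mem (isOpen_ball.mem_nhds ht) ih).deriv_eq),
          iteratedFDeriv_succ_apply_left]
        have h1 : HasFDerivAt (iteratedFDeriv ℂ n f) (fderiv ℂ (iteratedFDeriv ℂ n f) (z + t • y))
            (z + t • y) :=
          (((contDiffOn_of_differentiableOn isOpen_ball hfr).contDiffAt
            (isOpen_ball.mem_nhds (hmem t ht))).differentiableAt_iteratedFDeriv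
              (by exact_mod_cast WithTop.coe_lt_top _)).hasFDerivAt
        have h2 : HasDerivAt (fun t : ℂ => z + t • y) y t := by
          simpa using ((hasDerivAt_id t).smul_const y).const_add z
        have h3 := h1.comp_hasDerivAt t h2
        have h4 := ((ContinuousMultilinearMap.apply ℂ (fun _ : Fin n => E) F
          (fun _ => y)).hasFDerivAt).comp_hasDerivAt t h3
        exact h4.deriv
    have := Complex.hasSum_taylorSeries_on_ball hg (z := 1) (by simp)
    simp only [sub_zero, one_pow, one_smul] at this
    refine this.congr_fun ?_ |> fun h => h
    intro n
    simp [hp, hit n 0 (by simp)]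

end SeveralVariables

/-! ### Division by a defining function of a smooth hypersurface. -/

section Division

variable {E : Type*} [NormedAddCommGroup E] [NormedSpace ℂ E] [FiniteDimensional ℂ E]

/-- A holomorphic function vanishing on the smooth hypersurface `h = 0` is divisible by `h`. -/
theorem exists_eq_mul_of_eq_zero_on_zeros {h f : E → ℂ} {z₀ : E} (hh : AnalyticAt ℂ h z₀)
    (hf : AnalyticAt ℂ f z₀) (hd : fderiv ℂ h z₀ ≠ 0)
    (hz : ∀ᶠ z in 𝓝 z₀, h z = 0 → f z = 0) :
    ∃ u : E → ℂ, AnalyticAt ℂ u z₀ ∧ f =ᶠ[𝓝 z₀] fun z => h z * u z := by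
  classical
  have : ProperSpace E := FiniteDimensional.proper ℂ E
  obtain ⟨v, hv⟩ : ∃ v, fderiv ℂ h z₀ v ≠ 0 := by
    by_contra! H
    exact hd (ContinuousLinearMap.ext H)
  have hDc : ContinuousAt (fun z => fderiv ℂ h z v) z₀ :=
    (hh.fderiv.continuousAt).clm_apply continuousAt_const
  have hev : ∀ᶠ z in 𝓝 z₀, AnalyticAt ℂ h z ∧ AnalyticAt ℂ f z ∧ fderiv ℂ h z v ≠ 0 ∧
      (h z = 0 → f z = 0) :=
    hh.eventually_analyticAt.and (hf.eventually_analyticAt.and ((hDc.eventually_ne hv).and hz))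
  obtain ⟨r, hr, hball⟩ := Metric.eventually_nhds_iff_ball.1 hev
  have hv0 : v ≠ 0 := by rintro rfl; simp at hv
  have hline : ∀ (z : E) (t : ℂ), AnalyticAt ℂ (fun s : ℂ => z + s • v) t := fun z t => by fun_prop
  have hdl : ∀ z t, AnalyticAt ℂ h (z + t • v) →
      HasDerivAt (fun s : ℂ => h (z + s • v)) (fderiv ℂ h (z + t • v) v) t := fun z t H =>
    hasDerivAt_comp_line H.differentiableAt.hasFDerivAt
  have hdf : ∀ z t, AnalyticAt ℂ f (z + t • v) →
      HasDerivAt (fun s : ℂ => f (z + s • v)) (fderiv ℂ f (z + t • v) v) t := fun z t H =>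
    hasDerivAt_comp_line H.differentiableAt.hasFDerivAt
  -- a circle around the zero of `h` on the line through `z₀`
  have hne : ∀ᶠ t : ℂ in 𝓝[≠] 0, h (z₀ + t • v) ≠ 0 :=
    (hdl z₀ 0 (by simpa using hh)).eventually_ne (by simpa using hv)
  obtain ⟨ε, hε, hεne⟩ := Metric.eventually_nhds_iff_ball.1 (eventually_nhdsWithin_iff.1 hne)
  have hvn : 0 < ‖v‖ := norm_pos_iff.2 hv0
  set R : ℝ := min (ε / 2) (r / (4 * ‖v‖)) with hRdef
  have hR : 0 < R := by positivity
  have hRε : R < ε := (min_le_left _ _).trans_lt (by linarith)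
  have hRv : R * ‖v‖ ≤ r / 4 := by
    calc R * ‖v‖ ≤ r / (4 * ‖v‖) * ‖v‖ := by gcongr; exact min_le_right _ _
      _ = r / 4 := by field_simp
  have hmem : ∀ z ∈ ball z₀ (r / 2), ∀ t ∈ closedBall (0 : ℂ) R, z + t • v ∈ ball z₀ r := by
    intro z hz t ht
    rw [mem_closedBall_zero_iff] at ht
    rw [mem_ball_iff_norm] at hz ⊢
    calc ‖z + t • v - z₀‖ = ‖(z - z₀) + t • v‖ := by congr 1; abel
      _ ≤ ‖z - z₀‖ + ‖t‖ * ‖v‖ := (norm_add_le _ _).trans (by rw [norm_smul])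
      _ < r / 2 + R * ‖v‖ := by
        have : ‖t‖ * ‖v‖ ≤ R * ‖v‖ := by gcongr
        linarith
      _ ≤ r := by linarith
  set V : Set E := {z | z ∈ ball z₀ r ∧ h z ≠ 0} with hV
  have hVo : IsOpen V := by
    have hc : ContinuousOn h (ball z₀ r) := fun z hz => (hball z hz).1.continuousAt.continuousWithinAt
    exact hc.isOpen_inter_preimage isOpen_ball isOpen_ne
  -- On the line through `z₀` the function `h` has no zero on the circle of radius `R`; by
  -- compactness the same holds on all nearby parallel circles.
  have hVz : ∀ᶠ z in 𝓝 z₀, ∀ t ∈ sphere (0 : ℂ) R, z + t • v ∈ V := by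
    refine (isCompact_sphere (0 : ℂ) R).eventually_forall_of_forall_eventually fun t ht => ?_
    have hc : ContinuousAt (fun p : E × ℂ => p.1 + p.2 • v) (z₀, t) := by fun_prop
    refine hc.eventually_mem (hVo.mem_nhds ⟨hmem z₀ (mem_ball_self (by linarith)) t
      (sphere_subset_closedBall ht), ?_⟩)
    rw [mem_sphere_zero_iff_norm] at ht
    refine hεne t (by rw [mem_ball_zero_iff]; linarith) fun h0 => ?_
    rw [mem_singleton_iff] at h0
    rw [h0, norm_zero] at ht
    linarith
  -- The quotient, with the limit along the direction `v` as its value on the zero set. On each line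
  -- the zeros of `h` are simple, so there the singularities of `f / h` are removable.
  set Q : E → ℂ := fun z => if h z = 0 then fderiv ℂ f z v / fderiv ℂ h z v else f z / h z with hQ
  have hVd : DifferentiableOn ℂ (fun z => f z / h z) V := fun z hz =>
    ((hball z hz.1).2.1.div (hball z hz.1).1 hz.2).differentiableAt.differentiableWithinAt
  have hQV : ∀ z ∈ V, Q z = f z / h z := fun z hz => by simp [hQ, hz.2]
  have hQline : ∀ z ∈ ball z₀ (r / 2), ∀ t ∈ closedBall (0 : ℂ) R,
      DifferentiableAt ℂ (fun s : ℂ => Q (z + s • v)) t := by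
    intro z hz t ht
    have hp := hmem z hz t ht
    obtain ⟨ha, hb, hc, hd'⟩ := hball _ hp
    by_cases hp0 : h (z + t • v) = 0
    · have hfa : AnalyticAt ℂ (fun s : ℂ => f (z + s • v)) t :=
        AnalyticAt.fun_comp (f := fun s : ℂ => z + s • v) hb (hline z t)
      have hha : AnalyticAt ℂ (fun s : ℂ => h (z + s • v)) t :=
        AnalyticAt.fun_comp (f := fun s : ℂ => z + s • v) ha (hline z t)
      have hds : ∀ {g : ℂ → ℂ}, AnalyticAt ℂ g t → DifferentiableAt ℂ (dslope g t) t := by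
        intro g hg
        have hN := hg.eventually_analyticAt
        obtain ⟨δ, hδ, hδN⟩ := Metric.eventually_nhds_iff_ball.1 hN
        exact ((Complex.differentiableOn_dslope (ball_mem_nhds t hδ)).2 fun s hs =>
          (hδN s hs).differentiableAt.differentiableWithinAt).differentiableAt (ball_mem_nhds t hδ)
      have hder : dslope (fun s : ℂ => h (z + s • v)) t t ≠ 0 := by
        rw [dslope_same, (hdl z t ha).deriv]; exact hc
      refine ((hds hfa).div (hds hha) hder).congr_of_eventuallyEq ?_
      have hne' := eventually_nhdsWithin_iff.1 ((hdl z t ha).eventually_ne (c := 0) hc)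
      filter_upwards [hne'] with s hs
      rcases eq_or_ne s t with rfl | hst
      · simp only [hQ, hp0, if_true, Pi.div_apply, dslope_same, (hdl z s ha).deriv,
          (hdf z s hb).deriv]
      · have hsh : h (z + s • v) ≠ 0 := hs hst
        have hst' : s - t ≠ 0 := sub_ne_zero.2 hst
        simp only [hQ, hsh, if_false, Pi.div_apply, dslope_of_ne _ hst, slope_def_field, hp0,
          hd' hp0, sub_zero]
        field_simp
    · refine ((hb.div ha hp0).differentiableAt.comp t
        (hline z t).differentiableAt).congr_of_eventuallyEq ?_
      have hc2 : ContinuousAt (fun s : ℂ => h (z + s • v)) t :=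
        (hdl z t ha).continuousAt
      filter_upwards [hc2.eventually_ne hp0] with s hs
      simp [hQ, hs]
  set c : ℝ → ℂ := fun θ => (2 * Real.pi * Complex.I : ℂ)⁻¹ *
    (deriv (circleMap 0 R) θ * (circleMap 0 R θ - 0)⁻¹) with hc
  have hcc : Continuous c := by
    have : ∀ θ, circleMap 0 R θ - 0 ≠ 0 := fun θ => by simpa using hR.ne'
    simp only [hc, deriv_circleMap]
    refine continuous_const.mul (Continuous.mul (by fun_prop) ?_)
    exact Continuous.inv₀ (by fun_prop) this
  -- Cauchy's formula on the line expresses `Q` through its values on a circle avoiding the zeros of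
  -- `h`. The right-hand side depends holomorphically on all variables jointly, which separate
  -- holomorphy along the lines would not give directly.
  have key : ∀ᶠ z in 𝓝 z₀, Q z =
      ∫ θ in (0 : ℝ)..2 * Real.pi, c θ • (fun z => f z / h z) (z + circleMap 0 R θ • v) := by
    filter_upwards [hVz, ball_mem_nhds z₀ (show 0 < r / 2 by linarith)] with z hzV hz
    have hd : DifferentiableOn ℂ (fun t : ℂ => Q (z + t • v)) (closedBall 0 R) := fun t ht =>
      (hQline z hz t ht).differentiableWithinAt
    have h3 := (hd.diffContOnCl_ball subset_rfl).circleIntegral_sub_inv_smul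
      (mem_ball_self hR)
    have h4 : (2 * Real.pi * Complex.I : ℂ) ≠ 0 := by simp [Real.pi_ne_zero]
    rw [← inv_smul_smul₀ h4 (Q z)]
    rw [zero_smul, add_zero] at h3
    rw [← h3]
    simp only [circleIntegral, hc, ← intervalIntegral.integral_smul, smul_smul]
    refine intervalIntegral.integral_congr fun θ _ => ?_
    have := hQV _ (hzV (circleMap 0 R θ) (circleMap_mem_sphere 0 hR.le θ))
    simp only [this]
  have hQd : ∀ᶠ z in 𝓝 z₀, DifferentiableAt ℂ Q z := by
    filter_upwards [key.eventually_nhds, hVz] with z hz hzV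
    refine DifferentiableAt.congr_of_eventuallyEq ?_ hz
    exact differentiableAt_integral_smul_add hVo hVd hcc (γ := fun θ => circleMap 0 R θ • v)
      (by fun_prop) fun θ => hzV _ (circleMap_mem_sphere 0 hR.le θ)
  obtain ⟨δ, hδ, hδQ⟩ := Metric.eventually_nhds_iff_ball.1 hQd
  refine ⟨Q, analyticOnNhd_of_differentiableOn isOpen_ball
    (fun z hz => (hδQ z hz).differentiableWithinAt) z₀ (mem_ball_self hδ), ?_⟩
  filter_upwards [hev] with z hz
  by_cases hz0 : h z = 0
  · simp [hz0, hz.2.2.2 hz0]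
  · simp only [hQ, hz0, if_false]
    field_simp

end Division

/-! ### Local integrability of `log|f|` for holomorphic `f`. -/

section LogIntegrable

variable {ι : Type*} [Fintype ι]

/-- Jensen's inequality on the unit circle, for `log (M / |f|)` with value `∞` at the zeros. -/
theorem lintegral_circle_log_div_le {f : ℂ → ℂ} (hf : AnalyticOnNhd ℂ f (closedBall 0 1))
    (h0 : f 0 ≠ 0) {M : ℝ} (hfM : ∀ t ∈ sphere (0 : ℂ) 1, ‖f t‖ ≤ M) :
    ∫⁻ θ in Ioc 0 (2 * Real.pi), (if f (circleMap 0 1 θ) = 0 then ⊤ else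
      ENNReal.ofReal (Real.log M - Real.log ‖f (circleMap 0 1 θ)‖)) ≤
    ENNReal.ofReal (2 * Real.pi) * ENNReal.ofReal (Real.log M - Real.log ‖f 0‖) := by
  have habs : |(1 : ℝ)| = 1 := abs_one
  have hmero : MeromorphicOn f (closedBall 0 |(1 : ℝ)|) := by
    rw [habs]; exact fun z hz => (hf z hz).meromorphicAt
  -- almost no point of the circle is a zero
  have hcod : ∀ᶠ t in codiscreteWithin (closedBall (0 : ℂ) 1), f t ≠ 0 := by
    rcases hf.eqOn_zero_or_eventually_ne_zero_of_preconnected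
      (convex_closedBall 0 1).isPreconnected with h | h
    · exact absurd (h (mem_closedBall_self zero_le_one)) h0
    · exact h
  have hae : ∀ᵐ θ ∂volume.restrict (Ioc 0 (2 * Real.pi)), f (circleMap 0 1 θ) ≠ 0 := by
    have h1 : ∀ᶠ t in codiscreteWithin (sphere (0 : ℂ) |(1 : ℝ)|), f t ≠ 0 := by
      rw [habs]
      exact codiscreteWithin_mono sphere_subset_closedBall hcod
    have h2 := circleMap_preimage_codiscrete (one_ne_zero (α := ℝ)) h1
    exact ae_restrict_le_codiscreteWithin measurableSet_Ioc
      (codiscreteWithin_mono (by tauto) h2)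
  have hlog : CircleIntegrable (fun t => Real.log ‖f t‖) 0 1 :=
    MeromorphicOn.circleIntegrable_log_norm (hmero.mono_set sphere_subset_closedBall)
  have hlogI : IntegrableOn (fun θ => Real.log ‖f (circleMap 0 1 θ)‖) (Ioc 0 (2 * Real.pi)) := by
    unfold CircleIntegrable at hlog
    rwa [intervalIntegrable_iff_integrableOn_Ioc_of_le Real.two_pi_pos.le] at hlog
  have hI : IntegrableOn (fun θ => Real.log M - Real.log ‖f (circleMap 0 1 θ)‖)
      (Ioc 0 (2 * Real.pi)) := (integrable_const _).sub hlogI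
  -- In Jensen's formula each zero `u` contributes its multiplicity times `log (1/|u|)`, which is
  -- nonnegative on the closed unit disc.
  have hjensen : Real.log ‖f 0‖ ≤ Real.circleAverage (fun t => Real.log ‖f t‖) 0 1 := by
    rw [MeromorphicOn.circleAverage_log_norm one_ne_zero hmero,
      (hf 0 (mem_closedBall_self zero_le_one)).meromorphicTrailingCoeffAt_of_ne_zero h0]
    have : 0 ≤ ∑ᶠ u, (MeromorphicOn.divisor f (closedBall 0 |(1 : ℝ)|) u : ℝ) *
        Real.log (1 * ‖0 - u‖⁻¹) := by
      refine finsum_nonneg fun u => ?_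
      by_cases hu : u ∈ closedBall (0 : ℂ) |(1 : ℝ)|
      · refine mul_nonneg ?_ ?_
        · have := MeromorphicOn.AnalyticOnNhd.divisor_nonneg (U := closedBall 0 |(1 : ℝ)|)
            (f := f) (by rwa [habs])
          exact_mod_cast this u
        · rw [habs, mem_closedBall_zero_iff] at hu
          rw [one_mul, zero_sub, norm_neg]
          rcases eq_or_ne u 0 with rfl | hu0
          · simp
          · exact Real.log_nonneg ((one_le_inv₀ (norm_pos_iff.2 hu0)).2 hu)
      · simp [Function.locallyFinsuppWithin.apply_eq_zero_of_notMem _ hu]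
    simp only [Real.log_one, mul_zero, add_zero]
    linarith
  calc _ = ∫⁻ θ in Ioc 0 (2 * Real.pi),
        ENNReal.ofReal (Real.log M - Real.log ‖f (circleMap 0 1 θ)‖) := by
        refine lintegral_congr_ae ?_
        filter_upwards [hae] with θ hθ
        rw [if_neg hθ]
    _ = ENNReal.ofReal (∫ θ in Ioc 0 (2 * Real.pi),
        (Real.log M - Real.log ‖f (circleMap 0 1 θ)‖)) := by
        refine (ofReal_integral_eq_lintegral_ofReal hI ?_).symm
        filter_upwards [hae] with θ hθ
        exact sub_nonneg.2 (Real.log_le_log (norm_pos_iff.2 hθ)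
          (hfM _ (circleMap_mem_sphere 0 zero_le_one θ)))
    _ ≤ _ := by
        rw [← ENNReal.ofReal_mul Real.two_pi_pos.le]
        refine ENNReal.ofReal_le_ofReal ?_
        rw [Real.circleAverage_def, intervalIntegral.integral_of_le Real.two_pi_pos.le,
          smul_eq_mul, inv_mul_eq_div, le_div_iff₀ Real.two_pi_pos] at hjensen
        rw [integral_sub (integrable_const _) hlogI]
        simp only [integral_const, MeasurableSet.univ, measureReal_restrict_apply, univ_inter,
          Real.volume_real_Ioc_of_le Real.two_pi_pos.le, sub_zero, smul_eq_mul]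
        linarith

/-- The rotation of `ℂ^ι` about `z₀` by the angle `θ`. -/
def rotateAbout (z₀ : ι → ℂ) (θ : ℝ) (z : ι → ℂ) : ι → ℂ := z₀ + circleMap 0 1 θ • (z - z₀)

theorem measurePreserving_rotateAbout (z₀ : ι → ℂ) (θ : ℝ) :
    MeasurePreserving (rotateAbout z₀ θ) := by
  have h1 : MeasurePreserving (fun z : ι → ℂ => fun i => circleMap 0 1 θ * z i) := by
    refine volume_preserving_pi fun i => ?_
    have := (rotation (Circle.exp θ)).measurePreserving
    have h2 : ⇑(rotation (Circle.exp θ)) = fun z => circleMap 0 1 θ * z := by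
      ext z
      simp [rotation_apply, circleMap, Circle.coe_exp]
    rwa [h2] at this
  exact ((measurePreserving_add_left volume z₀).comp
    (h1.comp (measurePreserving_sub_right volume z₀)))

theorem rotateAbout_mem_ball {z₀ z : ι → ℂ} {θ r : ℝ} :
    rotateAbout z₀ θ z ∈ ball z₀ r ↔ z ∈ ball z₀ r := by
  rw [mem_ball_iff_norm, mem_ball_iff_norm, rotateAbout, add_sub_cancel_left, norm_smul]
  simp

/-- Rotations about the centre preserve both the ball and Lebesgue measure. Averaging over them
reduces an integral over the ball to integrals over circles in complex lines through the centre. -/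
theorem lintegral_ball_rotateAbout (z₀ : ι → ℂ) (r : ℝ) {g : (ι → ℂ) → ℝ≥0∞} (hg : Measurable g) :
    ENNReal.ofReal (2 * Real.pi) * ∫⁻ z in ball z₀ r, g z =
      ∫⁻ z in ball z₀ r, ∫⁻ θ in Ioc 0 (2 * Real.pi), g (rotateAbout z₀ θ z) := by
  have hcont : Continuous fun p : (ι → ℂ) × ℝ => rotateAbout z₀ p.2 p.1 := by
    unfold rotateAbout circleMap
    fun_prop
  have hm : AEMeasurable (Function.uncurry fun (z : ι → ℂ) (θ : ℝ) => g (rotateAbout z₀ θ z))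
      ((volume.restrict (ball z₀ r)).prod (volume.restrict (Ioc 0 (2 * Real.pi)))) :=
    (hg.comp hcont.measurable).aemeasurable
  rw [lintegral_lintegral_swap hm]
  have h : ∀ θ : ℝ, ∫⁻ z in ball z₀ r, g (rotateAbout z₀ θ z) = ∫⁻ z in ball z₀ r, g z := by
    intro θ
    have := (measurePreserving_rotateAbout z₀ θ).setLIntegral_comp_preimage
      (measurableSet_ball (x := z₀) (ε := r)) hg
    rw [← this]
    congr 2
    ext z
    exact rotateAbout_mem_ball.symm
  simp only [h, setLIntegral_const, Real.volume_Ioc, sub_zero, mul_comm]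

/-- On the circle through `z` in the complex line through `z₀`, Jensen's inequality bounds the
integral by `2π (log M - log|f z₀|)`, whatever `z` is. Averaging over rotations gives a finite
integral over the ball. The value `∞` at the zeros makes the same bound show that the zero set is
null. -/
theorem lintegral_log_div_lt_top {f : (ι → ℂ) → ℂ} {z₀ : ι → ℂ} {r : ℝ}
    (hf : AnalyticOnNhd ℂ f (ball z₀ r)) (h0 : f z₀ ≠ 0) {M : ℝ}
    (hfM : ∀ z ∈ ball z₀ r, ‖f z‖ ≤ M) :
    ∫⁻ z in ball z₀ r, (if f z = 0 then ⊤ else ENNReal.ofReal (Real.log M - Real.log ‖f z‖)) < ⊤ := by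
  classical
  set g : (ι → ℂ) → ℂ := (ball z₀ r).piecewise f 0 with hg
  have hgf : ∀ z ∈ ball z₀ r, g z = f z := fun z hz => piecewise_eq_of_mem _ _ _ hz
  have hgm : Measurable g := ContinuousOn.measurable_piecewise
    (fun z hz => (hf z hz).continuousAt.continuousWithinAt) continuousOn_const measurableSet_ball
  set q : (ι → ℂ) → ℝ≥0∞ := fun z => if g z = 0 then ⊤ else
    ENNReal.ofReal (Real.log M - Real.log ‖g z‖) with hq
  have hqm : Measurable q := by
    refine Measurable.ite (hgm (measurableSet_singleton 0)) measurable_const ?_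
    exact (measurable_const.sub (Real.measurable_log.comp hgm.norm)).ennreal_ofReal
  have h1 : ∫⁻ z in ball z₀ r, (if f z = 0 then ⊤ else
      ENNReal.ofReal (Real.log M - Real.log ‖f z‖)) = ∫⁻ z in ball z₀ r, q z := by
    refine setLIntegral_congr_fun measurableSet_ball fun z hz => ?_
    simp only [hq, hgf z hz]
  have h2 : ∀ z ∈ ball z₀ r, ∫⁻ θ in Ioc 0 (2 * Real.pi), q (rotateAbout z₀ θ z) ≤
      ENNReal.ofReal (2 * Real.pi) * ENNReal.ofReal (Real.log M - Real.log ‖f z₀‖) := by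
    intro z hz
    have hmem : ∀ t ∈ closedBall (0 : ℂ) 1, z₀ + t • (z - z₀) ∈ ball z₀ r := by
      intro t ht
      rw [mem_closedBall_zero_iff] at ht
      rw [mem_ball_iff_norm] at hz ⊢
      rw [add_sub_cancel_left, norm_smul]
      exact (mul_le_of_le_one_left (norm_nonneg _) ht).trans_lt hz
    have := lintegral_circle_log_div_le (f := fun t : ℂ => f (z₀ + t • (z - z₀)))
      (fun t ht => AnalyticAt.fun_comp (f := fun t : ℂ => z₀ + t • (z - z₀)) (hf _ (hmem t ht))
        (by fun_prop))
      (by simpa using h0) (fun t ht => hfM _ (hmem t (sphere_subset_closedBall ht)))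
    simp only [zero_smul, add_zero] at this
    refine le_trans (le_of_eq ?_) this
    refine lintegral_congr fun θ => ?_
    have := hgf _ (hmem _ (circleMap_mem_closedBall 0 zero_le_one θ))
    simp only [hq, rotateAbout, this]
  have h3 := lintegral_ball_rotateAbout z₀ r hqm
  rw [h1]
  have h4 : ENNReal.ofReal (2 * Real.pi) * ∫⁻ z in ball z₀ r, q z < ⊤ := by
    rw [h3]
    calc _ ≤ ∫⁻ z in ball z₀ r,
          ENNReal.ofReal (2 * Real.pi) * ENNReal.ofReal (Real.log M - Real.log ‖f z₀‖) :=
          setLIntegral_mono measurable_const h2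
      _ < ⊤ := by
        rw [setLIntegral_const]
        exact ENNReal.mul_lt_top (ENNReal.mul_lt_top ENNReal.ofReal_lt_top ENNReal.ofReal_lt_top)
          measure_ball_lt_top
  refine lt_of_le_of_ne le_top fun h5 => ?_
  rw [h5, ENNReal.mul_top (by simp [Real.pi_pos])] at h4
  exact lt_irrefl _ h4

/-- `f` is a holomorphic function on `U` that vanishes on no nonempty open subset of `U`. -/
structure IsNonvanishingOn {E : Type*} [NormedAddCommGroup E] [NormedSpace ℂ E] (f : E → ℂ)
    (U : Set E) : Prop where
  analytic : AnalyticOnNhd ℂ f U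
  not_eventually : ∀ z ∈ U, ¬ f =ᶠ[𝓝 z] 0

/-- The function may vanish at `p`, so the centre is moved to a nearby point where it does not,
within a third of the new radius. -/
theorem IsNonvanishingOn.exists_ball {f : (ι → ℂ) → ℂ} {U : Set (ι → ℂ)} (hU : IsOpen U)
    (hf : IsNonvanishingOn f U) {p : ι → ℂ} (hp : p ∈ U) :
    ∃ (z₀ : ι → ℂ) (r M : ℝ), p ∈ ball z₀ r ∧ ball z₀ r ⊆ U ∧ f z₀ ≠ 0 ∧
      ∀ z ∈ ball z₀ r, ‖f z‖ ≤ M := by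
  obtain ⟨ε, hε, hεU⟩ := Metric.isOpen_iff.1 hU p hp
  have hcU : closedBall p (ε / 2) ⊆ U := (closedBall_subset_ball (by linarith)).trans hεU
  obtain ⟨C, hC⟩ := (isCompact_closedBall p (ε / 2)).exists_bound_of_continuousOn
    (hf.analytic.continuousOn.mono hcU)
  have h1 : ∃ᶠ z in 𝓝 p, f z ≠ 0 := fun h => hf.not_eventually p hp (by
    filter_upwards [h] with z hz using not_not.1 hz)
  obtain ⟨z₀, hz₀, hz₀b⟩ := (h1.and_eventually (ball_mem_nhds p (show 0 < ε / 6 by linarith))).exists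
  have hsub : ball z₀ (ε / 3) ⊆ closedBall p (ε / 2) := by
    refine (ball_subset_ball' ?_).trans ball_subset_closedBall
    linarith
  refine ⟨z₀, ε / 3, C, ?_, hsub.trans hcU, hz₀, fun z hz => hC z (hsub hz)⟩
  rw [mem_ball, dist_comm]
  linarith

/-- The integrand of `lintegral_log_div_lt_top` is infinite on the zero set and has finite integral.
-/
theorem IsNonvanishingOn.ae_ne_zero {f : (ι → ℂ) → ℂ} {U : Set (ι → ℂ)} (hU : IsOpen U)
    (hf : IsNonvanishingOn f U) : ∀ᵐ z ∂volume, z ∈ U → f z ≠ 0 := by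
  rw [ae_iff]
  refine measure_null_of_locally_null _ fun p hp => ?_
  simp only [Classical.not_imp, not_not, mem_ofPred_eq] at hp
  obtain ⟨z₀, r, M, hpb, hsub, h0, hfM⟩ := hf.exists_ball hU hp.1
  refine ⟨{z | ¬(z ∈ U → f z ≠ 0)} ∩ ball z₀ r, inter_mem_nhdsWithin _ (isOpen_ball.mem_nhds hpb), ?_⟩
  have h1 := lintegral_log_div_lt_top (hf.analytic.mono hsub) h0 hfM
  have hmz : MeasurableSet (ball z₀ r ∩ f ⁻¹' {0}) := by
    have hc : ContinuousOn f (ball z₀ r) := (hf.analytic.mono hsub).continuousOn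
    have h2 := (hc.isOpen_inter_preimage isOpen_ball (isOpen_compl_singleton (x := (0 : ℂ))))
    have h3 : ball z₀ r ∩ f ⁻¹' {0} = ball z₀ r \ (ball z₀ r ∩ f ⁻¹' {0}ᶜ) := by
      ext z; simp
    rw [h3]
    exact measurableSet_ball.diff h2.measurableSet
  have h4 : ⊤ * volume (ball z₀ r ∩ f ⁻¹' {0}) < ⊤ := by
    refine lt_of_le_of_lt ?_ h1
    rw [← setLIntegral_const]
    calc _ ≤ ∫⁻ z in ball z₀ r ∩ f ⁻¹' {0}, (if f z = 0 then ⊤ else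
          ENNReal.ofReal (Real.log M - Real.log ‖f z‖)) := by
          refine (setLIntegral_congr_fun hmz fun z hz => ?_).le
          have : f z = 0 := hz.2
          simp [this]
      _ ≤ _ := lintegral_mono_set inter_subset_left
  have h5 : volume (ball z₀ r ∩ f ⁻¹' {0}) = 0 := by
    by_contra h
    rw [ENNReal.top_mul h] at h4
    exact lt_irrefl _ h4
  refine measure_mono_null ?_ h5
  rintro z ⟨hz, hzb⟩
  simp only [Classical.not_imp, not_not, mem_ofPred_eq] at hz
  exact ⟨hzb, hz.2⟩

theorem IsNonvanishingOn.locallyIntegrableOn_log {f : (ι → ℂ) → ℂ} {U : Set (ι → ℂ)}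
    (hU : IsOpen U) (hf : IsNonvanishingOn f U) :
    LocallyIntegrableOn (fun z => Real.log ‖f z‖) U := by
  intro p hp
  obtain ⟨z₀, r, M, hpb, hsub, h0, hfM⟩ := hf.exists_ball hU hp
  refine ⟨ball z₀ r, mem_nhdsWithin_of_mem_nhds (isOpen_ball.mem_nhds hpb), ?_⟩
  have h1 := lintegral_log_div_lt_top (hf.analytic.mono hsub) h0 hfM
  have hc : ContinuousOn f (ball z₀ r) := (hf.analytic.mono hsub).continuousOn
  have hm : AEStronglyMeasurable (fun z => Real.log ‖f z‖) (volume.restrict (ball z₀ r)) :=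
    (Real.measurable_log.comp_aemeasurable
      (hc.aestronglyMeasurable measurableSet_ball).aemeasurable.norm).aestronglyMeasurable
  have h2 : IntegrableOn (fun z => Real.log M - Real.log ‖f z‖) (ball z₀ r) := by
    refine ⟨aestronglyMeasurable_const.sub hm, ?_⟩
    refine lt_of_le_of_lt (lintegral_mono_ae ?_) h1
    filter_upwards [ae_restrict_mem measurableSet_ball] with z hz
    split_ifs with h
    · exact le_top
    · rw [Real.enorm_eq_ofReal]
      exact sub_nonneg.2 (Real.log_le_log (norm_pos_iff.2 h) (hfM z hz))
  have h3 : IntegrableOn (fun _ : ι → ℂ => Real.log M) (ball z₀ r) :=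
    integrableOn_const measure_ball_lt_top.ne
  refine (h3.sub h2).congr (Eventually.of_forall fun z => ?_)
  simp

end LogIntegrable

/-! ### The Poincaré-Lelong formula in one complex variable. -/

section OneVariable

/-- The Laplacian `∂_x² + ∂_y²` of a function on `ℂ`. -/
def planeLaplacian (u : ℂ → ℂ) (t : ℂ) : ℂ :=
  fderiv ℝ (fun s => fderiv ℝ u s 1) t 1 + fderiv ℝ (fun s => fderiv ℝ u s Complex.I) t Complex.I

theorem integrable_mul_of_tsupport_subset {u η : ℂ → ℂ} {W : Set ℂ} (hW : IsOpen W)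
    (hu : ContinuousOn u W) (hη : Continuous η) (hc : HasCompactSupport η) (hs : tsupport η ⊆ W) :
    Integrable fun t => u t * η t := by
  refine Continuous.integrable_of_hasCompactSupport ?_ hc.mul_left
  refine continuous_of_tsupport fun t ht => ?_
  have : t ∈ W := hs (tsupport_mul_subset_right ht)
  exact (hu.continuousAt (hW.mem_nhds this)).mul hη.continuousAt

theorem contDiff_fderiv_apply {χ : ℂ → ℂ} {n : ℕ} (hχ : ContDiff ℝ (n + 1 : ℕ) χ) (v : ℂ) :
    ContDiff ℝ n fun t => fderiv ℝ χ t v :=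
  (hχ.fderiv_right (m := n) (by push_cast; rfl)).clm_apply contDiff_const

theorem tsupport_fderiv_apply_subset (χ : ℂ → ℂ) (v : ℂ) :
    tsupport (fun t => fderiv ℝ χ t v) ⊆ tsupport χ := by
  refine (closure_mono fun t ht => ?_).trans (tsupport_fderiv_subset ℝ (f := χ))
  simp only [Function.mem_support, ne_eq] at ht ⊢
  intro h; rw [h] at ht; simp at ht

theorem integral_mul_fderiv_fderiv {u χ : ℂ → ℂ} {W : Set ℂ} (hW : IsOpen W)
    (hu : ContDiffOn ℝ 2 u W) (hχ : ContDiff ℝ 2 χ) (hc : HasCompactSupport χ)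
    (hs : tsupport χ ⊆ W) (v : ℂ) :
    ∫ t, u t * fderiv ℝ (fun s => fderiv ℝ χ s v) t v =
      ∫ t, fderiv ℝ (fun s => fderiv ℝ u s v) t v * χ t := by
  have hχ1 : ContDiff ℝ 1 fun t => fderiv ℝ χ t v := contDiff_fderiv_apply (n := 1) hχ v
  have hχ2 : ContDiff ℝ 0 fun t => fderiv ℝ (fun s => fderiv ℝ χ s v) t v :=
    contDiff_fderiv_apply (n := 0) hχ1 v
  have hs1 := (tsupport_fderiv_apply_subset χ v)
  have hs2 := (tsupport_fderiv_apply_subset (fun s => fderiv ℝ χ s v) v).trans hs1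
  have hc1 : HasCompactSupport fun t => fderiv ℝ χ t v := hc.of_isClosed_subset (isClosed_tsupport _) hs1
  have hc2 : HasCompactSupport fun t => fderiv ℝ (fun s => fderiv ℝ χ s v) t v :=
    hc.of_isClosed_subset (isClosed_tsupport _) hs2
  have hu1 : ContDiffOn ℝ 1 (fun t => fderiv ℝ u t v) W :=
    (hu.fderiv_of_isOpen hW (m := 1) (by norm_num)).clm_apply contDiffOn_const
  have hu2 : ContDiffOn ℝ 0 (fun t => fderiv ℝ (fun s => fderiv ℝ u s v) t v) W :=
    (hu1.fderiv_of_isOpen hW (m := 0) (by norm_num)).clm_apply contDiffOn_const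
  rw [integral_mul_fderiv_eq_neg_fderiv_mul_of_integrable
    (integrable_mul_of_tsupport_subset hW hu1.continuousOn hχ1.continuous hc1 (hs1.trans hs))
    (integrable_mul_of_tsupport_subset hW hu.continuousOn hχ2.continuous hc2 (hs2.trans hs))
    (integrable_mul_of_tsupport_subset hW hu.continuousOn hχ1.continuous hc1 (hs1.trans hs))
    (fun t ht => (hu.differentiableOn (by norm_num)).differentiableAt
      (hW.mem_nhds (hs (hs1 ht)))) (fun t _ => hχ1.differentiable (by norm_num) t),
    integral_mul_fderiv_eq_neg_fderiv_mul_of_integrable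
    (integrable_mul_of_tsupport_subset hW hu2.continuousOn hχ.continuous hc hs)
    (integrable_mul_of_tsupport_subset hW hu1.continuousOn hχ1.continuous hc1 (hs1.trans hs))
    (integrable_mul_of_tsupport_subset hW hu1.continuousOn hχ.continuous hc hs)
    (fun t ht => (hu1.differentiableOn (by norm_num)).differentiableAt
      (hW.mem_nhds (hs ht))) (fun t _ => hχ.differentiable (by norm_num) t), neg_neg]

theorem continuous_planeLaplacian {χ : ℂ → ℂ} (hχ : ContDiff ℝ 2 χ) :
    Continuous (planeLaplacian χ) := by
  have h : ∀ v, Continuous fun t => fderiv ℝ (fun s => fderiv ℝ χ s v) t v := fun v =>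
    (contDiff_fderiv_apply (n := 0) (contDiff_fderiv_apply (n := 1) hχ v) v).continuous
  exact (h 1).add (h Complex.I)

theorem tsupport_planeLaplacian_subset (χ : ℂ → ℂ) : tsupport (planeLaplacian χ) ⊆ tsupport χ := by
  have h : ∀ v, tsupport (fun t => fderiv ℝ (fun s => fderiv ℝ χ s v) t v) ⊆ tsupport χ := fun v =>
    (tsupport_fderiv_apply_subset (fun s => fderiv ℝ χ s v) v).trans
      (tsupport_fderiv_apply_subset χ v)
  exact (tsupport_add _ _).trans (union_subset (h 1) (h Complex.I))

/-- Green's identity. -/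
theorem integral_mul_planeLaplacian {u χ : ℂ → ℂ} {W : Set ℂ} (hW : IsOpen W)
    (hu : ContDiffOn ℝ 2 u W) (hχ : ContDiff ℝ 2 χ) (hc : HasCompactSupport χ)
    (hs : tsupport χ ⊆ W) :
    ∫ t, u t * planeLaplacian χ t = ∫ t, planeLaplacian u t * χ t := by
  have h1 : ∀ v, Integrable fun t => u t * fderiv ℝ (fun s => fderiv ℝ χ s v) t v := by
    intro v
    have hs2 := (tsupport_fderiv_apply_subset (fun s => fderiv ℝ χ s v) v).trans
      (tsupport_fderiv_apply_subset χ v)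
    exact integrable_mul_of_tsupport_subset hW hu.continuousOn
      (contDiff_fderiv_apply (n := 0) (contDiff_fderiv_apply (n := 1) hχ v) v).continuous
      (hc.of_isClosed_subset (isClosed_tsupport _) hs2) (hs2.trans hs)
  have h2 : ∀ v, Integrable fun t => fderiv ℝ (fun s => fderiv ℝ u s v) t v * χ t := by
    intro v
    have hu1 : ContDiffOn ℝ 1 (fun t => fderiv ℝ u t v) W :=
      (hu.fderiv_of_isOpen hW (m := 1) (by norm_num)).clm_apply contDiffOn_const
    have hu2 : ContDiffOn ℝ 0 (fun t => fderiv ℝ (fun s => fderiv ℝ u s v) t v) W :=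
      (hu1.fderiv_of_isOpen hW (m := 0) (by norm_num)).clm_apply contDiffOn_const
    exact integrable_mul_of_tsupport_subset hW hu2.continuousOn hχ.continuous hc hs
  simp only [planeLaplacian, mul_add, add_mul]
  rw [integral_add (h1 1) (h1 Complex.I), integral_add (h2 1) (h2 Complex.I),
    integral_mul_fderiv_fderiv hW hu hχ hc hs, integral_mul_fderiv_fderiv hW hu hχ hc hs]

theorem planeLaplacian_log_norm_eq_zero {g : ℂ → ℂ} {t : ℂ} (hg : AnalyticAt ℂ g t)
    (h0 : g t ≠ 0) : planeLaplacian (fun s => (Real.log ‖g s‖ : ℂ)) t = 0 := by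
  have hh := hg.harmonicAt_log_norm h0
  have h1 : Laplacian.laplacian (fun s => (Real.log ‖g s‖ : ℂ)) t = 0 := by
    have := hh.1.laplacian_CLM_comp_left (l := Complex.ofRealCLM)
    have h2 := hh.2.self_of_nhds
    simp only [Pi.zero_apply] at h2
    rw [Function.comp_apply, h2, map_zero] at this
    exact this
  have hC : ContDiffAt ℝ 2 (fun s => (Real.log ‖g s‖ : ℂ)) t :=
    Complex.ofRealCLM.contDiff.contDiffAt.comp t hh.1
  rw [InnerProductSpace.laplacian_eq_iteratedFDeriv_complexPlane] at h1
  have hd : DifferentiableAt ℝ (fderiv ℝ fun s => (Real.log ‖g s‖ : ℂ)) t :=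
    (hC.fderiv_right (m := 1) (by norm_num)).differentiableAt (by norm_num)
  simp only [iteratedFDeriv_two_apply, Matrix.cons_val_zero, Matrix.cons_val_one] at h1
  rw [planeLaplacian, fderiv_clm_apply hd (differentiableAt_const _),
    fderiv_clm_apply hd (differentiableAt_const _)]
  simpa using h1

theorem exists_isOpen_analyticAt_ne_zero {g : ℂ → ℂ} {K : Set ℂ} (hg : AnalyticOnNhd ℂ g K)
    (h0 : ∀ t ∈ K, g t ≠ 0) :
    ∃ W, IsOpen W ∧ K ⊆ W ∧ ∀ t ∈ W, AnalyticAt ℂ g t ∧ g t ≠ 0 := by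
  refine ⟨interior {t | AnalyticAt ℂ g t ∧ g t ≠ 0}, isOpen_interior, fun t ht =>
    mem_interior_iff_mem_nhds.2 ((hg t ht).eventually_analyticAt.and
      ((hg t ht).continuousAt.eventually_ne (h0 t ht))), fun t ht => ?_⟩
  have := interior_subset (s := {t | AnalyticAt ℂ g t ∧ g t ≠ 0}) ht
  exact this

theorem integral_log_norm_mul_planeLaplacian_eq_zero {g χ : ℂ → ℂ} (hχ : ContDiff ℝ 2 χ)
    (hc : HasCompactSupport χ) (hg : AnalyticOnNhd ℂ g (tsupport χ))
    (h0 : ∀ t ∈ tsupport χ, g t ≠ 0) :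
    ∫ t, (Real.log ‖g t‖ : ℂ) * planeLaplacian χ t = 0 := by
  obtain ⟨W, hWo, hs, hW⟩ := exists_isOpen_analyticAt_ne_zero hg h0
  rw [integral_mul_planeLaplacian hWo (W := W) _ hχ hc hs]
  · have : ∀ t, planeLaplacian (fun s => (Real.log ‖g s‖ : ℂ)) t * χ t = 0 := by
      intro t
      by_cases ht : t ∈ tsupport χ
      · rw [planeLaplacian_log_norm_eq_zero (hg t ht) (h0 t ht), zero_mul]
      · rw [image_eq_zero_of_notMem_tsupport ht, mul_zero]
    simp [this]
  · intro t ht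
    exact (Complex.ofRealCLM.contDiff.contDiffAt.comp t
      ((hW t ht).1.harmonicAt_log_norm (hW t ht).2).1).contDiffWithinAt

theorem hasFDerivAt_sq_add_sq (ε : ℝ) (t : ℂ) :
    HasFDerivAt (fun s : ℂ => s.re ^ 2 + s.im ^ 2 + ε)
      ((2 * t.re) • Complex.reCLM + (2 * t.im) • Complex.imCLM) t := by
  have h1 := (Complex.reCLM.hasFDerivAt (x := t)).pow 2
  have h2 := (Complex.imCLM.hasFDerivAt (x := t)).pow 2
  simpa using (h1.add h2).add_const ε

/-- A smooth regularization of `log|t|`: its Laplacian is `2π` times a rescaled probability density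
that concentrates at the origin as `ε` tends to `0`. The density for `ε = 1` is normalized in
`integral_one_add_sq_inv`. -/
theorem planeLaplacian_half_log {ε : ℝ} (hε : 0 < ε) (t : ℂ) :
    planeLaplacian (fun s => ((1 / 2 * Real.log (s.re ^ 2 + s.im ^ 2 + ε) : ℝ) : ℂ)) t =
      ((2 * ε / (t.re ^ 2 + t.im ^ 2 + ε) ^ 2 : ℝ) : ℂ) := by
  have hq : ∀ s : ℂ, 0 < s.re ^ 2 + s.im ^ 2 + ε := fun s => by positivity
  have h1 : ∀ s v : ℂ,
      fderiv ℝ (fun s => ((1 / 2 * Real.log (s.re ^ 2 + s.im ^ 2 + ε) : ℝ) : ℂ)) s v =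
      (((s.re * v.re + s.im * v.im) / (s.re ^ 2 + s.im ^ 2 + ε) : ℝ) : ℂ) := by
    intro s v
    have h2 := Complex.ofRealCLM.hasFDerivAt.comp s
      (((hasFDerivAt_sq_add_sq ε s).log (hq s).ne').const_mul (1 / 2))
    rw [show (fun s : ℂ => ((1 / 2 * Real.log (s.re ^ 2 + s.im ^ 2 + ε) : ℝ) : ℂ)) =
      (⇑Complex.ofRealCLM ∘ fun y : ℂ => 1 / 2 * Real.log (y.re ^ 2 + y.im ^ 2 + ε)) from rfl,
      h2.fderiv]
    simp only [ContinuousLinearMap.comp_apply, _root_.smul_apply,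
      _root_.add_apply, Complex.reCLM_apply, Complex.imCLM_apply,
      Complex.ofRealCLM_apply, smul_eq_mul]
    congr 1
    have := (hq s).ne'
    field_simp
  have hinv : HasFDerivAt (fun s : ℂ => (s.re ^ 2 + s.im ^ 2 + ε)⁻¹) _ t :=
    (hasDerivAt_inv (hq t).ne').comp_hasFDerivAt t (hasFDerivAt_sq_add_sq ε t)
  have hre' := (Complex.ofRealCLM.hasFDerivAt.comp t
    ((Complex.reCLM.hasFDerivAt (x := t)).mul hinv)).fderiv
  have him' := (Complex.ofRealCLM.hasFDerivAt.comp t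
    ((Complex.imCLM.hasFDerivAt (x := t)).mul hinv)).fderiv
  simp only [planeLaplacian, h1, Complex.one_re, Complex.one_im, Complex.I_re, Complex.I_im,
    mul_one, mul_zero, add_zero, zero_add]
  rw [show (fun s : ℂ => ((s.re / (s.re ^ 2 + s.im ^ 2 + ε) : ℝ) : ℂ)) =
      (⇑Complex.ofRealCLM ∘ fun s : ℂ => Complex.reCLM s * (s.re ^ 2 + s.im ^ 2 + ε)⁻¹) from rfl,
    show (fun s : ℂ => ((s.im / (s.re ^ 2 + s.im ^ 2 + ε) : ℝ) : ℂ)) =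
      (⇑Complex.ofRealCLM ∘ fun s : ℂ => Complex.imCLM s * (s.re ^ 2 + s.im ^ 2 + ε)⁻¹) from rfl]
  erw [hre', him']
  simp only [ContinuousLinearMap.comp_apply, _root_.smul_apply, _root_.add_apply,
    Complex.reCLM_apply, Complex.imCLM_apply, Complex.ofRealCLM_apply, smul_eq_mul, Complex.one_re,
    Complex.one_im, Complex.I_re, Complex.I_im]
  rw [← Complex.ofReal_add]
  congr 1
  have := (hq t).ne'
  field_simp
  ring

theorem integral_one_add_sq_inv :
    ∫ s : ℂ, (Real.pi⁻¹ * ((1 + ‖s‖ ^ 2) ^ 2)⁻¹) = 1 := by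
  rw [integral_const_mul, ← Complex.integral_comp_polarCoord_symm]
  simp only [Complex.norm_polarCoord_symm, sq_abs, polarCoord_target, smul_eq_mul]
  have h1 := setIntegral_prod_mul (μ := (volume : Measure ℝ)) (ν := (volume : Measure ℝ))
    (fun r : ℝ => r * ((1 + r ^ 2) ^ 2)⁻¹) (fun _ : ℝ => (1 : ℝ)) (Ioi 0) (Ioo (-Real.pi) Real.pi)
  simp only [mul_one] at h1
  rw [Measure.volume_eq_prod, h1]
  have h2 : ∫ r in Ioi (0 : ℝ), r * ((1 + r ^ 2) ^ 2)⁻¹ = 1 / 2 := by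
    have hd : ∀ r ∈ Ici (0 : ℝ), HasDerivAt (fun r : ℝ => -(1 / 2) * (1 + r ^ 2)⁻¹)
        (r * ((1 + r ^ 2) ^ 2)⁻¹) r := by
      intro r _
      have h3 : HasDerivAt (fun r : ℝ => 1 + r ^ 2) (2 * r) r := by
        simpa using (hasDerivAt_pow 2 r).const_add 1
      have h4 : (1 + r ^ 2 : ℝ) ≠ 0 := by positivity
      refine ((h3.inv h4).const_mul (-(1 / 2))).congr_deriv ?_
      field_simp
    have ht : Tendsto (fun r : ℝ => -(1 / 2) * (1 + r ^ 2)⁻¹) atTop (𝓝 0) := by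
      rw [show (0 : ℝ) = -(1 / 2) * 0 by simp]
      refine Tendsto.const_mul _ (tendsto_inv_atTop_zero.comp ?_)
      exact tendsto_atTop_add_const_left _ _ (tendsto_pow_atTop two_ne_zero)
    rw [integral_Ioi_of_hasDerivAt_of_nonneg' hd (fun r hr => by
      have : (0 : ℝ) < r := hr
      positivity) ht]
    norm_num
  rw [h2]
  simp only [integral_const, MeasurableSet.univ, measureReal_restrict_apply, univ_inter,
    Real.volume_real_Ioo_of_le (by linarith [Real.pi_pos] : -Real.pi ≤ Real.pi), smul_eq_mul]
  have := Real.pi_ne_zero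
  field_simp
  norm_num

/-- The one-dimensional case of `IsNonvanishingOn.locallyIntegrableOn_log`, transported along `Fin 1
→ ℂ ≃ ℂ`. -/
theorem locallyIntegrable_log_norm_sub (a : ℂ) :
    LocallyIntegrable fun t : ℂ => Real.log ‖t - a‖ := by
  have hN : IsNonvanishingOn (fun z : Fin 1 → ℂ => z 0 - a) univ := by
    refine ⟨fun z _ => ((ContinuousLinearMap.proj (R := ℂ) (φ := fun _ : Fin 1 => ℂ) 0).analyticAt
      z).sub analyticAt_const, fun z _ h => ?_⟩
    have h1 : Tendsto (fun t : ℂ => (fun _ : Fin 1 => z 0 + t)) (𝓝 0) (𝓝 z) := by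
      have : Continuous fun t : ℂ => (fun _ : Fin 1 => z 0 + t) := by fun_prop
      convert this.tendsto 0 using 2
      ext i; simp [Subsingleton.elim i 0]
    have h2 : ∀ᶠ t : ℂ in 𝓝 0, z 0 + t - a = 0 := h1.eventually h
    have h3 : (fun t : ℂ => z 0 + t - a) =ᶠ[𝓝 0] fun _ => 0 := h2
    have h4 := h3.deriv_eq
    simp at h4
  have h1 := locallyIntegrableOn_univ.1 (hN.locallyIntegrableOn_log isOpen_univ)
  have hmp := (volume_preserving_funUnique (Fin 1) ℂ)
  rw [locallyIntegrable_iff] at h1 ⊢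
  intro K hK
  have hK' : IsCompact ((Homeomorph.funUnique (Fin 1) ℂ) ⁻¹' K) :=
    (Homeomorph.funUnique (Fin 1) ℂ).isCompact_preimage.2 hK
  exact (hmp.integrableOn_comp_preimage
    (MeasurableEquiv.measurableEmbedding _)).1 (h1 _ hK')

theorem planeLaplacian_comp_add (χ : ℂ → ℂ) (a t : ℂ) :
    planeLaplacian (fun s => χ (s + a)) t = planeLaplacian χ (t + a) := by
  have h : ∀ v, fderiv ℝ (fun s => fderiv ℝ χ (s + a) v) t v =
      fderiv ℝ (fun s => fderiv ℝ χ s v) (t + a) v := fun v => by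
    rw [fderiv_comp_add_right (f := fun s => fderiv ℝ χ s v)]
  simp only [planeLaplacian, fderiv_comp_add_right, h]

theorem integrable_log_norm_mul {η : ℂ → ℂ} (hη : Continuous η) (hc : HasCompactSupport η) (a : ℂ) :
    Integrable fun t => (Real.log ‖t - a‖ : ℂ) * η t := by
  have := (locallyIntegrable_log_norm_sub a).integrable_smul_right_of_hasCompactSupport hη hc
  simpa using this

/-- The logarithm is the fundamental solution of the Laplacian. With `log|t|` replaced by `½
log(|t|² + c⁻²)`, Green's identity yields `2π` times a convolution of `χ` with an approximate
identity. The limit `c → ∞` is computed on both sides of that identity. -/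
theorem integral_log_norm_mul_planeLaplacian {χ : ℂ → ℂ} (hχ : ContDiff ℝ 2 χ)
    (hc : HasCompactSupport χ) :
    ∫ t, (Real.log ‖t‖ : ℂ) * planeLaplacian χ t = 2 * Real.pi * χ 0 := by
  have hL := continuous_planeLaplacian hχ
  have hLc : HasCompactSupport (planeLaplacian χ) :=
    hc.of_isClosed_subset (isClosed_tsupport _) (tsupport_planeLaplacian_subset χ)
  set u : ℝ → ℂ → ℂ := fun c s => ((1 / 2 * Real.log (s.re ^ 2 + s.im ^ 2 + c⁻¹ ^ 2) : ℝ) : ℂ)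
    with hu
  have hsq : ∀ s : ℂ, s.re ^ 2 + s.im ^ 2 = ‖s‖ ^ 2 := fun s => by
    rw [← Complex.normSq_eq_norm_sq, Complex.normSq_apply]; ring
  have hpos : ∀ {c : ℝ}, 0 < c → ∀ s : ℂ, 0 < s.re ^ 2 + s.im ^ 2 + c⁻¹ ^ 2 := fun hc s => by
    positivity
  have huC : ∀ {c : ℝ}, 0 < c → ContDiff ℝ 2 (u c) := by
    intro c hc0
    refine Complex.ofRealCLM.contDiff.comp (contDiff_const.mul (ContDiff.log ?_ fun s =>
      (hpos hc0 s).ne'))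
    exact ((Complex.reCLM.contDiff.pow 2).add (Complex.imCLM.contDiff.pow 2)).add contDiff_const
  have h1 : ∀ c : ℝ, 0 < c → ∫ t, u c t * planeLaplacian χ t =
      2 * Real.pi * ∫ t, (c ^ Module.finrank ℝ ℂ * (Real.pi⁻¹ * ((1 + ‖c • ((0 : ℂ) - t)‖ ^ 2) ^ 2)⁻¹))
        • χ t := by
    intro c hc0
    rw [integral_mul_planeLaplacian isOpen_univ (huC hc0).contDiffOn hχ hc (subset_univ _),
      ← integral_const_mul]
    refine integral_congr_ae (Eventually.of_forall fun t => ?_)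
    simp only [hu]
    rw [planeLaplacian_half_log (by positivity : 0 < c⁻¹ ^ 2), hsq, Complex.finrank_real_complex,
      zero_sub, norm_smul, norm_neg, Real.norm_eq_abs, mul_pow, sq_abs, Complex.real_smul,
      ← mul_assoc]
    congr 1
    rw [show (2 * Real.pi : ℂ) = ((2 * Real.pi : ℝ) : ℂ) by push_cast; rfl, ← Complex.ofReal_mul]
    congr 1
    have hp := Real.pi_ne_zero
    have h2 : (‖t‖ ^ 2 + c⁻¹ ^ 2) ≠ 0 := by positivity
    have h3 : (1 + c ^ 2 * ‖t‖ ^ 2) ≠ 0 := by positivity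
    have h4 : ‖t‖ ^ 2 + c⁻¹ ^ 2 = c⁻¹ ^ 2 * (1 + c ^ 2 * ‖t‖ ^ 2) := by
      field_simp
      ring
    rw [h4]
    field_simp
  have hT1 : Tendsto (fun c : ℝ => ∫ t, u c t * planeLaplacian χ t) atTop
      (𝓝 (2 * Real.pi * χ 0)) := by
    have h2 := tendsto_integral_comp_smul_smul_of_integrable' (μ := (volume : Measure ℂ))
      (φ := fun s : ℂ => Real.pi⁻¹ * ((1 + ‖s‖ ^ 2) ^ 2)⁻¹) (fun s => by positivity)
      integral_one_add_sq_inv ?_ (hχ.continuous.integrable_of_hasCompactSupport hc)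
      (x₀ := 0) hχ.continuous.continuousAt
    · refine (h2.const_mul (2 * Real.pi : ℂ)).congr' ?_
      filter_upwards [eventually_gt_atTop 0] with c hc0
      exact (h1 c hc0).symm
    · rw [Complex.finrank_real_complex]
      have h3 : Tendsto (fun r : ℝ => Real.pi⁻¹ * (1 + r ^ 2)⁻¹) atTop (𝓝 0) := by
        rw [show (0 : ℝ) = Real.pi⁻¹ * 0 by simp]
        refine Tendsto.const_mul _ (tendsto_inv_atTop_zero.comp ?_)
        exact tendsto_atTop_add_const_left _ _ (tendsto_pow_atTop two_ne_zero)
      refine squeeze_zero (fun s => by positivity) (fun s => ?_)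
        (h3.comp tendsto_norm_cobounded_atTop)
      simp only [Function.comp_apply]
      have h4 : (0 : ℝ) < 1 + ‖s‖ ^ 2 := by positivity
      have h5 := Real.pi_pos
      rw [← sub_nonneg]
      have : Real.pi⁻¹ * (1 + ‖s‖ ^ 2)⁻¹ - ‖s‖ ^ 2 * (Real.pi⁻¹ * ((1 + ‖s‖ ^ 2) ^ 2)⁻¹) =
          Real.pi⁻¹ * ((1 + ‖s‖ ^ 2) ^ 2)⁻¹ := by
        field_simp
        ring
      rw [this]
      positivity
  have hT2 : Tendsto (fun c : ℝ => ∫ t, u c t * planeLaplacian χ t) atTop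
      (𝓝 (∫ t, (Real.log ‖t‖ : ℂ) * planeLaplacian χ t)) := by
    -- For `c ≥ 1` the regularized logarithm lies between `log|t|` and `log(|t|² + 1)`; the sum of
    -- their absolute values, multiplied by the compactly supported Laplacian of `χ`, dominates.
    refine tendsto_integral_filter_of_dominated_convergence
      (fun t => ‖(Real.log ‖t - 0‖ : ℂ) * planeLaplacian χ t‖ +
        ‖((Real.log (‖t‖ ^ 2 + 1) : ℝ) : ℂ) * planeLaplacian χ t‖) ?_ ?_ ?_ ?_
    · filter_upwards [eventually_gt_atTop 0] with c hc0
      exact ((huC hc0).continuous.mul hL).aestronglyMeasurable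
    · filter_upwards [eventually_ge_atTop 1] with c hc1
      have hne : ∀ᵐ t : ℂ, t ≠ 0 := by simp [ae_iff]
      filter_upwards [hne] with t ht
      have hc0 : 0 < c := by linarith
      rw [norm_mul, norm_mul, norm_mul, ← add_mul, sub_zero, Complex.norm_real, Complex.norm_real,
        Complex.norm_real]
      refine mul_le_mul_of_nonneg_right ?_ (norm_nonneg _)
      have ht' : 0 < ‖t‖ := norm_pos_iff.2 ht
      have hc2 : c⁻¹ ^ 2 ≤ 1 := by
        have : c⁻¹ ≤ 1 := inv_le_one_of_one_le₀ hc1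
        have h0 : 0 ≤ c⁻¹ := by positivity
        nlinarith
      have hlo : Real.log ‖t‖ ≤ 1 / 2 * Real.log (‖t‖ ^ 2 + c⁻¹ ^ 2) := by
        have : Real.log (‖t‖ ^ 2) ≤ Real.log (‖t‖ ^ 2 + c⁻¹ ^ 2) :=
          Real.log_le_log (by positivity) (by have : 0 ≤ c⁻¹ ^ 2 := by positivity
                                              linarith)
        rw [Real.log_pow] at this
        push_cast at this
        linarith
      have hhi : 1 / 2 * Real.log (‖t‖ ^ 2 + c⁻¹ ^ 2) ≤ Real.log (‖t‖ ^ 2 + 1) := by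
        have h5 : Real.log (‖t‖ ^ 2 + c⁻¹ ^ 2) ≤ Real.log (‖t‖ ^ 2 + 1) :=
          Real.log_le_log (by positivity) (by linarith)
        have h6 : 0 ≤ Real.log (‖t‖ ^ 2 + 1) := Real.log_nonneg (by nlinarith)
        linarith
      rw [hsq, Real.norm_eq_abs, Real.norm_eq_abs, Real.norm_eq_abs, abs_le]
      have h7 := neg_abs_le (Real.log ‖t‖)
      have h8 := le_abs_self (Real.log (‖t‖ ^ 2 + 1))
      have h9 := abs_nonneg (Real.log ‖t‖)
      have h10 := abs_nonneg (Real.log (‖t‖ ^ 2 + 1))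
      constructor <;> linarith
    · refine (integrable_log_norm_mul hL hLc 0).norm.add (Continuous.integrable_of_hasCompactSupport
        ?_ hLc.mul_left).norm
      refine Continuous.mul (Complex.continuous_ofReal.comp (Continuous.log (by fun_prop) fun t => ?_)) hL
      positivity
    · have hne : ∀ᵐ t : ℂ, t ≠ 0 := by simp [ae_iff]
      filter_upwards [hne] with t ht
      refine Tendsto.mul_const _ ?_
      refine (Complex.continuous_ofReal.tendsto _).comp ?_
      have ht' : 0 < ‖t‖ := norm_pos_iff.2 ht
      have h3 : Tendsto (fun c : ℝ => t.re ^ 2 + t.im ^ 2 + c⁻¹ ^ 2) atTop (𝓝 (‖t‖ ^ 2)) := by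
        rw [hsq]
        have := (tendsto_inv_atTop_zero (𝕜 := ℝ)).pow 2
        simpa using this.const_add (‖t‖ ^ 2)
      have h4 := (h3.log (by positivity)).const_mul (1 / 2)
      rw [Real.log_pow] at h4
      convert h4 using 2
      push_cast; ring
  exact tendsto_nhds_unique hT2 hT1

theorem integral_log_norm_sub_mul_planeLaplacian {χ : ℂ → ℂ} (hχ : ContDiff ℝ 2 χ)
    (hc : HasCompactSupport χ) (a : ℂ) :
    ∫ t, (Real.log ‖t - a‖ : ℂ) * planeLaplacian χ t = 2 * Real.pi * χ a := by
  have h1 := integral_log_norm_mul_planeLaplacian (χ := fun s => χ (s + a))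
    (hχ.comp (contDiff_id.add contDiff_const)) (hc.comp_homeomorph (Homeomorph.addRight a))
  rw [zero_add] at h1
  rw [← h1, ← integral_add_right_eq_self _ a]
  simp [planeLaplacian_comp_add]

/-- The Poincaré–Lelong formula in one variable. -/
theorem tsum_order_mul_eq_integral_log {U : Set ℂ} {f χ : ℂ → ℂ}
    (hf : IsNonvanishingOn f U) (hχ : ContDiff ℝ 2 χ) (hc : HasCompactSupport χ)
    (hs : tsupport χ ⊆ U) :
    (tsupport χ ∩ f ⁻¹' {0}).Finite ∧
    ∑' t : {t : ℂ // t ∈ U ∧ f t = 0}, (analyticOrderNatAt f t : ℂ) * χ t =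
      (2 * Real.pi : ℂ)⁻¹ * ∫ t, (Real.log ‖f t‖ : ℂ) * planeLaplacian χ t := by
  set K := tsupport χ with hK
  have hKc : IsCompact K := hc
  have hfK : AnalyticOnNhd ℂ f K := hf.analytic.mono hs
  have hm : MeromorphicOn f K := fun z hz => (hfK z hz).meromorphicAt
  have hord : ∀ z ∈ K, analyticOrderAt f z ≠ ⊤ := fun z hz h =>
    hf.not_eventually z (hs hz) (analyticOrderAt_eq_top.1 h)
  have hmord : ∀ u : K, meromorphicOrderAt f u ≠ ⊤ := fun u => by
    rw [(hfK u u.2).meromorphicOrderAt_eq]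
    simpa using hord u u.2
  set D := MeromorphicOn.divisor f K with hD
  have hfin : D.support.Finite := D.finiteSupport hKc
  have hDn : ∀ z ∈ K, D z = analyticOrderNatAt f z := fun z hz => by
    rw [hD, MeromorphicOn.AnalyticOnNhd.divisor_apply hfK hz,
      ← Nat.cast_analyticOrderNatAt (hord z hz)]
    rfl
  have hD0 : ∀ z ∉ K, D z = 0 := fun z hz => D.apply_eq_zero_of_notMem hz
  -- Near the support of `χ`, `f` is a finite product of powers of `t - u` times a zero-free `g`.
  -- The factors contribute the values of `χ` at the zeros, while `log|g|` is harmonic and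
  -- contributes nothing.
  obtain ⟨g, hg, hg0, hgf⟩ := hm.extract_zeros_poles hmord hfin
  have hlog := MeromorphicOn.extract_zeros_poles_log hg0 hgf
  have hL := continuous_planeLaplacian hχ
  have hLs := tsupport_planeLaplacian_subset χ
  have hLc : HasCompactSupport (planeLaplacian χ) := hc.of_isClosed_subset (isClosed_tsupport _) hLs
  have hLK : ∀ t ∉ K, planeLaplacian χ t = 0 := fun t ht =>
    image_eq_zero_of_notMem_tsupport fun h => ht (hLs h)
  have hsub : ∀ t ∈ K, f t = 0 → t ∈ D.support := by
    intro t ht h0 hDt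
    rw [hDn t ht] at hDt
    have h1 : analyticOrderNatAt f t = 0 := by exact_mod_cast hDt
    have h2 := Nat.cast_analyticOrderNatAt (hord t ht)
    rw [h1] at h2
    exact ((hfK t ht).analyticOrderAt_ne_zero.2 h0) h2.symm
  have hsupp : ∀ t ∈ D.support, t ∈ K ∧ f t = 0 := by
    intro t ht
    have hK' : t ∈ K := by_contra fun h => ht (hD0 t h)
    refine ⟨hK', ?_⟩
    by_contra h0
    apply ht
    rw [hDn t hK', analyticOrderNatAt, (hfK t hK').analyticOrderAt_eq_zero.2 h0]
    rfl
  refine ⟨hfin.subset fun t ht => hsub t ht.1 ht.2, ?_⟩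
  have hsum : ∑' t : {t : ℂ // t ∈ U ∧ f t = 0}, (analyticOrderNatAt f t : ℂ) * χ t =
      ∑ u ∈ hfin.toFinset, (D u : ℂ) * χ u := by
    refine (tsum_subtype {t | t ∈ U ∧ f t = 0}
      fun t => (analyticOrderNatAt f t : ℂ) * χ t).trans ?_
    rw [tsum_eq_sum (s := hfin.toFinset)]
    · refine Finset.sum_congr rfl fun u hu => ?_
      obtain ⟨hu1, hu2⟩ := hsupp u (hfin.mem_toFinset.1 hu)
      rw [indicator_of_mem (show u ∈ {t | t ∈ U ∧ f t = 0} from ⟨hs hu1, hu2⟩), hDn u hu1]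
      simp
    · intro t ht
      by_cases htm : t ∈ {t | t ∈ U ∧ f t = 0}
      · rw [indicator_of_mem htm]
        have htK : t ∉ K := fun h => ht (hfin.mem_toFinset.2 (hsub t h htm.2))
        rw [image_eq_zero_of_notMem_tsupport htK, mul_zero]
      · rw [indicator_of_notMem htm]
  -- The factorization is known only off a discrete subset of `K`, which is null.
  have hae : ∀ᵐ t ∂volume.restrict K, Real.log ‖f t‖ =
      ∑ u ∈ hfin.toFinset, (D u : ℝ) * Real.log ‖t - u‖ + Real.log ‖g t‖ := by
    have h1 := ae_restrict_le_codiscreteWithin (μ := volume) hKc.measurableSet hlog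
    filter_upwards [h1] with t ht
    rw [ht, Pi.add_apply, finsum_eq_sum_of_support_subset (s := hfin.toFinset), Finset.sum_apply]
    intro u hu
    simp only [Finite.coe_toFinset, Function.mem_support, ne_eq] at hu ⊢
    intro h
    apply hu
    ext t
    have h' : (MeromorphicOn.divisor f K) u = 0 := h
    simp [h']
  obtain ⟨W, hWo, hKW, hW⟩ := exists_isOpen_analyticAt_ne_zero hg fun t ht => hg0 ⟨t, ht⟩
  have hgI : Integrable fun t => (Real.log ‖g t‖ : ℂ) * planeLaplacian χ t := by
    refine integrable_mul_of_tsupport_subset hWo (fun t ht => ContinuousAt.continuousWithinAt ?_)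
      hL hLc (hLs.trans hKW)
    have := ((hW t ht).1.harmonicAt_log_norm (hW t ht).2).1.continuousAt
    exact Complex.continuous_ofReal.continuousAt.comp this
  have hint : ∫ t, (Real.log ‖f t‖ : ℂ) * planeLaplacian χ t =
      ∫ t, (∑ u ∈ hfin.toFinset, (D u : ℂ) * ((Real.log ‖t - u‖ : ℂ) * planeLaplacian χ t) +
        (Real.log ‖g t‖ : ℂ) * planeLaplacian χ t) := by
    refine integral_congr_ae ?_
    filter_upwards [(ae_restrict_iff' hKc.measurableSet).1 hae] with t ht
    by_cases htK : t ∈ K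
    swap
    · simp [hLK t htK]
    rw [ht htK]
    push_cast
    rw [add_mul, Finset.sum_mul]
    simp only [mul_assoc]
  rw [hsum, hint, integral_add (integrable_finsetSum _ fun u _ =>
    (integrable_log_norm_mul hL hLc u).const_mul _) hgI,
    integral_log_norm_mul_planeLaplacian_eq_zero hχ hc hg (fun t ht => hg0 ⟨t, ht⟩), add_zero,
    integral_finsetSum _ fun u _ => (integrable_log_norm_mul hL hLc u).const_mul _, Finset.mul_sum]
  refine Finset.sum_congr rfl fun u _ => ?_
  rw [integral_const_mul, integral_log_norm_sub_mul_planeLaplacian hχ hc]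
  have : (Real.pi : ℂ) ≠ 0 := by exact_mod_cast Real.pi_ne_zero
  field_simp

end OneVariable

/-! ## Orders of vanishing along complex lines -/

section LineOrder

variable {E : Type*} [NormedAddCommGroup E] [NormedSpace ℂ E]

/-- The order of vanishing at `z` of the restriction of `F` to the line `z + ℂ v`. -/
def lineOrder (F : E → ℂ) (v z : E) : ℕ∞ := analyticOrderAt (fun s : ℂ => F (z + s • v)) 0

theorem analyticAt_line {F : E → ℂ} {v z : E} {t : ℂ} (h : AnalyticAt ℂ F (z + t • v)) :
    AnalyticAt ℂ (fun s : ℂ => F (z + s • v)) t :=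
  AnalyticAt.fun_comp (g := F) (f := fun s : ℂ => z + s • v) h (by fun_prop)

theorem analyticAt_line_zero {F : E → ℂ} {v z : E} (h : AnalyticAt ℂ F z) :
    AnalyticAt ℂ (fun s : ℂ => F (z + s • v)) 0 :=
  analyticAt_line (by simpa using h)

theorem tendsto_line (v z : E) : Tendsto (fun s : ℂ => z + s • v) (𝓝 0) (𝓝 z) := by
  have : Continuous fun s : ℂ => z + s • v := by fun_prop
  simpa using this.tendsto 0

theorem lineOrder_congr {F G : E → ℂ} {v z : E} (h : F =ᶠ[𝓝 z] G) :
    lineOrder F v z = lineOrder G v z :=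
  analyticOrderAt_congr ((tendsto_line v z).eventually h)

theorem lineOrder_mul {F G : E → ℂ} {v z : E} (hF : AnalyticAt ℂ F z) (hG : AnalyticAt ℂ G z) :
    lineOrder (fun z => F z * G z) v z = lineOrder F v z + lineOrder G v z :=
  analyticOrderAt_mul (analyticAt_line_zero hF) (analyticAt_line_zero hG)

theorem lineOrder_pow {F : E → ℂ} {v z : E} (hF : AnalyticAt ℂ F z) (k : ℕ) :
    lineOrder (fun z => F z ^ k) v z = k * lineOrder F v z := by
  rw [← nsmul_eq_mul]
  exact analyticOrderAt_pow (analyticAt_line_zero hF) k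

theorem lineOrder_eq_zero {F : E → ℂ} {v z : E} (hF : AnalyticAt ℂ F z) :
    lineOrder F v z = 0 ↔ F z ≠ 0 := by
  rw [lineOrder, (analyticAt_line_zero hF).analyticOrderAt_eq_zero]
  simp

theorem eventually_deriv_line {F : E → ℂ} {v z : E} (hF : AnalyticAt ℂ F z) :
    deriv (fun s : ℂ => F (z + s • v)) =ᶠ[𝓝 0] fun s => fderiv ℂ F (z + s • v) v := by
  filter_upwards [(tendsto_line v z).eventually hF.eventually_analyticAt] with s hs
  exact (hasDerivAt_comp_line hs.differentiableAt.hasFDerivAt).deriv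

theorem lineOrder_fderiv_add_one {F : E → ℂ} {v z : E} (hF : AnalyticAt ℂ F z) (h0 : F z = 0) :
    lineOrder (fun z => fderiv ℂ F z v) v z + 1 = lineOrder F v z := by
  have := (analyticAt_line_zero (v := v) hF).analyticOrderAt_deriv_add_one
  rw [lineOrder, lineOrder, ← analyticOrderAt_congr (eventually_deriv_line hF), this]
  simp [h0]

theorem analyticAt_fderiv_apply {F : E → ℂ} {z : E} (hF : AnalyticAt ℂ F z) (v : E) :
    AnalyticAt ℂ (fun z => fderiv ℂ F z v) z :=
  ((ContinuousLinearMap.apply ℂ ℂ v).analyticAt _).comp hF.fderiv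

theorem lineOrder_eq_one {F : E → ℂ} {v z : E} (hF : AnalyticAt ℂ F z) (h0 : F z = 0)
    (hv : fderiv ℂ F z v ≠ 0) : lineOrder F v z = 1 := by
  rw [← lineOrder_fderiv_add_one hF h0, (lineOrder_eq_zero (analyticAt_fderiv_apply hF v)).2 hv,
    zero_add]

theorem two_le_lineOrder {F : E → ℂ} {v z : E} (hF : AnalyticAt ℂ F z) (h0 : F z = 0)
    (hv : fderiv ℂ F z v = 0) : 2 ≤ lineOrder F v z := by
  rw [← lineOrder_fderiv_add_one hF h0, ← one_add_one_eq_two]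
  refine add_le_add_left (Order.one_le_iff_pos.2 (pos_iff_ne_zero.2 fun h => ?_)) 1
  exact (lineOrder_eq_zero (analyticAt_fderiv_apply hF v)).1 h hv

/-- The `i`-th derivative in the direction `v`. -/
def dirDeriv (v : E) (F : E → ℂ) (i : ℕ) : E → ℂ :=
  (fun G z => fderiv ℂ G z v)^[i] F

theorem analyticAt_dirDeriv {F : E → ℂ} {z : E} (hF : AnalyticAt ℂ F z) (v : E) (i : ℕ) :
    AnalyticAt ℂ (dirDeriv v F i) z := by
  induction i with
  | zero => exact hF
  | succ i ih =>
    rw [dirDeriv, Function.iterate_succ_apply']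
    exact analyticAt_fderiv_apply ih v

theorem lineOrder_dirDeriv {F : E → ℂ} {v z : E} (hF : AnalyticAt ℂ F z) {i : ℕ}
    (hi : i ≤ lineOrder F v z) : lineOrder (dirDeriv v F i) v z + i = lineOrder F v z := by
  induction i with
  | zero => simp [dirDeriv]
  | succ i ih =>
    have h1 := ih (le_trans (by exact_mod_cast i.le_succ) hi)
    have h2 : lineOrder (dirDeriv v F i) v z ≠ 0 := by
      intro h
      rw [h, zero_add] at h1
      rw [← h1] at hi
      exact absurd (Nat.cast_le.1 hi) (by omega)
    have hA := analyticAt_dirDeriv hF v i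
    have h3 : dirDeriv v F i z = 0 := by
      by_contra h
      exact h2 ((lineOrder_eq_zero hA).2 h)
    have h4 := lineOrder_fderiv_add_one (v := v) hA h3
    rw [← h1, ← h4, dirDeriv, Function.iterate_succ_apply']
    push_cast
    rw [add_assoc, add_comm (1 : ℕ∞)]
    rfl

/-- This makes a lower bound on the order a system of analytic equations in `z`, which can be
restricted to a hypersurface. -/
theorem le_lineOrder_iff {F : E → ℂ} {v z : E} (hF : AnalyticAt ℂ F z) (k : ℕ) :
    (k : ℕ∞) ≤ lineOrder F v z ↔ ∀ i < k, dirDeriv v F i z = 0 := by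
  constructor
  · intro h i hi
    have h1 := lineOrder_dirDeriv hF (le_trans (by exact_mod_cast hi.le) h)
    by_contra h0
    rw [(lineOrder_eq_zero (analyticAt_dirDeriv hF v i)).2 h0, zero_add] at h1
    rw [← h1] at h
    exact absurd (Nat.cast_le.1 h) (by omega)
  · intro h
    induction k with
    | zero => simp
    | succ k ih =>
      have h1 := ih fun i hi => h i (hi.trans k.lt_succ_self)
      have h2 := lineOrder_dirDeriv hF h1
      have h3 : lineOrder (dirDeriv v F k) v z ≠ 0 := fun h0 =>
        (lineOrder_eq_zero (analyticAt_dirDeriv hF v k)).1 h0 (h k k.lt_succ_self)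
      rw [← h2, Nat.cast_succ, add_comm]
      exact add_le_add_left (Order.one_le_iff_pos.2 (pos_iff_ne_zero.2 h3)) _

end LineOrder

/-! ## Regular zeros -/

section RegularZero

variable {n : ℕ} {F : (Fin (n + 1) → ℂ) → ℂ} {z : Fin (n + 1) → ℂ} {k k' : ℕ}
  {l l' : (Fin (n + 1) → ℂ) →L[ℂ] ℂ}

theorem IsRegularZero.eq_zero (h : IsRegularZero F z k l) : F z = 0 := by
  obtain ⟨hk, -, a, u, -, -, ha0, -, -, hF⟩ := h
  rw [hF.eq_of_nhds, ha0, zero_pow (by omega), zero_mul]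

/-- In `F = a ^ k u` the order along a line is `k` times that of `a`, which is `1` in transversal
directions and at least `2` in tangent ones. Multiplicity and tangent space can thus be read off
from `F` alone. -/
theorem IsRegularZero.lineOrder_eq (h : IsRegularZero F z k l) (v : Fin (n + 1) → ℂ) :
    (l v ≠ 0 → lineOrder F v z = k) ∧ (l v = 0 → k * 2 ≤ lineOrder F v z) := by
  obtain ⟨hk, -, a, u, ha, hu, ha0, rfl, hu0, hF⟩ := h
  have : lineOrder F v z = k * lineOrder a v z := by
    rw [lineOrder_congr hF, lineOrder_mul (F := fun w => a w ^ k) (ha.pow k) hu, lineOrder_pow ha,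
      (lineOrder_eq_zero hu).2 hu0, add_zero]
  rw [this]
  constructor
  · intro hv
    rw [lineOrder_eq_one ha ha0 hv, mul_one]
  · intro hv
    gcongr
    exact two_le_lineOrder ha ha0 hv

theorem IsRegularZero.exists_ne (h : IsRegularZero F z k l) : ∃ v, l v ≠ 0 := by
  by_contra! H
  exact h.2.1 (ContinuousLinearMap.ext H)

/-- A direction transversal for both representations gives both multiplicities at once. If no such
direction is found, each chosen transversal direction is tangent for the other representation, and
`2k' ≤ k` together with `2k ≤ k'` contradicts `k ≥ 1`. -/
theorem IsRegularZero.multiplicity_unique (h : IsRegularZero F z k l)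
    (h' : IsRegularZero F z k' l') : k = k' := by
  obtain ⟨v, hv⟩ := h.exists_ne
  obtain ⟨v', hv'⟩ := h'.exists_ne
  have h1 := (h.lineOrder_eq v).1 hv
  have h1' := (h'.lineOrder_eq v').1 hv'
  by_cases h2 : l' v = 0
  · have h3 := (h'.lineOrder_eq v).2 h2
    by_cases h4 : l v' = 0
    · have h5 := (h.lineOrder_eq v').2 h4
      rw [h1] at h3
      rw [h1'] at h5
      have h6 : k' * 2 ≤ k := by exact_mod_cast h3
      have h7 : k * 2 ≤ k' := by exact_mod_cast h5
      have := h.1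
      omega
    · have := (h.lineOrder_eq v').1 h4
      rw [h1'] at this
      exact_mod_cast this.symm
  · have := (h'.lineOrder_eq v).1 h2
    rw [h1] at this
    exact_mod_cast this

theorem IsRegularZero.ker_unique (h : IsRegularZero F z k l) (h' : IsRegularZero F z k' l')
    (v : Fin (n + 1) → ℂ) : l v = 0 ↔ l' v = 0 := by
  obtain rfl := h.multiplicity_unique h'
  have aux : ∀ {l₁ l₂ : (Fin (n + 1) → ℂ) →L[ℂ] ℂ}, IsRegularZero F z k l₁ →
      IsRegularZero F z k l₂ → l₁ v = 0 → l₂ v = 0 := by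
    intro l₁ l₂ h₁ h₂ h0
    by_contra h3
    have h4 := (h₁.lineOrder_eq v).2 h0
    rw [(h₂.lineOrder_eq v).1 h3] at h4
    have h5 : k * 2 ≤ k := by exact_mod_cast h4
    have := h.1
    omega
  exact ⟨aux h h', aux h' h⟩

theorem zeroMultiplicity_eq (h : IsRegularZero F z k l) : zeroMultiplicity F z = k := by
  have hex : ∃ k l, IsRegularZero F z k l := ⟨k, l, h⟩
  rw [zeroMultiplicity, dif_pos hex]
  obtain ⟨l', h'⟩ := hex.choose_spec
  exact h'.multiplicity_unique h

theorem zeroConormal_apply_eq_zero_iff (h : IsRegularZero F z k l) (v : Fin (n + 1) → ℂ) :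
    zeroConormal F z v = 0 ↔ l v = 0 := by
  have hex : ∃ l k, IsRegularZero F z k l := ⟨l, k, h⟩
  rw [zeroConormal, dif_pos hex]
  obtain ⟨k', h'⟩ := hex.choose_spec
  exact h'.ker_unique h v

theorem exists_isRegularZero_of_zeroConormal_ne {v : Fin (n + 1) → ℂ}
    (h : zeroConormal F z v ≠ 0) : ∃ k l, IsRegularZero F z k l := by
  by_cases hex : ∃ l k, IsRegularZero F z k l
  · obtain ⟨l, k, h⟩ := hex
    exact ⟨k, l, h⟩
  · rw [zeroConormal, dif_neg hex] at h
    simp at h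

theorem IsRegularZero.mem_zeroSheet_iff (h : IsRegularZero F z k l) (j : Fin (n + 1)) :
    z ∈ zeroSheet F j ↔ l (Pi.single j 1) ≠ 0 ∧ ∀ i < j, l (Pi.single i 1) = 0 := by
  simp only [zeroSheet, mem_ofPred_eq, ne_eq, zeroConormal_apply_eq_zero_iff h]

theorem exists_isRegularZero_of_mem_zeroSheet {j : Fin (n + 1)} (h : z ∈ zeroSheet F j) :
    ∃ k l, IsRegularZero F z k l :=
  exists_isRegularZero_of_zeroConormal_ne h.1

theorem eq_of_mem_zeroSheet {i j : Fin (n + 1)} (hi : z ∈ zeroSheet F i)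
    (hj : z ∈ zeroSheet F j) : i = j := by
  by_contra hne
  rcases lt_or_gt_of_ne hne with h | h
  · exact hi.1 (hj.2 i h)
  · exact hj.1 (hi.2 j h)

theorem IsRegularZero.exists_mem_zeroSheet (h : IsRegularZero F z k l) :
    ∃ j, z ∈ zeroSheet F j := by
  have hex : {j | l (Pi.single j 1) ≠ 0}.Nonempty := by
    by_contra! H
    apply h.2.1
    ext v
    rw [pi_eq_sum_univ' v, map_sum]
    have h0 : ∀ j, l (Pi.single j 1) = 0 := fun j => by_contra fun hj => by
      have : j ∈ {j | l (Pi.single j 1) ≠ 0} := hj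
      rw [H] at this
      exact this
    simp [h0]
  obtain ⟨j, hj, hmin⟩ := WellFounded.has_min (wellFounded_lt (α := Fin (n + 1))) _ hex
  exact ⟨j, (h.mem_zeroSheet_iff j).2 ⟨hj, fun i hi => by_contra fun h0 => hmin i h0 hi⟩⟩

/-- The tangent frame depends only on the kernel of the conormal, so the arbitrarily chosen conormal
may be replaced by any other one. -/
theorem zeroTangent_eq (h : IsRegularZero F z k l) {j : Fin (n + 1)}
    (hj : l (Pi.single j 1) ≠ 0) (i : Fin n) :
    zeroTangent F j z i = Pi.single (j.succAbove i) 1 -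
      (l (Pi.single (j.succAbove i) 1) / l (Pi.single j 1)) • Pi.single j 1 := by
  have hc := zeroConormal_apply_eq_zero_iff h
  have hj' : zeroConormal F z (Pi.single j 1) ≠ 0 := fun h0 => hj ((hc _).1 h0)
  have h1 := (hc (Pi.single (j.succAbove i) 1 -
      (l (Pi.single (j.succAbove i) 1) / l (Pi.single j 1)) • Pi.single j 1)).2 (by
    rw [map_sub, map_smul, smul_eq_mul, div_mul_cancel₀ _ hj, sub_self])
  rw [map_sub, map_smul, smul_eq_mul, sub_eq_zero] at h1
  rw [zeroTangent, h1, mul_div_cancel_right₀ _ hj']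

/-- Near a regular zero, the zeros of `F` are regular and form the zero set of a function without
critical points. -/
theorem IsRegularZero.exists_isOpen (h : IsRegularZero F z k l) :
    ∃ (V : Set (Fin (n + 1) → ℂ)) (a : (Fin (n + 1) → ℂ) → ℂ), IsOpen V ∧ z ∈ V ∧
      AnalyticOnNhd ℂ a V ∧ a z = 0 ∧ fderiv ℂ a z = l ∧
      (∀ y ∈ V, a y = 0 → IsRegularZero F y k (fderiv ℂ a y)) ∧ (∀ y ∈ V, a y ≠ 0 → F y ≠ 0) := by
  obtain ⟨hk, hl, a, u, ha, hu, ha0, rfl, hu0, hF⟩ := h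
  have hev : ∀ᶠ y in 𝓝 z, AnalyticAt ℂ a y ∧ AnalyticAt ℂ u y ∧ u y ≠ 0 ∧ fderiv ℂ a y ≠ 0 ∧
      F =ᶠ[𝓝 y] fun w => a w ^ k * u w :=
    ha.eventually_analyticAt.and (hu.eventually_analyticAt.and
      ((hu.continuousAt.eventually_ne hu0).and ((ha.fderiv.continuousAt.eventually_ne hl).and
        hF.eventuallyEq_nhds)))
  obtain ⟨V, hV, hVo, hzV⟩ := _root_.eventually_nhds_iff.1 hev
  refine ⟨V, a, hVo, hzV, fun y hy => (hV y hy).1, ha0, rfl, fun y hy hy0 => ?_, fun y hy hy0 => ?_⟩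
  · obtain ⟨h1, h2, h3, h4, h5⟩ := hV y hy
    exact ⟨hk, h4, a, u, h1, h2, hy0, rfl, h3, h5⟩
  · obtain ⟨h1, h2, h3, h4, h5⟩ := hV y hy
    rw [h5.eq_of_nhds]
    exact mul_ne_zero (pow_ne_zero _ hy0) h3

end RegularZero

/-! ## Local parametrizations of smooth hypersurfaces -/

section Graph

variable {n : ℕ}

/-- The holomorphic implicit function theorem, in a form that parametrizes all zeros in `V` and not
only those near a branch. -/
theorem exists_graph {h : (Fin (n + 1) → ℂ) → ℂ} {z₀ : Fin (n + 1) → ℂ} (hh : AnalyticAt ℂ h z₀)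
    {j : Fin (n + 1)} (hj : fderiv ℂ h z₀ (Pi.single j 1) ≠ 0)
    {N : Set (Fin (n + 1) → ℂ)} (hN : N ∈ 𝓝 z₀) :
    ∃ (V : Set (Fin (n + 1) → ℂ)) (W : Set (Fin n → ℂ)) (Γ : (Fin n → ℂ) → Fin (n + 1) → ℂ),
      IsOpen V ∧ z₀ ∈ V ∧ V ⊆ N ∧ IsOpen W ∧ AnalyticOnNhd ℂ Γ W ∧
      (∀ w ∈ W, Γ w ∈ V ∧ h (Γ w) = 0 ∧ j.removeNth (Γ w) = w) ∧
      ∀ z ∈ V, h z = 0 → j.removeNth z ∈ W ∧ Γ (j.removeNth z) = z := by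
  classical
  -- The map replaces the `j`-th coordinate by `h` and keeps the others. Its local inverse
  -- straightens `h = 0` to a coordinate hyperplane, and `Γ` is that inverse on the hyperplane.
  set Ψ : (Fin (n + 1) → ℂ) → Fin (n + 1) → ℂ := fun z => z + (h z - z j) • Pi.single j 1 with hΨ
  have hΨj : ∀ z, Ψ z j = h z := fun z => by simp [hΨ]
  have hΨr : ∀ z, j.removeNth (Ψ z) = j.removeNth z := fun z => by
    ext i
    simp [hΨ, Fin.removeNth]
  have hΨa : ∀ z, AnalyticAt ℂ h z → AnalyticAt ℂ Ψ z := fun z hz => by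
    have : AnalyticAt ℂ (fun z : Fin (n + 1) → ℂ => z j) z :=
      (ContinuousLinearMap.proj (R := ℂ) (φ := fun _ : Fin (n + 1) => ℂ) j).analyticAt z
    exact analyticAt_id.add ((hz.sub this).smul analyticAt_const)
  set L : (Fin (n + 1) → ℂ) →L[ℂ] Fin (n + 1) → ℂ := ContinuousLinearMap.id ℂ _ +
    (fderiv ℂ h z₀ - ContinuousLinearMap.proj (R := ℂ) (φ := fun _ : Fin (n + 1) => ℂ) j).smulRight
      (Pi.single j 1) with hL
  have hLd : ∀ z, AnalyticAt ℂ h z → HasFDerivAt Ψ (ContinuousLinearMap.id ℂ _ +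
      (fderiv ℂ h z - ContinuousLinearMap.proj (R := ℂ) (φ := fun _ : Fin (n + 1) => ℂ) j).smulRight
      (Pi.single j 1)) z := fun z hz => by
    have h1 : HasFDerivAt (fun z : Fin (n + 1) → ℂ => z j)
      (ContinuousLinearMap.proj (R := ℂ) (φ := fun _ : Fin (n + 1) => ℂ) j) z :=
      (ContinuousLinearMap.proj (R := ℂ) (φ := fun _ : Fin (n + 1) => ℂ) j).hasFDerivAt
    exact (hasFDerivAt_id z).add ((hz.differentiableAt.hasFDerivAt.sub h1).smul_const _)
  have hLi : Function.Injective L := by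
    rw [injective_iff_map_eq_zero]
    intro v hv
    have hv' : v + (fderiv ℂ h z₀ v - v j) • Pi.single j 1 = 0 := hv
    set c := fderiv ℂ h z₀ v - v j with hc
    have h1 : v = -c • Pi.single j 1 := by rw [neg_smul]; exact eq_neg_of_add_eq_zero_left hv'
    have h2 : v j = -c := by rw [h1]; simp
    have h3 : fderiv ℂ h z₀ v = -c * fderiv ℂ h z₀ (Pi.single j 1) := by
      conv_lhs => rw [h1]
      rw [map_smul, smul_eq_mul]
    have h4 : c * fderiv ℂ h z₀ (Pi.single j 1) = 0 := by
      have := hc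
      rw [h2, h3] at this
      linear_combination this
    have h5 : c = 0 := (mul_eq_zero.1 h4).resolve_right hj
    rw [h1, h5, neg_zero, zero_smul]
  have hLe : L.IsInvertible := by
    let e := LinearEquiv.ofInjectiveEndo (L : (Fin (n + 1) → ℂ) →ₗ[ℂ] _) hLi
    exact ⟨e.toContinuousLinearEquiv, by ext v; rfl⟩
  obtain ⟨Le, hLe⟩ := hLe
  have hstrict : HasStrictFDerivAt Ψ (Le : (Fin (n + 1) → ℂ) →L[ℂ] Fin (n + 1) → ℂ) z₀ := by
    rw [hLe, hL, ← (hLd z₀ hh).fderiv]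
    exact (hΨa z₀ hh).hasStrictFDerivAt
  set e₀ := hstrict.toOpenPartialHomeomorph Ψ with he₀
  have hinv : ∀ᶠ z in 𝓝 z₀, AnalyticAt ℂ h z ∧ (fderiv ℂ Ψ z).IsInvertible ∧ z ∈ N := by
    refine hh.eventually_analyticAt.and (Filter.Eventually.and ?_ hN)
    have hc : ContinuousAt (fderiv ℂ Ψ) z₀ := (hΨa z₀ hh).fderiv.continuousAt
    have := hc.preimage_mem_nhds (t := range ((↑) : ((Fin (n + 1) → ℂ) ≃L[ℂ] (Fin (n + 1) → ℂ)) →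
      (Fin (n + 1) → ℂ) →L[ℂ] (Fin (n + 1) → ℂ))) (by
        rw [(hLd z₀ hh).fderiv, ← hL, ← hLe]
        exact ContinuousLinearEquiv.nhds Le)
    filter_upwards [this] with z hz
    exact hz
  obtain ⟨N', hN', hN'o, hzN'⟩ := _root_.eventually_nhds_iff.1 hinv
  set e := e₀.restrOpen N' hN'o with he
  have hes : e.source ⊆ N' := fun z hz => by
    rw [he, OpenPartialHomeomorph.restrOpen_source] at hz
    exact hz.2
  have hecoe : ∀ z, e z = Ψ z := fun z => rfl
  have hz₀ : z₀ ∈ e.source := by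
    rw [he, OpenPartialHomeomorph.restrOpen_source]
    exact ⟨hstrict.mem_toOpenPartialHomeomorph_source, hzN'⟩
  have hinsc : Continuous fun w : Fin n → ℂ => (j.insertNth (0 : ℂ) w : Fin (n + 1) → ℂ) :=
    continuous_const.finInsertNth j continuous_id
  have hinsa : ∀ w, AnalyticAt ℂ (fun w : Fin n → ℂ => (j.insertNth (0 : ℂ) w : Fin (n + 1) → ℂ)) w := by
    intro w
    rw [analyticAt_pi_iff]
    intro i
    refine Fin.succAboveCases j ?_ (fun i => ?_) i
    · simpa using analyticAt_const
    · simp only [Fin.insertNth_apply_succAbove]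
      exact (ContinuousLinearMap.proj (R := ℂ) (φ := fun _ : Fin n => ℂ) i).analyticAt w
  refine ⟨e.source, (fun w => j.insertNth (0 : ℂ) w) ⁻¹' e.target,
    fun w => e.symm (j.insertNth (0 : ℂ) w), e.open_source, hz₀, fun z hz => (hN' z (hes hz)).2.2,
    e.open_target.preimage hinsc, fun w hw => ?_, fun w hw => ?_, fun z hz hz0 => ?_⟩
  · have hs := e.map_target hw
    obtain ⟨h1, ⟨A, hA⟩, -⟩ := hN' _ (hes hs)
    have : AnalyticAt ℂ e.symm (j.insertNth (0 : ℂ) w) :=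
      e.analyticAt_symm hw (hΨa _ h1) hA.symm
    exact AnalyticAt.fun_comp (g := e.symm) (f := fun w : Fin n → ℂ => j.insertNth (0 : ℂ) w) this (hinsa w)
  · have hs := e.map_target hw
    have hr := e.right_inv hw
    rw [hecoe] at hr
    refine ⟨hs, ?_, ?_⟩
    · rw [← hΨj, hr]; simp
    · rw [← hΨr, hr]; simp
  · have h1 : (j.insertNth (0 : ℂ) (j.removeNth z) : Fin (n + 1) → ℂ) = e z := by
      rw [hecoe, ← hΨr, ← hz0, ← hΨj]
      simp
    refine ⟨?_, ?_⟩
    · rw [mem_preimage, h1]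
      exact e.map_source hz
    · change e.symm _ = z
      rw [h1, e.left_inv hz]

end Graph

/-! ## Generic slices of the zero set -/

section Slices

variable {E : Type*} [NormedAddCommGroup E] [NormedSpace ℂ E]

theorem isNonvanishingOn_of_isPreconnected {f : E → ℂ} {U : Set E} {z : E}
    (hf : AnalyticOnNhd ℂ f U) (hU : IsPreconnected U) (h0 : U ∈ 𝓝 z)
    (hne : ¬ f =ᶠ[𝓝 z] 0) : IsNonvanishingOn f U :=
  ⟨hf, fun _ hy h => hne (Filter.mem_of_superset h0 fun _ hx =>
    hf.eqOn_zero_of_preconnected_of_eventuallyEq_zero hU hy h hx)⟩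

variable {n : ℕ}

theorem analyticAt_insertNth_left (j : Fin (n + 1)) (w : Fin n → ℂ) (t : ℂ) :
    AnalyticAt ℂ (fun t : ℂ => (j.insertNth t w : Fin (n + 1) → ℂ)) t := by
  rw [analyticAt_pi_iff]
  intro i
  refine Fin.succAboveCases j ?_ (fun i => ?_) i
  · simp only [Fin.insertNth_apply_same]
    exact analyticAt_id
  · simpa using analyticAt_const

theorem analyticAt_insertNth_right (j : Fin (n + 1)) (w : Fin n → ℂ) (t : ℂ) :
    AnalyticAt ℂ (fun w : Fin n → ℂ => (j.insertNth t w : Fin (n + 1) → ℂ)) w := by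
  rw [analyticAt_pi_iff]
  intro i
  refine Fin.succAboveCases j ?_ (fun i => ?_) i
  · simpa using analyticAt_const
  · simp only [Fin.insertNth_apply_succAbove]
    exact (ContinuousLinearMap.proj (R := ℂ) (φ := fun _ : Fin n => ℂ) i).analyticAt w

theorem insertNth_mem_ball_iff {j : Fin (n + 1)} {t : ℂ} {w : Fin n → ℂ} {z : Fin (n + 1) → ℂ}
    {r : ℝ} (hr : 0 < r) : (j.insertNth t w : Fin (n + 1) → ℂ) ∈ ball z r ↔
      t ∈ ball (z j) r ∧ w ∈ ball (j.removeNth z) r := by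
  simp only [mem_ball, dist_pi_lt_iff hr, j.forall_iff_succAbove, Fin.insertNth_apply_same,
    Fin.insertNth_apply_succAbove, Fin.removeNth]

theorem continuous_removeNth (j : Fin (n + 1)) :
    Continuous fun z : Fin (n + 1) → ℂ => j.removeNth z :=
  continuous_pi fun i => continuous_apply (j.succAbove i)

/-- A ball of the sup norm is a product of discs. If `F y ≠ 0` there, then `F` with the `j`-th
coordinate frozen at `y j` is nonzero for almost every `w`, and each such line meets the ball in a
disc on which `F` is not identically zero. Countably many balls suffice. -/
theorem ae_isNonvanishingOn_slice {F : (Fin (n + 1) → ℂ) → ℂ} {U : Set (Fin (n + 1) → ℂ)}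
    (hU : IsOpen U) (hF : IsNonvanishingOn F U) (j : Fin (n + 1)) :
    ∀ᵐ w : Fin n → ℂ, IsNonvanishingOn (fun t => F (j.insertNth t w))
      {t | (j.insertNth t w : Fin (n + 1) → ℂ) ∈ U} := by
  have hanl : ∀ w t, (j.insertNth t w : Fin (n + 1) → ℂ) ∈ U →
      AnalyticAt ℂ (fun t => F (j.insertNth t w)) t := fun w t h =>
    AnalyticAt.fun_comp (g := F) (f := fun t : ℂ => (j.insertNth t w : Fin (n + 1) → ℂ))
      (hF.analytic _ h) (analyticAt_insertNth_left j w t)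
  have hanr : ∀ w t, (j.insertNth t w : Fin (n + 1) → ℂ) ∈ U →
      AnalyticAt ℂ (fun w => F (j.insertNth t w)) w := fun w t h =>
    AnalyticAt.fun_comp (g := F) (f := fun w : Fin n → ℂ => (j.insertNth t w : Fin (n + 1) → ℂ))
      (hF.analytic _ h) (analyticAt_insertNth_right j w t)
  have key : ∀ z ∈ U, ∃ r > 0, ∀ᵐ w : Fin n → ℂ, ∀ t, (j.insertNth t w : Fin (n + 1) → ℂ) ∈ ball z r →
      ¬ (fun t => F (j.insertNth t w)) =ᶠ[𝓝 t] 0 := by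
    intro z hz
    obtain ⟨r, hr, hrU⟩ := Metric.isOpen_iff.1 hU z hz
    refine ⟨r, hr, ?_⟩
    obtain ⟨y, hy, hy0⟩ : ∃ y ∈ ball z r, F y ≠ 0 := by
      by_contra! H
      exact hF.not_eventually z hz (Filter.eventually_of_mem (ball_mem_nhds z hr) H)
    rw [← j.insertNth_self_removeNth y, insertNth_mem_ball_iff hr] at hy
    have hg : IsNonvanishingOn (fun w => F (j.insertNth (y j) w)) (ball (j.removeNth z) r) := by
      have hA : AnalyticOnNhd ℂ (fun w => F (j.insertNth (y j) w)) (ball (j.removeNth z) r) :=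
        fun w hw => hanr w _ (hrU ((insertNth_mem_ball_iff hr).2 ⟨hy.1, hw⟩))
      refine isNonvanishingOn_of_isPreconnected hA
        (convex_ball (j.removeNth z) r).isPreconnected (isOpen_ball.mem_nhds hy.2) fun h => hy0 ?_
      simpa using h.eq_of_nhds
    filter_upwards [hg.ae_ne_zero isOpen_ball] with w hw t ht
    rw [insertNth_mem_ball_iff hr] at ht
    have hA : AnalyticOnNhd ℂ (fun t => F (j.insertNth t w)) (ball (z j) r) :=
        fun t h => hanl w _ (hrU ((insertNth_mem_ball_iff hr).2 ⟨h, ht.2⟩))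
    refine (isNonvanishingOn_of_isPreconnected hA (convex_ball (z j) r).isPreconnected
      (isOpen_ball.mem_nhds hy.1) fun h => hw ht.2 ?_).not_eventually t ht.1
    simpa using h.eq_of_nhds
  choose! r hr hr' using key
  obtain ⟨s, hsU, hsc, hs⟩ := TopologicalSpace.countable_cover_nhdsWithin (s := U)
    (f := fun z => ball z (r z)) fun z hz => mem_nhdsWithin_of_mem_nhds (ball_mem_nhds z (hr z hz))
  have hall : ∀ᵐ w : Fin n → ℂ, ∀ z ∈ s, ∀ t, (j.insertNth t w : Fin (n + 1) → ℂ) ∈ ball z (r z) →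
      ¬ (fun t => F (j.insertNth t w)) =ᶠ[𝓝 t] 0 :=
    (ae_ball_iff hsc).2 fun z hz => hr' z (hsU hz)
  filter_upwards [hall] with w hw
  refine ⟨fun t ht => hanl w t ht, fun t ht => ?_⟩
  obtain ⟨z, hz, hzt⟩ := mem_iUnion₂.1 (hs ht)
  exact hw z hz t hzt

/-- The `k`-th derivative `G` in the axis direction vanishes to first order along the line, so `G =
0` is a smooth graph containing all nearby points of order `k + 1`. Either all lower derivatives
vanish identically on that graph, and then `F` is divisible by `G ^ (k + 1)`; or one of them does
not, and the points of order `k + 1` lie over its zero set, which is null in the base. -/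
theorem exists_isRegularZero_or_null {F : (Fin (n + 1) → ℂ) → ℂ} {z₀ : Fin (n + 1) → ℂ}
    (hF : AnalyticAt ℂ F z₀) (j : Fin (n + 1)) {k : ℕ}
    (hk : lineOrder F (Pi.single j 1) z₀ = (k + 1 : ℕ)) :
    (∃ l, IsRegularZero F z₀ (k + 1) l ∧ l (Pi.single j 1) ≠ 0) ∨
    ∃ V ∈ 𝓝 z₀, volume ((fun z => j.removeNth z) ''
      {z ∈ V | lineOrder F (Pi.single j 1) z = (k + 1 : ℕ)}) = 0 := by
  set e : Fin (n + 1) → ℂ := Pi.single j 1 with he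
  set G := dirDeriv e F k with hG
  have hGa : AnalyticAt ℂ G z₀ := analyticAt_dirDeriv hF e k
  have hG1 : lineOrder G e z₀ = 1 := by
    have := lineOrder_dirDeriv (v := e) hF (i := k) (by rw [hk]; exact_mod_cast k.le_succ)
    rw [hk] at this
    push_cast at this
    rw [add_comm (k : ℕ∞)] at this
    exact ENat.add_left_injective_of_ne_top (ENat.natCast_ne_top k) this
  have hG0 : G z₀ = 0 := by
    by_contra h
    rw [(lineOrder_eq_zero hGa).2 h] at hG1
    exact zero_ne_one hG1
  have hGd : fderiv ℂ G z₀ e ≠ 0 := fun h => by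
    have := two_le_lineOrder hGa hG0 h
    rw [hG1] at this
    exact absurd this (by norm_num)
  have hev : ∀ᶠ z in 𝓝 z₀, AnalyticAt ℂ F z ∧ fderiv ℂ G z e ≠ 0 :=
    hF.eventually_analyticAt.and
      ((analyticAt_fderiv_apply hGa e).continuousAt.eventually_ne hGd)
  obtain ⟨V, W, Γ, hVo, hzV, hVN, hWo, hΓa, hΓ, hΓV⟩ := exists_graph hGa hGd hev
  obtain ⟨hw₀, hΓ₀⟩ := hΓV z₀ hzV hG0
  have hea : ∀ i, AnalyticOnNhd ℂ (fun w => dirDeriv e F i (Γ w)) W := fun i w hw =>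
    AnalyticAt.fun_comp (g := dirDeriv e F i) (f := Γ)
      (analyticAt_dirDeriv (hVN (hΓ w hw).1).1 e i) (hΓa w hw)
  by_cases hcase : ∀ i < k + 1, (fun w => dirDeriv e F i (Γ w)) =ᶠ[𝓝 (j.removeNth z₀)] 0
  · left
    have hall : ∀ᶠ w in 𝓝 (j.removeNth z₀), ∀ i < k + 1, dirDeriv e F i (Γ w) = 0 := by
      have := (eventually_all_finite (finite_Iio (k + 1))).2 hcase
      exact this
    have hall' : ∀ᶠ z in 𝓝 z₀, G z = 0 → ((k + 1 : ℕ) : ℕ∞) ≤ lineOrder F e z := by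
      filter_upwards [(continuous_removeNth j).continuousAt.eventually hall, hVo.mem_nhds hzV]
        with z hz hzV h0
      obtain ⟨h1, h2⟩ := hΓV z hzV h0
      rw [h2] at hz
      exact (le_lineOrder_iff (hVN hzV).1 (k + 1)).2 hz
    -- One factor `G` is split off at a time: as long as `i < k + 1`, a cofactor not vanishing at a
    -- zero of `G` would make the order of `F` there equal to `i`, which is too small.
    have hdiv : ∀ i ≤ k + 1, ∃ u, AnalyticAt ℂ u z₀ ∧ F =ᶠ[𝓝 z₀] fun z => G z ^ i * u z := by
      intro i
      induction i with
      | zero => exact fun _ => ⟨F, hF, by simp⟩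
      | succ i ih =>
        intro hi
        obtain ⟨u, hu, hFu⟩ := ih (by omega)
        have hz : ∀ᶠ z in 𝓝 z₀, G z = 0 → u z = 0 := by
          filter_upwards [hall', hFu.eventuallyEq_nhds, hGa.eventually_analyticAt,
            hu.eventually_analyticAt, hev] with z h1 h2 h3 h4 h5 h0
          by_contra hne
          have h6 := h1 h0
          rw [lineOrder_congr h2, lineOrder_mul (F := fun w => G w ^ i) (h3.pow i) h4,
            lineOrder_pow h3, lineOrder_eq_one h3 h0 h5.2, (lineOrder_eq_zero h4).2 hne, mul_one,
            add_zero] at h6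
          exact absurd (Nat.cast_le.1 h6) (by omega)
        obtain ⟨u', hu', huu⟩ := exists_eq_mul_of_eq_zero_on_zeros hGa hu
          (fun h => hGd (by rw [h]; simp)) hz
        refine ⟨u', hu', ?_⟩
        filter_upwards [hFu, huu] with z h1 h2
        rw [h1, h2, pow_succ, mul_assoc]
    obtain ⟨u, hu, hFu⟩ := hdiv (k + 1) le_rfl
    refine ⟨fderiv ℂ G z₀, ⟨by omega, fun h => hGd (by rw [h]; simp), G, u, hGa, hu, hG0, rfl, ?_,
      hFu⟩, hGd⟩
    rw [lineOrder_congr hFu, lineOrder_mul (F := fun w => G w ^ (k + 1)) (hGa.pow _) hu,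
      lineOrder_pow hGa, hG1, mul_one] at hk
    rw [← lineOrder_eq_zero (v := e) hu]
    exact ENat.add_right_injective_of_ne_top (ENat.natCast_ne_top (k + 1)) (hk.trans (add_zero _).symm)
  · right
    push Not at hcase
    obtain ⟨i, hi, hne⟩ := hcase
    obtain ⟨r, hr, hrW⟩ := Metric.isOpen_iff.1 hWo _ hw₀
    refine ⟨V ∩ (fun z => j.removeNth z) ⁻¹' ball (j.removeNth z₀) r,
      inter_mem (hVo.mem_nhds hzV)
        ((continuous_removeNth j).continuousAt.preimage_mem_nhds (ball_mem_nhds _ hr)), ?_⟩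
    have hN := (isNonvanishingOn_of_isPreconnected ((hea i).mono hrW)
      (convex_ball (j.removeNth z₀) r).isPreconnected (ball_mem_nhds _ hr) hne).ae_ne_zero isOpen_ball
    refine measure_mono_null ?_ (ae_iff.1 hN)
    rintro w ⟨z, ⟨⟨hzV, hzr⟩, hz⟩, rfl⟩
    have h1 := (le_lineOrder_iff (hVN hzV).1 (k + 1)).1 hz.ge
    obtain ⟨h2, h3⟩ := hΓV z hzV (h1 k (by omega))
    simp only [mem_ofPred_eq, Classical.not_imp, not_not]
    exact ⟨hzr, by rw [h3]; exact h1 i hi⟩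

theorem lineOrder_insertNth (F : (Fin (n + 1) → ℂ) → ℂ) (j : Fin (n + 1)) (t : ℂ) (w : Fin n → ℂ) :
    lineOrder F (Pi.single j 1) (j.insertNth t w) =
      analyticOrderAt (fun t => F (j.insertNth t w)) t := by
  have h1 : (fun s : ℂ => F ((j.insertNth t w : Fin (n + 1) → ℂ) + s • Pi.single j 1)) =
      (fun t => F (j.insertNth t w)) ∘ fun s => t + s := by
    funext s
    simp only [Function.comp]
    congr 1
    ext i
    refine Fin.succAboveCases j ?_ (fun i => ?_) i <;> simp
  rw [lineOrder, h1, analyticOrderAt_comp_of_deriv_ne_zero (by fun_prop) (by simp)]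
  simp

/-- Along almost every line parallel to a coordinate axis, the zeros of `F` are regular, with the
multiplicity given by the order of vanishing along the line. -/
theorem ae_isRegularZero_slice {F : (Fin (n + 1) → ℂ) → ℂ} {U : Set (Fin (n + 1) → ℂ)}
    (hU : IsOpen U) (hF : IsNonvanishingOn F U) (j : Fin (n + 1)) :
    ∀ᵐ w : Fin n → ℂ, ∀ t, (j.insertNth t w : Fin (n + 1) → ℂ) ∈ U → F (j.insertNth t w) = 0 →
      ∃ l, IsRegularZero F (j.insertNth t w) (analyticOrderNatAt (fun t => F (j.insertNth t w)) t) l ∧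
        l (Pi.single j 1) ≠ 0 := by
  set B : ℕ → Set (Fin (n + 1) → ℂ) := fun k => {z ∈ U | lineOrder F (Pi.single j 1) z = (k + 1 : ℕ) ∧
    ¬ ∃ l, IsRegularZero F z (k + 1) l ∧ l (Pi.single j 1) ≠ 0} with hB
  have hnull : ∀ k, volume ((fun z : Fin (n + 1) → ℂ => j.removeNth z) '' B k) = 0 := by
    intro k
    -- The projection of `B k` need not be known to be measurable; pulling back Lebesgue outer
    -- measure along the projection turns the local null statements into a global one.
    have := measure_null_of_locally_null (μ := OuterMeasure.comap
      (fun z : Fin (n + 1) → ℂ => (j.removeNth z : Fin n → ℂ)) volume.toOuterMeasure) (B k) (by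
      intro z hz
      obtain ⟨V, hV, hV0⟩ := (exists_isRegularZero_or_null (hF.analytic z hz.1) j hz.2.1).resolve_left
        hz.2.2
      refine ⟨B k ∩ V, inter_mem self_mem_nhdsWithin (mem_nhdsWithin_of_mem_nhds hV), ?_⟩
      rw [OuterMeasure.comap_apply]
      refine measure_mono_null (image_mono ?_) hV0
      exact fun y hy => ⟨hy.2, hy.1.2.1⟩)
    rwa [OuterMeasure.comap_apply] at this
  have hae : ∀ᵐ w : Fin n → ℂ, ∀ k, w ∉ (fun z : Fin (n + 1) → ℂ => j.removeNth z) '' B k :=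
    ae_all_iff.2 fun k => measure_eq_zero_iff_ae_notMem.1 (hnull k)
  filter_upwards [hae, ae_isNonvanishingOn_slice hU hF j] with w hw hs t ht h0
  have ht' : t ∈ {t | (j.insertNth t w : Fin (n + 1) → ℂ) ∈ U} := ht
  have hfin : analyticOrderAt (fun t => F (j.insertNth t w)) t ≠ ⊤ := fun h =>
    hs.not_eventually t ht' (analyticOrderAt_eq_top.1 h)
  have hcast := Nat.cast_analyticOrderNatAt hfin
  have hne : analyticOrderNatAt (fun t => F (j.insertNth t w)) t ≠ 0 := by
    intro h
    rw [h] at hcast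
    exact ((hs.analytic t ht').analyticOrderAt_ne_zero.2 h0) hcast.symm
  obtain ⟨k, hk⟩ := Nat.exists_eq_succ_of_ne_zero hne
  rw [hk]
  by_contra hcon
  refine hw k ⟨j.insertNth t w, ⟨ht, ?_, hcon⟩, by simp⟩
  rw [lineOrder_insertNth, ← hcast, hk]

end Slices

/-! ## The measures on the sheets of the zero set -/

section Sheets

theorem _root_.ContinuousOn.measurableSet_inter_preimage_zero {α β : Type*} [TopologicalSpace α]
    [MeasurableSpace α] [OpensMeasurableSpace α] [TopologicalSpace β] [T1Space β] [Zero β]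
    {f : α → β} {V : Set α} (hf : ContinuousOn f V) (hV : IsOpen V) :
    MeasurableSet (V ∩ f ⁻¹' {0}) := by
  have h : V ∩ f ⁻¹' {0} = V \ (V ∩ f ⁻¹' {0}ᶜ) := by ext; simp
  rw [h]
  exact hV.measurableSet.diff (hf.isOpen_inter_preimage hV isOpen_compl_singleton).measurableSet

theorem measurableSet_of_forall_exists_inter {α : Type*} [TopologicalSpace α]
    [SecondCountableTopology α] [MeasurableSpace α] {S : Set α}
    (h : ∀ z ∈ S, ∃ V ∈ 𝓝 z, MeasurableSet (S ∩ V)) : MeasurableSet S := by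
  choose! V hV hm using h
  obtain ⟨s, hsS, hsc, hs⟩ := TopologicalSpace.countable_cover_nhdsWithin (s := S)
    (f := V) fun z hz => mem_nhdsWithin_of_mem_nhds (hV z hz)
  have : S = ⋃ z ∈ s, S ∩ V z := by
    rw [← inter_iUnion₂, eq_comm, inter_eq_left]
    exact hs
  rw [this]
  exact MeasurableSet.biUnion hsc fun z hz => hm z (hsS hz)

variable {n : ℕ}

theorem ext_insertNth {j : Fin (n + 1)} {x y : Fin (n + 1) → ℂ} (h : x j = y j)
    (h' : j.removeNth x = j.removeNth y) : x = y := by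
  rw [← j.insertNth_self_removeNth x, ← j.insertNth_self_removeNth y, h, h']

/-- `Γ : W → V` parametrizes the zero set of `F` in `V`, as a graph over the `j`-th coordinate
hyperplane; the zero set is regular, with defining function `a` and multiplicity `k`. -/
structure IsZeroGraph (F : (Fin (n + 1) → ℂ) → ℂ) (j : Fin (n + 1)) (V : Set (Fin (n + 1) → ℂ))
    (W : Set (Fin n → ℂ)) (Γ : (Fin n → ℂ) → Fin (n + 1) → ℂ) (a : (Fin (n + 1) → ℂ) → ℂ)
    (k : ℕ) : Prop where
  isOpen_source : IsOpen W
  isOpen_target : IsOpen V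
  measurable : Measurable Γ
  analytic : AnalyticOnNhd ℂ Γ W
  analytic_def : AnalyticOnNhd ℂ a V
  map_mem : ∀ w ∈ W, Γ w ∈ V
  apply_eq : ∀ w ∈ W, a (Γ w) = 0
  removeNth_eq : ∀ w ∈ W, j.removeNth (Γ w) = w
  removeNth_mem : ∀ z ∈ V, a z = 0 → j.removeNth z ∈ W
  eq_of_zero : ∀ z ∈ V, a z = 0 → Γ (j.removeNth z) = z
  fderiv_ne : ∀ z ∈ V, fderiv ℂ a z (Pi.single j 1) ≠ 0
  isRegularZero : ∀ z ∈ V, a z = 0 → IsRegularZero F z k (fderiv ℂ a z)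
  ne_zero : ∀ z ∈ V, a z ≠ 0 → F z ≠ 0

variable {F : (Fin (n + 1) → ℂ) → ℂ} {j : Fin (n + 1)} {V : Set (Fin (n + 1) → ℂ)}
    {W : Set (Fin n → ℂ)} {Γ : (Fin n → ℂ) → Fin (n + 1) → ℂ} {a : (Fin (n + 1) → ℂ) → ℂ}
    {k : ℕ}

theorem exists_isZeroGraph {z : Fin (n + 1) → ℂ} (hz : z ∈ zeroSheet F j)
    {N : Set (Fin (n + 1) → ℂ)} (hN : N ∈ 𝓝 z) :
    ∃ V W Γ a k, z ∈ V ∧ V ⊆ N ∧ IsZeroGraph F j V W Γ a k := by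
  obtain ⟨k, l, hl⟩ := exists_isRegularZero_of_mem_zeroSheet hz
  have hlj := ((hl.mem_zeroSheet_iff j).1 hz).1
  obtain ⟨V₁, a, hV₁, hzV₁, ha, haz, hal, hreg, hne⟩ := hl.exists_isOpen
  rw [← hal] at hlj
  have hev : ∀ᶠ y in 𝓝 z, fderiv ℂ a y (Pi.single j 1) ≠ 0 :=
    (analyticAt_fderiv_apply (ha z hzV₁) _).continuousAt.eventually_ne hlj
  obtain ⟨V, W, Γ, hVo, hzV, hVN, hWo, hΓa, hΓ, hΓV⟩ := exists_graph (ha z hzV₁) hlj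
    (inter_mem hN (inter_mem (hV₁.mem_nhds hzV₁) hev))
  -- The parametrization is extended by zero outside `W` to make it globally measurable, as
  -- push-forwards of measures require.
  have hE : EqOn (W.indicator Γ) Γ W := fun w hw => indicator_of_mem hw Γ
  refine ⟨V, W, W.indicator Γ, a, k, hzV, fun y hy => (hVN hy).1, hWo, hVo, ?_,
    (analyticOnNhd_congr hWo hE).2 hΓa, ha.mono fun y hy => (hVN hy).2.1, fun w hw => ?_,
    fun w hw => ?_, fun w hw => ?_,
    fun y hy h0 => (hΓV y hy h0).1, fun y hy h0 => ?_, fun y hy => (hVN hy).2.2,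
    fun y hy => hreg y (hVN hy).2.1, fun y hy => hne y (hVN hy).2.1⟩
  · classical
    rw [← piecewise_eq_indicator]
    exact hΓa.continuousOn.measurable_piecewise (g := fun _ => 0) continuousOn_const
      hWo.measurableSet
  · rw [hE hw]; exact (hΓ w hw).1
  · rw [hE hw]; exact (hΓ w hw).2.1
  · rw [hE hw]; exact (hΓ w hw).2.2
  · rw [hE (hΓV y hy h0).1]; exact (hΓV y hy h0).2

theorem IsZeroGraph.eq_zero_of_mem_zeroSheet (h : IsZeroGraph F j V W Γ a k) {i : Fin (n + 1)}
    {z : Fin (n + 1) → ℂ} (hz : z ∈ V) (hzs : z ∈ zeroSheet F i) : a z = 0 := by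
  by_contra h0
  obtain ⟨k, l, hl⟩ := exists_isRegularZero_of_mem_zeroSheet hzs
  exact h.ne_zero z hz h0 hl.eq_zero

theorem IsZeroGraph.measurableSet_inter (h : IsZeroGraph F j V W Γ a k) (i : Fin (n + 1)) :
    MeasurableSet (zeroSheet F i ∩ V) := by
  have hD : ∀ v, ContinuousOn (fun z => fderiv ℂ a z v) V := fun v z hz =>
    (analyticAt_fderiv_apply (h.analytic_def z hz) v).continuousAt.continuousWithinAt
  have heq : zeroSheet F i ∩ V = (V ∩ a ⁻¹' {0}) ∩
      ((V ∩ (fun z => fderiv ℂ a z (Pi.single i 1)) ⁻¹' {0}ᶜ) ∩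
        ⋂ i' : Fin (n + 1), ⋂ _ : i' < i, V ∩ (fun z => fderiv ℂ a z (Pi.single i' 1)) ⁻¹' {0}) ∪
      ∅ := by
    ext z
    simp only [mem_inter_iff, mem_preimage, mem_singleton_iff, mem_compl_iff, mem_iInter,
      union_empty]
    constructor
    · rintro ⟨hs, hV⟩
      have h0 := h.eq_zero_of_mem_zeroSheet hV hs
      obtain ⟨h1, h2⟩ := ((h.isRegularZero z hV h0).mem_zeroSheet_iff i).1 hs
      exact ⟨⟨hV, h0⟩, ⟨hV, h1⟩, fun i' hi' => ⟨hV, h2 i' hi'⟩⟩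
    · rintro ⟨⟨hV, h0⟩, ⟨-, h1⟩, h2⟩
      exact ⟨((h.isRegularZero z hV h0).mem_zeroSheet_iff i).2 ⟨h1, fun i' hi' => (h2 i' hi').2⟩, hV⟩
  rw [heq, union_empty]
  refine (h.analytic_def.continuousOn.measurableSet_inter_preimage_zero h.isOpen_target).inter
    (MeasurableSet.inter ?_ (MeasurableSet.iInter fun i' => MeasurableSet.iInter fun _ =>
      (hD _).measurableSet_inter_preimage_zero h.isOpen_target))
  exact ((hD _).isOpen_inter_preimage h.isOpen_target isOpen_compl_singleton).measurableSet

theorem measurableSet_zeroSheet (F : (Fin (n + 1) → ℂ) → ℂ) (j : Fin (n + 1)) :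
    MeasurableSet (zeroSheet F j) :=
  measurableSet_of_forall_exists_inter fun z hz => by
    obtain ⟨V, W, Γ, a, k, hzV, -, h⟩ := exists_isZeroGraph hz univ_mem
    exact ⟨V, h.isOpen_target.mem_nhds hzV, h.measurableSet_inter j⟩

/-- Countably many graphs cover the sheet; cut into disjoint pieces, their parametrizations push
Lebesgue measure forward to the required measure. It turns sums over the fibres of the projection
into ordinary integrals, to which the additivity and change of variables theorems apply. -/
theorem exists_sheetMeasure (F : (Fin (n + 1) → ℂ) → ℂ) (j : Fin (n + 1)) :
    ∃ μ : Measure (Fin (n + 1) → ℂ),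
      (∀ g : (Fin (n + 1) → ℂ) → ℝ≥0∞, Measurable g →
        ∫⁻ w : Fin n → ℂ, ∑' t : {t : ℂ // (j.insertNth t w : Fin (n + 1) → ℂ) ∈ zeroSheet F j},
          g (j.insertNth t.1 w) = ∫⁻ z, g z ∂μ) ∧
      ∀ g : (Fin (n + 1) → ℂ) → ℂ, Measurable g → Integrable g μ →
        ∫ w : Fin n → ℂ, ∑' t : {t : ℂ // (j.insertNth t w : Fin (n + 1) → ℂ) ∈ zeroSheet F j},
          g (j.insertNth t.1 w) = ∫ z, g z ∂μ := by
  rcases (zeroSheet F j).eq_empty_or_nonempty with hem | hne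
  · refine ⟨0, fun g hg => ?_, fun g hg _ => ?_⟩ <;>
    · have : ∀ w : Fin n → ℂ, IsEmpty {t : ℂ // (j.insertNth t w : Fin (n + 1) → ℂ) ∈ zeroSheet F j} :=
        fun w => ⟨fun t => eq_empty_iff_forall_notMem.1 hem _ t.2⟩
      simp
  have hex : ∀ z ∈ zeroSheet F j, ∃ V W Γ a k, z ∈ V ∧ V ⊆ univ ∧ IsZeroGraph F j V W Γ a k :=
    fun z hz => exists_isZeroGraph hz univ_mem
  choose! V₀ W₀ Γ₀ a₀ k₀ hzV _ hgr using hex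
  obtain ⟨s, hsS, hsc, hs⟩ := TopologicalSpace.countable_cover_nhdsWithin (s := zeroSheet F j)
    (f := V₀) fun z hz => mem_nhdsWithin_of_mem_nhds ((hgr z hz).isOpen_target.mem_nhds (hzV z hz))
  have hsne : s.Nonempty := by
    by_contra h
    rw [not_nonempty_iff_eq_empty] at h
    subst h
    simp only [mem_empty_iff_false, iUnion_of_empty, iUnion_empty, subset_empty_iff] at hs
    exact hne.ne_empty hs
  obtain ⟨c, rfl⟩ := hsc.exists_eq_range hsne
  set V := fun i => V₀ (c i)
  set W := fun i => W₀ (c i)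
  set Γ := fun i => Γ₀ (c i)
  set a := fun i => a₀ (c i)
  have hG : ∀ i, IsZeroGraph F j (V i) (W i) (Γ i) (a i) (k₀ (c i)) := fun i =>
    hgr _ (hsS ⟨i, rfl⟩)
  have hcov : zeroSheet F j ⊆ ⋃ i, disjointed V i := by
    rw [iUnion_disjointed]
    intro z hz
    obtain ⟨_, ⟨i, rfl⟩, hi⟩ := mem_iUnion₂.1 (hs hz)
    exact mem_iUnion.2 ⟨i, hi⟩
  have hTm : ∀ i, MeasurableSet (disjointed V i) := fun i =>
    MeasurableSet.disjointed (fun i => (hG i).isOpen_target.measurableSet) i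
  set A : ℕ → Set (Fin n → ℂ) := fun i => W i ∩ Γ i ⁻¹' (zeroSheet F j ∩ disjointed V i) with hA
  have hAm : ∀ i, MeasurableSet (A i) := fun i => (hG i).isOpen_source.measurableSet.inter
    ((hG i).measurable ((measurableSet_zeroSheet F j).inter (hTm i)))
  -- Each point of the sheet over `w` lies on exactly one of the disjoint pieces, and a graph has at
  -- most one point over `w`. Hence the fibre is in bijection with the indices `i` for which `w ∈ A
  -- i`.
  have key : ∀ {R : Type} [AddCommMonoid R] [TopologicalSpace R] (g : (Fin (n + 1) → ℂ) → R)
      (w : Fin n → ℂ),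
      ∑' t : {t : ℂ // (j.insertNth t w : Fin (n + 1) → ℂ) ∈ zeroSheet F j}, g (j.insertNth t.1 w) =
        ∑' i, (A i).indicator (fun w => g (Γ i w)) w := by
    intro R _ _ g w
    have hins : ∀ i : {i // w ∈ A i}, (j.insertNth (Γ i w j) w : Fin (n + 1) → ℂ) = Γ i w := fun i =>
      ext_insertNth (j := j) (by simp) (by rw [(hG i).removeNth_eq w i.2.1]; simp)
    let f : {i // w ∈ A i} → {t : ℂ // (j.insertNth t w : Fin (n + 1) → ℂ) ∈ zeroSheet F j} :=
      fun i => ⟨Γ i w j, by rw [hins]; exact i.2.2.1⟩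
    have hf : Function.Bijective f := by
      constructor
      · intro i i' h
        have h1 : Γ i w j = Γ i' w j := congrArg Subtype.val h
        have h2 : Γ i w = Γ i' w := by rw [← hins i, ← hins i', h1]
        by_contra hne
        have hd := disjoint_disjointed V (fun h => hne (Subtype.ext h) : (i : ℕ) ≠ i')
        exact disjoint_left.1 hd i.2.2.2 (h2 ▸ i'.2.2.2)
      · rintro ⟨t, ht⟩
        obtain ⟨i, hi⟩ := mem_iUnion.1 (hcov ht)
        have hV := disjointed_subset V i hi
        have h0 := (hG i).eq_zero_of_mem_zeroSheet hV ht
        have h1 := (hG i).removeNth_mem _ hV h0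
        have h2 := (hG i).eq_of_zero _ hV h0
        rw [Fin.removeNth_insertNth] at h1 h2
        refine ⟨⟨i, h1, ?_⟩, Subtype.ext ?_⟩
        · rw [mem_preimage, h2]; exact ⟨ht, hi⟩
        · change Γ i w j = t
          rw [h2]; simp
    rw [← (Equiv.ofBijective f hf).tsum_eq]
    refine Eq.trans (tsum_congr fun i => ?_) ((tsum_subtype {i | w ∈ A i} fun i => g (Γ i w)).trans ?_)
    · exact congrArg g (hins i)
    · exact tsum_congr fun i => by
        by_cases h : w ∈ A i
        · rw [indicator_of_mem (show i ∈ {i | w ∈ A i} from h), indicator_of_mem h]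
        · rw [indicator_of_notMem (show i ∉ {i | w ∈ A i} from h), indicator_of_notMem h]
  refine ⟨Measure.sum fun i => (volume.restrict (A i)).map (Γ i), fun g hg => ?_, fun g hg hi => ?_⟩
  · rw [lintegral_sum_measure]
    simp_rw [lintegral_map hg (hG _).measurable, key]
    have hm : ∀ i, Measurable ((A i).indicator fun w => g (Γ i w)) := fun i =>
      (hg.comp (hG i).measurable).indicator (hAm i)
    rw [lintegral_tsum fun i => (hm i).aemeasurable]
    exact tsum_congr fun i => lintegral_indicator (hAm i) _
  · rw [integral_sum_measure hi]
    simp_rw [integral_map (hG _).measurable.aemeasurable hg.aestronglyMeasurable, key]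
    have hm : ∀ i, Measurable ((A i).indicator fun w => g (Γ i w)) := fun i =>
      (hg.comp (hG i).measurable).indicator (hAm i)
    rw [integral_tsum fun i => (hm i).aestronglyMeasurable]
    · exact tsum_congr fun i => integral_indicator (hAm i)
    · have h2 := hi.2
      rw [HasFiniteIntegral, lintegral_sum_measure] at h2
      simp_rw [lintegral_map hg.enorm (hG _).measurable] at h2
      convert h2.ne using 1
      refine tsum_congr fun i => ?_
      rw [← lintegral_indicator (hAm i)]
      refine lintegral_congr fun w => ?_
      rw [enorm_indicator_eq_indicator_enorm]

/-- The measure on the `j`-th sheet of the zero set whose projection along the `j`-th coordinate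
axis is Lebesgue measure. -/
def sheetMeasure (F : (Fin (n + 1) → ℂ) → ℂ) (j : Fin (n + 1)) : Measure (Fin (n + 1) → ℂ) :=
  (exists_sheetMeasure F j).choose.restrict (zeroSheet F j)

theorem tsum_inter_eq_indicator {R : Type*} [AddCommMonoid R] [TopologicalSpace R]
    (S Z : Set (Fin (n + 1) → ℂ)) (g : (Fin (n + 1) → ℂ) → R) (w : Fin n → ℂ) :
    ∑' t : {t : ℂ // (j.insertNth t w : Fin (n + 1) → ℂ) ∈ S ∩ Z}, g (j.insertNth t.1 w) =
      ∑' t : {t : ℂ // (j.insertNth t w : Fin (n + 1) → ℂ) ∈ Z},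
        (S ∩ Z).indicator g (j.insertNth t.1 w) := by
  refine (tsum_subtype {t : ℂ | (j.insertNth t w : Fin (n + 1) → ℂ) ∈ S ∩ Z}
    fun t => g (j.insertNth t w)).trans (Eq.trans ?_
      (tsum_subtype {t : ℂ | (j.insertNth t w : Fin (n + 1) → ℂ) ∈ Z}
        fun t => (S ∩ Z).indicator g (j.insertNth t w)).symm)
  refine tsum_congr fun t => ?_
  by_cases h : (j.insertNth t w : Fin (n + 1) → ℂ) ∈ S ∩ Z
  · rw [indicator_of_mem (show t ∈ {t : ℂ | (j.insertNth t w : Fin (n + 1) → ℂ) ∈ S ∩ Z} from h),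
      indicator_of_mem (show t ∈ {t : ℂ | (j.insertNth t w : Fin (n + 1) → ℂ) ∈ Z} from h.2),
      indicator_of_mem h]
  · rw [indicator_of_notMem (show t ∉ {t : ℂ | (j.insertNth t w : Fin (n + 1) → ℂ) ∈ S ∩ Z} from h)]
    by_cases h' : (j.insertNth t w : Fin (n + 1) → ℂ) ∈ Z
    · rw [indicator_of_mem (show t ∈ {t : ℂ | (j.insertNth t w : Fin (n + 1) → ℂ) ∈ Z} from h'),
        indicator_of_notMem h]
    · rw [indicator_of_notMem
        (show t ∉ {t : ℂ | (j.insertNth t w : Fin (n + 1) → ℂ) ∈ Z} from h')]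

theorem lintegral_sheet {S : Set (Fin (n + 1) → ℂ)} (hS : MeasurableSet S)
    {g : (Fin (n + 1) → ℂ) → ℝ≥0∞} (hg : Measurable ((S ∩ zeroSheet F j).indicator g)) :
    ∫⁻ w : Fin n → ℂ, ∑' t : {t : ℂ // (j.insertNth t w : Fin (n + 1) → ℂ) ∈ S ∩ zeroSheet F j},
      g (j.insertNth t.1 w) = ∫⁻ z in S, g z ∂sheetMeasure F j := by
  have hm := measurableSet_zeroSheet F j
  simp_rw [tsum_inter_eq_indicator]
  rw [(exists_sheetMeasure F j).choose_spec.1 _ hg, sheetMeasure, Measure.restrict_restrict hS,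
    lintegral_indicator (hS.inter hm)]

theorem integral_sheet {S : Set (Fin (n + 1) → ℂ)} (hS : MeasurableSet S)
    {g : (Fin (n + 1) → ℂ) → ℂ} (hg : Measurable ((S ∩ zeroSheet F j).indicator g))
    (hi : IntegrableOn g S (sheetMeasure F j)) :
    ∫ w : Fin n → ℂ, ∑' t : {t : ℂ // (j.insertNth t w : Fin (n + 1) → ℂ) ∈ S ∩ zeroSheet F j},
      g (j.insertNth t.1 w) = ∫ z in S, g z ∂sheetMeasure F j := by
  have hm := measurableSet_zeroSheet F j
  simp_rw [tsum_inter_eq_indicator]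
  rw [sheetMeasure, IntegrableOn, Measure.restrict_restrict hS] at hi
  rw [(exists_sheetMeasure F j).choose_spec.2 _ hg ((integrable_indicator_iff (hS.inter hm)).2 hi),
    sheetMeasure, Measure.restrict_restrict hS, integral_indicator (hS.inter hm)]

end Sheets

/-! ## Frames and lifts -/

section Frames

variable {m p : ℕ}

theorem complexFrame_comp {m' : ℕ} (L : (Fin m → ℂ) →L[ℂ] (Fin m' → ℂ)) (b : Fin p → Fin m → ℂ) :
    (complexFrame fun i => L (b i)) = fun k => L (complexFrame b k) := by
  funext k
  unfold complexFrame
  split_ifs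
  · rfl
  · rw [map_smul]

/-- The real coordinate dual to the `k`-th vector of the standard real frame of `ℂ^p`. -/
def frameCoord (k : Fin (2 * p)) (v : Fin p → ℂ) : ℝ :=
  if k.val % 2 = 0 then (v ⟨k.val / 2, by omega⟩).re else (v ⟨k.val / 2, by omega⟩).im

theorem frameCoord_complexFrame (k k' : Fin (2 * p)) :
    frameCoord k (complexFrame (fun i => Pi.single i (1 : ℂ)) k') = if k = k' then 1 else 0 := by
  have hk := k.2
  have hk' := k'.2
  unfold frameCoord complexFrame
  by_cases hkk : k = k'
  · subst hkk
    by_cases h : k.val % 2 = 0 <;> simp [h]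
  · have : k.val ≠ k'.val := fun h => hkk (Fin.ext h)
    rw [if_neg hkk]
    split_ifs with h1 h2 h2
    · have : k.val / 2 ≠ k'.val / 2 := by omega
      simp [this]
    · by_cases h3 : k.val / 2 = k'.val / 2
      · simp [h3]
      · simp [h3]
    · by_cases h3 : k.val / 2 = k'.val / 2
      · simp [h3]
      · simp [h3]
    · have : k.val / 2 ≠ k'.val / 2 := by omega
      simp [this]

theorem frameCoord_sum_smul {ι : Type*} (s : Finset ι) (c : ι → ℝ) (v : ι → Fin p → ℂ)
    (k : Fin (2 * p)) : frameCoord k (∑ i ∈ s, c i • v i) = ∑ i ∈ s, c i * frameCoord k (v i) := by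
  unfold frameCoord
  split_ifs <;> simp [Finset.sum_apply]

theorem linearIndependent_complexFrame :
    LinearIndependent ℝ (complexFrame fun i : Fin p => (Pi.single i (1 : ℂ) : Fin p → ℂ)) := by
  rw [Fintype.linearIndependent_iff]
  intro c hc k
  have h := congrArg (frameCoord k) hc
  rw [frameCoord_sum_smul] at h
  simp only [frameCoord_complexFrame] at h
  simpa [frameCoord] using h

/-- The standard real basis of `ℂ^p`. -/
def frameBasis (p : ℕ) : Module.Basis (Fin (2 * p)) ℝ (Fin p → ℂ) :=
  basisOfLinearIndependentOfCardEqFinrank' _ linearIndependent_complexFrame (by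
    simp [Module.finrank_pi_fintype, mul_comm])

theorem coe_frameBasis : (frameBasis p : Fin (2 * p) → Fin p → ℂ) =
    complexFrame fun i : Fin p => (Pi.single i (1 : ℂ) : Fin p → ℂ) := by
  simp [frameBasis]

/-- Real alternating forms of top degree are multiples of the determinant; this is applied to the
real and the imaginary part of `η`. -/
theorem map_linearMap_complexFrame (η : (Fin p → ℂ) [⋀^Fin (2 * p)]→L[ℝ] ℂ)
    (L : (Fin p → ℂ) →L[ℝ] (Fin p → ℂ)) :
    η (fun k => L (complexFrame (fun i : Fin p => (Pi.single i (1 : ℂ) : Fin p → ℂ)) k)) =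
      (L.det : ℂ) * η (complexFrame fun i : Fin p => (Pi.single i (1 : ℂ) : Fin p → ℂ)) := by
  have key : ∀ g : (Fin p → ℂ) [⋀^Fin (2 * p)]→ₗ[ℝ] ℝ,
      g (fun k => L (frameBasis p k)) = L.det * g (frameBasis p) := by
    intro g
    have h1 : (frameBasis p).det (fun k => L (frameBasis p k)) = L.det := by
      have := (frameBasis p).det_comp (L : (Fin p → ℂ) →ₗ[ℝ] (Fin p → ℂ)) (frameBasis p)
      rw [(frameBasis p).det_self, mul_one] at this
      exact this
    rw [g.eq_smul_basis_det (frameBasis p), AlternatingMap.smul_apply, AlternatingMap.smul_apply, h1,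
      (frameBasis p).det_self]
    simp [mul_comm]
  rw [← coe_frameBasis]
  apply Complex.ext
  · have := key ((Complex.reLm).compAlternatingMap η.toAlternatingMap)
    simpa using this
  · have := key ((Complex.imLm).compAlternatingMap η.toAlternatingMap)
    simpa using this

/-- The real determinant of a complex linear map is nonnegative. -/
theorem det_restrictScalars_nonneg (L : (Fin p → ℂ) →L[ℂ] (Fin p → ℂ)) :
    0 ≤ (L.restrictScalars ℝ).det := by
  have := LinearMap.det_restrictScalars (S := ℂ) (R := ℝ) (f := (L : (Fin p → ℂ) →ₗ[ℂ] (Fin p → ℂ)))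
  change 0 ≤ LinearMap.det ((L : (Fin p → ℂ) →ₗ[ℂ] (Fin p → ℂ)).restrictScalars ℝ)
  rw [this, Algebra.norm_complex_apply]
  exact Complex.normSq_nonneg _

variable {n : ℕ} {j : Fin (n + 1)} {l : (Fin (n + 1) → ℂ) →L[ℂ] ℂ}

variable (j) in
/-- Forgetting the `j`-th coordinate. -/
def removeNthL : (Fin (n + 1) → ℂ) →L[ℂ] (Fin n → ℂ) :=
  ContinuousLinearMap.pi fun i =>
    ContinuousLinearMap.proj (R := ℂ) (φ := fun _ : Fin (n + 1) => ℂ) (j.succAbove i)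

@[simp] theorem removeNthL_apply (v : Fin (n + 1) → ℂ) : removeNthL j v = j.removeNth v := rfl

variable (j) in
/-- Inserting a zero at the `j`-th coordinate. -/
def insertZeroL : (Fin n → ℂ) →L[ℂ] (Fin (n + 1) → ℂ) :=
  ContinuousLinearMap.pi (j.insertNth (α := fun _ => (Fin n → ℂ) →L[ℂ] ℂ) 0
    fun i => ContinuousLinearMap.proj (R := ℂ) (φ := fun _ : Fin n => ℂ) i)

theorem insertZeroL_apply (v : Fin n → ℂ) : insertZeroL j v = j.insertNth (0 : ℂ) v := by
  ext i
  refine Fin.succAboveCases j ?_ (fun i => ?_) i <;> simp [insertZeroL]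

variable (l j) in
/-- The inverse of the projection of `ker l` along the `j`-th axis. -/
def kerLift : (Fin n → ℂ) →L[ℂ] (Fin (n + 1) → ℂ) :=
  insertZeroL j - (((l (Pi.single j 1))⁻¹ : ℂ) • l.comp (insertZeroL j)).smulRight (Pi.single j 1)

theorem kerLift_apply (v : Fin n → ℂ) : kerLift j l v =
    insertZeroL j v - ((l (Pi.single j 1))⁻¹ * l (insertZeroL j v)) • Pi.single j 1 := rfl

theorem apply_kerLift (hj : l (Pi.single j 1) ≠ 0) (v : Fin n → ℂ) : l (kerLift j l v) = 0 := by
  rw [kerLift_apply, map_sub, map_smul, smul_eq_mul]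
  field_simp
  ring

theorem removeNth_kerLift (v : Fin n → ℂ) : j.removeNth (kerLift j l v) = v := by
  ext i
  simp [kerLift_apply, insertZeroL_apply, Fin.removeNth]

theorem eq_kerLift (hj : l (Pi.single j 1) ≠ 0) {x : Fin (n + 1) → ℂ} (hx : l x = 0) :
    x = kerLift j l (j.removeNth x) := by
  set y := x - kerLift j l (j.removeNth x) with hy
  have h1 : j.removeNth y = 0 := by
    change removeNthL j y = 0
    rw [hy, map_sub, removeNthL_apply, removeNthL_apply, removeNth_kerLift, sub_self]
  have h2 : y = y j • Pi.single j 1 := by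
    refine ext_insertNth (j := j) (by simp) ?_
    rw [h1]
    ext i
    simp [Fin.removeNth]
  have h3 : l y = 0 := by rw [hy, map_sub, hx, apply_kerLift hj, sub_zero]
  have h4 : y j = 0 := by
    rw [h2, map_smul, smul_eq_mul] at h3
    exact (mul_eq_zero.1 h3).resolve_right hj
  rw [h4, zero_smul] at h2
  exact sub_eq_zero.1 h2

variable {F : (Fin (n + 1) → ℂ) → ℂ} {z : Fin (n + 1) → ℂ} {k : ℕ}

theorem zeroTangent_eq_kerLift (h : IsRegularZero F z k l) (hj : l (Pi.single j 1) ≠ 0) :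
    zeroTangent F j z = fun i => kerLift j l (Pi.single i 1) := by
  have hs : ∀ i : Fin n, insertZeroL j (Pi.single i 1) = Pi.single (j.succAbove i) 1 := fun i => by
    rw [insertZeroL_apply]
    ext i'
    refine Fin.succAboveCases j ?_ (fun i' => ?_) i'
    · simp
    · simp [Pi.single_apply]
  funext i
  rw [zeroTangent_eq h hj, kerLift_apply, hs, div_eq_inv_mul]

/-- This frees the coefficient from the choices in its definition: any local defining function may
be used, so that regularity and transformation rules become visible. -/
theorem zeroCoeff_eq (h : IsRegularZero F z k l) (hj : l (Pi.single j 1) ≠ 0)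
    (η : (Fin (n + 1) → ℂ) → (Fin (n + 1) → ℂ) [⋀^Fin (2 * n)]→L[ℝ] ℂ) :
    zeroCoeff F η j z = k * η z (fun i => kerLift j l
      (complexFrame (fun i : Fin n => (Pi.single i (1 : ℂ) : Fin n → ℂ)) i)) := by
  rw [zeroCoeff, zeroMultiplicity_eq h, zeroTangent_eq_kerLift h hj, complexFrame_comp]

end Frames

/-! ## The integral over the zero set as an integral against the sheet measures -/

section Coeff

variable {n : ℕ} {F : (Fin (n + 1) → ℂ) → ℂ} {j : Fin (n + 1)} {U S : Set (Fin (n + 1) → ℂ)}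
  {η : (Fin (n + 1) → ℂ) → (Fin (n + 1) → ℂ) [⋀^Fin (2 * n)]→L[ℝ] ℂ}

theorem continuousWithinAt_alternating_apply {X E : Type*} [TopologicalSpace X]
    [NormedAddCommGroup E] [NormedSpace ℝ E] {ι : Type*} [Fintype ι] {f : X → E [⋀^ι]→L[ℝ] ℂ}
    {v : X → ι → E} {s : Set X} {x : X} (hf : ContinuousWithinAt f s x)
    (hv : ContinuousWithinAt v s x) : ContinuousWithinAt (fun x => f x (v x)) s x := by
  have h1 : ContinuousWithinAt (fun x => (f x).toContinuousMultilinearMap) s x :=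
    ContinuousAlternatingMap.continuous_toContinuousMultilinearMap.continuousAt.comp_continuousWithinAt hf
  exact h1.eval hv

/-- On a local graph the conormal is the differential of the defining function and the multiplicity
is constant, so all ingredients vary continuously. This is the source of the measurability of the
coefficients. -/
theorem continuousOn_zeroCoeff (hη : ContinuousOn η U) :
    ContinuousOn (zeroCoeff F η j) (U ∩ zeroSheet F j) := by
  intro z hz
  obtain ⟨V, W, Γ, a, k, hzV, -, h⟩ := exists_isZeroGraph hz.2 univ_mem
  have hV : V ∈ 𝓝 z := h.isOpen_target.mem_nhds hzV
  have heq : zeroCoeff F η j =ᶠ[𝓝[U ∩ zeroSheet F j] z] fun y => (k : ℂ) * η y (fun i =>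
      kerLift j (fderiv ℂ a y)
        (complexFrame (fun i : Fin n => (Pi.single i (1 : ℂ) : Fin n → ℂ)) i)) := by
    filter_upwards [mem_nhdsWithin_of_mem_nhds hV, self_mem_nhdsWithin] with y hy hyU
    have h0 := h.eq_zero_of_mem_zeroSheet hy hyU.2
    exact zeroCoeff_eq (h.isRegularZero y hy h0) (h.fderiv_ne y hy) η
  have hz0 := h.eq_zero_of_mem_zeroSheet hzV hz.2
  refine ContinuousWithinAt.congr_of_eventuallyEq ?_ heq
    (zeroCoeff_eq (h.isRegularZero z hzV hz0) (h.fderiv_ne z hzV) η)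
  refine continuousWithinAt_const.mul (continuousWithinAt_alternating_apply
    ((hη z hz.1).mono inter_subset_left) (ContinuousAt.continuousWithinAt ?_))
  rw [continuousAt_pi]
  intro i
  simp only [kerLift_apply]
  have hc : ∀ v, ContinuousAt (fun y => fderiv ℂ a y v) z := fun v =>
    (analyticAt_fderiv_apply (h.analytic_def z hzV) v).continuousAt
  exact continuousAt_const.sub ((((hc _).inv₀ (h.fderiv_ne z hzV)).mul (hc _)).smul
    continuousAt_const)

theorem measurable_indicator_zeroCoeff (hη : ContinuousOn η U) (hS : MeasurableSet S)
    (hSU : S ⊆ U) : Measurable ((S ∩ zeroSheet F j).indicator (zeroCoeff F η j)) := by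
  classical
  rw [← piecewise_eq_indicator]
  exact ((continuousOn_zeroCoeff hη).mono (inter_subset_inter_left _ hSU)).measurable_piecewise
    (g := fun _ => 0) continuousOn_const (hS.inter (measurableSet_zeroSheet F j))

theorem zeroMassOn_eq_lintegral (hη : ContinuousOn η U) (hS : MeasurableSet S) (hSU : S ⊆ U) :
    zeroMassOn F η S = ∑ j, ∫⁻ z in S, ‖zeroCoeff F η j z‖ₑ ∂sheetMeasure F j := by
  refine Finset.sum_congr rfl fun j _ => lintegral_sheet (g := fun z => ‖zeroCoeff F η j z‖ₑ) hS ?_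
  have := (measurable_indicator_zeroCoeff (F := F) (j := j) hη hS hSU).enorm
  convert this using 1
  ext z
  exact (enorm_indicator_eq_indicator_enorm _ _).symm

theorem aestronglyMeasurable_zeroCoeff (hη : ContinuousOn η U) (hS : MeasurableSet S)
    (hSU : S ⊆ U) :
    AEStronglyMeasurable (zeroCoeff F η j) ((sheetMeasure F j).restrict S) := by
  rw [sheetMeasure, Measure.restrict_restrict hS,
    ← aestronglyMeasurable_indicator_iff (hS.inter (measurableSet_zeroSheet F j))]
  exact (measurable_indicator_zeroCoeff hη hS hSU).aestronglyMeasurable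

theorem integrableOn_zeroCoeff (hη : ContinuousOn η U) (hS : MeasurableSet S) (hSU : S ⊆ U)
    (hfin : zeroMassOn F η S < ⊤) : IntegrableOn (zeroCoeff F η j) S (sheetMeasure F j) := by
  refine ⟨aestronglyMeasurable_zeroCoeff hη hS hSU, ?_⟩
  rw [zeroMassOn_eq_lintegral hη hS hSU] at hfin
  exact (Finset.single_le_sum (f := fun j => ∫⁻ z in S, ‖zeroCoeff F η j z‖ₑ ∂sheetMeasure F j)
    (fun _ _ => zero_le) (Finset.mem_univ j)).trans_lt hfin

theorem zeroIntegralOn_eq_integral (hη : ContinuousOn η U) (hS : MeasurableSet S) (hSU : S ⊆ U)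
    (hfin : zeroMassOn F η S < ⊤) :
    zeroIntegralOn F η S = ∑ j, ∫ z in S, zeroCoeff F η j z ∂sheetMeasure F j :=
  Finset.sum_congr rfl fun _ _ => integral_sheet hS (measurable_indicator_zeroCoeff hη hS hSU)
    (integrableOn_zeroCoeff hη hS hSU hfin)

theorem zeroMassOn_mono (hη : ContinuousOn η U) (hS : MeasurableSet S) (hSU : S ⊆ U)
    {T : Set (Fin (n + 1) → ℂ)} (hT : MeasurableSet T) (hTS : T ⊆ S) :
    zeroMassOn F η T ≤ zeroMassOn F η S := by
  rw [zeroMassOn_eq_lintegral hη hS hSU, zeroMassOn_eq_lintegral hη hT (hTS.trans hSU)]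
  exact Finset.sum_le_sum fun j _ => lintegral_mono_set hTS

theorem zeroMassOn_iUnion {ι : Type*} [Countable ι] {S : ι → Set (Fin (n + 1) → ℂ)}
    (hη : ContinuousOn η U) (hS : ∀ i, MeasurableSet (S i)) (hd : Pairwise fun i i' => Disjoint (S i) (S i'))
    (hSU : ∀ i, S i ⊆ U) : zeroMassOn F η (⋃ i, S i) = ∑' i, zeroMassOn F η (S i) := by
  rw [zeroMassOn_eq_lintegral hη (MeasurableSet.iUnion hS) (iUnion_subset hSU)]
  simp_rw [fun i => zeroMassOn_eq_lintegral (F := F) hη (hS i) (hSU i), lintegral_iUnion hS hd]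
  exact (Summable.tsum_finsetSum fun _ _ => ENNReal.summable).symm

theorem hasSum_zeroIntegralOn {ι : Type*} [Countable ι] {S : ι → Set (Fin (n + 1) → ℂ)}
    (hη : ContinuousOn η U) (hS : ∀ i, MeasurableSet (S i)) (hd : Pairwise fun i i' => Disjoint (S i) (S i'))
    (hSU : ∀ i, S i ⊆ U) (hfin : zeroMassOn F η (⋃ i, S i) < ⊤) :
    HasSum (fun i => zeroIntegralOn F η (S i)) (zeroIntegralOn F η (⋃ i, S i)) := by
  have hm := MeasurableSet.iUnion hS
  have hU := iUnion_subset hSU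
  rw [zeroIntegralOn_eq_integral hη hm hU hfin]
  simp_rw [fun i => zeroIntegralOn_eq_integral (F := F) hη (hS i) (hSU i)
    ((zeroMassOn_mono hη hm hU (hS i) (subset_iUnion S i)).trans_lt hfin)]
  exact hasSum_sum fun j _ => hasSum_integral_iUnion hS hd (integrableOn_zeroCoeff hη hm hU hfin)

end Coeff

/-! ## Invariance under biholomorphic maps -/

section Graphs

variable {n : ℕ} {F : (Fin (n + 1) → ℂ) → ℂ} {j : Fin (n + 1)} {V : Set (Fin (n + 1) → ℂ)}
    {W : Set (Fin n → ℂ)} {Γ : (Fin n → ℂ) → Fin (n + 1) → ℂ} {a : (Fin (n + 1) → ℂ) → ℂ}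
    {k : ℕ}

/-- The fibre of the sheet over `w` inside `V` is a single point or empty, so the defining sum is an
indicator function. -/
theorem IsZeroGraph.restrict_sheetMeasure (h : IsZeroGraph F j V W Γ a k) :
    (sheetMeasure F j).restrict V = (volume.restrict (W ∩ Γ ⁻¹' zeroSheet F j)).map Γ := by
  ext T hT
  have hZ := measurableSet_zeroSheet F j
  have hV := h.isOpen_target.measurableSet
  rw [Measure.restrict_apply hT, Measure.map_apply h.measurable hT,
    Measure.restrict_apply (h.measurable hT), ← setLIntegral_one,
    ← lintegral_sheet (hT.inter hV) (g := fun _ => 1)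
      (measurable_one.indicator ((hT.inter hV).inter hZ)),
    ← setLIntegral_one, ← lintegral_indicator ((h.measurable hT).inter
      (h.isOpen_source.measurableSet.inter (h.measurable hZ)))]
  refine lintegral_congr fun w => ?_
  by_cases hw : w ∈ Γ ⁻¹' T ∩ (W ∩ Γ ⁻¹' zeroSheet F j)
  · rw [indicator_of_mem hw]
    have hins : (j.insertNth (Γ w j) w : Fin (n + 1) → ℂ) = Γ w :=
      ext_insertNth (j := j) (by simp) (by rw [h.removeNth_eq w hw.2.1]; simp)
    have hu : Unique {t : ℂ // (j.insertNth t w : Fin (n + 1) → ℂ) ∈ T ∩ V ∩ zeroSheet F j} :=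
      { default := ⟨Γ w j, by rw [hins]; exact ⟨⟨hw.1, h.map_mem w hw.2.1⟩, hw.2.2⟩⟩
        uniq := fun ⟨t, ht⟩ => Subtype.ext (by
          have h0 := h.eq_zero_of_mem_zeroSheet ht.1.2 ht.2
          have h1 := h.eq_of_zero _ ht.1.2 h0
          rw [Fin.removeNth_insertNth] at h1
          change t = Γ w j
          rw [h1]; simp) }
    rw [tsum_fintype]
    simp
  · rw [indicator_of_notMem hw]
    have hem : IsEmpty {t : ℂ // (j.insertNth t w : Fin (n + 1) → ℂ) ∈ T ∩ V ∩ zeroSheet F j} :=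
      ⟨fun ⟨t, ht⟩ => hw (by
        have h0 := h.eq_zero_of_mem_zeroSheet ht.1.2 ht.2
        have h1 := h.eq_of_zero _ ht.1.2 h0
        have h2 := h.removeNth_mem _ ht.1.2 h0
        rw [Fin.removeNth_insertNth] at h1 h2
        refine ⟨?_, h2, ?_⟩
        · rw [mem_preimage, h1]; exact ht.1.1
        · rw [mem_preimage, h1]; exact ht.2)⟩
    simp

theorem IsZeroGraph.restrict_sheetMeasure_subset (h : IsZeroGraph F j V W Γ a k)
    {S : Set (Fin (n + 1) → ℂ)} (hS : MeasurableSet S) (hSV : S ⊆ V) (hSZ : S ⊆ zeroSheet F j) :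
    (sheetMeasure F j).restrict S = (volume.restrict (W ∩ Γ ⁻¹' S)).map Γ := by
  have h1 : (sheetMeasure F j).restrict S = ((sheetMeasure F j).restrict V).restrict S := by
    rw [Measure.restrict_restrict hS, inter_eq_left.2 hSV]
  rw [h1, h.restrict_sheetMeasure, Measure.restrict_map h.measurable hS,
    Measure.restrict_restrict (h.measurable hS)]
  congr 2
  ext w
  simp only [mem_inter_iff, mem_preimage]
  exact ⟨fun hw => ⟨hw.2.1, hw.1⟩, fun hw => ⟨hw.2, hw.1, hSZ hw.2⟩⟩

/-- The derivative takes values in the kernel of `da`, as `a ∘ Γ = 0`, and it is a right inverse of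
the projection; these two properties characterize `kerLift`. -/
theorem IsZeroGraph.fderiv_eq (h : IsZeroGraph F j V W Γ a k) {w : Fin n → ℂ} (hw : w ∈ W) :
    fderiv ℂ Γ w = kerLift j (fderiv ℂ a (Γ w)) := by
  have hΓ := (h.analytic w hw).differentiableAt.hasFDerivAt
  have ha := (h.analytic_def _ (h.map_mem w hw)).differentiableAt.hasFDerivAt
  have hWn := h.isOpen_source.mem_nhds hw
  have h1 : (fderiv ℂ a (Γ w)).comp (fderiv ℂ Γ w) = 0 := by
    have h2 : HasFDerivAt (fun w => a (Γ w)) (0 : (Fin n → ℂ) →L[ℂ] ℂ) w :=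
      (hasFDerivAt_const (0 : ℂ) w).congr_of_eventuallyEq
        (Filter.eventually_of_mem hWn fun y hy => h.apply_eq y hy)
    exact (ha.comp w hΓ).unique h2
  have h3 : (removeNthL j).comp (fderiv ℂ Γ w) = ContinuousLinearMap.id ℂ _ := by
    have h2 : HasFDerivAt (fun w => removeNthL j (Γ w)) (ContinuousLinearMap.id ℂ _) w :=
      (hasFDerivAt_id w).congr_of_eventuallyEq
        (Filter.eventually_of_mem hWn fun y hy => h.removeNth_eq y hy)
    exact ((removeNthL j).hasFDerivAt.comp w hΓ).unique h2
  ext1 v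
  have h4 := eq_kerLift (x := fderiv ℂ Γ w v) (h.fderiv_ne _ (h.map_mem w hw)) (congrArg (· v) h1 :)
  have h5 : j.removeNth (fderiv ℂ Γ w v) = v := (congrArg (· v) h3 :)
  rw [h5] at h4
  exact h4

end Graphs

/-! ### Change of variables between two local graphs. -/

section Invariance

variable {n : ℕ}

theorem IsRegularZero.comp {F F' : (Fin (n + 1) → ℂ) → ℂ} {G : (Fin (n + 1) → ℂ) → Fin (n + 1) → ℂ}
    {z : Fin (n + 1) → ℂ} {k : ℕ} {l : (Fin (n + 1) → ℂ) →L[ℂ] ℂ} (h : IsRegularZero F' (G z) k l)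
    (hG : AnalyticAt ℂ G z) (hs : Function.Surjective (fderiv ℂ G z))
    (hF : F =ᶠ[𝓝 z] fun z => F' (G z)) : IsRegularZero F z k (l.comp (fderiv ℂ G z)) := by
  obtain ⟨hk, hl, a, u, ha, hu, ha0, rfl, hu0, hF'⟩ := h
  refine ⟨hk, fun h0 => hl ?_, fun z => a (G z), fun z => u (G z), ha.fun_comp hG, hu.fun_comp hG,
    ha0, ?_, hu0, ?_⟩
  · ext1 v
    obtain ⟨y, rfl⟩ := hs v
    exact (congrArg (· y) h0 :)
  · exact fderiv_comp z ha.differentiableAt hG.differentiableAt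
  · filter_upwards [hF, hG.continuousAt.eventually hF'] with y h1 h2
    rw [h1, h2]

/-- A biholomorphic map carrying the function `F'` to `F` and the form `η'` to `η`. -/
structure IsPullback (G : OpenPartialHomeomorph (Fin (n + 1) → ℂ) (Fin (n + 1) → ℂ))
    (F F' : (Fin (n + 1) → ℂ) → ℂ)
    (η η' : (Fin (n + 1) → ℂ) → (Fin (n + 1) → ℂ) [⋀^Fin (2 * n)]→L[ℝ] ℂ) : Prop where
  analytic : AnalyticOnNhd ℂ G G.source
  analytic_symm : AnalyticOnNhd ℂ G.symm G.target
  continuousOn : ContinuousOn η G.source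
  continuousOn' : ContinuousOn η' G.target
  fun_eq : ∀ z ∈ G.source, F z = F' (G z)
  form_eq : ∀ z ∈ G.source, η z = (η' (G z)).compContinuousLinearMap (fderiv ℝ G z)

variable {G : OpenPartialHomeomorph (Fin (n + 1) → ℂ) (Fin (n + 1) → ℂ)}
    {F F' : (Fin (n + 1) → ℂ) → ℂ}
    {η η' : (Fin (n + 1) → ℂ) → (Fin (n + 1) → ℂ) [⋀^Fin (2 * n)]→L[ℝ] ℂ}

theorem fderiv_symm_comp_fderiv {E : Type*} [NormedAddCommGroup E] [NormedSpace ℂ E]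
    {G : OpenPartialHomeomorph E E} {z : E} (hz : z ∈ G.source) (hG : DifferentiableAt ℂ G z)
    (hGs : DifferentiableAt ℂ G.symm (G z)) (v : E) :
    fderiv ℂ G.symm (G z) (fderiv ℂ G z v) = v := by
  have h1 : HasFDerivAt (fun y => G.symm (G y)) (ContinuousLinearMap.id ℂ E) z :=
    (hasFDerivAt_id z).congr_of_eventuallyEq
      (Filter.eventually_of_mem (G.open_source.mem_nhds hz) fun y hy => G.left_inv hy)
  exact (congrArg (· v) ((hGs.hasFDerivAt.comp z hG.hasFDerivAt).unique h1) :)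

theorem IsPullback.surjective_fderiv (h : IsPullback G F F' η η') {z : Fin (n + 1) → ℂ}
    (hz : z ∈ G.source) : Function.Surjective (fderiv ℂ G z) := by
  have h1 : ∀ v, fderiv ℂ G.symm (G z) (fderiv ℂ G z v) = v := fderiv_symm_comp_fderiv hz
    (h.analytic z hz).differentiableAt (h.analytic_symm _ (G.map_source hz)).differentiableAt
  have h2 : Function.Injective (fderiv ℂ G z) := Function.LeftInverse.injective h1
  exact (LinearMap.injective_iff_surjective
    (f := ((fderiv ℂ G z).toLinearMap : (Fin (n + 1) → ℂ) →ₗ[ℂ] (Fin (n + 1) → ℂ)))).1 h2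

theorem IsPullback.isRegularZero (h : IsPullback G F F' η η') {z : Fin (n + 1) → ℂ}
    (hz : z ∈ G.source) {k : ℕ} {l : (Fin (n + 1) → ℂ) →L[ℂ] ℂ} (hr : IsRegularZero F' (G z) k l) :
    IsRegularZero F z k (l.comp (fderiv ℂ G z)) :=
  hr.comp (h.analytic z hz) (h.surjective_fderiv hz)
    (Filter.eventually_of_mem (G.open_source.mem_nhds hz) h.fun_eq)

theorem IsPullback.measurableSet_image (h : IsPullback G F F' η η') {S : Set (Fin (n + 1) → ℂ)}
    (hS : MeasurableSet S) (hSs : S ⊆ G.source) : MeasurableSet (G '' S) :=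
  hS.image_of_continuousOn_injOn (h.analytic.continuousOn.mono hSs) (G.injOn.mono hSs)

/-- In the coordinates of the two graphs `G` becomes the holomorphic map `f`, parametrize by `Γ`,
apply `G`, then project along the axis `j'`. The coefficients differ by the real determinant of its
derivative, which is nonnegative because the map is complex linear. The usual change of variables
formula therefore holds without a sign. -/
theorem IsPullback.local_invariance (h : IsPullback G F F' η η') {j j' : Fin (n + 1)}
    {V V' W W' Γ Γ' a a' k k'} (hΓ : IsZeroGraph F j V W Γ a k)
    (hΓ' : IsZeroGraph F' j' V' W' Γ' a' k') {S : Set (Fin (n + 1) → ℂ)} (hS : MeasurableSet S)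
    (hSs : S ⊆ G.source) (hSV : S ⊆ V) (hSV' : ∀ z ∈ S, G z ∈ V')
    (hSZ : S ⊆ zeroSheet F j) (hSZ' : ∀ z ∈ S, G z ∈ zeroSheet F' j') :
    (∫⁻ z in S, ‖zeroCoeff F η j z‖ₑ ∂sheetMeasure F j =
      ∫⁻ z in G '' S, ‖zeroCoeff F' η' j' z‖ₑ ∂sheetMeasure F' j') ∧
    ∫ z in S, zeroCoeff F η j z ∂sheetMeasure F j =
      ∫ z in G '' S, zeroCoeff F' η' j' z ∂sheetMeasure F' j' := by
  have hS' := h.measurableSet_image hS hSs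
  have hST : G '' S ⊆ G.target := by rintro _ ⟨z, hz, rfl⟩; exact G.map_source (hSs hz)
  set A := W ∩ Γ ⁻¹' S with hA
  have hAm : MeasurableSet A := hΓ.isOpen_source.measurableSet.inter (hΓ.measurable hS)
  set f : (Fin n → ℂ) → Fin n → ℂ := fun w => removeNthL j' (G (Γ w)) with hf
  set f' : (Fin n → ℂ) → (Fin n → ℂ) →L[ℂ] Fin n → ℂ := fun w =>
    (removeNthL j').comp ((fderiv ℂ G (Γ w)).comp (fderiv ℂ Γ w)) with hf'
  have hfd : ∀ w ∈ A, HasFDerivAt f (f' w) w := fun w hw =>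
    (removeNthL j').hasFDerivAt.comp w
      ((h.analytic _ (hSs hw.2)).differentiableAt.hasFDerivAt.comp w
        (hΓ.analytic w hw.1).differentiableAt.hasFDerivAt)
  have hfdR : ∀ w ∈ A, HasFDerivWithinAt f ((f' w).restrictScalars ℝ) A w := fun w hw =>
    ((hfd w hw).restrictScalars ℝ).hasFDerivWithinAt
  have hG0 : ∀ w ∈ A, a' (G (Γ w)) = 0 := fun w hw =>
    hΓ'.eq_zero_of_mem_zeroSheet (hSV' _ hw.2) (hSZ' _ hw.2)
  have hΓ'f : ∀ w ∈ A, Γ' (f w) = G (Γ w) := fun w hw =>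
    hΓ'.eq_of_zero _ (hSV' _ hw.2) (hG0 w hw)
  have hinj : InjOn f A := by
    intro w hw y hy hwy
    have h1 : G (Γ w) = G (Γ y) := by rw [← hΓ'f w hw, ← hΓ'f y hy, hwy]
    have h2 := G.injOn (hSs hw.2) (hSs hy.2) h1
    rw [← hΓ.removeNth_eq w hw.1, ← hΓ.removeNth_eq y hy.1, h2]
  have himg : f '' A = W' ∩ Γ' ⁻¹' (G '' S) := by
    ext y
    constructor
    · rintro ⟨w, hw, rfl⟩
      refine ⟨hΓ'.removeNth_mem _ (hSV' _ hw.2) (hG0 w hw), ?_⟩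
      rw [mem_preimage, hΓ'f w hw]
      exact mem_image_of_mem _ hw.2
    · rintro ⟨hy, z, hz, hzy⟩
      have h0 := hΓ.eq_zero_of_mem_zeroSheet (hSV hz) (hSZ hz)
      have h1 := hΓ.eq_of_zero z (hSV hz) h0
      refine ⟨j.removeNth z, ⟨hΓ.removeNth_mem z (hSV hz) h0, ?_⟩, ?_⟩
      · rw [mem_preimage, h1]; exact hz
      · rw [hf]
        simp only [h1, hzy, removeNthL_apply]
        exact hΓ'.removeNth_eq y hy
  have hμ := hΓ.restrict_sheetMeasure_subset hS hSV hSZ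
  have hμ' := hΓ'.restrict_sheetMeasure_subset hS' (by rintro _ ⟨z, hz, rfl⟩; exact hSV' z hz)
    (by rintro _ ⟨z, hz, rfl⟩; exact hSZ' z hz)
  rw [← himg] at hμ'
  have hcoef : ∀ w ∈ A, zeroCoeff F η j (Γ w) =
      |((f' w).restrictScalars ℝ).det| • zeroCoeff F' η' j' (Γ' (f w)) := by
    intro w hw
    set z := Γ w with hz
    have hzs : z ∈ G.source := hSs hw.2
    have hr' := hΓ'.isRegularZero _ (hSV' z hw.2) (hG0 w hw)
    have hl' := hΓ'.fderiv_ne _ (hSV' z hw.2)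
    have hr := hΓ.isRegularZero z (hSV hw.2) (hΓ.apply_eq w hw.1)
    have hl := hΓ.fderiv_ne z (hSV hw.2)
    have hr2 := h.isRegularZero hzs hr'
    rw [hΓ'f w hw, zeroCoeff_eq hr hl, zeroCoeff_eq hr' hl', hr.multiplicity_unique hr2,
      h.form_eq z hzs, abs_of_nonneg (det_restrictScalars_nonneg _), Complex.real_smul]
    have hd : fderiv ℝ G z = (fderiv ℂ G z).restrictScalars ℝ :=
      (h.analytic z hzs).differentiableAt.fderiv_restrictScalars ℝ
    -- The differential of `G` maps one tangent space to the other, by uniqueness of the kernel at a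
    -- regular zero, and a tangent vector is determined by its projection.
    have hlift : ∀ v, fderiv ℂ G z (kerLift j (fderiv ℂ a z) v) =
        kerLift j' (fderiv ℂ a' (G z)) (f' w v) := by
      intro v
      have hf'w : f' w = (removeNthL j').comp ((fderiv ℂ G z).comp (kerLift j (fderiv ℂ a z))) := by
        rw [← hΓ.fderiv_eq hw.1]
      rw [hf'w]
      refine eq_kerLift hl' ?_
      exact (hr.ker_unique hr2 _).1 (apply_kerLift hl v)
    set P : (Fin n → ℂ) [⋀^Fin (2 * n)]→L[ℝ] ℂ := (η' (G z)).compContinuousLinearMap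
      ((kerLift j' (fderiv ℂ a' (G z))).restrictScalars ℝ) with hP
    have h3 := map_linearMap_complexFrame P ((f' w).restrictScalars ℝ)
    have h4 : ((η' (G z)).compContinuousLinearMap (fderiv ℝ G z)) (fun i => kerLift j (fderiv ℂ a z)
        (complexFrame (fun i : Fin n => (Pi.single i (1 : ℂ) : Fin n → ℂ)) i)) =
        P (fun i => (f' w).restrictScalars ℝ
          (complexFrame (fun i : Fin n => (Pi.single i (1 : ℂ) : Fin n → ℂ)) i)) := by
      rw [hd]
      exact congrArg (η' (G z)) (funext fun i => hlift _)
    rw [h4, h3]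
    change _ = _ * (_ * P _)
    ring
  have hA0 : ∀ᵐ w ∂volume.restrict A, w ∈ A := ae_restrict_mem hAm
  constructor
  · have hm : AEMeasurable (fun z => ‖zeroCoeff F η j z‖ₑ) ((sheetMeasure F j).restrict S) :=
      (aestronglyMeasurable_zeroCoeff h.continuousOn hS hSs).enorm
    have hm' : AEMeasurable (fun z => ‖zeroCoeff F' η' j' z‖ₑ)
        ((sheetMeasure F' j').restrict (G '' S)) :=
      (aestronglyMeasurable_zeroCoeff h.continuousOn' hS' hST).enorm
    rw [hμ] at hm ⊢
    rw [hμ'] at hm' ⊢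
    rw [lintegral_map' hm hΓ.measurable.aemeasurable, lintegral_map' hm' hΓ'.measurable.aemeasurable,
      lintegral_image_eq_lintegral_abs_det_fderiv_mul volume hAm hfdR hinj]
    refine lintegral_congr_ae (hA0.mono fun w hw => ?_)
    simp only
    rw [hcoef w hw, enorm_smul, Real.enorm_eq_ofReal (abs_nonneg _)]
  · have hm := aestronglyMeasurable_zeroCoeff (F := F) (j := j) h.continuousOn hS hSs
    have hm' := aestronglyMeasurable_zeroCoeff (F := F') (j := j') h.continuousOn' hS' hST
    rw [hμ] at hm ⊢
    rw [hμ'] at hm' ⊢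
    rw [integral_map hΓ.measurable.aemeasurable hm, integral_map hΓ'.measurable.aemeasurable hm',
      integral_image_eq_integral_abs_det_fderiv_smul volume hAm hfdR hinj]
    exact integral_congr_ae (hA0.mono fun w hw => hcoef w hw)

end Invariance

/-! ### From local graphs to arbitrary measurable sets. -/

section GlobalInvariance

variable {n : ℕ}

section

variable {F : (Fin (n + 1) → ℂ) → ℂ} {j : Fin (n + 1)} {U S T : Set (Fin (n + 1) → ℂ)}
  {η : (Fin (n + 1) → ℂ) → (Fin (n + 1) → ℂ) [⋀^Fin (2 * n)]→L[ℝ] ℂ}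

theorem zeroMassOn_congr_set (h : ∀ j, S ∩ zeroSheet F j = T ∩ zeroSheet F j) :
    zeroMassOn F η S = zeroMassOn F η T :=
  Finset.sum_congr rfl fun j _ => by rw [h j]

theorem zeroIntegralOn_congr_set (h : ∀ j, S ∩ zeroSheet F j = T ∩ zeroSheet F j) :
    zeroIntegralOn F η S = zeroIntegralOn F η T :=
  Finset.sum_congr rfl fun j _ => by rw [h j]

theorem restrict_sheetMeasure_eq_zero (hS : MeasurableSet S) (hSZ : S ⊆ zeroSheet F j)
    {i : Fin (n + 1)} (hij : i ≠ j) : (sheetMeasure F i).restrict S = 0 := by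
  rw [sheetMeasure, Measure.restrict_restrict hS, Measure.restrict_eq_zero]
  have : S ∩ zeroSheet F i = ∅ := by
    rw [← disjoint_iff_inter_eq_empty]
    exact disjoint_left.2 fun z hz hi => hij (eq_of_mem_zeroSheet hi (hSZ hz))
  rw [this, measure_empty]

theorem zeroMassOn_of_subset_zeroSheet (hη : ContinuousOn η U) (hS : MeasurableSet S)
    (hSU : S ⊆ U) (hSZ : S ⊆ zeroSheet F j) :
    zeroMassOn F η S = ∫⁻ z in S, ‖zeroCoeff F η j z‖ₑ ∂sheetMeasure F j := by
  rw [zeroMassOn_eq_lintegral hη hS hSU]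
  refine Finset.sum_eq_single j (fun i _ hij => ?_) (by simp)
  rw [restrict_sheetMeasure_eq_zero hS hSZ hij, lintegral_zero_measure]

theorem zeroIntegralOn_of_subset_zeroSheet (hη : ContinuousOn η U) (hS : MeasurableSet S)
    (hSU : S ⊆ U) (hSZ : S ⊆ zeroSheet F j) (hfin : zeroMassOn F η S < ⊤) :
    zeroIntegralOn F η S = ∫ z in S, zeroCoeff F η j z ∂sheetMeasure F j := by
  rw [zeroIntegralOn_eq_integral hη hS hSU hfin]
  refine Finset.sum_eq_single j (fun i _ hij => ?_) (by simp)
  rw [restrict_sheetMeasure_eq_zero hS hSZ hij, integral_zero_measure]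

end

variable {G : OpenPartialHomeomorph (Fin (n + 1) → ℂ) (Fin (n + 1) → ℂ)}
    {F F' : (Fin (n + 1) → ℂ) → ℂ}
    {η η' : (Fin (n + 1) → ℂ) → (Fin (n + 1) → ℂ) [⋀^Fin (2 * n)]→L[ℝ] ℂ}
    {S : Set (Fin (n + 1) → ℂ)}

/-- The mass and the integral over the zero sets agree on `S` and on its image. -/
def IsInvariantOn (G : OpenPartialHomeomorph (Fin (n + 1) → ℂ) (Fin (n + 1) → ℂ))
    (F F' : (Fin (n + 1) → ℂ) → ℂ)
    (η η' : (Fin (n + 1) → ℂ) → (Fin (n + 1) → ℂ) [⋀^Fin (2 * n)]→L[ℝ] ℂ)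
    (S : Set (Fin (n + 1) → ℂ)) : Prop :=
  zeroMassOn F η S = zeroMassOn F' η' (G '' S) ∧
    (zeroMassOn F η S < ⊤ → zeroIntegralOn F η S = zeroIntegralOn F' η' (G '' S))

theorem IsPullback.isInvariantOn_iUnion (h : IsPullback G F F' η η') {ι : Type*} [Countable ι]
    {S : ι → Set (Fin (n + 1) → ℂ)} (hS : ∀ i, MeasurableSet (S i))
    (hd : Pairwise fun i i' => Disjoint (S i) (S i')) (hSs : ∀ i, S i ⊆ G.source)
    (hinv : ∀ i, IsInvariantOn G F F' η η' (S i)) : IsInvariantOn G F F' η η' (⋃ i, S i) := by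
  have hS' : ∀ i, MeasurableSet (G '' S i) := fun i => h.measurableSet_image (hS i) (hSs i)
  have hSt : ∀ i, G '' S i ⊆ G.target := fun i => by
    rintro _ ⟨z, hz, rfl⟩; exact G.map_source (hSs i hz)
  have hd' : Pairwise fun i i' => Disjoint (G '' S i) (G '' S i') := fun i i' hii => by
    refine disjoint_left.2 ?_
    rintro _ ⟨z, hz, rfl⟩ ⟨y, hy, hzy⟩
    rw [G.injOn (hSs i' hy) (hSs i hz) hzy] at hy
    exact disjoint_left.1 (hd hii) hz hy
  have hmass : zeroMassOn F η (⋃ i, S i) = zeroMassOn F' η' (⋃ i, G '' S i) := by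
    rw [zeroMassOn_iUnion h.continuousOn hS hd hSs, zeroMassOn_iUnion h.continuousOn' hS' hd' hSt]
    exact tsum_congr fun i => (hinv i).1
  refine ⟨by rw [image_iUnion]; exact hmass, fun hfin => ?_⟩
  rw [image_iUnion]
  have h1 := hasSum_zeroIntegralOn h.continuousOn hS hd hSs hfin
  have h2 := hasSum_zeroIntegralOn h.continuousOn' hS' hd' hSt (hmass ▸ hfin)
  have h3 : (fun i => zeroIntegralOn F η (S i)) = fun i => zeroIntegralOn F' η' (G '' S i) :=
    funext fun i => (hinv i).2 ((zeroMassOn_mono h.continuousOn (MeasurableSet.iUnion hS)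
      (iUnion_subset hSs) (hS i) (subset_iUnion S i)).trans_lt hfin)
  rw [h3] at h1
  exact h1.unique h2

/-- When `S` lies in one sheet and its image in one sheet, countably many pairs of graphs cover the
situation; the local statement is then summed over a disjoint refinement. -/
theorem IsPullback.isInvariantOn_of_subset (h : IsPullback G F F' η η') {j j' : Fin (n + 1)}
    (hS : MeasurableSet S) (hSs : S ⊆ G.source)
    (hSZ : S ⊆ zeroSheet F j) (hSZ' : ∀ z ∈ S, G z ∈ zeroSheet F' j') :
    IsInvariantOn G F F' η η' S := by
  have hex : ∀ z ∈ S, ∃ V, IsOpen V ∧ z ∈ V ∧ ∀ T ⊆ S ∩ V, MeasurableSet T →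
      IsInvariantOn G F F' η η' T := by
    intro z hz
    obtain ⟨V, W, Γ, a, k, hzV, hVs, hΓ⟩ :=
      exists_isZeroGraph (hSZ hz) (G.open_source.mem_nhds (hSs hz))
    obtain ⟨V', W', Γ', a', k', hzV', -, hΓ'⟩ := exists_isZeroGraph (hSZ' z hz) univ_mem
    have hVo : IsOpen (G.source ∩ G ⁻¹' V') := G.isOpen_inter_preimage hΓ'.isOpen_target
    refine ⟨V ∩ (G.source ∩ G ⁻¹' V'), hΓ.isOpen_target.inter hVo, ⟨hzV, hSs hz, hzV'⟩,
      fun T hT hTm => ?_⟩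
    have hTs : T ⊆ G.source := fun y hy => (hT hy).2.2.1
    have hTZ : T ⊆ zeroSheet F j := fun y hy => hSZ (hT hy).1
    have hTZ' : ∀ y ∈ T, G y ∈ zeroSheet F' j' := fun y hy => hSZ' y (hT hy).1
    obtain ⟨h1, h2⟩ := h.local_invariance hΓ hΓ' hTm hTs (fun y hy => (hT hy).2.1)
      (fun y hy => (hT hy).2.2.2) hTZ hTZ'
    have hT' := h.measurableSet_image hTm hTs
    have hTt : G '' T ⊆ G.target := by rintro _ ⟨y, hy, rfl⟩; exact G.map_source (hTs hy)
    have hTZi : G '' T ⊆ zeroSheet F' j' := by rintro _ ⟨y, hy, rfl⟩; exact hTZ' y hy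
    have hmass : zeroMassOn F η T = zeroMassOn F' η' (G '' T) := by
      rw [zeroMassOn_of_subset_zeroSheet h.continuousOn hTm hTs hTZ,
        zeroMassOn_of_subset_zeroSheet h.continuousOn' hT' hTt hTZi, h1]
    refine ⟨hmass, fun hfin => ?_⟩
    rw [zeroIntegralOn_of_subset_zeroSheet h.continuousOn hTm hTs hTZ hfin,
      zeroIntegralOn_of_subset_zeroSheet h.continuousOn' hT' hTt hTZi (hmass ▸ hfin), h2]
  choose! V hVo hzV hV using hex
  obtain ⟨s, hsS, hsc, hs⟩ := TopologicalSpace.countable_cover_nhdsWithin (s := S)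
    (f := V) fun z hz => mem_nhdsWithin_of_mem_nhds ((hVo z hz).mem_nhds (hzV z hz))
  rcases s.eq_empty_or_nonempty with rfl | hsne
  · simp only [mem_empty_iff_false, iUnion_of_empty, iUnion_empty, subset_empty_iff] at hs
    subst hs
    have := h.isInvariantOn_iUnion (ι := Empty) (S := fun _ => ∅) (by simp) (fun i => i.elim)
      (by simp) (fun i => i.elim)
    simpa using this
  obtain ⟨c, rfl⟩ := hsc.exists_eq_range hsne
  have hcov : S = ⋃ i, S ∩ disjointed (fun i => V (c i)) i := by
    rw [← inter_iUnion, iUnion_disjointed, eq_comm, inter_eq_left]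
    intro z hz
    obtain ⟨_, ⟨i, rfl⟩, hi⟩ := mem_iUnion₂.1 (hs hz)
    exact mem_iUnion.2 ⟨i, hi⟩
  have hm : ∀ i, MeasurableSet (S ∩ disjointed (fun i => V (c i)) i) := fun i =>
    hS.inter (MeasurableSet.disjointed (fun i => (hVo _ (hsS ⟨i, rfl⟩)).measurableSet) i)
  rw [hcov]
  refine h.isInvariantOn_iUnion hm (fun i i' hii => ?_) (fun i => inter_subset_left.trans hSs)
    fun i => hV (c i) (hsS ⟨i, rfl⟩) _ (inter_subset_inter_right _ (disjointed_subset _ i)) (hm i)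
  exact ((disjoint_disjointed fun i => V (c i)) hii).mono inter_subset_right inter_subset_right

theorem IsPullback.exists_mem_zeroSheet_iff (h : IsPullback G F F' η η') {z : Fin (n + 1) → ℂ}
    (hz : z ∈ G.source) : (∃ j, z ∈ zeroSheet F j) ↔ ∃ j, G z ∈ zeroSheet F' j := by
  constructor
  · rintro ⟨j, hj⟩
    obtain ⟨k, l, hl⟩ := exists_isRegularZero_of_mem_zeroSheet hj
    have hGz := G.map_source hz
    have hz' : G.symm (G z) = z := G.left_inv hz
    have h1 : IsRegularZero F (G.symm (G z)) k l := by rwa [hz']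
    have hs : Function.Surjective (fderiv ℂ G.symm (G z)) := fun v =>
      ⟨fderiv ℂ G z v, fderiv_symm_comp_fderiv hz (h.analytic z hz).differentiableAt
        (h.analytic_symm _ hGz).differentiableAt v⟩
    have h2 := h1.comp (F := F') (h.analytic_symm _ hGz) hs (Filter.eventually_of_mem
      (G.open_target.mem_nhds hGz) fun y hy => by
        change F' y = F (G.symm y)
        rw [h.fun_eq _ (G.map_target hy), G.right_inv hy])
    exact h2.exists_mem_zeroSheet
  · rintro ⟨j, hj⟩
    obtain ⟨k, l, hl⟩ := exists_isRegularZero_of_mem_zeroSheet hj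
    exact (h.isRegularZero hz hl).exists_mem_zeroSheet

/-- Integration over zero sets is invariant under biholomorphic maps. -/
theorem IsPullback.isInvariantOn (h : IsPullback G F F' η η') (hS : MeasurableSet S)
    (hSs : S ⊆ G.source) : IsInvariantOn G F F' η η' S := by
  -- A biholomorphic map preserves regular zeros but can change the sheet in which they lie, so `S`
  -- is cut by pairs of sheet indices. What remains of `S` contains no regular zero and does not
  -- contribute on either side.
  set T : Fin (n + 1) × Fin (n + 1) → Set (Fin (n + 1) → ℂ) := fun p =>
    (S ∩ zeroSheet F p.1) ∩ (G.source ∩ G ⁻¹' zeroSheet F' p.2) with hT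
  have hTm : ∀ p, MeasurableSet (T p) := fun p => by
    have hm : MeasurableSet (G.source ∩ G ⁻¹' zeroSheet F' p.2) := by
      have h1 : G.source ∩ G ⁻¹' zeroSheet F' p.2 = G.symm '' (G.target ∩ zeroSheet F' p.2) := by
        rw [G.symm_image_target_inter_eq]
        ext z
        simp only [mem_inter_iff, mem_preimage]
        exact ⟨fun hz => ⟨hz.1, G.map_source hz.1, hz.2⟩, fun hz => ⟨hz.1, hz.2.2⟩⟩
      rw [h1]
      exact (G.open_target.measurableSet.inter (measurableSet_zeroSheet F' p.2)).image_of_continuousOn_injOn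
        (h.analytic_symm.continuousOn.mono inter_subset_left) (G.symm.injOn.mono inter_subset_left)
    exact (hS.inter (measurableSet_zeroSheet F p.1)).inter hm
  have hinv : IsInvariantOn G F F' η η' (⋃ p, T p) := by
    refine h.isInvariantOn_iUnion hTm (fun p q hpq => disjoint_left.2 fun z hp hq => hpq ?_)
      (fun p z hz => hSs hz.1.1) fun p => h.isInvariantOn_of_subset (hTm p)
        (fun z hz => hSs hz.1.1) (fun z hz => hz.1.2) fun z hz => hz.2.2
    exact Prod.ext (eq_of_mem_zeroSheet hp.1.2 hq.1.2) (eq_of_mem_zeroSheet hp.2.2 hq.2.2)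
  have h1 : ∀ j, (⋃ p, T p) ∩ zeroSheet F j = S ∩ zeroSheet F j := fun j => by
    ext z
    constructor
    · rintro ⟨hz, hj⟩
      obtain ⟨p, hp⟩ := mem_iUnion.1 hz
      exact ⟨hp.1.1, hj⟩
    · rintro ⟨hz, hj⟩
      obtain ⟨j', hj'⟩ := (h.exists_mem_zeroSheet_iff (hSs hz)).1 ⟨j, hj⟩
      exact ⟨mem_iUnion.2 ⟨(j, j'), ⟨hz, hj⟩, hSs hz, hj'⟩, hj⟩
  have h2 : ∀ j, (G '' ⋃ p, T p) ∩ zeroSheet F' j = (G '' S) ∩ zeroSheet F' j := fun j => by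
    ext y
    constructor
    · rintro ⟨⟨z, hz, rfl⟩, hj⟩
      obtain ⟨p, hp⟩ := mem_iUnion.1 hz
      exact ⟨⟨z, hp.1.1, rfl⟩, hj⟩
    · rintro ⟨⟨z, hz, rfl⟩, hj⟩
      obtain ⟨j', hj'⟩ := (h.exists_mem_zeroSheet_iff (hSs hz)).2 ⟨j, hj⟩
      exact ⟨⟨z, mem_iUnion.2 ⟨(j', j), ⟨hz, hj'⟩, hSs hz, hj⟩, rfl⟩, hj⟩
  rwa [IsInvariantOn, zeroMassOn_congr_set h1, zeroMassOn_congr_set h2, zeroIntegralOn_congr_set h1,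
    zeroIntegralOn_congr_set h2] at hinv

end GlobalInvariance

/-! ## The forms `Vol(v, iv, ·)` -/

section VolForm

variable {n : ℕ}

/-- The standard frame of `ℂ^(n+1)`. -/
abbrev stdFrame (n : ℕ) : Fin (2 * n + 1 + 1) → Fin (n + 1) → ℂ :=
  complexFrame fun i : Fin (n + 1) => (Pi.single i (1 : ℂ) : Fin (n + 1) → ℂ)

theorem continuous_det_frameBasis (p : ℕ) :
    Continuous fun v : Fin (2 * p) → Fin p → ℂ => (frameBasis p).det v := by
  simp_rw [Module.Basis.det_apply]
  refine Continuous.matrix_det (continuous_pi fun i => continuous_pi fun k => ?_)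
  simp only [Module.Basis.toMatrix_apply]
  exact (((frameBasis p).coord i).continuous_of_finiteDimensional).comp (continuous_apply k)

variable (n) in
/-- The volume form of `ℂ^(n+1)`. -/
def volForm : (Fin (n + 1) → ℂ) [⋀^Fin (2 * n + 1 + 1)]→L[ℝ] ℂ :=
  { (Complex.ofRealCLM : ℝ →ₗ[ℝ] ℂ).compAlternatingMap (frameBasis (n + 1)).det with
    cont := Complex.continuous_ofReal.comp (continuous_det_frameBasis (n + 1)) }

theorem volForm_apply (v : Fin (2 * n + 1 + 1) → Fin (n + 1) → ℂ) :
    volForm n v = ((frameBasis (n + 1)).det v : ℝ) := rfl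

theorem volForm_stdFrame : volForm n (stdFrame n) = 1 := by
  rw [volForm_apply, stdFrame, ← coe_frameBasis (p := n + 1)]
  have := (frameBasis (n + 1)).det_self
  rw [this]
  simp

theorem volForm_map (L : (Fin (n + 1) → ℂ) →L[ℝ] (Fin (n + 1) → ℂ))
    (v : Fin (2 * n + 1 + 1) → Fin (n + 1) → ℂ) :
    volForm n (fun k => L (v k)) = L.det * volForm n v := by
  rw [volForm_apply, volForm_apply, ← Complex.ofReal_mul]
  congr 1
  exact (frameBasis (n + 1)).det_comp (L : (Fin (n + 1) → ℂ) →ₗ[ℝ] (Fin (n + 1) → ℂ)) v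

variable (n) in
theorem det_mulI : (mulI (n + 1)).det = 1 := by
  have h1 : mulI (n + 1) = (Complex.I • ContinuousLinearMap.id ℂ (Fin (n + 1) → ℂ)).restrictScalars ℝ :=
    rfl
  have h2 := LinearMap.det_restrictScalars (S := ℂ) (R := ℝ)
    (f := ((Complex.I • ContinuousLinearMap.id ℂ (Fin (n + 1) → ℂ) :
      (Fin (n + 1) → ℂ) →L[ℂ] (Fin (n + 1) → ℂ)) : (Fin (n + 1) → ℂ) →ₗ[ℂ] (Fin (n + 1) → ℂ)))
  rw [h1]
  refine h2.trans ?_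
  rw [Algebra.norm_complex_apply, ContinuousLinearMap.toLinearMap_smul, LinearMap.det_smul]
  simp

/-- `Vol(v, w, ·)`. -/
def volForm₂ (v w : Fin (n + 1) → ℂ) : (Fin (n + 1) → ℂ) [⋀^Fin (2 * n)]→L[ℝ] ℂ :=
  ((volForm n).curryLeft v).curryLeft w

theorem volForm₂_apply (v w : Fin (n + 1) → ℂ) (x : Fin (2 * n) → Fin (n + 1) → ℂ) :
    volForm₂ v w x = volForm n (Matrix.vecCons v (Matrix.vecCons w x)) := rfl

theorem volForm₂_map (L : (Fin (n + 1) → ℂ) →L[ℝ] (Fin (n + 1) → ℂ)) (v w : Fin (n + 1) → ℂ)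
    (x : Fin (2 * n) → Fin (n + 1) → ℂ) :
    volForm₂ (L v) (L w) (fun k => L (x k)) = L.det * volForm₂ v w x := by
  rw [volForm₂_apply, volForm₂_apply, ← volForm_map]
  congr 1
  funext k
  refine Fin.cases rfl (fun k => Fin.cases rfl (fun k => rfl) k) k

theorem volForm₂_self (v : Fin (n + 1) → ℂ) : volForm₂ v v = 0 := by
  ext x
  rw [volForm₂_apply]
  exact (volForm n).map_eq_zero_of_eq _ (i := 0) (j := 1) rfl (by simp)

theorem volForm₂_add_left (v v' w : Fin (n + 1) → ℂ) :
    volForm₂ (v + v') w = volForm₂ v w + volForm₂ v' w := by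
  simp [volForm₂]

theorem volForm₂_add_right (v w w' : Fin (n + 1) → ℂ) :
    volForm₂ v (w + w') = volForm₂ v w + volForm₂ v w' := by
  simp [volForm₂]

theorem volForm₂_neg_left (v w : Fin (n + 1) → ℂ) : volForm₂ (-v) w = -volForm₂ v w := by
  have h := volForm₂_add_left (-v) v w
  rw [neg_add_cancel] at h
  have h0 : volForm₂ 0 w = 0 := by simp [volForm₂]
  rw [h0] at h
  exact eq_neg_of_add_eq_zero_left h.symm

theorem volForm₂_neg_right (v w : Fin (n + 1) → ℂ) : volForm₂ v (-w) = -volForm₂ v w := by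
  simp [volForm₂]

theorem volForm₂_swap (v w : Fin (n + 1) → ℂ) : volForm₂ w v = -volForm₂ v w := by
  have h := volForm₂_self (v + w)
  rw [volForm₂_add_left, volForm₂_add_right, volForm₂_add_right, volForm₂_self, volForm₂_self,
    zero_add, add_zero] at h
  exact eq_neg_of_add_eq_zero_right h

/-- The form `Vol(v, iv, ·)`, of bidegree `(n, n)`. -/
def lineForm (v : Fin (n + 1) → ℂ) : (Fin (n + 1) → ℂ) [⋀^Fin (2 * n)]→L[ℝ] ℂ :=
  volForm₂ v (Complex.I • v)

theorem I_smul_I_smul (v : Fin (n + 1) → ℂ) : Complex.I • Complex.I • v = -v := by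
  rw [smul_smul, Complex.I_mul_I, neg_one_smul]

theorem volForm₂_comp_mulI (v w : Fin (n + 1) → ℂ) :
    (volForm₂ v w).compContinuousLinearMap (mulI (n + 1)) =
      volForm₂ (Complex.I • v) (Complex.I • w) := by
  ext x
  have h := volForm₂_map (mulI (n + 1)) (-(Complex.I • v)) (-(Complex.I • w)) x
  have h1 : ∀ v : Fin (n + 1) → ℂ, mulI (n + 1) (-(Complex.I • v)) = v := fun v => by
    change Complex.I • (-(Complex.I • v)) = v
    rw [smul_neg, I_smul_I_smul, neg_neg]
  rw [det_mulI, h1, h1, volForm₂_neg_left, volForm₂_neg_right, neg_neg] at h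
  simpa [Function.comp_def] using h

/-- Polarization: `Vol(v, iv, ·)` is quadratic in `v`, and the left-hand side is its associated
bilinear expression at `(v, -iw)`. It expresses the invariant part of `Vol(v, w, ·)` under
multiplication by `i` through line forms. -/
theorem volForm₂_add_eq_lineForm (v w : Fin (n + 1) → ℂ) :
    volForm₂ v w + volForm₂ (Complex.I • v) (Complex.I • w) =
      lineForm (v + -(Complex.I • w)) - lineForm v - lineForm w := by
  simp only [lineForm, smul_add, smul_neg, I_smul_I_smul, neg_neg, volForm₂_add_left,
    volForm₂_add_right, volForm₂_neg_left]
  rw [volForm₂_swap (Complex.I • v) (Complex.I • w), volForm₂_swap w (Complex.I • w)]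
  abel

/-- For a real basis and a set `s` of `2n` indices, with complement `{α, β}`, the form `Vol(f α, f
β, ·)` vanishes on every tuple of distinct basis vectors except the permutations of those indexed by
`s`. Up to scalars these forms are thus the dual basis. The data do not depend on `η`, so the
coefficients of a smooth form are smooth. -/
theorem exists_eq_sum_volForm₂ (n : ℕ) : ∃ (A : Type) (_ : Fintype A)
    (κ : A → ℂ) (v w : A → Fin (n + 1) → ℂ) (x : A → Fin (2 * n) → Fin (n + 1) → ℂ),
    ∀ η : (Fin (n + 1) → ℂ) [⋀^Fin (2 * n)]→L[ℝ] ℂ,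
      η = ∑ a, (κ a * η (x a)) • volForm₂ (v a) (w a) := by
  classical
  set f : Module.Basis (Fin (2 * n + 1 + 1)) ℝ (Fin (n + 1) → ℂ) := frameBasis (n + 1) with hf
  set A : Type := {s : Finset (Fin (2 * n + 1 + 1)) // s.card = 2 * n} with hA
  have hc : ∀ s : A, (s.1ᶜ).card = 2 := fun s => by rw [Finset.card_compl, s.2]; simp; omega
  set σ : A → Fin (2 * n) → Fin (2 * n + 1 + 1) := fun s => s.1.orderEmbOfFin s.2 with hσ
  set α : A → Fin (2 * n + 1 + 1) := fun s => (s.1ᶜ).orderEmbOfFin (hc s) 0 with hα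
  set β : A → Fin (2 * n + 1 + 1) := fun s => (s.1ᶜ).orderEmbOfFin (hc s) 1 with hβ
  have hαm : ∀ s, α s ∉ s.1 := fun s =>
    Finset.mem_compl.1 (Finset.orderEmbOfFin_mem _ (hc s) 0)
  have hβm : ∀ s, β s ∉ s.1 := fun s =>
    Finset.mem_compl.1 (Finset.orderEmbOfFin_mem _ (hc s) 1)
  have hαβ : ∀ s, α s ≠ β s := fun s h => by
    have := ((s.1ᶜ).orderEmbOfFin (hc s)).injective h
    simp at this
  have hcompl : ∀ s : A, ∀ i, i ∉ s.1 → i = α s ∨ i = β s := fun s i hi => by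
    have h1 : i ∈ range ((s.1ᶜ).orderEmbOfFin (hc s)) := by
      rw [Finset.range_orderEmbOfFin]
      simpa using hi
    obtain ⟨k, rfl⟩ := h1
    fin_cases k
    · exact Or.inl rfl
    · exact Or.inr rfl
  set D : A → (Fin (n + 1) → ℂ) [⋀^Fin (2 * n)]→L[ℝ] ℂ := fun s =>
    volForm₂ (f (α s)) (f (β s)) with hD
  -- The indices `α`, `β` and those of `s` together form a permutation of the whole basis.
  have hD0 : ∀ s, D s (fun i => f (σ s i)) ≠ 0 := fun s => by
    set τ : Fin (2 * n + 1 + 1) → Fin (2 * n + 1 + 1) :=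
      Matrix.vecCons (α s) (Matrix.vecCons (β s) (σ s)) with hτ
    have hinj : Function.Injective τ := by
      have hσm : ∀ i, σ s i ∈ s.1 := fun i => Finset.orderEmbOfFin_mem _ s.2 i
      refine Fin.cons_injective_iff.2 ⟨?_, Fin.cons_injective_iff.2 ⟨?_, ?_⟩⟩
      · rintro ⟨k, hk⟩
        revert hk
        refine Fin.cases (fun h => hαβ s h.symm) (fun k h => hαm s ?_) k
        rw [← h]; exact hσm k
      · rintro ⟨k, h⟩
        exact hβm s (h ▸ hσm k)
      · exact (s.1.orderEmbOfFin s.2).injective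
    set e : Equiv.Perm (Fin (2 * n + 1 + 1)) := Equiv.ofBijective τ
      (Finite.injective_iff_bijective.1 hinj) with he
    have h1 : D s (fun i => f (σ s i)) = volForm n (fun k => f (e k)) := by
      rw [hD, volForm₂_apply]
      congr 1
      funext k
      refine Fin.cases rfl (fun k => Fin.cases rfl (fun k => rfl) k) k
    have h2 : f.det (fun k => f (e k)) ≠ 0 := by
      have : (fun k => f (e k)) = f.reindex e.symm := by ext k; simp
      rw [this]
      exact (f.isUnit_det _).ne_zero
    rw [h1, volForm_apply]
    exact_mod_cast h2
  refine ⟨A, inferInstance, fun s => (D s (fun i => f (σ s i)))⁻¹, fun s => f (α s),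
    fun s => f (β s), fun s i => f (σ s i), fun η => ?_⟩
  apply ContinuousAlternatingMap.toAlternatingMap_injective
  refine f.ext_alternating fun v hv => ?_
  set s : A := ⟨Finset.univ.image v, by rw [Finset.card_image_of_injective _ hv]; simp⟩ with hs
  have hvs : ∀ i, v i ∈ s.1 := fun i => Finset.mem_image_of_mem v (Finset.mem_univ i)
  have hperm : ∃ τ : Equiv.Perm (Fin (2 * n)), ∀ i, v i = σ s (τ i) := by
    have hb : Function.Bijective (fun i => (⟨v i, hvs i⟩ : s.1)) := by
      constructor
      · intro i k h
        exact hv (congrArg Subtype.val h)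
      · rintro ⟨y, hy⟩
        obtain ⟨i, -, hi⟩ := Finset.mem_image.1 hy
        exact ⟨i, Subtype.ext hi⟩
    refine ⟨(Equiv.ofBijective _ hb).trans (s.1.orderIsoOfFin s.2).toEquiv.symm, fun i => ?_⟩
    have : σ s ((s.1.orderIsoOfFin s.2).toEquiv.symm ⟨v i, hvs i⟩) =
        ((s.1.orderIsoOfFin s.2) ((s.1.orderIsoOfFin s.2).symm ⟨v i, hvs i⟩) : Fin (2 * n + 1 + 1)) := rfl
    rw [OrderIso.apply_symm_apply] at this
    exact this.symm
  obtain ⟨τ, hτ⟩ := hperm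
  have hsgn : ∀ θ : (Fin (n + 1) → ℂ) [⋀^Fin (2 * n)]→L[ℝ] ℂ,
      θ (fun i => f (v i)) = Equiv.Perm.sign τ • θ (fun i => f (σ s i)) := fun θ => by
    have := θ.toAlternatingMap.map_perm (fun i => f (σ s i)) τ
    have h2 : (fun i => f (v i)) = (fun i => f (σ s i)) ∘ τ := by
      funext i
      simp only [Function.comp, hτ]
    rw [h2]
    exact this
  change η (fun i => f (v i)) = (∑ a, ((D a (fun i => f (σ a i)))⁻¹ *
    η (fun i => f (σ a i))) • D a) (fun i => f (v i))
  rw [ContinuousAlternatingMap.sum_apply, Finset.sum_eq_single s]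
  · rw [_root_.ContinuousAlternatingMap.smul_apply, hsgn η, hsgn (D s), smul_eq_mul]
    have := hD0 s
    simp only [Units.smul_def, zsmul_eq_mul]
    field_simp
  · intro a _ has
    rw [ContinuousAlternatingMap.smul_apply]
    have : ∃ i, v i ∉ a.1 := by
      by_contra! H
      apply has
      have h1 : s.1 ⊆ a.1 := fun y hy => by
        obtain ⟨i, -, rfl⟩ := Finset.mem_image.1 hy
        exact H i
      exact Subtype.ext (Finset.eq_of_subset_of_card_le h1 (by rw [a.2, s.2])).symm
    obtain ⟨i, hi⟩ := this
    have h0 : D a (fun i => f (v i)) = 0 := by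
      rw [hD, volForm₂_apply]
      rcases hcompl a _ hi with h | h
      · exact (volForm n).map_eq_zero_of_eq _ (i := 0) (j := i.succ.succ)
          (congrArg f h.symm) (by simp [Fin.ext_iff])
      · exact (volForm n).map_eq_zero_of_eq _ (i := 1) (j := i.succ.succ)
          (congrArg f h.symm) (by simp [Fin.ext_iff])
    rw [h0, smul_zero]
  · simp

/-- The forms of bidegree `(n, n)` are spanned by the forms `Vol(v, iv, ·)`. -/
theorem exists_eq_sum_lineForm (n : ℕ) : ∃ (A : Type) (_ : Fintype A)
    (κ : A → ℂ) (v : A → Fin (n + 1) → ℂ) (x : A → Fin (2 * n) → Fin (n + 1) → ℂ),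
    ∀ η : (Fin (n + 1) → ℂ) [⋀^Fin (2 * n)]→L[ℝ] ℂ,
      η.compContinuousLinearMap (mulI (n + 1)) = η →
      η = ∑ a, (κ a * η (x a)) • lineForm (v a) := by
  obtain ⟨A, hA, κ, v, w, x, h⟩ := exists_eq_sum_volForm₂ n
  refine ⟨A × Fin 3, inferInstance,
    fun a => ![κ a.1 / 2, -(κ a.1 / 2), -(κ a.1 / 2)] a.2,
    fun a => ![v a.1 + -(Complex.I • w a.1), v a.1, w a.1] a.2, fun a => x a.1, fun η hη => ?_⟩
  -- Since `η` is invariant under multiplication by `i`, its expansion may be pulled back by `i` and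
  -- averaged with itself; polarization applies to the averaged terms.
  have h1 : η = ∑ a, (κ a * η (x a)) • volForm₂ (Complex.I • v a) (Complex.I • w a) := by
    conv_lhs => rw [← hη, h η]
    ext y
    simp only [ContinuousAlternatingMap.compContinuousLinearMap_apply,
      ContinuousAlternatingMap.sum_apply, ContinuousAlternatingMap.smul_apply]
    refine Finset.sum_congr rfl fun a _ => ?_
    rw [← volForm₂_comp_mulI]
    rfl
  have h2 : η = (1 / 2 : ℂ) • (η + η) := by
    rw [← two_smul ℂ η, smul_smul]; norm_num
  calc η = (1 / 2 : ℂ) • (∑ a, (κ a * η (x a)) • volForm₂ (v a) (w a) +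
        ∑ a, (κ a * η (x a)) • volForm₂ (Complex.I • v a) (Complex.I • w a)) := by
        rw [← h η, ← h1, ← h2]
    _ = _ := by
      rw [← Finset.sum_add_distrib, Finset.smul_sum, Fintype.sum_prod_type]
      refine Finset.sum_congr rfl fun a _ => ?_
      ext y
      have h3 : volForm₂ (v a) (w a) y + volForm₂ (Complex.I • v a) (Complex.I • w a) y =
          lineForm (v a + -(Complex.I • w a)) y - lineForm (v a) y - lineForm (w a) y :=
        congrArg (fun θ => θ y) (volForm₂_add_eq_lineForm (v a) (w a))
      rw [Fin.sum_univ_three]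
      simp only [Matrix.cons_val_zero, Matrix.cons_val_one, Matrix.cons_val,
        ContinuousAlternatingMap.add_apply, ContinuousAlternatingMap.smul_apply, smul_eq_mul]
      linear_combination (κ a * η (x a) / 2) * h3

end VolForm

/-! ## The line form on the sheets, and `∂∂̄` -/

section LineFormSheets

variable {n : ℕ} {F : (Fin (n + 1) → ℂ) → ℂ} {z : Fin (n + 1) → ℂ}

theorem lineForm_comp_mulI (v : Fin (n + 1) → ℂ) :
    (lineForm v).compContinuousLinearMap (mulI (n + 1)) = lineForm v := by
  rw [lineForm, volForm₂_comp_mulI, I_smul_I_smul, volForm₂_neg_right, volForm₂_swap, neg_neg]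

theorem insertZeroL_single (j : Fin (n + 1)) (i : Fin n) :
    insertZeroL j (Pi.single i 1) = Pi.single (j.succAbove i) 1 := by
  rw [insertZeroL_apply]
  ext i'
  refine Fin.succAboveCases j ?_ (fun i' => ?_) i'
  · simp
  · simp [Pi.single_apply]

theorem stdFrame_zero : stdFrame n 0 = Pi.single 0 1 := by simp [stdFrame, complexFrame]

theorem stdFrame_one : stdFrame n 1 = Complex.I • Pi.single 0 1 := by
  have h : (1 : Fin (2 * n + 1 + 1)) = ⟨1, by omega⟩ := Fin.ext (by simp)
  rw [h]
  simp [stdFrame, complexFrame]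

theorem stdFrame_succ_succ (k : Fin (2 * n)) : stdFrame n k.succ.succ =
    insertZeroL 0 (complexFrame (fun i : Fin n => (Pi.single i (1 : ℂ) : Fin n → ℂ)) k) := by
  have hk := k.2
  have h1 : (k.succ.succ : Fin (2 * n + 1 + 1)).val / 2 = k.val / 2 + 1 := by
    simp only [Fin.val_succ]; omega
  have h2 : (k.succ.succ : Fin (2 * n + 1 + 1)).val % 2 = k.val % 2 := by
    simp only [Fin.val_succ]; omega
  have h3 : ∀ h, (⟨(k.succ.succ : Fin (2 * n + 1 + 1)).val / 2, h⟩ : Fin (n + 1)) =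
      Fin.succ ⟨k.val / 2, by omega⟩ := fun h => Fin.ext h1
  unfold stdFrame complexFrame
  simp only [h2, h3]
  split_ifs
  · rw [insertZeroL_single]; rfl
  · rw [map_smul, insertZeroL_single]; rfl

/-- The vectors `e`, `ie` and the tangent frame arise from the standard frame by a transvection
along `e`, whose determinant is `1`. The restriction of the line form to this sheet is thus Lebesgue
measure of the projection. -/
theorem lineForm_zeroTangent_zero (hz : z ∈ zeroSheet F 0) :
    lineForm (Pi.single 0 1) (complexFrame (zeroTangent F 0 z)) = 1 := by
  obtain ⟨k, l, hl⟩ := exists_isRegularZero_of_mem_zeroSheet hz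
  have hl0 := ((hl.mem_zeroSheet_iff 0).1 hz).1
  set e : Fin (n + 1) → ℂ := Pi.single 0 1 with he
  set f : Module.Dual ℂ (Fin (n + 1) → ℂ) :=
    -((l e)⁻¹ • (l.comp ((insertZeroL 0).comp (removeNthL 0))).toLinearMap) with hf
  have hfe : f e = 0 := by
    have : (insertZeroL (0 : Fin (n + 1))) (removeNthL 0 e) = 0 := by
      have h0 : removeNthL (0 : Fin (n + 1)) e = 0 := by
        ext i
        simp [he, Fin.removeNth]
      rw [h0, map_zero]
    change -((l e)⁻¹ * l (insertZeroL 0 (removeNthL 0 e))) = 0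
    rw [this, map_zero, mul_zero, neg_zero]
  set L : (Fin (n + 1) → ℂ) →L[ℂ] (Fin (n + 1) → ℂ) :=
    LinearMap.toContinuousLinearMap (LinearMap.transvection f e) with hL
  have hLx : ∀ x, L x = x + f x • e := fun x => rfl
  have hdet : (L.restrictScalars ℝ).det = 1 := by
    have h2 := LinearMap.det_restrictScalars (S := ℂ) (R := ℝ) (f := LinearMap.transvection f e)
    refine h2.trans ?_
    rw [LinearMap.transvection.det, hfe, add_zero, map_one]
  have h1 := volForm_map (L.restrictScalars ℝ) (stdFrame n)
  rw [hdet, volForm_stdFrame] at h1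
  rw [lineForm, volForm₂_apply, zeroTangent_eq_kerLift hl hl0, complexFrame_comp]
  convert h1 using 2
  · funext k
    refine Fin.cases ?_ (fun k => Fin.cases ?_ (fun k => ?_) k) k
    · change e = L (stdFrame n 0)
      rw [stdFrame_zero, hLx, ← he, hfe, zero_smul, add_zero]
    · change Complex.I • e = L (stdFrame n 1)
      rw [stdFrame_one, map_smul, hLx, ← he, hfe, zero_smul, add_zero]
    · change kerLift 0 l _ = L (stdFrame n k.succ.succ)
      rw [stdFrame_succ_succ, hLx, kerLift_apply, sub_eq_add_neg, ← neg_smul]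
      congr 2
  · simp

/-- On a later sheet the conormal kills the first basis vector, since `j` is the first index where
it is nonzero. That vector is then itself tangent and occurs twice in the determinant. -/
theorem lineForm_zeroTangent_of_ne {j : Fin (n + 1)} (hj : j ≠ 0) (hz : z ∈ zeroSheet F j) :
    lineForm (Pi.single 0 1) (complexFrame (zeroTangent F j z)) = 0 := by
  obtain ⟨i, hi⟩ := Fin.exists_succAbove_eq hj.symm
  have h0 := hz.2 0 (Fin.pos_of_ne_zero hj)
  have h1 : zeroTangent F j z i = Pi.single 0 1 := by
    rw [zeroTangent, hi, h0, zero_div, zero_smul, sub_zero]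
  have h2 : complexFrame (zeroTangent F j z) ⟨2 * i.val, by omega⟩ = Pi.single 0 1 := by
    simp [complexFrame, h1]
  rw [lineForm, volForm₂_apply]
  exact (volForm n).map_eq_zero_of_eq _ (i := 0)
    (j := (⟨2 * i.val, by omega⟩ : Fin (2 * n)).succ.succ) h2.symm (by simp [Fin.ext_iff])

end LineFormSheets

/-! ### Calculus of `∂̄` and `∂∂̄`: regularity, pullback and additivity. -/

section Ddbar

variable {m k : ℕ}

theorem contDiffAt_extDeriv {η : (Fin m → ℂ) → (Fin m → ℂ) [⋀^Fin k]→L[ℝ] ℂ} {z : Fin m → ℂ}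
    {r s : ℕ∞} (h : ContDiffAt ℝ r η z) (hrs : s + 1 ≤ r) : ContDiffAt ℝ s (extDeriv η) z :=
  (ContinuousAlternatingMap.alternatizeUncurryFinCLM ℝ (Fin m → ℂ) ℂ (n := k)).contDiff.contDiffAt.comp z
    (h.fderiv_right (by exact_mod_cast hrs))

theorem contDiffAt_delbar {η : (Fin m → ℂ) → (Fin m → ℂ) [⋀^Fin k]→L[ℝ] ℂ} {z : Fin m → ℂ}
    {r s : ℕ∞} (h : ContDiffAt ℝ r η z) (hrs : s + 1 ≤ r) : ContDiffAt ℝ s (delbar η) z := by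
  have h1 := contDiffAt_extDeriv h hrs
  have h2 : ContDiffAt ℝ s
      (fun z => (extDeriv η z).compContinuousLinearMap (mulI m)) z :=
    (ContinuousAlternatingMap.compContinuousLinearMapCLM (𝕜 := ℝ) (F := ℂ) (ι := Fin (k + 1))
      (mulI m)).contDiff.contDiffAt.comp z h1
  exact ((h1.add (h2.const_smul Complex.I)).const_smul (1 / 2 : ℂ))

theorem contDiffAt_ddbar {η : (Fin m → ℂ) → (Fin m → ℂ) [⋀^Fin k]→L[ℝ] ℂ} {z : Fin m → ℂ}
    {r s : ℕ∞} (h : ContDiffAt ℝ r η z) (hrs : s + 1 + 1 ≤ r) : ContDiffAt ℝ s (ddbar η) z :=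
  contDiffAt_extDeriv (contDiffAt_delbar h hrs) le_rfl

/-- The exterior derivative commutes with any smooth pullback, and precomposition with `i` commutes
with it because the differential of a holomorphic map is complex linear. -/
theorem delbar_pullback {m' : ℕ} {η : (Fin m' → ℂ) → (Fin m' → ℂ) [⋀^Fin k]→L[ℝ] ℂ}
    {G : (Fin m → ℂ) → Fin m' → ℂ} {z : Fin m → ℂ} (hη : DifferentiableAt ℝ η (G z))
    (hG : AnalyticAt ℂ G z) :
    delbar (fun y => (η (G y)).compContinuousLinearMap (fderiv ℝ G y)) z =
      (delbar η (G z)).compContinuousLinearMap (fderiv ℝ G z) := by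
  have hGR : ContDiffAt ℝ 2 G z := (hG.contDiffAt (n := 2)).restrict_scalars ℝ
  have hd : fderiv ℝ G z = (fderiv ℂ G z).restrictScalars ℝ :=
    hG.differentiableAt.fderiv_restrictScalars ℝ
  have hmul : (fderiv ℝ G z).comp (mulI m) = (mulI m').comp (fderiv ℝ G z) := by
    ext1 v
    rw [hd]
    change fderiv ℂ G z (Complex.I • v) = Complex.I • fderiv ℂ G z v
    rw [map_smul]
  unfold delbar
  rw [extDeriv_pullback hη hGR (by simp)]
  ext x
  have h1 : (fun i => fderiv ℝ G z (mulI m (x i))) = fun i => mulI m' (fderiv ℝ G z (x i)) :=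
    funext fun i => (congrArg (fun L => L (x i)) hmul :)
  simp only [ContinuousAlternatingMap.smul_apply, ContinuousAlternatingMap.add_apply,
    ContinuousAlternatingMap.compContinuousLinearMap_apply, Function.comp_def, h1]

/-- `∂∂̄` commutes with pullback under holomorphic maps. -/
theorem ddbar_pullback {m' : ℕ} {η : (Fin m' → ℂ) → (Fin m' → ℂ) [⋀^Fin k]→L[ℝ] ℂ}
    {G : (Fin m → ℂ) → Fin m' → ℂ} {z : Fin m → ℂ} (hη : ContDiffAt ℝ 2 η (G z))
    (hG : AnalyticAt ℂ G z) :
    ddbar (fun y => (η (G y)).compContinuousLinearMap (fderiv ℝ G y)) z =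
      (ddbar η (G z)).compContinuousLinearMap (fderiv ℝ G z) := by
  have hev : delbar (fun y => (η (G y)).compContinuousLinearMap (fderiv ℝ G y)) =ᶠ[𝓝 z]
      fun y => (delbar η (G y)).compContinuousLinearMap (fderiv ℝ G y) := by
    have h1 : ∀ᶠ y in 𝓝 (G z), ContDiffAt ℝ 2 η y := hη.eventually (by simp)
    filter_upwards [hG.eventually_analyticAt, hG.continuousAt.eventually h1] with y hy h2
    exact delbar_pullback (h2.differentiableAt (by norm_num)) hy
  unfold ddbar
  rw [hev.extDeriv_eq]
  have hGR : ContDiffAt ℝ 2 G z := (hG.contDiffAt (n := 2)).restrict_scalars ℝ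
  have hd : DifferentiableAt ℝ (delbar η) (G z) :=
    (contDiffAt_delbar (r := 2) (s := 1) hη (by norm_num)).differentiableAt (by norm_num)
  exact extDeriv_pullback hd hGR (by simp)

theorem ddbar_congr {η η' : (Fin m → ℂ) → (Fin m → ℂ) [⋀^Fin k]→L[ℝ] ℂ} {z : Fin m → ℂ}
    (h : η =ᶠ[𝓝 z] η') : ddbar η z = ddbar η' z := by
  refine Filter.EventuallyEq.extDeriv_eq ?_
  filter_upwards [h.extDeriv] with y hy
  rw [delbar, delbar, hy]

theorem ddbar_zero (z : Fin m → ℂ) :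
    ddbar (fun _ => (0 : (Fin m → ℂ) [⋀^Fin k]→L[ℝ] ℂ)) z = 0 := by
  have h : ∀ {k : ℕ} (z : Fin m → ℂ),
      extDeriv (fun _ : Fin m → ℂ => (0 : (Fin m → ℂ) [⋀^Fin k]→L[ℝ] ℂ)) z = 0 := fun z => by
    ext v
    rw [extDeriv_apply (by fun_prop)]
    simp
  have h2 : delbar (fun _ => (0 : (Fin m → ℂ) [⋀^Fin k]→L[ℝ] ℂ)) = fun _ => 0 := by
    funext z
    rw [delbar, h]
    ext v
    simp
  rw [ddbar, h2, h]

theorem ddbar_add {η η' : (Fin m → ℂ) → (Fin m → ℂ) [⋀^Fin k]→L[ℝ] ℂ} {z : Fin m → ℂ}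
    (h : ContDiffAt ℝ 2 η z) (h' : ContDiffAt ℝ 2 η' z) :
    ddbar (fun z => η z + η' z) z = ddbar η z + ddbar η' z := by
  have hev : delbar (fun z => η z + η' z) =ᶠ[𝓝 z] fun z => delbar η z + delbar η' z := by
    filter_upwards [h.eventually (by simp), h'.eventually (by simp)] with y hy hy'
    rw [delbar, extDeriv_fun_add (hy.differentiableAt (by norm_num))
      (hy'.differentiableAt (by norm_num)), delbar, delbar]
    ext v
    simp only [ContinuousAlternatingMap.smul_apply, ContinuousAlternatingMap.add_apply,
      ContinuousAlternatingMap.compContinuousLinearMap_apply, smul_eq_mul]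
    ring
  rw [ddbar, hev.extDeriv_eq, extDeriv_fun_add, ddbar, ddbar]
  · exact (contDiffAt_delbar (r := 2) (s := 1) h (by norm_num)).differentiableAt (by norm_num)
  · exact (contDiffAt_delbar (r := 2) (s := 1) h' (by norm_num)).differentiableAt (by norm_num)

theorem ddbar_finsetSum {ι : Type*} (s : Finset ι)
    {η : ι → (Fin m → ℂ) → (Fin m → ℂ) [⋀^Fin k]→L[ℝ] ℂ} {z : Fin m → ℂ}
    (h : ∀ i ∈ s, ContDiffAt ℝ 2 (η i) z) :
    ddbar (fun z => ∑ i ∈ s, η i z) z = ∑ i ∈ s, ddbar (η i) z := by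
  classical
  induction s using Finset.induction_on with
  | empty => simpa using ddbar_zero z
  | insert i s hi ih =>
    have hs := fun i' hi' => h i' (Finset.mem_insert_of_mem hi')
    simp_rw [Finset.sum_insert hi]
    rw [ddbar_add (h i (Finset.mem_insert_self i s)) (ContDiffAt.sum hs), ih hs]

end Ddbar

/-! ### `∂∂̄` of a function times the line form of the first axis. -/

section DdbarLine

variable {n : ℕ}

theorem lineForm_eq_zero_of_eq {x : Fin (2 * n) → Fin (n + 1) → ℂ} {i : Fin (2 * n)}
    (h : x i = stdFrame n 0 ∨ x i = stdFrame n 1) : lineForm (Pi.single 0 1) x = 0 := by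
  rw [stdFrame_zero, stdFrame_one] at h
  rw [lineForm, volForm₂_apply]
  rcases h with h | h
  · exact (volForm n).map_eq_zero_of_eq _ (i := 0) (j := i.succ.succ) h.symm (by simp [Fin.ext_iff])
  · exact (volForm n).map_eq_zero_of_eq _ (i := 1) (j := i.succ.succ) h.symm (by simp [Fin.ext_iff])

theorem lineForm_removeNth_eq_zero {k : Fin (2 * n + 1 + 1)} {i : Fin (2 * n + 1)}
    {r : Fin (2 * n + 1 + 1)} (hr : r = 0 ∨ r = 1) (hk : k ≠ r) (hi : k.succAbove i ≠ r) :
    lineForm (Pi.single 0 1) (i.removeNth (k.removeNth (stdFrame n))) = 0 := by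
  obtain ⟨i₁, rfl⟩ := Fin.exists_succAbove_eq hk.symm
  have h1 : i₁ ≠ i := fun h => hi (by rw [h])
  obtain ⟨i₂, rfl⟩ := Fin.exists_succAbove_eq h1
  refine lineForm_eq_zero_of_eq (i := i₂) ?_
  simp only [Fin.removeNth]
  rcases hr with h | h
  · exact Or.inl (by rw [h])
  · exact Or.inr (by rw [h])

theorem lineForm_stdFrame : lineForm (Pi.single 0 1) (fun i => stdFrame n i.succ.succ) = 1 := by
  rw [lineForm, volForm₂_apply]
  refine Eq.trans ?_ (volForm_stdFrame (n := n))
  congr 1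
  funext k
  refine Fin.cases ?_ (fun k => Fin.cases ?_ (fun k => ?_) k) k
  · exact stdFrame_zero.symm
  · exact stdFrame_one.symm
  · rfl

variable {χ : (Fin (n + 1) → ℂ) → ℂ}

/-- The coefficients of `∂̄χ`. -/
def delbarFun (χ : (Fin (n + 1) → ℂ) → ℂ) (u z : Fin (n + 1) → ℂ) : ℂ :=
  (1 / 2 : ℂ) * (fderiv ℝ χ z u + Complex.I * fderiv ℝ χ z (Complex.I • u))

theorem extDeriv_smul_const {k : ℕ} (hχ : Differentiable ℝ χ)
    (θ : (Fin (n + 1) → ℂ) [⋀^Fin k]→L[ℝ] ℂ) (z : Fin (n + 1) → ℂ)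
    (v : Fin (k + 1) → Fin (n + 1) → ℂ) :
    extDeriv (fun z => χ z • θ) z v =
      ∑ i, (-1) ^ i.val • (fderiv ℝ χ z (v i) * θ (i.removeNth v)) := by
  rw [extDeriv_apply ((hχ z).smul_const θ)]
  refine Finset.sum_congr rfl fun i _ => ?_
  congr 1
  have : (fun z => (χ z • θ) (i.removeNth v)) = fun z => χ z * θ (i.removeNth v) := rfl
  rw [this, fderiv_mul_const (hχ z)]
  simp [mul_comm]

theorem delbar_smul_lineForm (hχ : Differentiable ℝ χ) (e z : Fin (n + 1) → ℂ)
    (v : Fin (2 * n + 1) → Fin (n + 1) → ℂ) :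
    delbar (fun z => χ z • lineForm e) z v =
      ∑ i, (-1) ^ i.val • (delbarFun χ (v i) z * lineForm e (i.removeNth v)) := by
  have h1 : ∀ i : Fin (2 * n + 1), lineForm e (i.removeNth fun k => mulI (n + 1) (v k)) =
      lineForm e (i.removeNth v) := fun i => by
    conv_rhs => rw [← lineForm_comp_mulI]
    rfl
  have h2 : delbar (fun z => χ z • lineForm e) z v = (1 / 2 : ℂ) *
      (extDeriv (fun z => χ z • lineForm e) z v + Complex.I *
        extDeriv (fun z => χ z • lineForm e) z (fun k => mulI (n + 1) (v k))) := rfl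
  rw [h2, extDeriv_smul_const hχ, extDeriv_smul_const hχ]
  simp_rw [h1]
  rw [Finset.mul_sum, ← Finset.sum_add_distrib, Finset.mul_sum]
  refine Finset.sum_congr rfl fun i _ => ?_
  have h3 : mulI (n + 1) (v i) = Complex.I • v i := rfl
  rw [h3, delbarFun]
  simp only [zsmul_eq_mul]
  ring

theorem differentiable_delbarFun (hχ : ContDiff ℝ 2 χ) (u : Fin (n + 1) → ℂ) :
    Differentiable ℝ (delbarFun χ u) := by
  have h1 : Differentiable ℝ (fderiv ℝ χ) :=
    (hχ.fderiv_right (m := 1) (by norm_num)).differentiable (by norm_num)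
  unfold delbarFun
  fun_prop

/-- The line form vanishes as soon as one of its arguments is `e` or `ie`. Of the double sum over
the two omitted frame vectors only the terms omitting exactly these two survive. In them the mixed
second derivatives cancel by symmetry, and the Laplacian in the first coordinate remains. -/
theorem topCoeff_ddbar_smul_lineForm (hχ : ContDiff ℝ 2 χ) (z : Fin (n + 1) → ℂ) :
    topCoeff (ddbar (fun z => χ z • lineForm (Pi.single 0 1)) z) =
      -(Complex.I / 2) * (fderiv ℝ (fderiv ℝ χ) z (Pi.single 0 1) (Pi.single 0 1) +
        fderiv ℝ (fderiv ℝ χ) z (Complex.I • Pi.single 0 1) (Complex.I • Pi.single 0 1)) := by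
  set e : Fin (n + 1) → ℂ := Pi.single 0 1 with he
  have hχd : Differentiable ℝ χ := hχ.differentiable (by norm_num)
  have hη : ContDiff ℝ 2 fun z => χ z • lineForm e := hχ.smul contDiff_const
  have hdb : DifferentiableAt ℝ (delbar fun z => χ z • lineForm e) z :=
    (contDiffAt_delbar (r := 2) (s := 1) hη.contDiffAt (by norm_num)).differentiableAt (by norm_num)
  have h1 : topCoeff (ddbar (fun z => χ z • lineForm e) z) =
      ∑ k : Fin (2 * n + 1 + 1), (-1) ^ k.val • ∑ i : Fin (2 * n + 1), (-1) ^ i.val •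
        (fderiv ℝ (delbarFun χ (k.removeNth (stdFrame n) i)) z (stdFrame n k) *
          lineForm e (i.removeNth (k.removeNth (stdFrame n)))) := by
    change extDeriv (delbar fun z => χ z • lineForm e) z (stdFrame n) = _
    rw [extDeriv_apply hdb]
    refine Finset.sum_congr rfl fun k _ => ?_
    congr 1
    simp_rw [delbar_smul_lineForm hχd]
    rw [fderiv_fun_sum fun i _ => ((differentiable_delbarFun hχ _ z).mul_const _).fun_const_smul _,
      _root_.sum_apply]
    refine Finset.sum_congr rfl fun i _ => ?_
    rw [fderiv_fun_const_smul ((differentiable_delbarFun hχ _ z).mul_const _),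
      fderiv_mul_const (differentiable_delbarFun hχ _ z)]
    simp [mul_comm]
  have h2 : ∀ k : Fin (2 * n + 1 + 1), ∑ i : Fin (2 * n + 1), (-1) ^ i.val •
        (fderiv ℝ (delbarFun χ (k.removeNth (stdFrame n) i)) z (stdFrame n k) *
          lineForm e (i.removeNth (k.removeNth (stdFrame n)))) =
      fderiv ℝ (delbarFun χ (k.removeNth (stdFrame n) 0)) z (stdFrame n k) *
          lineForm e ((0 : Fin (2 * n + 1)).removeNth (k.removeNth (stdFrame n))) := fun k => by
    rw [Fin.sum_univ_succ]
    have h3 : ∀ i : Fin (2 * n), lineForm e (i.succ.removeNth (k.removeNth (stdFrame n))) = 0 := by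
      intro i
      by_cases hk : k = 0
      · subst hk
        refine lineForm_removeNth_eq_zero (Or.inr rfl) (by simp) ?_
        simp [Fin.ext_iff]
      · refine lineForm_removeNth_eq_zero (Or.inl rfl) hk ?_
        exact Fin.succAbove_ne_zero hk (Fin.succ_ne_zero i)
    simp [h3]
  have h4 : ∀ k : Fin (2 * n), lineForm e
      ((0 : Fin (2 * n + 1)).removeNth ((k.succ.succ).removeNth (stdFrame n))) = 0 := fun k =>
    lineForm_removeNth_eq_zero (Or.inr rfl) (by simp [Fin.ext_iff]) (by
      rw [Fin.succAbove_ne_zero_zero (Fin.succ_ne_zero _)]; simp)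
  have hw0 : (0 : Fin (2 * n + 1 + 1)).removeNth (stdFrame n) 0 = Complex.I • e := stdFrame_one
  have hw1 : (1 : Fin (2 * n + 1 + 1)).removeNth (stdFrame n) 0 = e := by
    simp only [Fin.removeNth]
    rw [Fin.succAbove_ne_zero_zero (by simp)]
    exact stdFrame_zero
  have hl0 : lineForm e ((0 : Fin (2 * n + 1)).removeNth
      ((0 : Fin (2 * n + 1 + 1)).removeNth (stdFrame n))) = 1 := lineForm_stdFrame
  have hl1 : lineForm e ((0 : Fin (2 * n + 1)).removeNth
      ((1 : Fin (2 * n + 1 + 1)).removeNth (stdFrame n))) = 1 := by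
    rw [← lineForm_stdFrame (n := n)]
    congr 1
  have hD : ∀ u v, fderiv ℝ (delbarFun χ u) z v = (1 / 2 : ℂ) *
      (fderiv ℝ (fderiv ℝ χ) z v u + Complex.I * fderiv ℝ (fderiv ℝ χ) z v (Complex.I • u)) := by
    intro u v
    have hF : HasFDerivAt (fderiv ℝ χ) (fderiv ℝ (fderiv ℝ χ) z) z :=
      ((hχ.fderiv_right (m := 1) (by norm_num)).differentiable (by norm_num) z).hasFDerivAt
    have ha : ∀ u, HasFDerivAt (fun z => fderiv ℝ χ z u) ((fderiv ℝ (fderiv ℝ χ) z).flip u) z :=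
      fun u => by simpa using hF.clm_apply (hasFDerivAt_const u z)
    have hb := ((ha u).add ((ha (Complex.I • u)).const_mul Complex.I)).const_mul (1 / 2 : ℂ)
    rw [show delbarFun χ u = fun z => (1 / 2 : ℂ) * ((fun z => fderiv ℝ χ z u) z +
      Complex.I * (fun z => fderiv ℝ χ z (Complex.I • u)) z) from rfl]
    exact congrArg (fun L => L v) hb.fderiv
  have hsym : fderiv ℝ (fderiv ℝ χ) z e (Complex.I • e) =
      fderiv ℝ (fderiv ℝ χ) z (Complex.I • e) e :=
    (hχ.contDiffAt.isSymmSndFDerivAt (by simp)) e (Complex.I • e)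
  rw [h1]
  simp_rw [h2]
  rw [Fin.sum_univ_succ, Fin.sum_univ_succ]
  simp only [h4, mul_zero, smul_zero, Finset.sum_const_zero, add_zero, Fin.succ_zero_eq_one]
  rw [hl0, hl1, hw0, hw1, stdFrame_zero, stdFrame_one, ← he, hD, hD, I_smul_I_smul, map_neg, hsym]
  simp only [Fin.val_zero, Fin.val_one, pow_zero, pow_one, one_smul, neg_smul]
  ring

end DdbarLine

/-! ## The Poincaré-Lelong formula on open subsets of `ℂ^(n+1)` -/

section PoincareLelong

theorem _root_.MeasureTheory.LocallyIntegrableOn.integrable_mul_of_hasCompactSupport {α : Type*}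
    [TopologicalSpace α] [T2Space α] [MeasurableSpace α] [OpensMeasurableSpace α]
    {μ : Measure α} {u θ : α → ℂ} {U : Set α}
    (hu : LocallyIntegrableOn u U μ) (hθ : Continuous θ) (hc : HasCompactSupport θ)
    (hs : tsupport θ ⊆ U) : Integrable (fun z => u z * θ z) μ := by
  have h := (hu.integrableOn_compact_subset hs hc).mul_continuousOn hθ.continuousOn hc
  refine (integrableOn_iff_integrable_of_support_subset fun z hz => ?_).1 h
  exact subset_tsupport θ (right_ne_zero_of_mul hz)

theorem _root_.MeasureTheory.LocallyIntegrableOn.ofReal {α : Type*}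
    [TopologicalSpace α] [MeasurableSpace α] {μ : Measure α} {u : α → ℝ} {U : Set α}
    (hu : LocallyIntegrableOn u U μ) : LocallyIntegrableOn (fun z => (u z : ℂ)) U μ :=
  fun z hz => (hu z hz).imp fun _ h => ⟨h.1, h.2.ofReal⟩

variable {n : ℕ}

theorem insertNth_zero_eq (t : ℂ) (w : Fin n → ℂ) :
    ((0 : Fin (n + 1)).insertNth t w : Fin (n + 1) → ℂ) =
      ContinuousLinearMap.single ℝ (fun _ : Fin (n + 1) => ℂ) 0 t +
        (0 : Fin (n + 1)).insertNth 0 w := by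
  ext i
  refine Fin.cases ?_ (fun i => ?_) i <;> simp

theorem hasFDerivAt_insertNth_zero (t : ℂ) (w : Fin n → ℂ) :
    HasFDerivAt (fun t : ℂ => ((0 : Fin (n + 1)).insertNth t w : Fin (n + 1) → ℂ))
      (ContinuousLinearMap.single ℝ (fun _ : Fin (n + 1) => ℂ) 0) t := by
  rw [funext fun t => insertNth_zero_eq t w]
  exact (ContinuousLinearMap.hasFDerivAt _).add_const _

theorem contDiff_insertNth_zero {r : WithTop ℕ∞} (w : Fin n → ℂ) :
    ContDiff ℝ r (fun t : ℂ => ((0 : Fin (n + 1)).insertNth t w : Fin (n + 1) → ℂ)) := by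
  rw [funext fun t => insertNth_zero_eq t w]
  exact (ContinuousLinearMap.contDiff _).add contDiff_const

/-- The Laplacian in the first coordinate. -/
def axisLaplacian (χ : (Fin (n + 1) → ℂ) → ℂ) (z : Fin (n + 1) → ℂ) : ℂ :=
  fderiv ℝ (fderiv ℝ χ) z (Pi.single 0 1) (Pi.single 0 1) +
    fderiv ℝ (fderiv ℝ χ) z (Complex.I • Pi.single 0 1) (Complex.I • Pi.single 0 1)

variable {χ : (Fin (n + 1) → ℂ) → ℂ}

theorem planeLaplacian_insertNth (hχ : ContDiff ℝ 2 χ) (w : Fin n → ℂ) (t : ℂ) :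
    planeLaplacian (fun t => χ ((0 : Fin (n + 1)).insertNth t w)) t =
      axisLaplacian χ ((0 : Fin (n + 1)).insertNth t w) := by
  have h1 : ∀ s v : ℂ, fderiv ℝ (fun t => χ ((0 : Fin (n + 1)).insertNth t w)) s v =
      fderiv ℝ χ ((0 : Fin (n + 1)).insertNth s w) (Pi.single 0 v) := fun s v => by
    have := ((hχ.differentiable (by norm_num)).differentiableAt
      (x := (0 : Fin (n + 1)).insertNth s w)).hasFDerivAt.comp s (hasFDerivAt_insertNth_zero s w)
    simpa [Function.comp_def] using congrArg (· v) this.fderiv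
  have h2 : ∀ v : ℂ, fderiv ℝ (fun s => fderiv ℝ (fun t =>
        χ ((0 : Fin (n + 1)).insertNth t w)) s v) t v =
      fderiv ℝ (fderiv ℝ χ) ((0 : Fin (n + 1)).insertNth t w) (Pi.single 0 v)
        (Pi.single 0 v) := fun v => by
    simp only [h1]
    have hd : Differentiable ℝ (fderiv ℝ χ) :=
      (hχ.fderiv_right (m := 1) (by norm_num)).differentiable (by norm_num)
    have := ((hd ((0 : Fin (n + 1)).insertNth t w)).hasFDerivAt.comp t
      (hasFDerivAt_insertNth_zero t w)).clm_apply
      (hasFDerivAt_const (Pi.single 0 v : Fin (n + 1) → ℂ) t)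
    simpa using congrArg (· v) this.fderiv
  have h3 : (Pi.single 0 Complex.I : Fin (n + 1) → ℂ) = Complex.I • Pi.single 0 1 := by
    rw [← Pi.single_smul]; simp
  rw [planeLaplacian, h2, h2, h3, axisLaplacian]

theorem continuous_axisLaplacian (hχ : ContDiff ℝ 2 χ) : Continuous (axisLaplacian χ) := by
  have h : Continuous (fderiv ℝ (fderiv ℝ χ)) :=
    (hχ.fderiv_right (m := 1) (by norm_num)).continuous_fderiv (by norm_num)
  exact ((h.clm_apply continuous_const).clm_apply continuous_const).add
    ((h.clm_apply continuous_const).clm_apply continuous_const)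

theorem tsupport_axisLaplacian_subset (χ : (Fin (n + 1) → ℂ) → ℂ) :
    tsupport (axisLaplacian χ) ⊆ tsupport χ := by
  refine (closure_mono fun z hz => ?_).trans
    ((tsupport_fderiv_subset ℝ (f := fderiv ℝ χ)).trans (tsupport_fderiv_subset ℝ))
  contrapose! hz
  simp only [Function.mem_support, ne_eq, not_not] at hz ⊢
  simp [axisLaplacian, hz]

theorem hasCompactSupport_insertNth (hc : HasCompactSupport χ) (w : Fin n → ℂ) :
    HasCompactSupport fun t => χ ((0 : Fin (n + 1)).insertNth t w) := by
  refine HasCompactSupport.intro (hc.image (continuous_apply (0 : Fin (n + 1)))) fun t ht => ?_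
  by_contra h0
  exact ht ⟨_, subset_tsupport χ h0, by simp⟩

theorem tsupport_insertNth_subset (χ : (Fin (n + 1) → ℂ) → ℂ) (w : Fin n → ℂ) :
    tsupport (fun t => χ ((0 : Fin (n + 1)).insertNth t w)) ⊆
      {t | ((0 : Fin (n + 1)).insertNth t w : Fin (n + 1) → ℂ) ∈ tsupport χ} :=
  tsupport_comp_subset_preimage χ (contDiff_insertNth_zero (r := 0) w).continuous

theorem measurePreserving_insertNth (n : ℕ) :
    MeasurePreserving (fun p : ℂ × (Fin n → ℂ) =>
      ((0 : Fin (n + 1)).insertNth p.1 p.2 : Fin (n + 1) → ℂ)) volume volume :=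
  (volume_preserving_piFinSuccAbove (fun _ => ℂ) (0 : Fin (n + 1))).symm

theorem integrable_insertNth {f : (Fin (n + 1) → ℂ) → ℂ} (hf : Integrable f) :
    Integrable fun p : ℂ × (Fin n → ℂ) => f ((0 : Fin (n + 1)).insertNth p.1 p.2) :=
  (measurePreserving_insertNth n).integrable_comp_of_integrable hf

theorem integral_integral_insertNth {f : (Fin (n + 1) → ℂ) → ℂ} (hf : Integrable f) :
    ∫ w : Fin n → ℂ, ∫ t : ℂ, f ((0 : Fin (n + 1)).insertNth t w) = ∫ z, f z := by
  rw [← (measurePreserving_insertNth n).integral_comp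
    (MeasurableEquiv.piFinSuccAbove (fun _ => ℂ) (0 : Fin (n + 1))).symm.measurableEmbedding]
  exact (integral_prod_symm _ (integrable_insertNth hf)).symm

variable {F : (Fin (n + 1) → ℂ) → ℂ} {U : Set (Fin (n + 1) → ℂ)}

theorem ae_mem_zeroSheet_iff (hU : IsOpen U) (hF : IsNonvanishingOn F U) :
    ∀ᵐ w : Fin n → ℂ, ∀ t, (0 : Fin (n + 1)).insertNth t w ∈ U →
      ((0 : Fin (n + 1)).insertNth t w ∈ zeroSheet F 0 ↔ F ((0 : Fin (n + 1)).insertNth t w) = 0) ∧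
      (F ((0 : Fin (n + 1)).insertNth t w) = 0 →
        zeroMultiplicity F ((0 : Fin (n + 1)).insertNth t w) =
          analyticOrderNatAt (fun t => F ((0 : Fin (n + 1)).insertNth t w)) t) := by
  filter_upwards [ae_isRegularZero_slice hU hF 0] with w hw t ht
  refine ⟨⟨fun h => ?_, fun h => ?_⟩, fun h => ?_⟩
  · obtain ⟨k, l, hl⟩ := exists_isRegularZero_of_mem_zeroSheet h
    exact hl.eq_zero
  · obtain ⟨l, hl, hl0⟩ := hw t ht h
    exact (hl.mem_zeroSheet_iff 0).2 ⟨hl0, fun i hi => absurd hi (Fin.not_lt_zero i)⟩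
  · obtain ⟨l, hl, -⟩ := hw t ht h
    exact zeroMultiplicity_eq hl

/-- The one-variable formula on almost every line, where the points of the sheet are exactly the
zeros of the slice and the multiplicities agree. The null set of lines depends on `F` only, not on
`χ`. -/
theorem ae_tsum_zeroMultiplicity_mul (hU : IsOpen U) (hF : IsNonvanishingOn F U) :
    ∀ᵐ w : Fin n → ℂ, ∀ χ : (Fin (n + 1) → ℂ) → ℂ, ContDiff ℝ 2 χ → HasCompactSupport χ →
      tsupport χ ⊆ U →
      (Function.support fun t : {t : ℂ // (0 : Fin (n + 1)).insertNth t w ∈ U ∩ zeroSheet F 0} =>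
        (zeroMultiplicity F ((0 : Fin (n + 1)).insertNth t.1 w) : ℂ) *
          χ ((0 : Fin (n + 1)).insertNth t.1 w)).Finite ∧
      ∑' t : {t : ℂ // (0 : Fin (n + 1)).insertNth t w ∈ U ∩ zeroSheet F 0},
        (zeroMultiplicity F ((0 : Fin (n + 1)).insertNth t.1 w) : ℂ) *
          χ ((0 : Fin (n + 1)).insertNth t.1 w) =
      (2 * Real.pi : ℂ)⁻¹ * ∫ t, (Real.log ‖F ((0 : Fin (n + 1)).insertNth t w)‖ : ℂ) *
        axisLaplacian χ ((0 : Fin (n + 1)).insertNth t w) := by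
  filter_upwards [ae_mem_zeroSheet_iff hU hF, ae_isNonvanishingOn_slice hU hF 0]
    with w hw hnv χ hχ hc hs
  obtain ⟨hfin, hsum⟩ := tsum_order_mul_eq_integral_log hnv
    (hχ.comp (contDiff_insertNth_zero w))
    (hasCompactSupport_insertNth hc w) ((tsupport_insertNth_subset χ w).trans fun t ht => hs ht)
  simp only [planeLaplacian_insertNth hχ, Function.comp_def] at hsum
  constructor
  · refine Set.Finite.of_finite_image (f := Subtype.val) (hfin.subset ?_) Subtype.val_injective.injOn
    rintro _ ⟨t, ht, rfl⟩
    exact ⟨subset_tsupport _ (right_ne_zero_of_mul ht), ((hw t.1 t.2.1).1).1 t.2.2⟩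
  · rw [← hsum]
    have hiff : ∀ t : ℂ, (0 : Fin (n + 1)).insertNth t w ∈ U ∩ zeroSheet F 0 ↔
        t ∈ {t | (0 : Fin (n + 1)).insertNth t w ∈ U} ∧ F ((0 : Fin (n + 1)).insertNth t w) = 0 :=
      fun t => ⟨fun h => ⟨h.1, ((hw t h.1).1).1 h.2⟩, fun h => ⟨h.1, ((hw t h.1).1).2 h.2⟩⟩
    rw [← (Equiv.subtypeEquivRight hiff).tsum_eq]
    refine tsum_congr fun t => ?_
    rw [((hw t.1 t.2.1).2 (((hw t.1 t.2.1).1).1 t.2.2))]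
    rfl

/-- The integrand of the Poincaré-Lelong formula is integrable. -/
theorem IsNonvanishingOn.integrable_log_mul (hU : IsOpen U) (hF : IsNonvanishingOn F U)
    {θ : (Fin (n + 1) → ℂ) → ℂ} (hθ : Continuous θ) (hc : HasCompactSupport θ)
    (hs : tsupport θ ⊆ U) : Integrable fun z => (Real.log ‖F z‖ : ℂ) * θ z :=
  (hF.locallyIntegrableOn_log hU).ofReal.integrable_mul_of_hasCompactSupport hθ hc hs

theorem integrable_log_mul_axisLaplacian (hU : IsOpen U) (hF : IsNonvanishingOn F U)
    (hχ : ContDiff ℝ 2 χ) (hc : HasCompactSupport χ) (hs : tsupport χ ⊆ U) :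
    Integrable fun z => (Real.log ‖F z‖ : ℂ) * axisLaplacian χ z :=
  hF.integrable_log_mul hU (continuous_axisLaplacian hχ)
    (hc.of_isClosed_subset (isClosed_tsupport _) (tsupport_axisLaplacian_subset χ))
    ((tsupport_axisLaplacian_subset χ).trans hs)

theorem zeroCoeff_smul_lineForm {j : Fin (n + 1)} {z : Fin (n + 1) → ℂ} (hz : z ∈ zeroSheet F j) :
    zeroCoeff F (fun z => χ z • lineForm (Pi.single 0 1)) j z =
      if j = 0 then (zeroMultiplicity F z : ℂ) * χ z else 0 := by
  simp only [zeroCoeff, ContinuousAlternatingMap.smul_apply, smul_eq_mul]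
  split_ifs with h
  · subst h
    rw [lineForm_zeroTangent_zero hz, mul_one]
  · rw [lineForm_zeroTangent_of_ne h hz, mul_zero, mul_zero]

/-- Only the sheet `j = 0` contributes; there the one-variable formula is integrated over the lines
by Fubini. The constants match because `(i/π)(-i/2) = 1/(2π)`. -/
theorem zeroIntegralOn_smul_lineForm (hU : IsOpen U) (hF : IsNonvanishingOn F U)
    (hχ : ContDiff ℝ 2 χ) (hc : HasCompactSupport χ) (hs : tsupport χ ⊆ U) :
    zeroIntegralOn F (fun z => χ z • lineForm (Pi.single 0 1)) U =
      Complex.I / Real.pi * ∫ z, (Real.log ‖F z‖ : ℂ) *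
        topCoeff (ddbar (fun z => χ z • lineForm (Pi.single 0 1)) z) := by
  have h0 : ∀ j ≠ (0 : Fin (n + 1)), ∫ w : Fin n → ℂ,
      ∑' t : {t : ℂ // (j.insertNth t w : Fin (n + 1) → ℂ) ∈ U ∩ zeroSheet F j},
        zeroCoeff F (fun z => χ z • lineForm (Pi.single 0 1)) j (j.insertNth t.1 w) = 0 :=
    fun j hj => by
      rw [← integral_zero (Fin n → ℂ) ℂ]
      refine integral_congr_ae (Eventually.of_forall fun w => ?_)
      simp only
      refine (tsum_congr fun t => ?_).trans tsum_zero
      rw [zeroCoeff_smul_lineForm t.2.2, if_neg hj]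
  rw [zeroIntegralOn, Finset.sum_eq_single 0 (fun j _ hj => h0 j hj) (by simp)]
  have h1 : ∫ w : Fin n → ℂ,
      ∑' t : {t : ℂ // ((0 : Fin (n + 1)).insertNth t w : Fin (n + 1) → ℂ) ∈ U ∩ zeroSheet F 0},
        zeroCoeff F (fun z => χ z • lineForm (Pi.single 0 1)) 0 ((0 : Fin (n + 1)).insertNth t.1 w) =
      ∫ w : Fin n → ℂ, (2 * Real.pi : ℂ)⁻¹ *
        ∫ t, (Real.log ‖F ((0 : Fin (n + 1)).insertNth t w)‖ : ℂ) *
          axisLaplacian χ ((0 : Fin (n + 1)).insertNth t w) := by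
    refine integral_congr_ae ?_
    filter_upwards [ae_tsum_zeroMultiplicity_mul hU hF] with w hw
    rw [← (hw χ hχ hc hs).2]
    exact tsum_congr fun t => by rw [zeroCoeff_smul_lineForm t.2.2, if_pos rfl]
  rw [h1, integral_const_mul, integral_integral_insertNth
    (f := fun z => (Real.log ‖F z‖ : ℂ) * axisLaplacian χ z)
    (integrable_log_mul_axisLaplacian hU hF hχ hc hs)]
  have h2 : ∀ z, (Real.log ‖F z‖ : ℂ) *
      topCoeff (ddbar (fun z => χ z • lineForm (Pi.single 0 1)) z) =
        -(Complex.I / 2) * ((Real.log ‖F z‖ : ℂ) * axisLaplacian χ z) := fun z => by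
    rw [topCoeff_ddbar_smul_lineForm hχ z, axisLaplacian]; ring
  simp only [h2]
  rw [integral_const_mul, ← mul_assoc]
  congr 1
  have hpi : (Real.pi : ℂ) ≠ 0 := by exact_mod_cast Real.pi_ne_zero
  field_simp
  rw [Complex.I_sq, neg_neg]

theorem tsum_enorm_ofReal {ι : Type*} {f : ι → ℝ} (hf : ∀ i, 0 ≤ f i)
    (hfin : (Function.support fun i => (f i : ℂ)).Finite) :
    ∑' i, ‖(f i : ℂ)‖ₑ = ‖∑' i, (f i : ℂ)‖ₑ := by
  have hs : Summable f := summable_of_hasFiniteSupport (hfin.subset fun i hi => by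
    simpa using hi)
  rw [← Complex.ofReal_tsum]
  simp only [← ofReal_norm, Complex.norm_real, Real.norm_of_nonneg (hf _),
    Real.norm_of_nonneg (tsum_nonneg hf)]
  exact (ENNReal.ofReal_tsum_of_nonneg hf hs).symm

/-- For a nonnegative smooth weight the total mass equals the integral, which the slice formula
expresses through an integrable function. Since `|χ|` is not smooth, it is first dominated by a
multiple of a nonnegative smooth cutoff `ρ`. -/
theorem zeroMassOn_smul_lineForm_lt_top (hU : IsOpen U) (hF : IsNonvanishingOn F U)
    (hχ : Continuous χ) (hc : HasCompactSupport χ) (hs : tsupport χ ⊆ U) :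
    zeroMassOn F (fun z => χ z • lineForm (Pi.single 0 1)) U < ⊤ := by
  obtain ⟨C, hC⟩ := hc.exists_bound_of_continuous hχ
  obtain ⟨V, hVo, hsV, hVU, hVc⟩ := exists_open_between_and_isCompact_closure hc hU hs
  obtain ⟨ρ, hρ, hρr, hρs, hρ1⟩ := exists_contMDiff_support_eq_eq_one_iff
    𝓘(ℝ, Fin (n + 1) → ℂ) (n := 2) hVo (isClosed_tsupport χ) hsV
  have hρ0 : ∀ z, 0 ≤ ρ z := fun z => (hρr (mem_range_self z)).1
  have hρd : ContDiff ℝ 2 fun z => (ρ z : ℂ) := Complex.ofRealCLM.contDiff.comp hρ.contDiff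
  have hts : tsupport (fun z => (ρ z : ℂ)) ⊆ closure V := by
    refine closure_mono fun z hz => hρs.subset ?_
    simpa using hz
  have hρc : HasCompactSupport fun z => (ρ z : ℂ) :=
    hVc.of_isClosed_subset (isClosed_tsupport _) hts
  have hχρ : ∀ z, ‖χ z‖ₑ ≤ ENNReal.ofReal C * ‖(ρ z : ℂ)‖ₑ := fun z => by
    by_cases hz : z ∈ tsupport χ
    · rw [(hρ1 z).1 hz]
      rw [Complex.ofReal_one, enorm_one, mul_one, ← ofReal_norm]
      exact ENNReal.ofReal_le_ofReal (hC z)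
    · rw [image_eq_zero_of_notMem_tsupport hz]; simp
  have h0 : ∀ j, ∫⁻ w : Fin n → ℂ,
      ∑' t : {t : ℂ // (j.insertNth t w : Fin (n + 1) → ℂ) ∈ U ∩ zeroSheet F j},
        ‖zeroCoeff F (fun z => χ z • lineForm (Pi.single 0 1)) j (j.insertNth t.1 w)‖ₑ < ⊤ := by
    intro j
    by_cases hj : j = 0
    · subst hj
      have hle : ∫⁻ w : Fin n → ℂ,
          ∑' t : {t : ℂ // ((0 : Fin (n + 1)).insertNth t w : Fin (n + 1) → ℂ) ∈ U ∩ zeroSheet F 0},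
            ‖zeroCoeff F (fun z => χ z • lineForm (Pi.single 0 1)) 0
              ((0 : Fin (n + 1)).insertNth t.1 w)‖ₑ ≤
          ∫⁻ w : Fin n → ℂ, ENNReal.ofReal C * (‖(2 * Real.pi : ℂ)⁻¹‖ₑ *
            ‖∫ t, (Real.log ‖F ((0 : Fin (n + 1)).insertNth t w)‖ : ℂ) *
              axisLaplacian (fun z => (ρ z : ℂ)) ((0 : Fin (n + 1)).insertNth t w)‖ₑ) := by
        refine lintegral_mono_ae ?_
        filter_upwards [ae_tsum_zeroMultiplicity_mul hU hF] with w hw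
        obtain ⟨hfin, hsum⟩ := hw _ hρd hρc (hts.trans hVU)
        rw [← enorm_mul, ← hsum, ← ENNReal.tsum_mul_left.trans (congrArg _ (by
          have := tsum_enorm_ofReal (f := fun t : {t : ℂ // (0 : Fin (n + 1)).insertNth t w ∈
              U ∩ zeroSheet F 0} => (zeroMultiplicity F ((0 : Fin (n + 1)).insertNth t.1 w) : ℝ) *
            ρ ((0 : Fin (n + 1)).insertNth t.1 w))
            (fun t => mul_nonneg (Nat.cast_nonneg _) (hρ0 _)) (by simpa using hfin)
          push_cast at this
          exact this))]
        refine ENNReal.tsum_le_tsum fun t => ?_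
        rw [zeroCoeff_smul_lineForm t.2.2, if_pos rfl, enorm_mul, enorm_mul, mul_left_comm]
        gcongr
        exact hχρ _
      refine hle.trans_lt ?_
      have hint := (integrable_insertNth
        (integrable_log_mul_axisLaplacian hU hF hρd hρc (hts.trans hVU))).integral_prod_right.2
      rw [lintegral_const_mul' _ _ ENNReal.ofReal_ne_top, lintegral_const_mul' _ _ enorm_ne_top]
      exact ENNReal.mul_lt_top ENNReal.ofReal_lt_top (ENNReal.mul_lt_top enorm_lt_top hint)
    · have hz : ∀ w : Fin n → ℂ,
          ∑' t : {t : ℂ // (j.insertNth t w : Fin (n + 1) → ℂ) ∈ U ∩ zeroSheet F j},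
            ‖zeroCoeff F (fun z => χ z • lineForm (Pi.single 0 1)) j (j.insertNth t.1 w)‖ₑ = 0 :=
        fun w => ENNReal.tsum_eq_zero.2 fun t => by
          rw [zeroCoeff_smul_lineForm t.2.2, if_neg hj, enorm_zero]
      simp only [hz, lintegral_zero]
      exact ENNReal.zero_lt_top
  exact ENNReal.sum_lt_top.2 fun j _ => h0 j

end PoincareLelong

/-! ### From one line form to all compactly supported forms of bidegree `(n, n)`. -/

section PoincareLelongGeneral

variable {n : ℕ} {F F' : (Fin (n + 1) → ℂ) → ℂ} {U S : Set (Fin (n + 1) → ℂ)}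
  {η η' : (Fin (n + 1) → ℂ) → (Fin (n + 1) → ℂ) [⋀^Fin (2 * n)]→L[ℝ] ℂ}
  {G : OpenPartialHomeomorph (Fin (n + 1) → ℂ) (Fin (n + 1) → ℂ)}

theorem zeroCoeff_finsetSum {ι : Type*} (s : Finset ι)
    (η : ι → (Fin (n + 1) → ℂ) → (Fin (n + 1) → ℂ) [⋀^Fin (2 * n)]→L[ℝ] ℂ) (j : Fin (n + 1))
    (z : Fin (n + 1) → ℂ) :
    zeroCoeff F (fun z => ∑ i ∈ s, η i z) j z = ∑ i ∈ s, zeroCoeff F (η i) j z := by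
  simp only [zeroCoeff, ContinuousAlternatingMap.sum_apply, Finset.mul_sum]

theorem zeroMassOn_finsetSum_le {ι : Type*} (s : Finset ι)
    {η : ι → (Fin (n + 1) → ℂ) → (Fin (n + 1) → ℂ) [⋀^Fin (2 * n)]→L[ℝ] ℂ}
    (hη : ∀ i ∈ s, ContinuousOn (η i) U) (hS : MeasurableSet S) (hSU : S ⊆ U) :
    zeroMassOn F (fun z => ∑ i ∈ s, η i z) S ≤ ∑ i ∈ s, zeroMassOn F (η i) S := by
  rw [zeroMassOn_eq_lintegral (continuousOn_finsetSum s hη) hS hSU, Finset.sum_congr rfl fun i hi =>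
    zeroMassOn_eq_lintegral (hη i hi) hS hSU, Finset.sum_comm]
  refine Finset.sum_le_sum fun j _ => ?_
  simp only [zeroCoeff_finsetSum]
  rw [← lintegral_finsetSum' _ fun i hi =>
    (aestronglyMeasurable_zeroCoeff (hη i hi) hS hSU).enorm]
  exact lintegral_mono fun z => enorm_sum_le _ _

theorem zeroMassOn_finsetSum_lt_top {ι : Type*} (s : Finset ι)
    {η : ι → (Fin (n + 1) → ℂ) → (Fin (n + 1) → ℂ) [⋀^Fin (2 * n)]→L[ℝ] ℂ}
    (hη : ∀ i ∈ s, ContinuousOn (η i) U) (hS : MeasurableSet S) (hSU : S ⊆ U)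
    (hfin : ∀ i ∈ s, zeroMassOn F (η i) S < ⊤) :
    zeroMassOn F (fun z => ∑ i ∈ s, η i z) S < ⊤ :=
  (zeroMassOn_finsetSum_le s hη hS hSU).trans_lt (ENNReal.sum_lt_top.2 hfin)

theorem zeroIntegralOn_finsetSum {ι : Type*} (s : Finset ι)
    {η : ι → (Fin (n + 1) → ℂ) → (Fin (n + 1) → ℂ) [⋀^Fin (2 * n)]→L[ℝ] ℂ}
    (hη : ∀ i ∈ s, ContinuousOn (η i) U) (hS : MeasurableSet S) (hSU : S ⊆ U)
    (hfin : ∀ i ∈ s, zeroMassOn F (η i) S < ⊤) :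
    zeroIntegralOn F (fun z => ∑ i ∈ s, η i z) S = ∑ i ∈ s, zeroIntegralOn F (η i) S := by
  rw [zeroIntegralOn_eq_integral (continuousOn_finsetSum s hη) hS hSU
    (zeroMassOn_finsetSum_lt_top s hη hS hSU hfin), Finset.sum_congr rfl fun i hi =>
      zeroIntegralOn_eq_integral (hη i hi) hS hSU (hfin i hi), Finset.sum_comm]
  refine Finset.sum_congr rfl fun j _ => ?_
  simp only [zeroCoeff_finsetSum]
  exact integral_finsetSum s fun i hi => integrableOn_zeroCoeff (hη i hi) hS hSU (hfin i hi)

theorem topCoeff_compContinuousLinearMap (θ : (Fin (n + 1) → ℂ) [⋀^Fin (2 * (n + 1))]→L[ℝ] ℂ)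
    (L : (Fin (n + 1) → ℂ) →L[ℂ] (Fin (n + 1) → ℂ)) :
    topCoeff (θ.compContinuousLinearMap (L.restrictScalars ℝ)) =
      |(L.restrictScalars ℝ).det| • topCoeff θ := by
  rw [abs_of_nonneg (det_restrictScalars_nonneg L), Complex.real_smul]
  exact map_linearMap_complexFrame θ (L.restrictScalars ℝ)

theorem IsPullback.topCoeff_ddbar (h : IsPullback G F F' η η') (h2 : ContDiffOn ℝ 2 η' G.target)
    {z : Fin (n + 1) → ℂ} (hz : z ∈ G.source) :
    topCoeff (ddbar η z) = |(fderiv ℝ G z).det| • topCoeff (ddbar η' (G z)) := by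
  have h1 : η =ᶠ[𝓝 z] fun y => (η' (G y)).compContinuousLinearMap (fderiv ℝ G y) :=
    Filter.mem_of_superset (G.open_source.mem_nhds hz) h.form_eq
  rw [ddbar_congr h1, ddbar_pullback (h2.contDiffAt (G.open_target.mem_nhds (G.map_source hz)))
    (h.analytic z hz), (h.analytic z hz).differentiableAt.fderiv_restrictScalars ℝ]
  exact topCoeff_compContinuousLinearMap _ _

theorem IsPullback.hasFDerivWithinAt (h : IsPullback G F F' η η') (hS : S ⊆ G.source) :
    ∀ z ∈ S, HasFDerivWithinAt G (fderiv ℝ G z) S z := fun z hz =>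
  ((h.analytic z (hS hz)).differentiableAt.restrictScalars ℝ).hasFDerivAt.hasFDerivWithinAt

theorem IsPullback.setIntegral_ddbar (h : IsPullback G F F' η η')
    (h2 : ContDiffOn ℝ 2 η' G.target) (hS : MeasurableSet S) (hSs : S ⊆ G.source)
    (u : (Fin (n + 1) → ℂ) → ℂ) :
    ∫ z in G '' S, u z * topCoeff (ddbar η' z) = ∫ z in S, u (G z) * topCoeff (ddbar η z) := by
  rw [integral_image_eq_integral_abs_det_fderiv_smul volume hS (h.hasFDerivWithinAt hSs)
    (G.injOn.mono hSs)]
  refine setIntegral_congr_fun hS fun z hz => ?_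
  rw [h.topCoeff_ddbar h2 (hSs hz), mul_smul_comm]

theorem IsPullback.integrableOn_ddbar_iff (h : IsPullback G F F' η η')
    (h2 : ContDiffOn ℝ 2 η' G.target) (hS : MeasurableSet S) (hSs : S ⊆ G.source)
    (u : (Fin (n + 1) → ℂ) → ℂ) :
    IntegrableOn (fun z => u z * topCoeff (ddbar η' z)) (G '' S) ↔
      IntegrableOn (fun z => u (G z) * topCoeff (ddbar η z)) S := by
  rw [integrableOn_image_iff_integrableOn_abs_det_fderiv_smul volume hS (h.hasFDerivWithinAt hSs)
    (G.injOn.mono hSs)]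
  refine integrableOn_congr_fun (fun z hz => ?_) hS
  rw [h.topCoeff_ddbar h2 (hSs hz), mul_smul_comm]

theorem continuous_topCoeff : Continuous
    (topCoeff : ((Fin (n + 1) → ℂ) [⋀^Fin (2 * (n + 1))]→L[ℝ] ℂ) → ℂ) :=
  ContinuousEvalConst.continuous_eval_const _

theorem continuous_ddbar (hη : ContDiff ℝ 2 η) : Continuous (ddbar η) :=
  continuous_iff_continuousAt.2 fun z =>
    (contDiffAt_ddbar (r := 2) (s := 0) hη.contDiffAt (by norm_num)).continuousAt

theorem tsupport_ddbar_subset {k : ℕ} (η : (Fin (n + 1) → ℂ) → (Fin (n + 1) → ℂ) [⋀^Fin k]→L[ℝ] ℂ) :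
    tsupport (ddbar η) ⊆ tsupport η := by
  refine closure_minimal (fun z hz => ?_) (isClosed_tsupport η)
  contrapose! hz
  simp only [Function.mem_support, ne_eq, not_not]
  rw [ddbar_congr (notMem_tsupport_iff_eventuallyEq.1 hz)]
  exact ddbar_zero z

theorem tsupport_topCoeff_ddbar_subset
    (η : (Fin (n + 1) → ℂ) → (Fin (n + 1) → ℂ) [⋀^Fin (2 * n)]→L[ℝ] ℂ) :
    tsupport (fun z => topCoeff (ddbar η z)) ⊆ tsupport η := by
  refine (closure_mono fun z hz => ?_).trans (tsupport_ddbar_subset η)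
  contrapose! hz
  simp only [Function.mem_support, ne_eq, not_not] at hz ⊢
  rw [hz]
  rfl

theorem IsNonvanishingOn.comp_continuousLinearEquiv (hF : IsNonvanishingOn F U)
    (A : (Fin (n + 1) → ℂ) ≃L[ℂ] (Fin (n + 1) → ℂ)) :
    IsNonvanishingOn (fun z => F (A z)) (A ⁻¹' U) := by
  refine ⟨fun z hz => (hF.analytic _ hz).comp (A.analyticAt z), fun z hz h => ?_⟩
  refine hF.not_eventually _ hz ?_
  rw [EventuallyEq, ← A.map_nhds_eq]
  exact h

theorem volForm₂_zero_left (w : Fin (n + 1) → ℂ) : volForm₂ 0 w = 0 := by simp [volForm₂]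

/-- The Poincaré-Lelong formula holds for the form `η` on `U`. -/
structure PoincareLelongOn (F : (Fin (n + 1) → ℂ) → ℂ) (U : Set (Fin (n + 1) → ℂ))
    (η : (Fin (n + 1) → ℂ) → (Fin (n + 1) → ℂ) [⋀^Fin (2 * n)]→L[ℝ] ℂ) : Prop where
  mass_lt_top : zeroMassOn F η U < ⊤
  integral_eq : zeroIntegralOn F η U =
    Complex.I / Real.pi * ∫ z in U, (Real.log ‖F z‖ : ℂ) * topCoeff (ddbar η z)

theorem setIntegral_topCoeff_ddbar {u : (Fin (n + 1) → ℂ) → ℂ} (hs : tsupport η ⊆ U) :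
    ∫ z in U, u z * topCoeff (ddbar η z) = ∫ z, u z * topCoeff (ddbar η z) :=
  setIntegral_eq_integral_of_forall_compl_eq_zero fun z hz => by
    have : z ∉ tsupport (fun z => topCoeff (ddbar η z)) := fun h =>
      hz (hs (tsupport_topCoeff_ddbar_subset η h))
    rw [image_eq_zero_of_notMem_tsupport this, mul_zero]

theorem tsupport_smul_form_subset {k : ℕ} (χ : (Fin (n + 1) → ℂ) → ℂ)
    (θ : (Fin (n + 1) → ℂ) [⋀^Fin k]→L[ℝ] ℂ) : tsupport (fun z => χ z • θ) ⊆ tsupport χ :=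
  closure_mono fun z hz => by
    contrapose! hz
    simp only [Function.mem_support, ne_eq, not_not] at hz ⊢
    ext x
    simp [hz]

/-- A complex linear automorphism `A` carrying the first basis vector to `v` pulls `lineForm v` back
to a constant multiple of the form treated in `zeroIntegralOn_smul_lineForm`, the constant being the
real determinant of `A`. Both sides of the formula are invariant under `A`. For `v = 0` the form is
zero. -/
theorem poincareLelongOn_smul_lineForm {χ : (Fin (n + 1) → ℂ) → ℂ} (hU : IsOpen U)
    (hF : IsNonvanishingOn F U) (hχ : ContDiff ℝ 2 χ) (hc : HasCompactSupport χ)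
    (hs : tsupport χ ⊆ U) (v : Fin (n + 1) → ℂ) :
    PoincareLelongOn F U (fun z => χ z • lineForm v) := by
  by_cases hv : v = 0
  · have h0 : (fun z => χ z • lineForm v) = fun _ => 0 := by
      funext z
      ext x
      simp [hv, lineForm, volForm₂_zero_left]
    rw [h0]
    constructor
    · simp [zeroMassOn, zeroCoeff]
    · simp [zeroIntegralOn, zeroCoeff, ddbar_zero, topCoeff]
  obtain ⟨A, hA⟩ := SeparatingDual.exists_continuousLinearEquiv_apply_eq (R := ℂ)
    (V := Fin (n + 1) → ℂ) (x := Pi.single 0 1) (y := v) (by simp) hv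
  set L : (Fin (n + 1) → ℂ) →L[ℝ] (Fin (n + 1) → ℂ) :=
    (A : (Fin (n + 1) → ℂ) →L[ℂ] (Fin (n + 1) → ℂ)).restrictScalars ℝ with hL
  have hLA : ∀ z, L z = A z := fun z => rfl
  have hfd : ∀ z, fderiv ℝ (fun z => A z) z = L := fun z => L.fderiv
  have hform : ∀ z, (χ (A z) * L.det) • lineForm (Pi.single 0 1) =
      (χ (A z) • lineForm v).compContinuousLinearMap L := fun z => by
    ext x
    simp only [ContinuousAlternatingMap.smul_apply, smul_eq_mul,
      ContinuousAlternatingMap.compContinuousLinearMap_apply, lineForm, mul_assoc]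
    rw [← volForm₂_map, hLA, hLA, map_smul, hA]
    rfl
  have hp : IsPullback A.toHomeomorph.toOpenPartialHomeomorph (fun z => F (A z)) F
      (fun z => (χ (A z) * L.det) • lineForm (Pi.single 0 1)) (fun z => χ z • lineForm v) := by
    refine ⟨fun z _ => A.analyticAt z, fun z _ => A.symm.analyticAt z, ?_, ?_, fun _ _ => rfl,
      fun z _ => ?_⟩
    · exact (((hχ.continuous.comp A.continuous).mul continuous_const).smul
        continuous_const).continuousOn
    · exact (hχ.continuous.smul continuous_const).continuousOn
    · rw [hform z]
      congr 1
      exact (hfd z).symm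
  have hχA : ContDiff ℝ 2 fun z => χ (A z) * L.det := (hχ.comp L.contDiff).mul contDiff_const
  have hts : tsupport (fun z => χ (A z) * (L.det : ℂ)) ⊆ A ⁻¹' tsupport χ :=
    (tsupport_mul_subset_left).trans (tsupport_comp_subset_preimage χ A.continuous)
  have hcA : HasCompactSupport fun z => χ (A z) * (L.det : ℂ) :=
    (hc.comp_homeomorph A.toHomeomorph).mul_right
  have hsA : tsupport (fun z => χ (A z) * (L.det : ℂ)) ⊆ A ⁻¹' U := hts.trans (preimage_mono hs)
  have hUA : IsOpen (A ⁻¹' U) := hU.preimage A.continuous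
  have hFA := hF.comp_continuousLinearEquiv A
  have himg : A.toHomeomorph.toOpenPartialHomeomorph '' (A ⁻¹' U) = U :=
    image_preimage_eq U A.surjective
  have hinv := hp.isInvariantOn hUA.measurableSet (subset_univ _)
  rw [IsInvariantOn, himg] at hinv
  have hfin := zeroMassOn_smul_lineForm_lt_top hUA hFA hχA.continuous hcA hsA
  refine ⟨hinv.1 ▸ hfin, ?_⟩
  rw [← hinv.2 hfin, zeroIntegralOn_smul_lineForm hUA hFA hχA hcA hsA]
  have := hp.setIntegral_ddbar (hχ.smul contDiff_const).contDiffOn hUA.measurableSet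
    (subset_univ _) (fun z => (Real.log ‖F z‖ : ℂ))
  rw [himg] at this
  rw [this, ← setIntegral_topCoeff_ddbar (U := A ⁻¹' U)]
  · rfl
  · exact (tsupport_smul_form_subset _ _).trans hsA

/-- The Poincaré-Lelong formula on open subsets of `ℂ^(n+1)`. -/
theorem poincareLelongOn (hU : IsOpen U) (hF : IsNonvanishingOn F U) (hη : ContDiff ℝ 2 η)
    (hc : HasCompactSupport η) (hs : tsupport η ⊆ U)
    (hI : ∀ z, (η z).compContinuousLinearMap (mulI (n + 1)) = η z) : PoincareLelongOn F U η := by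
  obtain ⟨A, _, κ, v, x, hsum⟩ := exists_eq_sum_lineForm n
  -- The vectors `x a` and the scalars `κ a` are the same for all `z`, so the coefficients inherit
  -- smoothness and compact support from `η`.
  set χ : A → (Fin (n + 1) → ℂ) → ℂ := fun a z => κ a * η z (x a) with hχdef
  have hχ : ∀ a, ContDiff ℝ 2 (χ a) := fun a =>
    contDiff_const.mul ((ContinuousAlternatingMap.apply ℝ (Fin (n + 1) → ℂ) ℂ (x a)).contDiff.comp hη)
  have hsub : ∀ a, tsupport (χ a) ⊆ tsupport η := fun a => closure_mono fun z hz => by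
    contrapose! hz
    simp only [Function.mem_support, ne_eq, not_not] at hz ⊢
    simp [hχdef, hz]
  have hca : ∀ a, HasCompactSupport (χ a) := fun a => hc.of_isClosed_subset (isClosed_tsupport _) (hsub a)
  have hpl := fun a => poincareLelongOn_smul_lineForm hU hF (hχ a) (hca a) ((hsub a).trans hs) (v a)
  have heq : η = fun z => ∑ a, χ a z • lineForm (v a) := funext fun z => hsum (η z) (hI z)
  have hcd : ∀ a, ContDiff ℝ 2 fun z => χ a z • lineForm (v a) := fun a => (hχ a).smul contDiff_const
  have hcont : ∀ a ∈ Finset.univ, ContinuousOn (fun z => χ a z • lineForm (v a)) U := fun a _ =>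
    (hcd a).continuous.continuousOn
  rw [heq]
  refine ⟨zeroMassOn_finsetSum_lt_top _ hcont hU.measurableSet subset_rfl fun a _ =>
    (hpl a).mass_lt_top, ?_⟩
  rw [zeroIntegralOn_finsetSum _ hcont hU.measurableSet subset_rfl fun a _ => (hpl a).mass_lt_top,
    Finset.sum_congr rfl fun a _ => (hpl a).integral_eq, ← Finset.mul_sum,
    ← integral_finsetSum]
  · congr 1
    refine setIntegral_congr_fun hU.measurableSet fun z _ => ?_
    rw [ddbar_finsetSum _ fun a _ => (hcd a).contDiffAt, ← Finset.mul_sum]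
    simp only [topCoeff, ContinuousAlternatingMap.sum_apply]
  · intro a _
    refine (hF.integrable_log_mul hU (continuous_topCoeff.comp (continuous_ddbar (hcd a))) ?_
      ?_).integrableOn
    · exact (hca a).of_isClosed_subset (isClosed_tsupport _)
        ((tsupport_topCoeff_ddbar_subset _).trans (tsupport_smul_form_subset _ _))
    · exact ((tsupport_topCoeff_ddbar_subset _).trans
        (tsupport_smul_form_subset _ _)).trans ((hsub a).trans hs)

end PoincareLelongGeneral

/-! ## Forms and holomorphic functions in charts of a complex manifold -/

section Manifold

theorem isManifold_real_of_complex {E : Type*} [NormedAddCommGroup E] [NormedSpace ℂ E] (X : Type*)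
    [TopologicalSpace X] [ChartedSpace E X] [IsManifold 𝓘(ℂ, E) ω X] : IsManifold 𝓘(ℝ, E) ω X := by
  refine isManifold_of_contDiffOn _ _ _ fun e e' he he' => ?_
  have h := (contDiffGroupoid ω 𝓘(ℂ, E)).compatible he he'
  rw [contDiffGroupoid, mem_groupoid_of_pregroupoid] at h
  exact ContDiffOn.restrict_scalars ℝ h.1

variable {n : ℕ} {X : Type*} [TopologicalSpace X] [ChartedSpace (Fin (n + 1) → ℂ) X]

/-- The transition map between the charts at `c` and `c'`. -/
def transition (n : ℕ) {X : Type*} [TopologicalSpace X] [ChartedSpace (Fin (n + 1) → ℂ) X]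
    (c c' : X) : OpenPartialHomeomorph (Fin (n + 1) → ℂ) (Fin (n + 1) → ℂ) :=
  (chartAt (Fin (n + 1) → ℂ) c).symm ≫ₕ chartAt (Fin (n + 1) → ℂ) c'

theorem mem_transition_source {c c' : X} {z : Fin (n + 1) → ℂ} :
    z ∈ (transition n c c').source ↔ z ∈ (chartAt (Fin (n + 1) → ℂ) c).target ∧
      (chartAt (Fin (n + 1) → ℂ) c).symm z ∈ (chartAt (Fin (n + 1) → ℂ) c').source := by
  simp [transition]

theorem symm_transition_apply {c c' : X} {z : Fin (n + 1) → ℂ}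
    (hz : z ∈ (transition n c c').source) :
    (chartAt (Fin (n + 1) → ℂ) c').symm (transition n c c' z) =
      (chartAt (Fin (n + 1) → ℂ) c).symm z :=
  (chartAt (Fin (n + 1) → ℂ) c').left_inv (mem_transition_source.1 hz).2

theorem transition_symm (c c' : X) : (transition n c c').symm = transition n c' c := by
  simp [transition, OpenPartialHomeomorph.trans_symm_eq_symm_trans_symm]

theorem transition_target (c c' : X) :
    (transition n c c').target = (transition n c' c).source := by
  rw [← transition_symm c c', OpenPartialHomeomorph.symm_source]

theorem image_chart_eq (c : X) {P : Set X} (hP : P ⊆ (chartAt (Fin (n + 1) → ℂ) c).source) :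
    chartAt (Fin (n + 1) → ℂ) c '' P = (chartAt (Fin (n + 1) → ℂ) c).target ∩
      (chartAt (Fin (n + 1) → ℂ) c).symm ⁻¹' P := by
  rw [OpenPartialHomeomorph.image_eq_target_inter_inv_preimage _ hP]

theorem transition_image_eq (c c' : X) (P : Set X) :
    transition n c c' '' ((transition n c c').source ∩ (chartAt (Fin (n + 1) → ℂ) c).symm ⁻¹' P) =
      (transition n c' c).source ∩ (chartAt (Fin (n + 1) → ℂ) c').symm ⁻¹' P := by
  rw [← transition_target c c']
  ext z
  constructor
  · rintro ⟨y, ⟨hy, hyP⟩, rfl⟩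
    refine ⟨(transition n c c').map_source hy, ?_⟩
    rwa [mem_preimage, symm_transition_apply hy]
  · rintro ⟨hz, hzP⟩
    refine ⟨(transition n c c').symm z, ⟨(transition n c c').map_target hz, ?_⟩,
      (transition n c c').right_inv hz⟩
    rw [transition_target] at hz
    rwa [transition_symm, mem_preimage, symm_transition_apply hz]

theorem measurableSet_inter_preimage_diff (c : X) {O O' : Set X} (hO : IsOpen O) (hO' : IsOpen O') :
    MeasurableSet ((chartAt (Fin (n + 1) → ℂ) c).target ∩
      (chartAt (Fin (n + 1) → ℂ) c).symm ⁻¹' (O \ O')) := by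
  have h : (chartAt (Fin (n + 1) → ℂ) c).target ∩ (chartAt (Fin (n + 1) → ℂ) c).symm ⁻¹' (O \ O') =
      ((chartAt (Fin (n + 1) → ℂ) c).target ∩ (chartAt (Fin (n + 1) → ℂ) c).symm ⁻¹' O) \
      ((chartAt (Fin (n + 1) → ℂ) c).target ∩ (chartAt (Fin (n + 1) → ℂ) c).symm ⁻¹' O') := by
    ext z
    simp only [mem_inter_iff, mem_preimage, Set.mem_sdiff]
    tauto
  rw [h]
  exact ((chartAt (Fin (n + 1) → ℂ) c).isOpen_inter_preimage_symm hO).measurableSet.diff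
    ((chartAt (Fin (n + 1) → ℂ) c).isOpen_inter_preimage_symm hO').measurableSet

section Pieces

variable (H : Type*) {Y : Type*} [TopologicalSpace H] [TopologicalSpace Y]
    [ChartedSpace H Y] [SecondCountableTopology Y] [Nonempty Y]

theorem iUnion_chartPiece : ⋃ k, chartPiece H (X := Y) k = univ := by
  simp only [chartPiece]
  rw [iUnion_disjointed]
  exact (exists_chart_cover H Y).choose_spec

theorem chartPiece_subset (k : ℕ) :
    chartPiece H (X := Y) k ⊆ (chartAt H (chartCenter H (X := Y) k)).source :=
  disjointed_subset _ k

theorem disjoint_chartPiece :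
    Pairwise fun k l => Disjoint (chartPiece H (X := Y) k) (chartPiece H (X := Y) l) :=
  disjoint_disjointed _

theorem exists_chartPiece_eq_diff (k : ℕ) :
    ∃ O O' : Set Y, IsOpen O ∧ IsOpen O' ∧ chartPiece H k = O \ O' := by
  refine ⟨_, _, (chartAt H (chartCenter H (X := Y) k)).open_source, ?_, disjointed_apply ..⟩
  rw [Finset.sup_set_eq_biUnion]
  exact isOpen_biUnion fun i _ => (chartAt H (chartCenter H (X := Y) i)).open_source

end Pieces

theorem measurableSet_preimage_chartPiece [SecondCountableTopology X] [Nonempty X] (c : X) (k : ℕ) :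
    MeasurableSet ((chartAt (Fin (n + 1) → ℂ) c).target ∩
      (chartAt (Fin (n + 1) → ℂ) c).symm ⁻¹' chartPiece (Fin (n + 1) → ℂ) k) := by
  obtain ⟨O, O', hO, hO', h⟩ := exists_chartPiece_eq_diff (Fin (n + 1) → ℂ) (Y := X) k
  rw [h]
  exact measurableSet_inter_preimage_diff c hO hO'

theorem iUnion_preimage_chartPiece [SecondCountableTopology X] [Nonempty X] (c : X) :
    ⋃ k, (chartAt (Fin (n + 1) → ℂ) c).target ∩
      (chartAt (Fin (n + 1) → ℂ) c).symm ⁻¹' chartPiece (Fin (n + 1) → ℂ) k =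
      (chartAt (Fin (n + 1) → ℂ) c).target := by
  rw [← inter_iUnion, ← preimage_iUnion, iUnion_chartPiece, preimage_univ, inter_univ]

theorem disjoint_preimage_chartPiece [SecondCountableTopology X] [Nonempty X] (c : X) : Pairwise fun k l =>
    Disjoint ((chartAt (Fin (n + 1) → ℂ) c).target ∩
      (chartAt (Fin (n + 1) → ℂ) c).symm ⁻¹' chartPiece (Fin (n + 1) → ℂ) k)
      ((chartAt (Fin (n + 1) → ℂ) c).target ∩
      (chartAt (Fin (n + 1) → ℂ) c).symm ⁻¹' chartPiece (Fin (n + 1) → ℂ) l) := fun _ _ hkl =>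
  ((disjoint_chartPiece (Fin (n + 1) → ℂ) hkl).preimage _).mono inter_subset_right
    inter_subset_right

theorem DiffForm.comp_congr {m k : ℕ} {X : Type*} [TopologicalSpace X] [ChartedSpace (Fin m → ℂ) X]
    (ψ : DiffForm m X k) {x y : X} (h : x = y) (L : (Fin m → ℂ) →L[ℝ] (Fin m → ℂ)) :
    (show (Fin m → ℂ) [⋀^Fin k]→L[ℝ] ℂ from ψ x).compContinuousLinearMap L =
      (show (Fin m → ℂ) [⋀^Fin k]→L[ℝ] ℂ from ψ y).compContinuousLinearMap L := by
  subst h; rfl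

variable [IsManifold 𝓘(ℂ, Fin (n + 1) → ℂ) ω X]

theorem analyticOnNhd_transition (c c' : X) :
    AnalyticOnNhd ℂ (transition n c c') (transition n c c').source := by
  have h := (contDiffGroupoid ω 𝓘(ℂ, Fin (n + 1) → ℂ)).compatible
    (chart_mem_atlas (Fin (n + 1) → ℂ) c) (chart_mem_atlas (Fin (n + 1) → ℂ) c')
  rw [contDiffGroupoid, mem_groupoid_of_pregroupoid] at h
  intro z hz
  have h' : ContDiffOn ℂ ω (transition n c c') (transition n c c').source := by
    simpa [transition, contDiffPregroupoid] using h.1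
  exact (h'.contDiffAt ((transition n c c').open_source.mem_nhds hz)).analyticAt

/-- The chain rule for the inverse charts: the local expressions of a form are related by pullback
under the transition map, which is what `IsPullback` asks for. -/
theorem inChart_transition {k : ℕ} (ψ : DiffForm (n + 1) X k) {c c' : X} {z : Fin (n + 1) → ℂ}
    (hz : z ∈ (transition n c c').source) :
    DiffForm.inChart ψ c z = (DiffForm.inChart ψ c' (transition n c c' z)).compContinuousLinearMap
      (fderiv ℝ (transition n c c') z) := by
  have := isManifold_real_of_complex (E := Fin (n + 1) → ℂ) X
  have : IsManifold 𝓘(ℝ, Fin (n + 1) → ℂ) 1 X := IsManifold.of_le (n := ω) le_top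
  set e := chartAt (Fin (n + 1) → ℂ) c
  set e' := chartAt (Fin (n + 1) → ℂ) c'
  have hev : e.symm =ᶠ[𝓝 z] e'.symm ∘ transition n c c' := by
    filter_upwards [(transition n c c').open_source.mem_nhds hz] with y hy
    exact (symm_transition_apply hy).symm
  have hzt : transition n c c' z ∈ e'.target := by
    have := (transition n c c').map_source hz
    rw [transition_target] at this
    exact (mem_transition_source.1 this).1
  have hD : mfderiv 𝓘(ℝ, Fin (n + 1) → ℂ) 𝓘(ℝ, Fin (n + 1) → ℂ) e.symm z =
      (mfderiv 𝓘(ℝ, Fin (n + 1) → ℂ) 𝓘(ℝ, Fin (n + 1) → ℂ) e'.symm (transition n c c' z)).comp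
        (fderiv ℝ (transition n c c') z) := by
    rw [hev.mfderiv_eq, mfderiv_comp z (mdifferentiableAt_atlas_symm (chart_mem_atlas _ _) hzt)
      ((analyticOnNhd_transition c c' z hz).differentiableAt.restrictScalars ℝ).mdifferentiableAt,
      mfderiv_eq_fderiv]
    rfl
  refine (DiffForm.comp_congr ψ (symm_transition_apply hz).symm _).trans ?_
  exact congrArg (fun L => (show (Fin (n + 1) → ℂ) [⋀^Fin k]→L[ℝ] ℂ from
    ψ (e'.symm (transition n c c' z))).compContinuousLinearMap L) hD

theorem isPullback_inChart (ψ : DiffForm (n + 1) X (2 * n)) (f : X → ℂ)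
    (hψ : ∀ c : X, ContinuousOn (DiffForm.inChart ψ c) (chartAt (Fin (n + 1) → ℂ) c).target)
    (c c' : X) : IsPullback (transition n c c')
      (fun z => f ((chartAt (Fin (n + 1) → ℂ) c).symm z))
      (fun z => f ((chartAt (Fin (n + 1) → ℂ) c').symm z))
      (DiffForm.inChart ψ c) (DiffForm.inChart ψ c') where
  analytic := analyticOnNhd_transition c c'
  analytic_symm := by
    rw [transition_target, transition_symm]
    exact analyticOnNhd_transition c' c
  continuousOn := (hψ c).mono fun z hz => (mem_transition_source.1 hz).1
  continuousOn' := by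
    rw [transition_target]
    exact (hψ c').mono fun z hz => (mem_transition_source.1 hz).1
  fun_eq z hz := by rw [symm_transition_apply hz]
  form_eq z hz := inChart_transition ψ hz

/-- The identity theorem: the set of points near which `f` vanishes is open and closed, hence empty
if `f` is nonzero somewhere on the connected manifold. -/
theorem isNonvanishingOn_chart [ConnectedSpace X] {f : X → ℂ}
    (hf : MDifferentiable 𝓘(ℂ, Fin (n + 1) → ℂ) 𝓘(ℂ, ℂ) f) (h0 : ∃ x, f x ≠ 0) (c : X) :
    IsNonvanishingOn (fun z => f ((chartAt (Fin (n + 1) → ℂ) c).symm z))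
      (chartAt (Fin (n + 1) → ℂ) c).target := by
  have : IsManifold 𝓘(ℂ, Fin (n + 1) → ℂ) 1 X := IsManifold.of_le (n := ω) le_top
  have han : ∀ c : X, AnalyticOnNhd ℂ (fun z => f ((chartAt (Fin (n + 1) → ℂ) c).symm z))
      (chartAt (Fin (n + 1) → ℂ) c).target := fun c =>
    analyticOnNhd_of_differentiableOn (chartAt (Fin (n + 1) → ℂ) c).open_target
      (mdifferentiableOn_iff_differentiableOn.1 (hf.comp_mdifferentiableOn
        (mdifferentiableOn_atlas_symm (I := 𝓘(ℂ, Fin (n + 1) → ℂ)) (chart_mem_atlas _ c))))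
  have hev : ∀ (c : X), ∀ z ∈ (chartAt (Fin (n + 1) → ℂ) c).target,
      (f =ᶠ[𝓝 ((chartAt (Fin (n + 1) → ℂ) c).symm z)] 0 ↔
        (fun z => f ((chartAt (Fin (n + 1) → ℂ) c).symm z)) =ᶠ[𝓝 z] 0) := fun c z hz => by
    have h := (chartAt (Fin (n + 1) → ℂ) c).symm.map_nhds_eq hz
    rw [EventuallyEq, ← h, eventually_map]
    rfl
  set Z : Set X := {x | f =ᶠ[𝓝 x] 0} with hZ
  have hZo : IsOpen Z := isOpen_iff_mem_nhds.2 fun x hx => eventually_eventually_nhds.2 hx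
  have hZc : IsClosed Z := by
    refine isClosed_of_closure_subset fun x hx => ?_
    set e := chartAt (Fin (n + 1) → ℂ) x
    have hxs : x ∈ e.source := mem_chart_source _ x
    obtain ⟨r, hr, hball⟩ := Metric.isOpen_iff.1 e.open_target (e x) (e.map_source hxs)
    have hN : e.source ∩ e ⁻¹' ball (e x) r ∈ 𝓝 x :=
      (e.isOpen_inter_preimage isOpen_ball).mem_nhds ⟨hxs, mem_ball_self hr⟩
    obtain ⟨y, ⟨hys, hyb⟩, hyZ⟩ := mem_closure_iff_nhds.1 hx _ hN
    have hy : (fun z => f (e.symm z)) =ᶠ[𝓝 (e y)] 0 :=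
      (hev x (e y) (e.map_source hys)).1 (by rw [e.left_inv hys]; exact hyZ)
    have hz := ((han x).mono hball).eqOn_zero_of_preconnected_of_eventuallyEq_zero
      (convex_ball _ _).isPreconnected hyb hy
    have := (hev x (e x) (e.map_source hxs)).2
      (Filter.mem_of_superset (ball_mem_nhds _ hr) hz)
    rwa [e.left_inv hxs] at this
  refine ⟨han c, fun z hz h => ?_⟩
  have hzZ : (chartAt (Fin (n + 1) → ℂ) c).symm z ∈ Z := (hev c z hz).2 h
  obtain ⟨x, hx⟩ := h0
  have : x ∈ Z := (IsClopen.eq_univ ⟨hZc, hZo⟩ ⟨_, hzZ⟩) ▸ mem_univ x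
  exact hx this.eq_of_nhds

end Manifold

/-! ### Forms supported in a single chart. -/

section ChartForm

variable {n : ℕ}

section Congr

variable {F : (Fin (n + 1) → ℂ) → ℂ} {S S' : Set (Fin (n + 1) → ℂ)}
  {η η' : (Fin (n + 1) → ℂ) → (Fin (n + 1) → ℂ) [⋀^Fin (2 * n)]→L[ℝ] ℂ}

theorem tsum_sheet_congr {β : Type*} [AddCommMonoid β] [TopologicalSpace β] (N : ℂ → β)
    (hN : N 0 = 0) (h : S.indicator η = S'.indicator η') (j : Fin (n + 1)) (w : Fin n → ℂ) :
    ∑' t : {t : ℂ // (j.insertNth t w : Fin (n + 1) → ℂ) ∈ S ∩ zeroSheet F j},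
      N (zeroCoeff F η j (j.insertNth t.1 w)) =
    ∑' t : {t : ℂ // (j.insertNth t w : Fin (n + 1) → ℂ) ∈ S' ∩ zeroSheet F j},
      N (zeroCoeff F η' j (j.insertNth t.1 w)) := by
  classical
  have key : ∀ (S : Set (Fin (n + 1) → ℂ))
      (η : (Fin (n + 1) → ℂ) → (Fin (n + 1) → ℂ) [⋀^Fin (2 * n)]→L[ℝ] ℂ),
      ∑' t : {t : ℂ // (j.insertNth t w : Fin (n + 1) → ℂ) ∈ S ∩ zeroSheet F j},
        N (zeroCoeff F η j (j.insertNth t.1 w)) =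
      ∑' t : ℂ, {t : ℂ | (j.insertNth t w : Fin (n + 1) → ℂ) ∈ zeroSheet F j}.indicator
        (fun t => N (zeroCoeff F (S.indicator η) j (j.insertNth t w))) t := fun S η => by
    refine (tsum_subtype {t : ℂ | (j.insertNth t w : Fin (n + 1) → ℂ) ∈ S ∩ zeroSheet F j}
      fun t => N (zeroCoeff F η j (j.insertNth t w))).trans (tsum_congr fun t => ?_)
    simp only [indicator_apply, mem_ofPred_eq, mem_inter_iff, zeroCoeff]
    by_cases h1 : (j.insertNth t w : Fin (n + 1) → ℂ) ∈ S <;>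
      by_cases h2 : (j.insertNth t w : Fin (n + 1) → ℂ) ∈ zeroSheet F j <;> simp [h1, h2, hN]
  rw [key, key, h]

theorem zeroMassOn_congr_indicator (h : S.indicator η = S'.indicator η') :
    zeroMassOn F η S = zeroMassOn F η' S' := by
  unfold zeroMassOn
  simp only [tsum_sheet_congr (fun z : ℂ => ‖z‖ₑ) enorm_zero h]

theorem zeroIntegralOn_congr_indicator (h : S.indicator η = S'.indicator η') :
    zeroIntegralOn F η S = zeroIntegralOn F η' S' := by
  unfold zeroIntegralOn
  simp only [tsum_sheet_congr (fun z : ℂ => z) rfl h]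

end Congr

variable {X : Type*} [TopologicalSpace X] [ChartedSpace (Fin (n + 1) → ℂ) X]

/-- `ψ` is a smooth form of bidegree `(n, n)`, with support in the compact subset `K` of the domain
of the chart at `c`. -/
structure IsChartForm (ψ : DiffForm (n + 1) X (2 * n)) (c : X) (K : Set X) : Prop where
  smooth : ∀ c : X, ContDiffOn ℝ ∞ (DiffForm.inChart ψ c) (chartAt (Fin (n + 1) → ℂ) c).target
  isCompact : IsCompact K
  subset : K ⊆ (chartAt (Fin (n + 1) → ℂ) c).source
  eq_zero : ∀ x ∉ K, ψ x = 0
  comp_mulI : ∀ z ∈ (chartAt (Fin (n + 1) → ℂ) c).target,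
    (DiffForm.inChart ψ c z).compContinuousLinearMap (mulI (n + 1)) = DiffForm.inChart ψ c z

/-- The expression of a form in a chart, extended by zero. -/
def DiffForm.extendChart {k : ℕ} (ψ : DiffForm (n + 1) X k) (c : X) :
    (Fin (n + 1) → ℂ) → (Fin (n + 1) → ℂ) [⋀^Fin k]→L[ℝ] ℂ :=
  (chartAt (Fin (n + 1) → ℂ) c).target.indicator (DiffForm.inChart ψ c)

theorem DiffForm.inChart_eq_zero {k : ℕ} {ψ : DiffForm (n + 1) X k} {c : X} {z : Fin (n + 1) → ℂ}
    (h : ψ ((chartAt (Fin (n + 1) → ℂ) c).symm z) = 0) : DiffForm.inChart ψ c z = 0 := by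
  rw [DiffForm.inChart, h]
  rfl

namespace IsChartForm

variable {ψ : DiffForm (n + 1) X (2 * n)} {c : X} {K : Set X} (h : IsChartForm ψ c K)

include h

theorem isCompact_image : IsCompact (chartAt (Fin (n + 1) → ℂ) c '' K) :=
  h.isCompact.image_of_continuousOn ((chartAt _ c).continuousOn.mono h.subset)

theorem image_subset : chartAt (Fin (n + 1) → ℂ) c '' K ⊆ (chartAt (Fin (n + 1) → ℂ) c).target := by
  rintro _ ⟨x, hx, rfl⟩
  exact (chartAt _ c).map_source (h.subset hx)

theorem extendChart_eq_zero {z : Fin (n + 1) → ℂ} (hz : z ∉ chartAt (Fin (n + 1) → ℂ) c '' K) :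
    DiffForm.extendChart ψ c z = 0 := by
  rw [DiffForm.extendChart, indicator_apply_eq_zero]
  refine fun hzt => DiffForm.inChart_eq_zero (h.eq_zero _ fun hK => hz ?_)
  exact ⟨_, hK, (chartAt _ c).right_inv hzt⟩

theorem tsupport_subset_image :
    tsupport (DiffForm.extendChart ψ c) ⊆ chartAt (Fin (n + 1) → ℂ) c '' K :=
  closure_minimal (fun z hz => by
    by_contra h0
    exact hz (h.extendChart_eq_zero h0)) h.isCompact_image.isClosed

theorem tsupport_subset :
    tsupport (DiffForm.extendChart ψ c) ⊆ (chartAt (Fin (n + 1) → ℂ) c).target :=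
  h.tsupport_subset_image.trans h.image_subset

theorem hasCompactSupport : HasCompactSupport (DiffForm.extendChart ψ c) :=
  h.isCompact_image.of_isClosed_subset (isClosed_tsupport _) h.tsupport_subset_image

theorem contDiff : ContDiff ℝ ∞ (DiffForm.extendChart ψ c) := by
  refine contDiff_iff_contDiffAt.2 fun z => ?_
  by_cases hz : z ∈ (chartAt (Fin (n + 1) → ℂ) c).target
  · have hN := (chartAt (Fin (n + 1) → ℂ) c).open_target.mem_nhds hz
    refine ((h.smooth c).contDiffAt hN).congr_of_eventuallyEq ?_
    filter_upwards [hN] with y hy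
    exact indicator_of_mem hy _
  · have hN : (chartAt (Fin (n + 1) → ℂ) c '' K)ᶜ ∈ 𝓝 z :=
      h.isCompact_image.isClosed.isOpen_compl.mem_nhds fun hK => hz (h.image_subset hK)
    refine (contDiffAt_const (c := 0)).congr_of_eventuallyEq ?_
    filter_upwards [hN] with y hy
    exact h.extendChart_eq_zero hy

theorem extendChart_comp_mulI (z : Fin (n + 1) → ℂ) :
    (DiffForm.extendChart ψ c z).compContinuousLinearMap (mulI (n + 1)) =
      DiffForm.extendChart ψ c z := by
  by_cases hz : z ∈ (chartAt (Fin (n + 1) → ℂ) c).target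
  · rw [DiffForm.extendChart, indicator_of_mem hz, h.comp_mulI z hz]
  · rw [DiffForm.extendChart, indicator_of_notMem hz]
    rfl

theorem poincareLelongOn {f : X → ℂ}
    (hf : IsNonvanishingOn (fun z => f ((chartAt (Fin (n + 1) → ℂ) c).symm z))
      (chartAt (Fin (n + 1) → ℂ) c).target) :
    PoincareLelongOn (fun z => f ((chartAt (Fin (n + 1) → ℂ) c).symm z))
      (chartAt (Fin (n + 1) → ℂ) c).target (DiffForm.extendChart ψ c) :=
  RandomWaves.poincareLelongOn (chartAt (Fin (n + 1) → ℂ) c).open_target hf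
    (h.contDiff.of_le (WithTop.coe_le_coe.2 (le_top : (2 : ℕ∞) ≤ ⊤))) h.hasCompactSupport h.tsupport_subset
    h.extendChart_comp_mulI

variable [IsManifold 𝓘(ℂ, Fin (n + 1) → ℂ) ω X] [T2Space X]

/-- The global definitions integrate over pieces seen in the charts `c'` of the fixed atlas, whereas
the Poincaré-Lelong formula is known in the chart `c` containing the support. Each piece is moved to
`c` by the transition map. -/
theorem invariance {P : Set X} {c' : X}
    (hP : P ⊆ (chartAt (Fin (n + 1) → ℂ) c').source)
    (hm : MeasurableSet ((chartAt (Fin (n + 1) → ℂ) c').target ∩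
      (chartAt (Fin (n + 1) → ℂ) c').symm ⁻¹' P)) (f : X → ℂ) :
    zeroMassOn (fun z => f ((chartAt (Fin (n + 1) → ℂ) c').symm z)) (DiffForm.inChart ψ c')
      (chartAt (Fin (n + 1) → ℂ) c' '' P) =
    zeroMassOn (fun z => f ((chartAt (Fin (n + 1) → ℂ) c).symm z)) (DiffForm.extendChart ψ c)
      ((chartAt (Fin (n + 1) → ℂ) c).target ∩ (chartAt (Fin (n + 1) → ℂ) c).symm ⁻¹' P) ∧
    (zeroMassOn (fun z => f ((chartAt (Fin (n + 1) → ℂ) c).symm z)) (DiffForm.extendChart ψ c)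
      ((chartAt (Fin (n + 1) → ℂ) c).target ∩ (chartAt (Fin (n + 1) → ℂ) c).symm ⁻¹' P) < ⊤ →
      zeroIntegralOn (fun z => f ((chartAt (Fin (n + 1) → ℂ) c').symm z)) (DiffForm.inChart ψ c')
        (chartAt (Fin (n + 1) → ℂ) c' '' P) =
      zeroIntegralOn (fun z => f ((chartAt (Fin (n + 1) → ℂ) c).symm z)) (DiffForm.extendChart ψ c)
        ((chartAt (Fin (n + 1) → ℂ) c).target ∩ (chartAt (Fin (n + 1) → ℂ) c).symm ⁻¹' P)) ∧
    ∀ u : X → ℂ,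
      (IntegrableOn (fun z => u ((chartAt (Fin (n + 1) → ℂ) c').symm z) *
          topCoeff (ddbar (DiffForm.inChart ψ c') z)) (chartAt (Fin (n + 1) → ℂ) c' '' P) ↔
        IntegrableOn (fun z => u ((chartAt (Fin (n + 1) → ℂ) c).symm z) *
          topCoeff (ddbar (DiffForm.extendChart ψ c) z)) ((chartAt (Fin (n + 1) → ℂ) c).target ∩
            (chartAt (Fin (n + 1) → ℂ) c).symm ⁻¹' P)) ∧
      ∫ z in chartAt (Fin (n + 1) → ℂ) c' '' P, u ((chartAt (Fin (n + 1) → ℂ) c').symm z) *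
          topCoeff (ddbar (DiffForm.inChart ψ c') z) =
        ∫ z in (chartAt (Fin (n + 1) → ℂ) c).target ∩ (chartAt (Fin (n + 1) → ℂ) c).symm ⁻¹' P,
          u ((chartAt (Fin (n + 1) → ℂ) c).symm z) *
            topCoeff (ddbar (DiffForm.extendChart ψ c) z) := by
  set e := chartAt (Fin (n + 1) → ℂ) c
  set e' := chartAt (Fin (n + 1) → ℂ) c'
  rw [image_chart_eq c' hP]
  have hpull := isPullback_inChart ψ f (fun c => (h.smooth c).continuousOn) c' c
  set S := e'.target ∩ e'.symm ⁻¹' P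
  set T := e.target ∩ e.symm ⁻¹' P
  set S' := (transition n c' c).source ∩ e'.symm ⁻¹' P
  have hS'S : S' ⊆ S := fun z hz => ⟨(mem_transition_source.1 hz.1).1, hz.2⟩
  have himg : transition n c' c '' S' = T := by
    rw [transition_image_eq]
    ext z
    simp only [T, mem_inter_iff, mem_transition_source]
    exact ⟨fun hz => ⟨hz.1.1, hz.2⟩, fun hz => ⟨⟨hz.1, hP hz.2⟩, hz.2⟩⟩
  have hS'm : MeasurableSet S' := by
    have : S' = S ∩ (transition n c' c).source := by
      ext z
      simp only [S', S, mem_inter_iff, mem_transition_source]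
      tauto
    rw [this]
    exact hm.inter (transition n c' c).open_source.measurableSet
  have hTm : MeasurableSet T := himg ▸ hpull.measurableSet_image hS'm inter_subset_left
  -- Nothing is lost outside the overlap of the charts: the support is closed and lies in the domain
  -- of `c`. The form vanishes in a whole neighbourhood, so its `∂∂̄` vanishes too.
  have hzero : ∀ z ∈ S, z ∉ S' → DiffForm.inChart ψ c' =ᶠ[𝓝 z] fun _ => 0 := by
    intro z hz hzS'
    have hzK : z ∈ e'.target ∩ e'.symm ⁻¹' Kᶜ := ⟨hz.1, fun hK =>
      hzS' ⟨mem_transition_source.2 ⟨hz.1, h.subset hK⟩, hz.2⟩⟩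
    filter_upwards [(e'.isOpen_inter_preimage_symm h.isCompact.isClosed.isOpen_compl).mem_nhds hzK]
      with y hy
    exact DiffForm.inChart_eq_zero (h.eq_zero _ hy.2)
  have hext : ∀ z ∈ T, DiffForm.extendChart ψ c =ᶠ[𝓝 z] DiffForm.inChart ψ c := fun z hz => by
    filter_upwards [e.open_target.mem_nhds hz.1] with y hy
    exact indicator_of_mem hy _
  have hind : S.indicator (DiffForm.inChart ψ c') = S'.indicator (DiffForm.inChart ψ c') := by
    ext1 z
    by_cases h1 : z ∈ S'
    · rw [indicator_of_mem h1, indicator_of_mem (hS'S h1)]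
    · rw [indicator_of_notMem h1, indicator_apply_eq_zero]
      exact fun h2 => (hzero z h2 h1).eq_of_nhds
  have hindT : T.indicator (DiffForm.inChart ψ c) = T.indicator (DiffForm.extendChart ψ c) :=
    indicator_congr fun z hz => (hext z hz).eq_of_nhds.symm
  have hinv := hpull.isInvariantOn hS'm inter_subset_left
  rw [IsInvariantOn, himg] at hinv
  rw [zeroMassOn_congr_indicator hind, zeroIntegralOn_congr_indicator hind,
    ← zeroMassOn_congr_indicator hindT, ← zeroIntegralOn_congr_indicator hindT]
  refine ⟨hinv.1, fun hfin => hinv.2 (hinv.1 ▸ hfin), fun u => ?_⟩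
  have h2 : ContDiffOn ℝ 2 (DiffForm.inChart ψ c) (transition n c' c).target := by
    rw [transition_target]
    exact ((h.smooth c).of_le (WithTop.coe_le_coe.2 (le_top : (2 : ℕ∞) ≤ ⊤))).mono fun z hz =>
      (mem_transition_source.1 hz).1
  have hindu : S.indicator (fun z => u (e'.symm z) * topCoeff (ddbar (DiffForm.inChart ψ c') z)) =
      S'.indicator (fun z => u (e.symm (transition n c' c z)) *
        topCoeff (ddbar (DiffForm.inChart ψ c') z)) := by
    ext1 z
    by_cases h1 : z ∈ S'
    · rw [indicator_of_mem h1, indicator_of_mem (hS'S h1), symm_transition_apply h1.1]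
    · rw [indicator_of_notMem h1, indicator_apply_eq_zero]
      intro h2
      rw [ddbar_congr (hzero z h2 h1), ddbar_zero]
      exact mul_zero _
  have hindTu : T.indicator (fun z => u (e.symm z) * topCoeff (ddbar (DiffForm.inChart ψ c) z)) =
      T.indicator (fun z => u (e.symm z) * topCoeff (ddbar (DiffForm.extendChart ψ c) z)) :=
    indicator_congr fun z hz => by rw [ddbar_congr (hext z hz)]
  rw [← integrable_indicator_iff hm, ← integrable_indicator_iff hTm, ← integral_indicator hm,
    ← integral_indicator hTm, ← hindTu, hindu, integrable_indicator_iff hS'm,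
    integrable_indicator_iff hTm, integral_indicator hS'm, integral_indicator hTm, ← himg]
  exact ⟨(hpull.integrableOn_ddbar_iff h2 hS'm inter_subset_left fun z => u (e.symm z)).symm,
    (hpull.setIntegral_ddbar h2 hS'm inter_subset_left fun z => u (e.symm z)).symm⟩

variable [SecondCountableTopology X] [Nonempty X]

theorem ddbarCurrent_hasSum (u : X → ℂ)
    (hu : IntegrableOn (fun z => u ((chartAt (Fin (n + 1) → ℂ) c).symm z) *
      topCoeff (ddbar (DiffForm.extendChart ψ c) z)) (chartAt (Fin (n + 1) → ℂ) c).target) :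
    (∀ k : ℕ, IntegrableOn (fun z =>
      u ((chartAt (Fin (n + 1) → ℂ) (chartCenter (Fin (n + 1) → ℂ) k : X)).symm z) *
        topCoeff (ddbar (DiffForm.inChart ψ (chartCenter (Fin (n + 1) → ℂ) k)) z))
      (chartAt (Fin (n + 1) → ℂ) (chartCenter (Fin (n + 1) → ℂ) k : X) ''
        chartPiece (Fin (n + 1) → ℂ) k)) ∧
    HasSum (fun k : ℕ => ∫ z in chartAt (Fin (n + 1) → ℂ) (chartCenter (Fin (n + 1) → ℂ) k : X) ''
        chartPiece (Fin (n + 1) → ℂ) k,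
      u ((chartAt (Fin (n + 1) → ℂ) (chartCenter (Fin (n + 1) → ℂ) k : X)).symm z) *
        topCoeff (ddbar (DiffForm.inChart ψ (chartCenter (Fin (n + 1) → ℂ) k)) z))
      (∫ z in (chartAt (Fin (n + 1) → ℂ) c).target, u ((chartAt (Fin (n + 1) → ℂ) c).symm z) *
        topCoeff (ddbar (DiffForm.extendChart ψ c) z)) := by
  have hk := fun k => (h.invariance (chartPiece_subset (Fin (n + 1) → ℂ) k)
    (measurableSet_preimage_chartPiece _ k) 0).2.2 u
  constructor
  · exact fun k => (hk k).1.2 (hu.mono_set inter_subset_left)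
  · simp only [fun k => (hk k).2]
    have := hasSum_integral_iUnion (fun k => measurableSet_preimage_chartPiece (n := n) c k)
      (disjoint_preimage_chartPiece c) (by rwa [iUnion_preimage_chartPiece])
    rwa [iUnion_preimage_chartPiece] at this

/-- In the chart `c` the pieces of the atlas partition the whole target, so countable additivity
reassembles them into the integral to which the Poincaré-Lelong formula applies. -/
theorem zeroCurrent_hasSum {f : X → ℂ}
    (hf : IsNonvanishingOn (fun z => f ((chartAt (Fin (n + 1) → ℂ) c).symm z))
      (chartAt (Fin (n + 1) → ℂ) c).target) :
    zeroMass f ψ < ⊤ ∧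
    HasSum (fun k : ℕ => zeroIntegralOn
      (fun z => f ((chartAt (Fin (n + 1) → ℂ) (chartCenter (Fin (n + 1) → ℂ) k : X)).symm z))
      (DiffForm.inChart ψ (chartCenter (Fin (n + 1) → ℂ) k))
      (chartAt (Fin (n + 1) → ℂ) (chartCenter (Fin (n + 1) → ℂ) k : X) ''
        chartPiece (Fin (n + 1) → ℂ) k))
      (Complex.I / Real.pi * ∫ z, (Real.log ‖f ((chartAt (Fin (n + 1) → ℂ) c).symm z)‖ : ℂ) *
        topCoeff (ddbar (DiffForm.extendChart ψ c) z)) := by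
  have hk := fun k => h.invariance (chartPiece_subset (Fin (n + 1) → ℂ) k)
    (measurableSet_preimage_chartPiece _ k) f
  have hpl := h.poincareLelongOn hf
  have hm := fun k => measurableSet_preimage_chartPiece (n := n) c k
  have hd := disjoint_preimage_chartPiece (n := n) c
  have hc : ContinuousOn (DiffForm.extendChart ψ c) univ := h.contDiff.continuous.continuousOn
  have hle := fun k => zeroMassOn_mono (F := fun z => f ((chartAt (Fin (n + 1) → ℂ) c).symm z)) hc
    (chartAt (Fin (n + 1) → ℂ) c).open_target.measurableSet (subset_univ _) (hm k) inter_subset_left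
  constructor
  · rw [zeroMass]
    simp only [fun k => (hk k).1]
    rw [← zeroMassOn_iUnion hc hm hd fun _ => subset_univ _, iUnion_preimage_chartPiece]
    exact hpl.mass_lt_top
  · simp only [fun k => (hk k).2.1 ((hle k).trans_lt hpl.mass_lt_top)]
    rw [← setIntegral_topCoeff_ddbar h.tsupport_subset, ← hpl.integral_eq]
    have := hasSum_zeroIntegralOn (F := fun z => f ((chartAt (Fin (n + 1) → ℂ) c).symm z)) hc hm hd
      (fun _ => subset_univ _) (by rw [iUnion_preimage_chartPiece]; exact hpl.mass_lt_top)
    rwa [iUnion_preimage_chartPiece] at this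

end IsChartForm

end ChartForm

/-! ### Partition of unity and the Poincaré-Lelong formula on the manifold. -/

section TestForm

variable {n : ℕ} {X : Type*} [TopologicalSpace X] [ChartedSpace (Fin (n + 1) → ℂ) X]
  [IsManifold 𝓘(ℂ, Fin (n + 1) → ℂ) ω X] [T2Space X] [SecondCountableTopology X]

/-- A test form is a finite sum of forms supported in charts. -/
theorem IsTestForm.exists_eq_sum {ψ : DiffForm (n + 1) X (2 * n)} (hψ : IsTestForm n ψ) :
    ∃ (t : Finset X) (ξ : t → DiffForm (n + 1) X (2 * n)) (K : t → Set X),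
      (∀ i, IsChartForm (ξ i) i.1 (K i)) ∧
      ∀ c z, DiffForm.inChart ψ c z = ∑ i, DiffForm.inChart (ξ i) c z := by
  have := isManifold_real_of_complex (E := Fin (n + 1) → ℂ) X
  have : IsManifold 𝓘(ℝ, Fin (n + 1) → ℂ) ∞ X := IsManifold.of_le (n := ω) le_top
  have : LocallyCompactSpace X := ChartedSpace.locallyCompactSpace (Fin (n + 1) → ℂ) X
  obtain ⟨K, hK, hK0⟩ := hψ.compact_support
  obtain ⟨t, -, ht⟩ := hK.elim_nhds_subcover (fun x => (chartAt (Fin (n + 1) → ℂ) x).source)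
    fun x _ => chart_source_mem_nhds _ x
  obtain ⟨ρ, hρ⟩ := SmoothPartitionOfUnity.exists_isSubordinate 𝓘(ℝ, Fin (n + 1) → ℂ) hK.isClosed
    (fun i : t => (chartAt (Fin (n + 1) → ℂ) i.1).source)
    (fun i => (chartAt (Fin (n + 1) → ℂ) i.1).open_source) (by simpa [iUnion_subtype] using ht)
  have hin : ∀ (i : t) (c : X) (z : Fin (n + 1) → ℂ),
      DiffForm.inChart (fun x => ρ i x • ψ x) c z =
        ρ i ((chartAt (Fin (n + 1) → ℂ) c).symm z) • DiffForm.inChart ψ c z := fun _ _ _ => rfl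
  refine ⟨t, fun i x => ρ i x • ψ x, fun i => K ∩ tsupport (ρ i), fun i =>
    ⟨fun c => ?_, hK.inter_right (isClosed_tsupport _), inter_subset_right.trans (hρ i),
      fun x hx => ?_, fun z hz => ?_⟩, fun c z => ?_⟩
  · simp only [funext (hin i c)]
    have hs : ContDiffOn ℝ ∞ (fun z => ρ i ((chartAt (Fin (n + 1) → ℂ) c).symm z))
        (chartAt (Fin (n + 1) → ℂ) c).target :=
      contMDiffOn_iff_contDiffOn.1 ((ρ i).contMDiff.comp_contMDiffOn
        (contMDiffOn_chart_symm (I := 𝓘(ℝ, Fin (n + 1) → ℂ))))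
    exact hs.smul (hψ.smooth c)
  · by_cases hxK : x ∈ K
    · have : ρ i x = 0 := image_eq_zero_of_notMem_tsupport fun h => hx ⟨hxK, h⟩
      simp only [this]
      exact zero_smul ℝ (ψ x)
    · simp only [hK0 x hxK]
      ext v
      exact smul_zero (ρ i x)
  · rw [hin]
    ext v
    -- With `a = i` the factor is `(i · (-i))^n = 1`: bidegree `(n, n)` enters only as invariance
    -- under multiplication by `i`.
    have := hψ.bidegree i.1 z hz Complex.I v
    rw [← mul_pow, Complex.conj_I, mul_neg, Complex.I_mul_I, neg_neg, one_pow, one_mul] at this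
    simp only [ContinuousAlternatingMap.compContinuousLinearMap_apply,
      ContinuousAlternatingMap.smul_apply]
    exact congrArg (fun x => _ • x) this
  · simp only [hin]
    rw [← Finset.sum_smul]
    by_cases hxK : (chartAt (Fin (n + 1) → ℂ) c).symm z ∈ K
    · have := ρ.sum_eq_one hxK
      rw [finsum_eq_sum_of_fintype] at this
      rw [this, one_smul]
    · rw [DiffForm.inChart_eq_zero (hK0 _ hxK)]
      ext v
      exact (smul_zero (_ : ℝ)).symm

/-- The Poincaré-Lelong formula on a complex manifold, with `∂∂̄ψ` cut into finitely many densities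
supported in charts. -/
theorem IsTestForm.exists_densities [Nonempty X] {ψ : DiffForm (n + 1) X (2 * n)}
    (hψ : IsTestForm n ψ) :
    ∃ (t : Finset X) (θ : t → (Fin (n + 1) → ℂ) → ℂ),
      (∀ i, Continuous (θ i) ∧ HasCompactSupport (θ i) ∧
        tsupport (θ i) ⊆ (chartAt (Fin (n + 1) → ℂ) i.1).target) ∧
      (∀ u : X → ℝ, (∀ i : t, Integrable fun z =>
          (u ((chartAt (Fin (n + 1) → ℂ) i.1).symm z) : ℂ) * θ i z) →
        ddbarCurrent u ψ =
          ∑ i, ∫ z, (u ((chartAt (Fin (n + 1) → ℂ) i.1).symm z) : ℂ) * θ i z) ∧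
      ∀ f : X → ℂ, (∀ c : X, IsNonvanishingOn
          (fun z => f ((chartAt (Fin (n + 1) → ℂ) c).symm z)) (chartAt (Fin (n + 1) → ℂ) c).target) →
        zeroMass f ψ < ⊤ ∧ zeroCurrent f ψ = Complex.I / Real.pi *
          ∑ i, ∫ z, (Real.log ‖f ((chartAt (Fin (n + 1) → ℂ) i.1).symm z)‖ : ℂ) * θ i z := by
  obtain ⟨t, ξ, K, hξ, hsum⟩ := hψ.exists_eq_sum
  have hts : ∀ i : t, tsupport (fun z => topCoeff (ddbar (DiffForm.extendChart (ξ i) i.1) z)) ⊆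
      tsupport (DiffForm.extendChart (ξ i) i.1) := fun i => tsupport_topCoeff_ddbar_subset _
  have hcont : ∀ i, ∀ c : X, ContinuousOn (DiffForm.inChart (ξ i) c)
      (chartAt (Fin (n + 1) → ℂ) c).target := fun i c => ((hξ i).smooth c).continuousOn
  have hm : ∀ k, MeasurableSet (chartAt (Fin (n + 1) → ℂ) (chartCenter (Fin (n + 1) → ℂ) k : X) ''
      chartPiece (Fin (n + 1) → ℂ) k) := fun k => by
    rw [image_chart_eq _ (chartPiece_subset (Fin (n + 1) → ℂ) k)]
    exact measurableSet_preimage_chartPiece _ k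
  have hsub : ∀ k, chartAt (Fin (n + 1) → ℂ) (chartCenter (Fin (n + 1) → ℂ) k : X) ''
      chartPiece (Fin (n + 1) → ℂ) k ⊆
      (chartAt (Fin (n + 1) → ℂ) (chartCenter (Fin (n + 1) → ℂ) k : X)).target := fun k => by
    rw [image_chart_eq _ (chartPiece_subset (Fin (n + 1) → ℂ) k)]
    exact inter_subset_left
  refine ⟨t, fun i z => topCoeff (ddbar (DiffForm.extendChart (ξ i) i.1) z), fun i => ⟨?_, ?_, ?_⟩,
    fun u hu => ?_, fun f hf => ⟨?_, ?_⟩⟩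
  · exact continuous_topCoeff.comp (continuous_ddbar ((hξ i).contDiff.of_le
      (WithTop.coe_le_coe.2 (le_top : (2 : ℕ∞) ≤ ⊤))))
  · exact (hξ i).hasCompactSupport.of_isClosed_subset (isClosed_tsupport _) (hts i)
  · exact (hts i).trans (hξ i).tsupport_subset
  · have h := fun i : t => (hξ i).ddbarCurrent_hasSum (fun x => (u x : ℂ)) (hu i).integrableOn
    rw [ddbarCurrent, chartIntegral]
    have hk : ∀ k : ℕ, ∫ z in chartAt (Fin (n + 1) → ℂ) (chartCenter (Fin (n + 1) → ℂ) k : X) ''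
          chartPiece (Fin (n + 1) → ℂ) k,
        (u ((chartAt (Fin (n + 1) → ℂ) (chartCenter (Fin (n + 1) → ℂ) k : X)).symm z) : ℂ) *
          topCoeff (ddbar (DiffForm.inChart ψ (chartCenter (Fin (n + 1) → ℂ) k)) z) =
        ∑ i : t, ∫ z in chartAt (Fin (n + 1) → ℂ) (chartCenter (Fin (n + 1) → ℂ) k : X) ''
          chartPiece (Fin (n + 1) → ℂ) k,
        (u ((chartAt (Fin (n + 1) → ℂ) (chartCenter (Fin (n + 1) → ℂ) k : X)).symm z) : ℂ) *
          topCoeff (ddbar (DiffForm.inChart (ξ i) (chartCenter (Fin (n + 1) → ℂ) k)) z) := by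
      intro k
      rw [← integral_finsetSum _ fun i _ => (h i).1 k]
      refine setIntegral_congr_fun (hm k) fun z hz => ?_
      rw [← Finset.mul_sum, funext (hsum _), ddbar_finsetSum]
      · simp only [topCoeff, ContinuousAlternatingMap.sum_apply]
      · exact fun i _ => (((hξ i).smooth _).contDiffAt ((chartAt _ _).open_target.mem_nhds
          (hsub k hz))).of_le (WithTop.coe_le_coe.2 (le_top : (2 : ℕ∞) ≤ ⊤))
    refine (tsum_congr hk).trans ((hasSum_sum fun i _ => (h i).2).tsum_eq.trans ?_)
    refine Finset.sum_congr rfl fun i _ => setIntegral_topCoeff_ddbar (hξ i).tsupport_subset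
  · have h := fun i : t => (hξ i).zeroCurrent_hasSum (hf i.1)
    have hle : zeroMass f ψ ≤ ∑ i, zeroMass f (ξ i) := by
      simp only [zeroMass]
      rw [← Summable.tsum_finsetSum fun _ _ => ENNReal.summable]
      refine ENNReal.tsum_le_tsum fun k => ?_
      rw [funext (hsum _)]
      exact zeroMassOn_finsetSum_le _ (fun i _ => hcont i _) (hm k) (hsub k)
    exact hle.trans_lt (ENNReal.sum_lt_top.2 fun i _ => (h i).1)
  · have h := fun i : t => (hξ i).zeroCurrent_hasSum (hf i.1)
    have hmass : ∀ k : ℕ, ∀ i ∈ (Finset.univ : Finset t), zeroMassOn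
        (fun z => f ((chartAt (Fin (n + 1) → ℂ) (chartCenter (Fin (n + 1) → ℂ) k : X)).symm z))
        (DiffForm.inChart (ξ i) (chartCenter (Fin (n + 1) → ℂ) k))
        (chartAt (Fin (n + 1) → ℂ) (chartCenter (Fin (n + 1) → ℂ) k : X) ''
          chartPiece (Fin (n + 1) → ℂ) k) < ⊤ := fun k i _ =>
      (ENNReal.le_tsum k).trans_lt (h i).1
    rw [zeroCurrent, Finset.mul_sum, ← (hasSum_sum fun i _ => (h i).2).tsum_eq]
    refine tsum_congr fun k => ?_
    simp only
    rw [funext (hsum _)]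
    exact zeroIntegralOn_finsetSum _ (fun i _ => hcont i _) (hm k) (hsub k) (hmass k)

end TestForm

/-! ## Logarithms of Gaussian linear forms -/

section Gaussian

open ProbabilityTheory

theorem map_sum_mul_pi_gaussianReal {d : ℕ} (v : ℝ≥0) (a : Fin d → ℝ) :
    (Measure.pi fun _ : Fin d => gaussianReal 0 v).map (fun c => ∑ j, c j * a j) =
      gaussianReal 0 (∑ j, ‖a j‖₊ ^ 2 * v) := by
  have hind : iIndepFun (fun (j : Fin d) (c : Fin d → ℝ) => c j * a j)
      (Measure.pi fun _ : Fin d => gaussianReal 0 v) :=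
    iIndepFun_pi (X := fun j x => x * a j) fun j => by fun_prop
  have h : ∀ s : Finset (Fin d), (Measure.pi fun _ : Fin d => gaussianReal 0 v).map
      (∑ j ∈ s, fun c => c j * a j) = gaussianReal 0 (∑ j ∈ s, ‖a j‖₊ ^ 2 * v) := by
    intro s
    induction s using Finset.induction_on with
    | empty =>
      simp only [Finset.sum_empty, gaussianReal_zero_var]
      exact (Measure.map_const _ (0 : ℝ)).trans (by simp)
    | insert i s hi ih =>
      have h1 := (measurePreserving_eval (fun _ : Fin d => gaussianReal 0 v) i).map_eq
      have h2 : (fun c : Fin d → ℝ => c i * a i) = (fun x => x * a i) ∘ Function.eval i := rfl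
      have h3 : (Measure.pi fun _ : Fin d => gaussianReal 0 v).map (fun c => c i * a i) =
          gaussianReal 0 (‖a i‖₊ ^ 2 * v) := by
        rw [h2, ← Measure.map_map (by fun_prop) (by fun_prop), h1, gaussianReal_map_mul_const,
          mul_zero]
        congr 2
        ext
        simp
      have h4 := gaussianReal_add_gaussianReal_of_indepFun
        ((hind.indepFun_finsetSum_of_notMem (fun j => by fun_prop) hi).symm) h3 ih
      rw [Finset.sum_insert hi, Finset.sum_insert hi, h4, add_zero]
  have := h Finset.univ
  convert this using 2
  ext c
  simp

/-- On `[-1, 1]` the Gaussian density is at most `1`, so integrability of the logarithm for Lebesgue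
measure suffices; outside, `|log|x|| ≤ x²`. -/
theorem integrable_log_gaussianReal : Integrable (fun x => Real.log x) (gaussianReal 0 1) := by
  have hm : Measurable Real.log := Real.measurable_log
  have h1 : IntegrableOn Real.log (Icc (-1) 1) (gaussianReal 0 1) := by
    have hle : gaussianReal 0 1 ≤ volume := by
      rw [gaussianReal_of_var_ne_zero 0 one_ne_zero]
      conv_rhs => rw [← withDensity_one (μ := (volume : Measure ℝ))]
      refine withDensity_mono (Eventually.of_forall fun x => ?_)
      simp only [gaussianPDF, Pi.one_apply, ENNReal.ofReal_le_one, gaussianPDFReal]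
      have hpi := Real.pi_gt_three
      refine mul_le_one₀ (inv_le_one_of_one_le₀ ?_) (Real.exp_nonneg _) ?_
      · rw [Real.one_le_sqrt]; norm_num; linarith
      · rw [Real.exp_le_one_iff]
        simp only [NNReal.coe_one]
        nlinarith [sq_nonneg (x - 0)]
    have h2 : IntegrableOn Real.log (Icc (-1) 1) volume :=
      (intervalIntegrable_iff_integrableOn_Icc_of_le (by norm_num)).1
        intervalIntegral.intervalIntegrable_log'
    exact h2.mono_measure hle
  have h2 : IntegrableOn Real.log (Icc (-1) 1)ᶜ (gaussianReal 0 1) := by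
    have hsq : Integrable (fun x : ℝ => x ^ 2) (gaussianReal 0 1) :=
      (memLp_id_gaussianReal 2).integrable_sq
    refine hsq.integrableOn.mono' hm.aestronglyMeasurable ?_
    refine ae_restrict_of_forall_mem measurableSet_Icc.compl fun x hx => ?_
    have hx1 : 1 ≤ |x| := by
      by_contra h
      exact hx ⟨by linarith [neg_abs_le x], by linarith [le_abs_self x]⟩
    rw [Real.norm_eq_abs, ← Real.log_abs, abs_of_nonneg (Real.log_nonneg hx1), ← sq_abs]
    nlinarith [Real.log_le_sub_one_of_pos (by linarith : 0 < |x|)]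
  have := h1.union h2
  rwa [union_compl_self, integrableOn_univ] at this

/-- The mean of `|log|x||` for a standard Gaussian variable `x`. -/
def gaussianLogMean : ℝ := ∫ x, |Real.log x| ∂gaussianReal 0 1

variable {d : ℕ}

theorem map_sum_mul_waveMeasure (a : Fin d → ℝ) :
    (waveMeasure d).map (fun c => ∑ j, c j * a j) =
      gaussianReal 0 (∑ j, ‖a j‖₊ ^ 2 * ((2 * d : ℝ≥0)⁻¹)) :=
  map_sum_mul_pi_gaussianReal _ a

instance : IsProbabilityMeasure (waveMeasure d) := by
  unfold waveMeasure; infer_instance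

theorem measurable_sum_mul (a : Fin d → ℝ) : Measurable fun c : Fin d → ℝ => ∑ j, c j * a j := by
  fun_prop

theorem integral_sq_sum_mul (a : Fin d → ℝ) :
    Integrable (fun c => (∑ j, c j * a j) ^ 2) (waveMeasure d) ∧
    ∫ c, (∑ j, c j * a j) ^ 2 ∂waveMeasure d = (∑ j, a j ^ 2) / (2 * d) := by
  have hint : Integrable (fun x : ℝ => x ^ 2)
      (gaussianReal 0 (∑ j, ‖a j‖₊ ^ 2 * ((2 * d : ℝ≥0)⁻¹))) :=
    (memLp_id_gaussianReal 2).integrable_sq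
  have hmap := map_sum_mul_waveMeasure a
  rw [← hmap] at hint
  refine ⟨hint.comp_measurable (measurable_sum_mul a), ?_⟩
  have h := integral_map (μ := waveMeasure d) (measurable_sum_mul a).aemeasurable
    (f := fun x : ℝ => x ^ 2) (by fun_prop)
  rw [← h, hmap]
  have hv := variance_fun_id_gaussianReal (μ := 0) (v := ∑ j, ‖a j‖₊ ^ 2 * ((2 * d : ℝ≥0)⁻¹))
  rw [variance_eq_integral (by fun_prop)] at hv
  simp only [integral_id_gaussianReal, sub_zero] at hv
  rw [hv]
  push_cast
  simp only [Real.norm_eq_abs, sq_abs]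
  rw [← Finset.sum_mul, div_eq_mul_inv]

theorem waveMeasure_sum_mul_eq_zero (hd : 0 < d) {a : Fin d → ℝ} (ha : a ≠ 0) :
    ∀ᵐ c ∂waveMeasure d, ∑ j, c j * a j ≠ 0 := by
  obtain ⟨j, hj⟩ := Function.ne_iff.1 ha
  have hv : (∑ j, ‖a j‖₊ ^ 2 * ((2 * d : ℝ≥0)⁻¹)) ≠ 0 := by
    have h1 : 0 < ‖a j‖₊ ^ 2 * ((2 * d : ℝ≥0)⁻¹) := by
      have : 0 < ‖a j‖₊ := nnnorm_pos.2 hj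
      have : (0 : ℝ≥0) < d := by exact_mod_cast hd
      positivity
    exact (h1.trans_le (Finset.single_le_sum (f := fun j => ‖a j‖₊ ^ 2 * ((2 * d : ℝ≥0)⁻¹))
      (fun _ _ => zero_le) (Finset.mem_univ j))).ne'
  have := nullSingletonClass_gaussianReal (μ := 0) hv
  have h0 : ∀ᵐ x ∂gaussianReal 0 (∑ j, ‖a j‖₊ ^ 2 * ((2 * d : ℝ≥0)⁻¹)), x ≠ 0 := by
    rw [ae_iff]
    simp only [ne_eq, not_not]
    exact measure_singleton 0
  rw [← map_sum_mul_waveMeasure] at h0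
  exact ae_of_ae_map (measurable_sum_mul a).aemeasurable h0

/-- The normalization cancels the variance `1/(2d)` of the coefficients, so the linear form is
standard Gaussian and the mean is independent of `d` and `a`. -/
theorem integral_abs_log_sum_mul (hd : 0 < d) {a : Fin d → ℝ} (ha : ∑ j, a j ^ 2 = 2 * d) :
    Integrable (fun c => |Real.log (∑ j, c j * a j)|) (waveMeasure d) ∧
    ∫ c, |Real.log (∑ j, c j * a j)| ∂waveMeasure d = gaussianLogMean := by
  have hv : (∑ j, ‖a j‖₊ ^ 2 * ((2 * d : ℝ≥0)⁻¹)) = 1 := by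
    ext
    push_cast
    simp only [Real.norm_eq_abs, sq_abs]
    rw [← Finset.sum_mul, ha]
    have : (0 : ℝ) < d := by exact_mod_cast hd
    field_simp
  have hmap := map_sum_mul_waveMeasure a
  rw [hv] at hmap
  constructor
  · have := integrable_log_gaussianReal.abs
    rw [← hmap] at this
    exact this.comp_measurable (measurable_sum_mul a)
  · rw [gaussianLogMean, ← hmap, integral_map (measurable_sum_mul a).aemeasurable]
    exact (Real.measurable_log.abs).aestronglyMeasurable

/-- The mean deviation of `log|∑ c_j Φ_j|` from `log (∑ |Φ_j|² / 2d)^(1/2)` is bounded. -/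
theorem integral_abs_log_norm_sum_le (hd : 0 < d) {Φ : Fin d → ℂ} (hΦ : 0 < ∑ j, ‖Φ j‖ ^ 2) :
    Integrable (fun c : Fin d → ℝ => |Real.log ‖∑ j, (c j : ℂ) * Φ j‖ -
      (Real.log (∑ j, ‖Φ j‖ ^ 2) / 2 - Real.log (2 * d) / 2)|) (waveMeasure d) ∧
    ∫ c : Fin d → ℝ, |Real.log ‖∑ j, (c j : ℂ) * Φ j‖ -
      (Real.log (∑ j, ‖Φ j‖ ^ 2) / 2 - Real.log (2 * d) / 2)| ∂waveMeasure d ≤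
        gaussianLogMean + 2 := by
  have hd0 : (0 : ℝ) < d := by exact_mod_cast hd
  set s := ∑ j, ‖Φ j‖ ^ 2 with hs
  set X : (Fin d → ℝ) → ℝ := fun c => ‖∑ j, (c j : ℂ) * Φ j‖ with hX
  have hre : ∀ c : Fin d → ℝ, (∑ j, (c j : ℂ) * Φ j).re = ∑ j, c j * (Φ j).re := fun c => by simp
  have him : ∀ c : Fin d → ℝ, (∑ j, (c j : ℂ) * Φ j).im = ∑ j, c j * (Φ j).im := fun c => by simp
  have hXsq : ∀ c, X c ^ 2 = (∑ j, c j * (Φ j).re) ^ 2 + (∑ j, c j * (Φ j).im) ^ 2 := fun c => by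
    rw [hX, Complex.sq_norm, Complex.normSq_apply, hre, him]; ring
  have hsum : s = ∑ j, (Φ j).re ^ 2 + ∑ j, (Φ j).im ^ 2 := by
    rw [hs, ← Finset.sum_add_distrib]
    exact Finset.sum_congr rfl fun j _ => by rw [Complex.sq_norm, Complex.normSq_apply]; ring
  -- The larger of the real and imaginary parts of `Φ`. It controls how small `X` can become, at the
  -- price of a factor `2` in the variance.
  obtain ⟨b, hb, hbX⟩ : ∃ b : Fin d → ℝ, s / 2 ≤ ∑ j, b j ^ 2 ∧ ∀ c, |∑ j, c j * b j| ≤ X c := by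
    rcases le_total (∑ j, (Φ j).re ^ 2) (∑ j, (Φ j).im ^ 2) with h | h
    · refine ⟨fun j => (Φ j).im, by linarith, fun c => ?_⟩
      rw [← him]; exact Complex.abs_im_le_norm _
    · refine ⟨fun j => (Φ j).re, by linarith, fun c => ?_⟩
      rw [← hre]; exact Complex.abs_re_le_norm _
  set p := ∑ j, b j ^ 2 with hp
  have hp0 : 0 < p := by linarith
  set κ := √(2 * d / p) with hκ
  have hκsq : κ ^ 2 = 2 * d / p := Real.sq_sqrt (by positivity)
  have hκ0 : 0 < κ := Real.sqrt_pos.2 (by positivity)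
  set a : Fin d → ℝ := fun j => κ * b j with ha
  have hasq : ∑ j, a j ^ 2 = 2 * d := by
    simp only [ha, mul_pow, ← Finset.mul_sum]
    rw [hκsq, ← hp]; field_simp
  have hU : ∀ c : Fin d → ℝ, ∑ j, c j * a j = κ * ∑ j, c j * b j := fun c => by
    rw [Finset.mul_sum]; exact Finset.sum_congr rfl fun j _ => by rw [ha]; ring
  have ha0 : a ≠ 0 := by
    intro h
    rw [h] at hasq
    simp at hasq
    omega
  obtain ⟨hi1, he1⟩ := integral_abs_log_sum_mul hd hasq
  obtain ⟨hi2, he2⟩ := integral_sq_sum_mul (d := d) fun j => (Φ j).re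
  obtain ⟨hi3, he3⟩ := integral_sq_sum_mul (d := d) fun j => (Φ j).im
  -- A majorant of the deviation. The quadratic term is the normalized square of `X`, with mean `1`,
  -- and handles large values through `log x ≤ x - 1`; the logarithm of the standard Gaussian
  -- handles small values; the final `1` absorbs the loss of the factor `2`. The mean is `1 +
  -- gaussianLogMean + 1`.
  set g : (Fin d → ℝ) → ℝ := fun c => 2 * d / s * ((∑ j, c j * (Φ j).re) ^ 2 +
    (∑ j, c j * (Φ j).im) ^ 2) + |Real.log (∑ j, c j * a j)| + 1 with hg
  have hgi : Integrable g (waveMeasure d) :=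
    (((hi2.add hi3).const_mul _).add hi1).add (integrable_const _)
  have hge : ∫ c, g c ∂waveMeasure d = gaussianLogMean + 2 := by
    have e1 : ∫ c, g c ∂waveMeasure d = 2 * d / s * (∫ c, (∑ j, c j * (Φ j).re) ^ 2 ∂waveMeasure d +
        ∫ c, (∑ j, c j * (Φ j).im) ^ 2 ∂waveMeasure d) +
        ∫ c, |Real.log (∑ j, c j * a j)| ∂waveMeasure d + 1 := by
      have h23 : Integrable (fun c => 2 * d / s * ((∑ j, c j * (Φ j).re) ^ 2 +
        (∑ j, c j * (Φ j).im) ^ 2)) (waveMeasure d) := (hi2.add hi3).const_mul _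
      have h123 : Integrable (fun c => 2 * d / s * ((∑ j, c j * (Φ j).re) ^ 2 +
        (∑ j, c j * (Φ j).im) ^ 2) + |Real.log (∑ j, c j * a j)|) (waveMeasure d) := h23.add hi1
      simp only [hg]
      rw [integral_add h123 (integrable_const _), integral_add h23 hi1, integral_const_mul,
        integral_add hi2 hi3]
      simp
    rw [e1, he1, he2, he3, ← add_div, ← hsum]
    field_simp
    ring
  have hle : ∀ᵐ c ∂waveMeasure d, |Real.log (X c) -
      (Real.log s / 2 - Real.log (2 * d) / 2)| ≤ g c := by
    filter_upwards [waveMeasure_sum_mul_eq_zero hd ha0] with c hc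
    have hXc : 0 < X c := by
      refine lt_of_lt_of_le (abs_pos.2 fun h => hc ?_) (hbX c)
      rw [hU, h, mul_zero]
    have hlogκ : Real.log κ = (Real.log (2 * d) - Real.log p) / 2 := by
      rw [hκ, Real.log_sqrt (by positivity), Real.log_div (by positivity) hp0.ne']
    have h1 : Real.log (∑ j, c j * a j) ≤ Real.log κ + Real.log (X c) := by
      rw [← Real.log_abs, hU, abs_mul, abs_of_pos hκ0, ← Real.log_mul hκ0.ne' hXc.ne']
      refine Real.log_le_log ?_ (mul_le_mul_of_nonneg_left (hbX c) hκ0.le)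
      rw [← abs_of_pos hκ0, ← abs_mul, ← hU]
      exact abs_pos.2 hc
    have h2 : Real.log s ≤ Real.log p + 1 := by
      have : Real.log s ≤ Real.log (2 * p) := Real.log_le_log hΦ (by linarith)
      rw [Real.log_mul two_ne_zero hp0.ne'] at this
      linarith [Real.log_two_lt_d9]
    have h3 : Real.log (2 * d) + 2 * Real.log (X c) - Real.log s ≤ 2 * d / s * X c ^ 2 := by
      have h4 := Real.log_le_sub_one_of_pos (by positivity : 0 < 2 * d / s * X c ^ 2)
      rw [Real.log_mul (by positivity) (by positivity), Real.log_div (by positivity) hΦ.ne',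
        Real.log_pow] at h4
      push_cast at h4
      linarith
    have h5 : 0 ≤ 2 * d / s * X c ^ 2 := by positivity
    have h6 := neg_abs_le (Real.log (∑ j, c j * a j))
    have h7 := abs_nonneg (Real.log (∑ j, c j * a j))
    rw [hg]
    simp only
    rw [← hXsq, abs_le]
    constructor <;> linarith
  have hm : AEStronglyMeasurable (fun c => |Real.log (X c) -
      (Real.log s / 2 - Real.log (2 * d) / 2)|) (waveMeasure d) := by
    have : Measurable X := by fun_prop
    exact ((Real.measurable_log.comp this).sub_const _).abs.aestronglyMeasurable
  have hint : Integrable (fun c => |Real.log (X c) -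
      (Real.log s / 2 - Real.log (2 * d) / 2)|) (waveMeasure d) := by
    refine hgi.mono' hm ?_
    filter_upwards [hle] with c hc
    rwa [Real.norm_eq_abs, abs_abs]
  exact ⟨hint, (integral_mono_ae hint hgi hle).trans_eq hge⟩

end Gaussian

/-! ## The expected zero current -/

section Expectation

variable {n d : ℕ}

/-- The logarithm of the sum lies between `2 log|G j₀|`, which is locally integrable, and the sum
itself, which is continuous. -/
theorem locallyIntegrableOn_log_sum {G : Fin d → (Fin (n + 1) → ℂ) → ℂ}
    {U : Set (Fin (n + 1) → ℂ)} (hU : IsOpen U) (hG : ∀ j, ContinuousOn (G j) U) {j₀ : Fin d}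
    (h0 : IsNonvanishingOn (G j₀) U) :
    LocallyIntegrableOn (fun z => Real.log (∑ j, ‖G j z‖ ^ 2)) U := by
  have hc : ContinuousOn (fun z => ∑ j, ‖G j z‖ ^ 2) U :=
    continuousOn_finsetSum _ fun j _ => (hG j).norm.pow 2
  have hle : ∀ z, G j₀ z ≠ 0 → ‖Real.log (∑ j, ‖G j z‖ ^ 2)‖ ≤
      2 * |Real.log ‖G j₀ z‖| + ∑ j, ‖G j z‖ ^ 2 := fun z hz => by
    have h1 : 0 < ‖G j₀ z‖ ^ 2 := by positivity
    have h2 : ‖G j₀ z‖ ^ 2 ≤ ∑ j, ‖G j z‖ ^ 2 :=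
      Finset.single_le_sum (f := fun j => ‖G j z‖ ^ 2) (fun _ _ => by positivity) (Finset.mem_univ j₀)
    have h3 := Real.log_le_log h1 h2
    rw [Real.log_pow] at h3
    push_cast at h3
    have h4 := Real.log_le_sub_one_of_pos (h1.trans_le h2)
    have h5 := neg_abs_le (Real.log ‖G j₀ z‖)
    have h6 := abs_nonneg (Real.log ‖G j₀ z‖)
    rw [Real.norm_eq_abs, abs_le]
    constructor <;> linarith
  have hbound : LocallyIntegrableOn
      (fun z => 2 * |Real.log ‖G j₀ z‖| + ∑ j, ‖G j z‖ ^ 2) U := by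
    refine LocallyIntegrableOn.add (fun z hz => ?_) (hc.locallyIntegrableOn hU.measurableSet)
    obtain ⟨s, hs, hi⟩ := h0.locallyIntegrableOn_log hU z hz
    exact ⟨s, hs, hi.norm.const_mul 2⟩
  intro z hz
  obtain ⟨s, hs, hi⟩ := hbound z hz
  refine ⟨s ∩ U, inter_mem hs self_mem_nhdsWithin, ?_⟩
  have hm : AEStronglyMeasurable (fun z => Real.log (∑ j, ‖G j z‖ ^ 2)) (volume.restrict (s ∩ U)) :=
    (Real.measurable_log.comp_aemeasurable
      (hc.aemeasurable hU.measurableSet)).aestronglyMeasurable.mono_measure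
        (Measure.restrict_mono inter_subset_right le_rfl)
  refine (hi.mono_set inter_subset_left).mono' hm ?_
  have h1 : ∀ᵐ z ∂volume.restrict (s ∩ U), G j₀ z ≠ 0 :=
    ae_mono (Measure.restrict_mono inter_subset_right le_rfl)
      ((ae_restrict_iff' hU.measurableSet).2 (h0.ae_ne_zero hU))
  filter_upwards [h1] with y hy using hle y hy

theorem gaussianLogMean_nonneg : 0 ≤ gaussianLogMean := integral_nonneg fun _ => abs_nonneg _

/-- The pointwise mean bound, integrated against `θ`. The deviation `T`, not the logarithm itself,
is put on the product space: its mean is bounded uniformly in `z`, which makes `T θ` integrable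
there and justifies Fubini. -/
theorem integral_log_norm_sum_mul {α : Type*} [MeasurableSpace α] {μ : Measure α} [SFinite μ]
    {G : Fin d → α → ℂ} {θ : α → ℂ}
    (hd : 0 < d) (hG : ∀ j, Measurable (G j)) (hθ : Integrable θ μ)
    (hpos : ∀ᵐ z ∂μ, θ z ≠ 0 → 0 < ∑ j, ‖G j z‖ ^ 2)
    (hlog : Integrable (fun z => (Real.log (∑ j, ‖G j z‖ ^ 2) : ℂ) * θ z) μ) :
    Integrable (fun c : Fin d → ℝ => ∫ z, (Real.log ‖∑ j, (c j : ℂ) * G j z‖ : ℂ) * θ z ∂μ)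
      (waveMeasure d) ∧
    ‖∫ c : Fin d → ℝ, ∫ z, (Real.log ‖∑ j, (c j : ℂ) * G j z‖ : ℂ) * θ z ∂μ ∂waveMeasure d -
      ((1 / 2 : ℂ) * ∫ z, (Real.log (∑ j, ‖G j z‖ ^ 2) : ℂ) * θ z ∂μ -
        (Real.log (2 * d) / 2 : ℂ) * ∫ z, θ z ∂μ)‖ ≤ (gaussianLogMean + 2) * ∫ z, ‖θ z‖ ∂μ := by
  obtain ⟨T, hT⟩ : ∃ T : (Fin d → ℝ) → α → ℝ, ∀ c z, T c z =
      Real.log ‖∑ j, (c j : ℂ) * G j z‖ -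
        (Real.log (∑ j, ‖G j z‖ ^ 2) / 2 - Real.log (2 * d) / 2) := ⟨_, fun _ _ => rfl⟩
  have hTm : Measurable fun p : (Fin d → ℝ) × α => T p.1 p.2 := by
    simp only [hT]
    refine Measurable.sub (Real.measurable_log.comp (Measurable.norm ?_))
      (((Real.measurable_log.comp ?_).div_const _).sub_const _)
    · exact Finset.measurable_fun_sum _ fun j _ =>
        (Complex.measurable_ofReal.comp ((measurable_pi_apply j).comp measurable_fst)).mul
          ((hG j).comp measurable_snd)
    · exact Finset.measurable_fun_sum _ fun j _ => ((hG j).comp measurable_snd).norm.pow_const 2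
  have hKm : AEStronglyMeasurable (fun p : (Fin d → ℝ) × α => (T p.1 p.2 : ℂ) * θ p.2)
      ((waveMeasure d).prod μ) :=
    (Complex.measurable_ofReal.comp hTm).aestronglyMeasurable.mul
      hθ.aestronglyMeasurable.comp_snd
  have hnorm : ∀ c z, ‖(T c z : ℂ) * θ z‖ = |T c z| * ‖θ z‖ := fun c z => by
    rw [norm_mul, Complex.norm_real, Real.norm_eq_abs]
  have hsec : ∀ᵐ z ∂μ, Integrable (fun c => (T c z : ℂ) * θ z) (waveMeasure d) ∧
      ∫ c, ‖(T c z : ℂ) * θ z‖ ∂waveMeasure d ≤ (gaussianLogMean + 2) * ‖θ z‖ := by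
    filter_upwards [hpos] with z hz
    by_cases h0 : θ z = 0
    · simp [h0]
    obtain ⟨h1, h2⟩ := integral_abs_log_norm_sum_le (Φ := fun j => G j z) hd (hz h0)
    simp only [hnorm, integral_mul_const]
    have hpair : Measurable fun c : Fin d → ℝ => (c, z) := measurable_id.prodMk measurable_const
    have hm : Measurable fun c => T c z := hTm.comp hpair
    have h3 : Integrable (fun c => |T c z|) (waveMeasure d) := by simpa only [hT] using h1
    have h4 : Integrable (fun c => T c z) (waveMeasure d) :=
      (integrable_norm_iff hm.aestronglyMeasurable).1 (by simpa only [Real.norm_eq_abs] using h3)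
    have h5 : ∫ c, |T c z| ∂waveMeasure d ≤ gaussianLogMean + 2 := by simpa only [hT] using h2
    exact ⟨h4.ofReal.mul_const (θ z), mul_le_mul_of_nonneg_right h5 (norm_nonneg _)⟩
  have hK : Integrable (fun p : (Fin d → ℝ) × α => (T p.1 p.2 : ℂ) * θ p.2)
      ((waveMeasure d).prod μ) := by
    refine (integrable_prod_iff' hKm).2 ⟨hsec.mono fun z h => h.1, ?_⟩
    refine (hθ.norm.const_mul (gaussianLogMean + 2)).mono' hKm.norm.prod_swap.integral_prod_right' ?_
    filter_upwards [hsec] with z hz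
    rw [Real.norm_of_nonneg (integral_nonneg fun _ => norm_nonneg _)]
    exact hz.2
  set B : ℂ := (1 / 2 : ℂ) * ∫ z, (Real.log (∑ j, ‖G j z‖ ^ 2) : ℂ) * θ z ∂μ -
    (Real.log (2 * d) / 2 : ℂ) * ∫ z, θ z ∂μ with hB
  have hBi : Integrable (fun z => (1 / 2 : ℂ) * ((Real.log (∑ j, ‖G j z‖ ^ 2) : ℂ) * θ z) -
      (Real.log (2 * d) / 2 : ℂ) * θ z) μ := (hlog.const_mul _).sub (hθ.const_mul _)
  have hBe : ∫ z, ((1 / 2 : ℂ) * ((Real.log (∑ j, ‖G j z‖ ^ 2) : ℂ) * θ z) -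
      (Real.log (2 * d) / 2 : ℂ) * θ z) ∂μ = B := by
    rw [integral_sub (hlog.const_mul _) (hθ.const_mul _), integral_const_mul, integral_const_mul]
  have hsplit : (fun c : Fin d → ℝ => ∫ z, (Real.log ‖∑ j, (c j : ℂ) * G j z‖ : ℂ) * θ z ∂μ)
      =ᵐ[waveMeasure d] fun c => ∫ z, (T c z : ℂ) * θ z ∂μ + B := by
    filter_upwards [hK.prod_right_ae] with c hc
    rw [← hBe, ← integral_add hc hBi]
    refine integral_congr_ae (Eventually.of_forall fun z => ?_)
    simp only [hT]
    push_cast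
    ring
  have hKc := hK.integral_prod_left
  refine ⟨(hKc.add (integrable_const B)).congr hsplit.symm, ?_⟩
  rw [integral_congr_ae hsplit, integral_add hKc (integrable_const B), integral_const,
    probReal_univ, one_smul, add_sub_cancel_right, integral_integral_swap hK,
    ← integral_const_mul]
  refine norm_integral_le_of_norm_le (hθ.norm.const_mul _) ?_
  filter_upwards [hsec] with z hz
  exact (norm_integral_le_integral_norm _).trans hz.2

theorem zeroSheet_eq_empty {F : (Fin (n + 1) → ℂ) → ℂ} (h : ∀ z k l, ¬ IsRegularZero F z k l)
    (j : Fin (n + 1)) : zeroSheet F j = ∅ :=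
  eq_empty_iff_forall_notMem.2 fun z hz => by
    obtain ⟨k, l, hl⟩ := exists_isRegularZero_of_mem_zeroSheet hz
    exact h z k l hl

theorem zeroMassOn_of_zeroSheet_eq_empty {F : (Fin (n + 1) → ℂ) → ℂ}
    (h : ∀ j, zeroSheet F j = ∅) (η) (S : Set (Fin (n + 1) → ℂ)) :
    zeroMassOn F η S = 0 ∧ zeroIntegralOn F η S = 0 := by
  have he : ∀ j (w : Fin n → ℂ),
      IsEmpty {t : ℂ // (j.insertNth t w : Fin (n + 1) → ℂ) ∈ S ∩ zeroSheet F j} := fun j w =>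
    ⟨fun t => eq_empty_iff_forall_notMem.1 (h j) _ t.2.2⟩
  simp [zeroMassOn, zeroIntegralOn]

/-- If `a ^ k u` vanished identically near `z` with `u z ≠ 0`, then so would `a`, against `da ≠ 0`.
Hence the zero function has zero current `0`. -/
theorem not_isRegularZero_zero (z : Fin (n + 1) → ℂ) (k : ℕ) (l : (Fin (n + 1) → ℂ) →L[ℂ] ℂ) :
    ¬ IsRegularZero (fun _ => 0) z k l := by
  rintro ⟨hk, hl, a, u, ha, hu, -, rfl, hu0, hF⟩
  have : a =ᶠ[𝓝 z] fun _ => 0 := by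
    filter_upwards [hF, hu.continuousAt.eventually_ne hu0] with y hy hy0
    exact (pow_eq_zero_iff (by omega)).1 ((mul_eq_zero.1 hy.symm).resolve_right hy0)
  rw [this.fderiv_eq] at hl
  simp at hl

variable {X : Type*} [TopologicalSpace X] [ChartedSpace (Fin (n + 1) → ℂ) X]

theorem zeroMass_eq_zero [SecondCountableTopology X] [Nonempty X] {f : X → ℂ}
    (h : ∀ (c : X) z k l, ¬ IsRegularZero
      (fun z => f ((chartAt (Fin (n + 1) → ℂ) c).symm z)) z k l) (ψ : DiffForm (n + 1) X (2 * n)) :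
    zeroMass f ψ = 0 ∧ zeroCurrent f ψ = 0 := by
  simp only [zeroMass, zeroCurrent,
    (zeroMassOn_of_zeroSheet_eq_empty (zeroSheet_eq_empty (h _)) _ _).1,
    (zeroMassOn_of_zeroSheet_eq_empty (zeroSheet_eq_empty (h _)) _ _).2, tsum_zero, and_self]

variable [IsManifold 𝓘(ℂ, Fin (n + 1) → ℂ) ω X] [T2Space X] [SecondCountableTopology X]
  [ConnectedSpace X]

/-- The mean of the zero current of a Gaussian combination of holomorphic functions `Φ_j` differs
from `(i/2π) ∂∂̄ log ∑ |Φ_j|²` by a bounded current, uniformly in the family `Φ`. -/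
theorem IsTestForm.exists_bound {ψ : DiffForm (n + 1) X (2 * n)} (hψ : IsTestForm n ψ) :
    ∃ C : ℝ, 0 ≤ C ∧ ∀ d : ℕ, 0 < d → ∀ Φ : Fin d → X → ℂ,
      (∀ j, MDifferentiable 𝓘(ℂ, Fin (n + 1) → ℂ) 𝓘(ℂ, ℂ) (Φ j)) → (∃ j x, Φ j x ≠ 0) →
      (∀ᵐ c : Fin d → ℝ ∂waveMeasure d, zeroMass (fun x => ∑ j, (c j : ℂ) * Φ j x) ψ < ⊤) ∧
      Integrable (fun c : Fin d → ℝ => zeroCurrent (fun x => ∑ j, (c j : ℂ) * Φ j x) ψ)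
        (waveMeasure d) ∧
      (∀ x : X, LocallyIntegrableOn
        (fun z => Real.log (∑ j, ‖Φ j ((chartAt (Fin (n + 1) → ℂ) x).symm z)‖ ^ 2))
        (chartAt (Fin (n + 1) → ℂ) x).target) ∧
      ‖∫ c : Fin d → ℝ, zeroCurrent (fun x => ∑ j, (c j : ℂ) * Φ j x) ψ ∂waveMeasure d -
        Complex.I / (2 * Real.pi) *
          ddbarCurrent (fun x => Real.log (∑ j, ‖Φ j x‖ ^ 2)) ψ‖ ≤ C := by
  obtain ⟨t, θ, hθ, hdd, hzero⟩ := hψ.exists_densities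
  have hθi : ∀ i, Integrable (θ i) := fun i => (hθ i).1.integrable_of_hasCompactSupport (hθ i).2.1
  -- Stokes' theorem for `∂∂̄ψ`, read off from the Poincaré-Lelong formula: the constant function
  -- `e` has no zeros and its logarithm is `1`.
  have hθ0 : ∑ i, ∫ z, θ i z = 0 := by
    have h1 := (hzero (fun _ => (Real.exp 1 : ℂ)) fun c => ⟨fun z _ => analyticAt_const,
      fun z _ h => by simpa using h.eq_of_nhds⟩).2
    rw [(zeroMass_eq_zero (fun c z k l h => by simpa using h.eq_zero) ψ).2] at h1
    have hpi : (Real.pi : ℂ) ≠ 0 := by exact_mod_cast Real.pi_ne_zero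
    simpa [hpi, Complex.I_ne_zero, ← Complex.ofReal_exp, abs_of_pos (Real.exp_pos 1)] using h1
  have hC := gaussianLogMean_nonneg
  refine ⟨Real.pi⁻¹ * ∑ i, (gaussianLogMean + 2) * ∫ z, ‖θ i z‖, by positivity,
    fun d hd Φ hΦ ⟨j₀, x₀, hx₀⟩ => ?_⟩
  have hnv := isNonvanishingOn_chart (hΦ j₀) ⟨x₀, hx₀⟩
  have hcont : ∀ (x : X) j, ContinuousOn (fun z => Φ j ((chartAt (Fin (n + 1) → ℂ) x).symm z))
      (chartAt (Fin (n + 1) → ℂ) x).target := fun x j =>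
    (hΦ j).continuous.comp_continuousOn (chartAt (Fin (n + 1) → ℂ) x).continuousOn_symm
  have hloc : ∀ x : X, LocallyIntegrableOn
      (fun z => Real.log (∑ j, ‖Φ j ((chartAt (Fin (n + 1) → ℂ) x).symm z)‖ ^ 2))
      (chartAt (Fin (n + 1) → ℂ) x).target := fun x =>
    locallyIntegrableOn_log_sum (chartAt (Fin (n + 1) → ℂ) x).open_target (hcont x) (hnv x)
  -- Almost surely the random combination does not vanish at `x₀`, since the real or the imaginary
  -- part there is a nondegenerate Gaussian. By connectedness the formula then applies to it.
  have hae : ∀ᵐ c : Fin d → ℝ ∂waveMeasure d, ∑ j, (c j : ℂ) * Φ j x₀ ≠ 0 := by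
    by_cases h : (Φ j₀ x₀).re = 0
    · have him : (fun j => (Φ j x₀).im) ≠ 0 := fun h' => hx₀ (Complex.ext h (congrFun h' j₀))
      filter_upwards [waveMeasure_sum_mul_eq_zero hd him] with c hc h0
      exact hc (by simpa using congrArg Complex.im h0)
    · have hre : (fun j => (Φ j x₀).re) ≠ 0 := fun h' => h (congrFun h' j₀)
      filter_upwards [waveMeasure_sum_mul_eq_zero hd hre] with c hc h0
      exact hc (by simpa using congrArg Complex.re h0)
  have hz : ∀ᵐ c : Fin d → ℝ ∂waveMeasure d,
      zeroMass (fun x => ∑ j, (c j : ℂ) * Φ j x) ψ < ⊤ ∧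
      zeroCurrent (fun x => ∑ j, (c j : ℂ) * Φ j x) ψ = Complex.I / Real.pi * ∑ i, ∫ z,
        (Real.log ‖∑ j, (c j : ℂ) * Φ j ((chartAt (Fin (n + 1) → ℂ) i.1).symm z)‖ : ℂ) * θ i z := by
    filter_upwards [hae] with c hc
    refine hzero _ fun x => isNonvanishingOn_chart (f := fun x => ∑ j, (c j : ℂ) * Φ j x) ?_
      ⟨x₀, hc⟩ x
    intro x
    have h := MDifferentiableAt.sum (t := Finset.univ) fun j _ => ((hΦ j) x).const_smul (c j : ℂ)
    convert h using 1
    ext y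
    simp
  have hlogi : ∀ i : t, Integrable fun z =>
      (Real.log (∑ j, ‖Φ j ((chartAt (Fin (n + 1) → ℂ) i.1).symm z)‖ ^ 2) : ℂ) * θ i z := fun i =>
    (hloc i.1).ofReal.integrable_mul_of_hasCompactSupport (hθ i).1 (hθ i).2.1 (hθ i).2.2
  have hmain : ∀ i : t,
      Integrable (fun c : Fin d → ℝ => ∫ z,
        (Real.log ‖∑ j, (c j : ℂ) * Φ j ((chartAt (Fin (n + 1) → ℂ) i.1).symm z)‖ : ℂ) * θ i z)
        (waveMeasure d) ∧
      ‖∫ c : Fin d → ℝ, (∫ z, (Real.log ‖∑ j, (c j : ℂ) *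
          Φ j ((chartAt (Fin (n + 1) → ℂ) i.1).symm z)‖ : ℂ) * θ i z) ∂waveMeasure d -
        ((1 / 2 : ℂ) * (∫ z, (Real.log (∑ j, ‖Φ j ((chartAt (Fin (n + 1) → ℂ) i.1).symm z)‖ ^ 2) : ℂ) *
          θ i z) - (Real.log (2 * d) / 2 : ℂ) * ∫ z, θ i z)‖ ≤
        (gaussianLogMean + 2) * ∫ z, ‖θ i z‖ := by
    intro i
    set U := (chartAt (Fin (n + 1) → ℂ) i.1).target
    have hUo : IsOpen U := (chartAt (Fin (n + 1) → ℂ) i.1).open_target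
    -- The inverse chart is uncontrolled outside its target; extension by zero gives measurable
    -- functions on the whole space, and `θ i` vanishes there anyway.
    set G : Fin d → (Fin (n + 1) → ℂ) → ℂ := fun j =>
      U.indicator fun z => Φ j ((chartAt (Fin (n + 1) → ℂ) i.1).symm z) with hG
    have hGU : ∀ z, θ i z ≠ 0 → ∀ j, G j z = Φ j ((chartAt (Fin (n + 1) → ℂ) i.1).symm z) :=
      fun z hz j => indicator_of_mem ((hθ i).2.2 (subset_tsupport _ hz)) _
    have hGm : ∀ j, Measurable (G j) := fun j => by
      classical
      simp only [hG]
      rw [← piecewise_eq_indicator]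
      exact (hcont i.1 j).measurable_piecewise (g := fun _ => 0) continuousOn_const hUo.measurableSet
    have e1 : ∀ (c : Fin d → ℝ) z,
        (Real.log ‖∑ j, (c j : ℂ) * Φ j ((chartAt (Fin (n + 1) → ℂ) i.1).symm z)‖ : ℂ) * θ i z =
        (Real.log ‖∑ j, (c j : ℂ) * G j z‖ : ℂ) * θ i z := fun c z => by
      by_cases h : θ i z = 0
      · simp [h]
      · simp only [hGU z h]
    have e2 : ∀ z, (Real.log (∑ j, ‖Φ j ((chartAt (Fin (n + 1) → ℂ) i.1).symm z)‖ ^ 2) : ℂ) * θ i z =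
        (Real.log (∑ j, ‖G j z‖ ^ 2) : ℂ) * θ i z := fun z => by
      by_cases h : θ i z = 0
      · simp [h]
      · simp only [hGU z h]
    have hl := hlogi i
    simp only [e1, e2] at hl ⊢
    refine integral_log_norm_sum_mul hd hGm (hθi i) ?_ hl
    have hne := (ae_restrict_iff' hUo.measurableSet).1
      ((ae_restrict_iff' hUo.measurableSet).2 ((hnv i.1).ae_ne_zero hUo))
    filter_upwards [hne] with z hz hθz
    have h1 := hz ((hθ i).2.2 (subset_tsupport _ hθz))
    rw [← hGU z hθz] at h1
    have h2 : 0 < ‖G j₀ z‖ ^ 2 := by positivity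
    exact h2.trans_le (Finset.single_le_sum (f := fun j => ‖G j z‖ ^ 2) (fun _ _ => by positivity)
      (Finset.mem_univ j₀))
  have hzc := hz.mono fun c h => h.2
  refine ⟨hz.mono fun c h => h.1, ?_, hloc, ?_⟩
  · exact ((integrable_finsetSum _ fun i _ => (hmain i).1).const_mul _).congr
      (EventuallyEq.symm hzc)
  · rw [integral_congr_ae hzc, integral_const_mul, integral_finsetSum _ fun i _ => (hmain i).1,
      hdd (fun x => Real.log (∑ j, ‖Φ j x‖ ^ 2)) hlogi]
    -- Because the densities have total integral zero, the terms with `log(2d)` may be inserted for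
    -- free. They do not vanish chart by chart, only in the sum.
    have e : ∀ A : t → ℂ, Complex.I / Real.pi * ∑ i, A i - Complex.I / (2 * Real.pi) *
        ∑ i, ∫ z, (Real.log (∑ j, ‖Φ j ((chartAt (Fin (n + 1) → ℂ) i.1).symm z)‖ ^ 2) : ℂ) * θ i z =
        Complex.I / Real.pi * ∑ i, (A i - ((1 / 2 : ℂ) * (∫ z, (Real.log (∑ j, ‖Φ j
          ((chartAt (Fin (n + 1) → ℂ) i.1).symm z)‖ ^ 2) : ℂ) * θ i z) -
          (Real.log (2 * d) / 2 : ℂ) * ∫ z, θ i z)) := fun A => by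
      simp only [Finset.sum_sub_distrib, ← Finset.mul_sum, hθ0]
      have hpi : (Real.pi : ℂ) ≠ 0 := by exact_mod_cast Real.pi_ne_zero
      field_simp
      ring
    rw [e, norm_mul, norm_div, Complex.norm_I, Complex.norm_real, Real.norm_of_nonneg Real.pi_pos.le,
      one_div]
    gcongr
    exact (norm_sum_le _ _).trans (Finset.sum_le_sum fun i _ => (hmain i).2)

end Expectation

/-! ### Application to complexified waves. -/

theorem mdifferentiable_complexify {m : ℕ} {X M : Type*} [TopologicalSpace X]
    [ChartedSpace (Fin m → ℂ) X] (ι : M → X) (φ : M → ℝ) :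
    MDifferentiable 𝓘(ℂ, Fin m → ℂ) 𝓘(ℂ, ℂ) (complexify m ι φ) := by
  rw [complexify]
  split_ifs with h
  · exact h.choose_spec.1
  · exact mdifferentiable_const

end RandomWaves

end

theorem mainTheorem6 (n : ℕ)
    {M : Type*} [TopologicalSpace M] [T2Space M] [SecondCountableTopology M]
    [CompactSpace M] [ConnectedSpace M]
    [ChartedSpace (EuclideanSpace ℝ (Fin (n + 1))) M] [IsManifold (𝓡 (n + 1)) ω M]
    (g : AnalyticMetric (n + 1) M)
    {X : Type*} [TopologicalSpace X] [T2Space X] [SecondCountableTopology X] [ConnectedSpace X]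
    [ChartedSpace (Fin (n + 1) → ℂ) X] [IsManifold 𝓘(ℂ, Fin (n + 1) → ℂ) ω X]
    (ι : M → X) (ρ : X → ℝ) (r : ℝ) (hX : IsGrauertTube g ι ρ r)
    (J : ℕ → Set ℝ)
    (ψ : DiffForm (n + 1) X (2 * n)) (hψ : IsTestForm n ψ) :
    ∃ C : ℝ, ∀ N : ℕ, 1 ≤ N → ∀ (d : ℕ), 0 < d → ∀ φ : Fin d → M → ℝ,
      IsOrthonormalBasisOf g (spectralSpace g (J N)) φ →
      (∀ᵐ c ∂waveMeasure d, zeroMass (complexWave (n + 1) ι φ c) ψ < ⊤) ∧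
      Integrable (fun c => zeroCurrent (complexWave (n + 1) ι φ c) ψ) (waveMeasure d) ∧
      (∀ x : X, LocallyIntegrableOn
        (fun z => Real.log (spectralKernel (n + 1) ι φ ((chartAt (Fin (n + 1) → ℂ) x).symm z)))
        (chartAt (Fin (n + 1) → ℂ) x).target) ∧
      ‖(1 / N : ℂ) * ∫ c, zeroCurrent (complexWave (n + 1) ι φ c) ψ ∂waveMeasure d -
        (1 / N : ℂ) * (Complex.I / (2 * Real.pi) *
          ddbarCurrent (fun x => Real.log (spectralKernel (n + 1) ι φ x)) ψ)‖ ≤ C / N := by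
  obtain ⟨C, hC0, hC⟩ := hψ.exists_bound
  refine ⟨C, fun N hN d hd φ _ => ?_⟩
  have hΦ : ∀ j, MDifferentiable 𝓘(ℂ, Fin (n + 1) → ℂ) 𝓘(ℂ, ℂ) (complexify (n + 1) ι (φ j)) :=
    fun j => mdifferentiable_complexify ι (φ j)
  have hN0 : (0 : ℝ) < N := by exact_mod_cast hN
  by_cases h0 : ∃ j x, complexify (n + 1) ι (φ j) x ≠ 0
  · obtain ⟨h1, h2, h3, h4⟩ := hC d hd (fun j => complexify (n + 1) ι (φ j)) hΦ h0
    refine ⟨h1, h2, h3, ?_⟩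
    rw [← mul_sub, norm_mul, norm_div, norm_one, Complex.norm_natCast, one_div_mul_eq_div]
    exact div_le_div_of_nonneg_right h4 hN0.le
  -- All complexifications vanish identically. The zero function has no regular zeros, and `Real.log
  -- 0 = 0`, so both currents are zero.
  · push Not at h0
    have hw : ∀ c, complexWave (n + 1) ι φ c = fun _ => 0 := fun c => by
      funext x
      simp [complexWave, h0]
    have hk : ∀ x, Real.log (spectralKernel (n + 1) ι φ x) = 0 := fun x => by
      simp [spectralKernel, h0]
    have hz := zeroMass_eq_zero (X := X) (f := fun _ => 0)
      (fun _ z k l => not_isRegularZero_zero z k l) ψ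
    simp only [hw, hz.1, hz.2, hk]
    refine ⟨Filter.Eventually.of_forall fun _ => ENNReal.zero_lt_top, MeasureTheory.integrable_zero _ _ _,
      fun x => MeasureTheory.locallyIntegrableOn_const 0, ?_⟩
    simp only [ddbarCurrent, chartIntegral, Complex.ofReal_zero, zero_mul,
      MeasureTheory.integral_zero, tsum_zero, mul_zero, sub_zero, norm_zero]
    positivity
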